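/- **Setting.** Let $X=\mathbb C^{n}$ with coordinates divided into blocks $z=(z^{(0)},z^{(1)},\dots,z^{(m)})$, $z^{(k)}\in\mathbb C^{n_k}$, where $|\cdot|$ denotes the maximum norm. Let $A=(a_{jk})$ be an $\ell\times m$ matrix of non-negative rational numbers of rank $L\ge 1$ whose upper left $L\times L$ block is invertible. Put $K_j=\{k: a_{jk}\neq 0\}$, $Z_j=\{z^{(k)}=0\ (k\in K_j)\}$ and $\chi=\{Z_1,\dots,Z_\ell\}$; $Z_j$ is the fixed point set of $\mu_j(z,t)=(z^{(0)},t^{a_{j1}}z^{(1)},\dots,t^{a_{jm}}z^{(m)})$. Let $\sigma$ be the positive rational number for which the entries of $\sigma A$ are integers without common divisor. Put $\varphi_k(\lambda)=\prod_j\lambda_j^{a_{jk}}$. For $\tau=(\tau_1,\dots,\tau_m)$, $\lambda=(\lambda',\lambda'')$ with $\lambda'=(\lambda_1,\dots,\lambda_L)$, let $\lambda'=\varphi^{-1}(\tau,\lambda'')$ be the solution of $\tau_k=\varphi_k(\lambda',\lambda'')$ $(k\le L)$, and put $\psi_k=\tau_k/\varphi_k(\varphi^{-1}(\tau,\lambda''),\lambda'')$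 for $L<k\le m$, a monomial in $\tau$. Let $\zeta=(\zeta^{(1)},\dots,\zeta^{(m)})$, $\zeta^{(k)}\in\mathbb C^{n_k}$, be such that $\zeta^{(k)}\ne0$ for $k\le L$, and $\zeta^{(k)}=0$ whenever the $k$-th column of $A$ is zero. **Semigroups.** Consider pairs $(f,v)$, where $f$ is a monomial with rational exponents and coefficient $1$ and $v\ge0$, with the multiplication $(f,v)(g,w)=(fg,vw)$; for a set $B$ of pairs let $[B]$ be the set of finite products of elements of $B$, including $(1,1)$. Put $$G_0=\{(\varphi^{-1}_j,0)\}_{j\le L}\cup\{(\psi_k,\psi_k(|\zeta^{(1)}|,\dots,|\zeta^{(m)}|))\}_{k>L}\cup\{(\lambda_j,0)\}_{j>L},\qquad G=G_0\cup\{(1/f,1/v):(f,v)\in G_0,\ v\ne0\},$$ and let $\mathcal G$ be the set of the $(f,v)\in[G]$ with $f$ a monomial in $\tau$ only. Let $H$ be a finite set of pairs $(f,v)$ with $f$ a monomial in $\tau$ only, such that $[H]$ is equivalent to $\mathcal G$: for some integers $N_1,N_2\ge1$, every $N_1$-th power of an element of $[H]$ is an $N_2$-th power of an element of $\mathcal G$,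 and every $N_2$-th power of an element of $\mathcal G$ lies in $[H]$. **Multisectors.** Let $V(\zeta)$ be the set of the $V=\mathbb C^{n_0}\times V_1\times\dots\times V_m$ such that $V_k$ is an open convex cone (stable under multiplication by positive reals) which contains $\zeta^{(k)}$ and does not contain $0$, if $\zeta^{(k)}\ne0$, and $V_k=\mathbb C^{n_k}$, if $\zeta^{(k)}=0$. For $V\in V(\zeta)$ and a family $\{\epsilon\}$ of positive numbers $\epsilon_0$, $\epsilon_{f,\pm}$ (one pair $\epsilon_{f,\pm}$ for each $(f,v)\in H$) put $$S_H(V,\{\epsilon\})=\{z\in V:\ |z^{(0)}|<\epsilon_0,\ v-\epsilon_{f,-}<f(|z^{(1)}|,\dots,|z^{(m)}|)<v+\epsilon_{f,+}\ \text{for all }(f,v)\in H\}.$$ The multisector $S_H(V',\{\epsilon'\})$ is *properly contained* in $S_H(V,\{\epsilon\})$ if $V'\in V(\zeta)$, $\overline{V'_k}\setminus\{0\}\subset V_k$ for $k=1,\dots,m$, and every number of the family $\{\epsilon'\}$ is positive and strictly smaller than the corresponding one of $\{\epsilon\}$. **Level functions.** For $L<j\le\ell$ and a monomial $f$ let $\nu_j(f)$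 be its exponent in $\lambda_j$. Put $F^{L}=G$, and for $L<j\le\ell$ let $F^{j}$ consist of the $(f,v)\in F^{j-1}$ with $\nu_j(f)=0$ and of the $(f,v)^a(g,w)^b$ with $(f,v),(g,w)\in F^{j-1}$, $\nu_j(f)>0>\nu_j(g)$, where $a,b$ are the coprime positive integers with $a\,|\nu_j(f)|=b\,|\nu_j(g)|$. Let $\rho_j(\tau,\lambda'')$ be the maximum of $\lambda_jf^{1/|\nu_j(f)|}$ over the $(f,v)\in F^{j-1}$ with $\nu_j(f)<0$ ($\rho_j=1$ if there is none); it depends only on $\tau_1,\dots,\tau_L$ and $\lambda_{j+1},\dots,\lambda_\ell$. Define $\rho_{\Lambda,\ell},\rho_{\Lambda,\ell-1},\dots,\rho_{\Lambda,L+1}$ successively by substituting $\lambda_i=\rho_{\Lambda,i}(\tau)$ $(i>j)$ in $\rho_j$, put $\rho_{\Lambda,j}=\varphi_j^{-1}(\tau,\rho_{\Lambda,L+1},\dots,\rho_{\Lambda,\ell})$ for $j\le L$, and $\rho_{\Lambda,j}(z)=\rho_{\Lambda,j}(|z^{(1)}|,\dots,|z^{(m)}|)$. **Developability.** For a non-empty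 $J\subset\{1,\dots,\ell\}$ put $K_J=\bigcup_{j\in J}K_j$, $Z_J=\bigcap_{j\in J}Z_j$, let $\pi_J:X\to Z_J$ be the projection forgetting the blocks $z^{(k)}$, $k\in K_J$, and let $\mathbb Z_{\ge0}^{(K_J)}$ be the set of the $\alpha\in\mathbb Z_{\ge0}^n$ with $\alpha^{(k)}=0$ for $k\notin K_J$. Let $S=S_H(V,\{\epsilon\})$. A holomorphic function $f$ on $S$ is *multi-asymptotically developable along $\chi$ on $S$* if there are holomorphic functions $f_{J,\alpha}$ on $\pi_J(S)$ ($J\ne\emptyset$, $\alpha\in\mathbb Z_{\ge0}^{(K_J)}$) such that for every multisector $S'$ properly contained in $S$ and every $N=(N_1,\dots,N_\ell)\in\mathbb Z_{\ge0}^\ell$ there is a constant $C$ with $$\Bigl|f(z)-\sum_{J\neq\emptyset}(-1)^{\#J+1}\sum_{\alpha\in A_J(N)}\frac{f_{J,\alpha}(\pi_J(z))}{\alpha!}z^\alpha\Bigr|\le C\prod_{j=1}^\ell\rho_{\Lambda,j}(z)^{N_j/\sigma}\qquad(z\in S'),$$ where $A_J(N)=\{\alpha\in\mathbb Z_{\ge0}^{(K_J)}:\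 \sum_{k\in K_J}a_{jk}|\alpha^{(k)}|<N_j/\sigma\ \text{for all }j\in J\}$. **Theorem 3.37.** Let $V\in V(\zeta)$, let $\{\epsilon\}$ be a family of positive numbers as above, and let $f$ be a holomorphic function on $S=S_H(V,\{\epsilon\})$. The following conditions are equivalent. 1. $f$ is multi-asymptotically developable along $\chi$ on $S$. 2. For every multisector $S'=S_H(V',\{\epsilon'\})$ properly contained in $S$ and every $\alpha\in\mathbb Z_{\ge0}^n$, $\left|\frac{\partial^\alpha f}{\partial z^\alpha}\right|$ is bounded on $S'$. 3. For every multisector $S'=S_H(V',\{\epsilon'\})$ properly contained in $S$, the function $f|_{S'}$ extends to a $C^\infty$ function on $X_{\mathbb R}$, the real manifold underlying $X$. -/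

import Mathlib

open scoped NNReal ContDiff

noncomputable section

namespace MultiAsymptotics

/-! ## Coordinates

The `ℓ = L + p` rows of the exponent matrix (the parameters `λ`) are indexed by `Fin L ⊕ Fin p`, and
its `m = L + r` columns (the coordinate blocks `z^(1), …, z^(m)`, and the variables `τ`) by
`Fin L ⊕ Fin r`. Here `L` is the rank and `Sum.inl` marks the first `L` indices. The coordinate
blocks of the ambient space are indexed by `Option (Fin L ⊕ Fin r)`: `none` is the block `z^(0)`
and `some k` is the block `z^(k)`. -/

/-- The space `X = ℂ^{n_0} × ℂ^{n_1} × ⋯ × ℂ^{n_m}`; every block carries the maximum norm. -/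
abbrev Space {L r : ℕ} (n : Option (Fin L ⊕ Fin r) → ℕ) : Type :=
  (b : Option (Fin L ⊕ Fin r)) → Fin (n b) → ℂ

/-- Multi-indices `α = (α^(0), …, α^(m))`. -/
abbrev MultiIndex {L r : ℕ} (n : Option (Fin L ⊕ Fin r) → ℕ) : Type :=
  (b : Option (Fin L ⊕ Fin r)) → Fin (n b) → ℕ

/-- The vector `|z^(*)| = (|z^(1)|, …, |z^(m)|)`. -/
def blockNorm {L r : ℕ} {n : Option (Fin L ⊕ Fin r) → ℕ} (z : Space n) : Fin L ⊕ Fin r → ℝ :=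
  fun k => ‖z (some k)‖

/-- The partial derivative of `f` in the `i.2`-th coordinate of the block `i.1`. -/
def partialD {L r : ℕ} {n : Option (Fin L ⊕ Fin r) → ℕ}
    (i : (b : Option (Fin L ⊕ Fin r)) × Fin (n b)) (f : Space n → ℂ) : Space n → ℂ :=
  fun z => fderiv ℂ f z (Pi.single i.1 (Pi.single i.2 1))

/-- The iterated partial derivative `∂_{i_1} ⋯ ∂_{i_s} f`. -/
def iterPartialD {L r : ℕ} {n : Option (Fin L ⊕ Fin r) → ℕ} :
    List ((b : Option (Fin L ⊕ Fin r)) × Fin (n b)) → (Space n → ℂ) → Space n → ℂ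
  | [], f => f
  | i :: l, f => partialD i (iterPartialD l f)

/-! ## Monomials -/

/-- Exponents of monomials, with rational powers and coefficient `1`, in `τ_1, …, τ_m` and in
`λ_{L+1}, …, λ_ℓ`. -/
abbrev Expo (L p r : ℕ) : Type := (Fin L ⊕ Fin r → ℚ) × (Fin p → ℚ)

/-- Pairs `(f, v)` with `f` a monomial in `τ` and `λ''` and `v ≥ 0`, with the multiplication
`(f, v)(g, w) = (fg, vw)`. -/
abbrev PairTL (L p r : ℕ) : Type := Multiplicative (Expo L p r) × ℝ≥0

/-- Pairs `(f, v)` with `f` a monomial in `τ` only and `v ≥ 0`. -/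
abbrev PairT (L r : ℕ) : Type := Multiplicative (Fin L ⊕ Fin r → ℚ) × ℝ≥0

/-- A pair without `λ`-variables seen as a pair in `τ` and `λ''`. -/
def PairT.toTL {L r : ℕ} (p : ℕ) (x : PairT L r) : PairTL L p r :=
  (Multiplicative.ofAdd (Multiplicative.toAdd x.1, (0 : Fin p → ℚ)), x.2)

/-- Value at `τ` of a monomial in `τ`. -/
def evalT {L r : ℕ} (f : Multiplicative (Fin L ⊕ Fin r → ℚ)) (τ : Fin L ⊕ Fin r → ℝ) : ℝ :=
  ∏ k, τ k ^ ((Multiplicative.toAdd f k : ℚ) : ℝ)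

/-- Value of the monomial with exponent `e` at `(τ, λ'')`. -/
def evalTL {L p r : ℕ} (e : Expo L p r) (τ : Fin L ⊕ Fin r → ℝ) (lam : Fin p → ℝ) : ℝ :=
  (∏ k, τ k ^ ((e.1 k : ℚ) : ℝ)) * ∏ s, lam s ^ ((e.2 s : ℚ) : ℝ)

/-- The exponent of `λ_{L+s}` in the monomial of a pair. -/
def lamExp {L p r : ℕ} (s : Fin p) (x : PairTL L p r) : ℚ := (Multiplicative.toAdd x.1).2 s

/-- The monomial `λ_{L+s}`. -/
def lamVar {L p r : ℕ} (s : Fin p) : Expo L p r := (0, Pi.single s 1)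

/-- The monomial `φ_j^{-1}(τ', λ'')` for `j ≤ L`: the solution `λ_j` of the system
`τ_k = ∏_i λ_i ^ a_{ik}` (`k ≤ L`) in the unknowns `λ_1, …, λ_L`. In logarithms, the system is
`log τ' = (log λ') A₁₁ + (log λ'') A₂₁`. -/
def phiInv {L p r : ℕ} (A : Matrix (Fin L ⊕ Fin p) (Fin L ⊕ Fin r) ℚ) (j : Fin L) : Expo L p r :=
  (Sum.elim (fun i => (A.toBlocks₁₁)⁻¹ i j) 0,
    fun s => -∑ i, A.toBlocks₂₁ s i * (A.toBlocks₁₁)⁻¹ i j)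

/-- The monomial `ψ_k = τ_k / φ_k(φ^{-1}(τ', λ''), λ'')` for `k > L`, where
`φ_k(λ) = ∏_j λ_j ^ a_{jk}`. -/
def psi {L p r : ℕ} (A : Matrix (Fin L ⊕ Fin p) (Fin L ⊕ Fin r) ℚ) (k : Fin r) : Expo L p r :=
  ((Pi.single (Sum.inr k) 1, 0) : Expo L p r)
    - ((∑ j : Fin L, A (Sum.inl j) (Sum.inr k) • phiInv A j)
      + ∑ s : Fin p, A (Sum.inr s) (Sum.inr k) • lamVar s)

/-- The number `n_k(ζ) = ψ_k(|ζ^(1)|, …, |ζ^(m)|)`, for `ζ` with `ζ^(1), …, ζ^(L)` all non-zero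
(`ψ_k` does not involve `λ''`). -/
def nval {L p r : ℕ} {n : Option (Fin L ⊕ Fin r) → ℕ}
    (A : Matrix (Fin L ⊕ Fin p) (Fin L ⊕ Fin r) ℚ)
    (ζ : (k : Fin L ⊕ Fin r) → Fin (n (some k)) → ℂ) (k : Fin r) : ℝ≥0 :=
  Real.toNNReal (evalTL (psi A k) (fun i => ‖ζ i‖) 1)

open Classical in
/-- `Q(F) = F ∪ {(1/f, 1/v) ; (f, v) ∈ F, v ≠ 0}`. -/
def fractions {L p r : ℕ} (F : Finset (PairTL L p r)) : Finset (PairTL L p r) :=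
  F ∪ (F.filter fun x => x.2 ≠ 0).image fun x => (x.1⁻¹, x.2⁻¹)

open Classical in
/-- The finite set
`G = Q({(φ_j^{-1}, 0)}_{j ≤ L} ∪ {(ψ_k, n_k(ζ))}_{k > L} ∪ {(λ_j, 0)}_{j > L})`. -/
def setG {L p r : ℕ} {n : Option (Fin L ⊕ Fin r) → ℕ}
    (A : Matrix (Fin L ⊕ Fin p) (Fin L ⊕ Fin r) ℚ)
    (ζ : (k : Fin L ⊕ Fin r) → Fin (n (some k)) → ℂ) : Finset (PairTL L p r) :=
  fractions
    ((Finset.univ.image fun j : Fin L => (Multiplicative.ofAdd (phiInv A j), 0))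
      ∪ (Finset.univ.image fun k : Fin r => (Multiplicative.ofAdd (psi A k), nval A ζ k))
      ∪ (Finset.univ.image fun s : Fin p => (Multiplicative.ofAdd (lamVar s), 0)))

/-- The semigroup `𝒢` of the pairs `(f, v)` in the semigroup generated by `G` for which `f` is a
monomial in `τ` only. (This is the form of `𝒢` for `ζ` with `ζ^(1), …, ζ^(L)` all non-zero.) -/
def semigroupG {L p r : ℕ} {n : Option (Fin L ⊕ Fin r) → ℕ}
    (A : Matrix (Fin L ⊕ Fin p) (Fin L ⊕ Fin r) ℚ)
    (ζ : (k : Fin L ⊕ Fin r) → Fin (n (some k)) → ℂ) : Set (PairT L r) :=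
  {x | x.toTL p ∈ Submonoid.closure (setG A ζ : Set (PairTL L p r))}

/-- Equivalence of semigroups of pairs: `⟨𝒜⟩_{N₁} ⊆ ⟨ℬ⟩_{N₂} ⊆ 𝒜` for some positive integers
`N₁, N₂`, where `⟨𝒜⟩_N` is the set of the `N`-th powers of the elements of `𝒜`. -/
def Equivalent {L r : ℕ} (𝒜 ℬ : Set (PairT L r)) : Prop :=
  ∃ N₁ N₂ : ℕ, 0 < N₁ ∧ 0 < N₂ ∧
    (fun x => x ^ N₁) '' 𝒜 ⊆ (fun x => x ^ N₂) '' ℬ ∧ (fun x => x ^ N₂) '' ℬ ⊆ 𝒜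

/-! ## Multicones -/

/-- The family `{ε}` of the numbers `ε_0` and `ε_{f,+}`, `ε_{f,-}` for `(f, v) ∈ H`. -/
structure Radii (L r : ℕ) where
  eps0 : ℝ
  plus : PairT L r → ℝ
  minus : PairT L r → ℝ

/-- All the numbers of the family `{ε}` are positive. -/
def Radii.Pos {L r : ℕ} (H : Finset (PairT L r)) (ε : Radii L r) : Prop :=
  0 < ε.eps0 ∧ ∀ h ∈ H, 0 < ε.plus h ∧ 0 < ε.minus h

/-- `V = ℂ^{n_0} × V_1 × ⋯ × V_m` belongs to `V(ζ)`: if `ζ^(k) ≠ 0`, then `V_k` is an open convex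
proper cone containing `ζ^(k)` (an open convex cone is proper, i.e. contains no line through the
origin, if and only if it does not contain the origin), and `V_k` is the whole space if
`ζ^(k) = 0`. -/
def IsConeAt {L r : ℕ} {n : Option (Fin L ⊕ Fin r) → ℕ}
    (ζ : (k : Fin L ⊕ Fin r) → Fin (n (some k)) → ℂ)
    (V : (k : Fin L ⊕ Fin r) → Set (Fin (n (some k)) → ℂ)) : Prop :=
  ∀ k,
    (ζ k ≠ 0 → IsOpen (V k) ∧ Convex ℝ (V k) ∧ (∀ t : ℝ, 0 < t → ∀ x ∈ V k, t • x ∈ V k) ∧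
      0 ∉ V k ∧ ζ k ∈ V k) ∧
    (ζ k = 0 → V k = Set.univ)

/-- The multicone (multisector) `S_H(V, {ε})`. -/
def multicone {L r : ℕ} {n : Option (Fin L ⊕ Fin r) → ℕ} (H : Finset (PairT L r))
    (V : (k : Fin L ⊕ Fin r) → Set (Fin (n (some k)) → ℂ)) (ε : Radii L r) : Set (Space n) :=
  {z | (∀ k, z (some k) ∈ V k) ∧ ‖z none‖ < ε.eps0 ∧
    ∀ h ∈ H, (h.2 : ℝ) - ε.minus h < evalT h.1 (blockNorm z) ∧
      evalT h.1 (blockNorm z) < (h.2 : ℝ) + ε.plus h}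

/-- `S_H(V', {ε'})` is a multicone (with `V' ∈ V(ζ)`) properly contained in `S_H(V, {ε})`. -/
def ProperlyContained {L r : ℕ} {n : Option (Fin L ⊕ Fin r) → ℕ} (H : Finset (PairT L r))
    (ζ : (k : Fin L ⊕ Fin r) → Fin (n (some k)) → ℂ)
    (V' : (k : Fin L ⊕ Fin r) → Set (Fin (n (some k)) → ℂ)) (ε' : Radii L r)
    (V : (k : Fin L ⊕ Fin r) → Set (Fin (n (some k)) → ℂ)) (ε : Radii L r) : Prop :=
  IsConeAt ζ V' ∧ ε'.Pos H ∧ (∀ k, closure (V' k) \ {0} ⊆ V k) ∧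
    ε'.eps0 < ε.eps0 ∧ ∀ h ∈ H, ε'.plus h < ε.plus h ∧ ε'.minus h < ε.minus h

/-! ## Level functions -/

open Classical in
/-- Elimination of `λ_{L+s}`: the pairs of `F` without `λ_{L+s}`, and the pairs
`(f^a g^b, v^a w^b)` with `(f, v), (g, w) ∈ F` of exponents `ν(f) > 0 > ν(g)` in `λ_{L+s}`, where
`a, b` are the coprime positive integers with `a |ν(f)| = b |ν(g)|`. -/
def eliminate {L p r : ℕ} (s : Fin p) (F : Finset (PairTL L p r)) : Finset (PairTL L p r) :=
  (F.filter fun x => lamExp s x = 0) ∪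
    ((F ×ˢ F).filter fun xy => 0 < lamExp s xy.1 ∧ lamExp s xy.2 < 0).image fun xy =>
      xy.1 ^ (|lamExp s xy.2| / |lamExp s xy.1|).num.natAbs *
        xy.2 ^ (|lamExp s xy.2| / |lamExp s xy.1|).den

/-- The set obtained from `G` by eliminating successively the first `t` variables
`λ_{L+1}, λ_{L+2}, …` of `λ''`. -/
def stage {L p r : ℕ} {n : Option (Fin L ⊕ Fin r) → ℕ}
    (A : Matrix (Fin L ⊕ Fin p) (Fin L ⊕ Fin r) ℚ)
    (ζ : (k : Fin L ⊕ Fin r) → Fin (n (some k)) → ℂ) : ℕ → Finset (PairTL L p r)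
  | 0 => setG A ζ
  | t + 1 => if h : t < p then eliminate ⟨t, h⟩ (stage A ζ t) else stage A ζ t

/-- The solution `λ_{L+s} · f^{1/|ν(f)|}` (independent of `λ_{L+s}`) of `f(τ, λ'') = 1` in the
unknown `λ_{L+s}`, for a monomial `f` with negative exponent `ν(f)` in `λ_{L+s}`. -/
def sol {L p r : ℕ} (s : Fin p) (x : PairTL L p r) (τ : Fin L ⊕ Fin r → ℝ) (lam : Fin p → ℝ) : ℝ :=
  lam s * evalTL (Multiplicative.toAdd x.1) τ lam ^ (1 / ((|lamExp s x| : ℚ) : ℝ))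

open Classical in
/-- The function `ρ_{L+s}(τ, λ'')`: the maximum of the solutions `sol` over the pairs with negative
exponent in `λ_{L+s}` among those obtained by eliminating the preceding variables of `λ''`, and `1`
if there is none. It depends only on `τ_1, …, τ_L` and on the variables of `λ''` after
`λ_{L+s}`. -/
def rho {L p r : ℕ} {n : Option (Fin L ⊕ Fin r) → ℕ}
    (A : Matrix (Fin L ⊕ Fin p) (Fin L ⊕ Fin r) ℚ)
    (ζ : (k : Fin L ⊕ Fin r) → Fin (n (some k)) → ℂ) (s : Fin p)
    (τ : Fin L ⊕ Fin r → ℝ) (lam : Fin p → ℝ) : ℝ :=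
  if h : ((stage A ζ s).filter fun x => lamExp s x < 0).Nonempty then
    ((stage A ζ s).filter fun x => lamExp s x < 0).sup' h fun x => sol s x τ lam
  else 1

/-- The restriction of `ρ_{L+s}` to `Λ = {λ_{L+s} = ρ_{L+s}(τ, λ'') for all s}`, as a function of
`τ`: the equations are solved from the last one on. (The entries set to `1` do not occur in
`ρ_{L+s}`.) -/
def rhoLast {L p r : ℕ} {n : Option (Fin L ⊕ Fin r) → ℕ}
    (A : Matrix (Fin L ⊕ Fin p) (Fin L ⊕ Fin r) ℚ)
    (ζ : (k : Fin L ⊕ Fin r) → Fin (n (some k)) → ℂ)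
    (τ : Fin L ⊕ Fin r → ℝ) (s : Fin p) : ℝ :=
  rho A ζ s τ fun s' => if s < s' then rhoLast A ζ τ s' else 1
termination_by p - (s : ℕ)
decreasing_by omega

/-- The level functions `ρ_{Λ,j}(τ)`: the restriction of `φ_j^{-1}` to `Λ` for `j ≤ L`, and that of
`ρ_j` for `j > L`. -/
def level {L p r : ℕ} {n : Option (Fin L ⊕ Fin r) → ℕ}
    (A : Matrix (Fin L ⊕ Fin p) (Fin L ⊕ Fin r) ℚ)
    (ζ : (k : Fin L ⊕ Fin r) → Fin (n (some k)) → ℂ)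
    (τ : Fin L ⊕ Fin r → ℝ) : Fin L ⊕ Fin p → ℝ :=
  Sum.elim (fun j => evalTL (phiInv A j) τ (rhoLast A ζ τ)) (rhoLast A ζ τ)

/-! ## Multi-asymptotic expansions -/

/-- `σ` is the positive rational number for which the entries of `σ A` are integers without common
divisor. -/
def IsScale {L p r : ℕ} (A : Matrix (Fin L ⊕ Fin p) (Fin L ⊕ Fin r) ℚ) (σ : ℚ) : Prop :=
  0 < σ ∧ ∃ c : Fin L ⊕ Fin p → Fin L ⊕ Fin r → ℤ, (∀ j k, σ * A j k = c j k) ∧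
    (Finset.univ.gcd fun jk : (Fin L ⊕ Fin p) × (Fin L ⊕ Fin r) => c jk.1 jk.2) = 1

/-- The set `K_J` of blocks: `Z_j = {z^(k) = 0 for all k with a_{jk} ≠ 0}` is the fixed point set of
the action `μ_j(z, t) = (z^(0), t^{a_{j1}} z^(1), …, t^{a_{jm}} z^(m))`, and `Z_J = ⋂_{j ∈ J} Z_j`
is defined by `z^(k) = 0` for `k ∈ K_J`. -/
def KJ {L p r : ℕ} (A : Matrix (Fin L ⊕ Fin p) (Fin L ⊕ Fin r) ℚ) (J : Finset (Fin L ⊕ Fin p)) :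
    Set (Option (Fin L ⊕ Fin r)) :=
  {b | ∃ k, b = some k ∧ ∃ j ∈ J, A j k ≠ 0}

/-- The submanifold `Z_J`, in the coordinates `z^(k)`, `k ∉ K_J`. -/
abbrev ZJ {L p r : ℕ} (n : Option (Fin L ⊕ Fin r) → ℕ)
    (A : Matrix (Fin L ⊕ Fin p) (Fin L ⊕ Fin r) ℚ) (J : Finset (Fin L ⊕ Fin p)) : Type :=
  (b : {b : Option (Fin L ⊕ Fin r) // b ∉ KJ A J}) → Fin (n b) → ℂ

/-- The projection `π_J : X → Z_J`. -/
def projJ {L p r : ℕ} {n : Option (Fin L ⊕ Fin r) → ℕ}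
    (A : Matrix (Fin L ⊕ Fin p) (Fin L ⊕ Fin r) ℚ) (J : Finset (Fin L ⊕ Fin p)) (z : Space n) :
    ZJ n A J :=
  fun b => z b

/-- The multi-indices supported on the blocks of `K_J`. -/
def indicesJ {L p r : ℕ} (n : Option (Fin L ⊕ Fin r) → ℕ)
    (A : Matrix (Fin L ⊕ Fin p) (Fin L ⊕ Fin r) ℚ) (J : Finset (Fin L ⊕ Fin p)) :
    Set (MultiIndex n) :=
  {α | ∀ b, b ∉ KJ A J → α b = 0}

/-- Families `{f_{J,α}}` of functions `f_{J,α}` on `Z_J`; only the non-empty `J` and the `α` supported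
on `K_J` matter. -/
abbrev Coeffs {L p r : ℕ} (n : Option (Fin L ⊕ Fin r) → ℕ)
    (A : Matrix (Fin L ⊕ Fin p) (Fin L ⊕ Fin r) ℚ) : Type :=
  (J : Finset (Fin L ⊕ Fin p)) → MultiIndex n → ZJ n A J → ℂ

/-- `F` is a total family of coefficients on `S`: the `f_{J,α}` are holomorphic on
`S_J = π_J(S)`. -/
def IsTotalFamily {L p r : ℕ} {n : Option (Fin L ⊕ Fin r) → ℕ}
    (A : Matrix (Fin L ⊕ Fin p) (Fin L ⊕ Fin r) ℚ) (S : Set (Space n)) (F : Coeffs n A) : Prop :=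
  ∀ J : Finset (Fin L ⊕ Fin p), J.Nonempty → ∀ α ∈ indicesJ n A J,
    DifferentiableOn ℂ (F J α) (projJ A J '' S)

/-- The (finite) set `A_J(N)` of the `α` supported on `K_J` with
`∑_{k ∈ K_J} a_{jk} |α^(k)| < n_j / σ` for all `j ∈ J`. -/
def indicesBelow {L p r : ℕ} (n : Option (Fin L ⊕ Fin r) → ℕ)
    (A : Matrix (Fin L ⊕ Fin p) (Fin L ⊕ Fin r) ℚ) (σ : ℚ) (J : Finset (Fin L ⊕ Fin p))
    (N : Fin L ⊕ Fin p → ℕ) : Set (MultiIndex n) :=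
  {α | α ∈ indicesJ n A J ∧
    ∀ j ∈ J, ∑ k, A j k * ((∑ i, α (some k) i : ℕ) : ℚ) < (N j : ℚ) / σ}

/-- The set `A_J(N)` is finite, so that the sum over it below is an honest finite sum. -/
theorem indicesBelow_finite {L p r : ℕ} (n : Option (Fin L ⊕ Fin r) → ℕ)
    (A : Matrix (Fin L ⊕ Fin p) (Fin L ⊕ Fin r) ℚ) (hA : ∀ j k, 0 ≤ A j k) (σ : ℚ)
    (J : Finset (Fin L ⊕ Fin p)) (N : Fin L ⊕ Fin p → ℕ) :
    (indicesBelow n A σ J N).Finite := by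
  have hB : ∀ b : Option (Fin L ⊕ Fin r), ∃ B : ℕ, ∀ α ∈ indicesBelow n A σ J N, ∀ i,
      α b i ≤ B := by
    intro b
    by_cases hb : b ∈ KJ A J
    · obtain ⟨k, rfl, j, hj, hjk⟩ := hb
      have hpos : 0 < A j k := lt_of_le_of_ne (hA j k) (Ne.symm hjk)
      obtain ⟨B, hB⟩ := exists_nat_ge ((N j : ℚ) / σ / A j k)
      refine ⟨B, fun α hα i => ?_⟩
      have h1 : A j k * ((∑ i, α (some k) i : ℕ) : ℚ) < (N j : ℚ) / σ :=
        lt_of_le_of_lt (Finset.single_le_sum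
          (f := fun k => A j k * ((∑ i, α (some k) i : ℕ) : ℚ))
          (fun k _ => mul_nonneg (hA j k) (Nat.cast_nonneg _)) (Finset.mem_univ k)) (hα.2 j hj)
      have h2 : ((∑ i, α (some k) i : ℕ) : ℚ) < (N j : ℚ) / σ / A j k := by
        rw [lt_div_iff₀ hpos, mul_comm]
        exact h1
      have h3 : (∑ i, α (some k) i : ℕ) ≤ B := by
        exact_mod_cast (h2.trans_le hB).le
      exact (Finset.single_le_sum (f := fun i => α (some k) i) (fun _ _ => Nat.zero_le _)
        (Finset.mem_univ i)).trans h3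
    · exact ⟨0, fun α hα i => by rw [hα.1 b hb]; exact le_rfl⟩
  choose B hB using hB
  exact (Set.finite_Iic (fun (b : Option (Fin L ⊕ Fin r)) (_ : Fin (n b)) => B b)).subset
    fun α hα b i => hB b α hα i

/-- `T_J^{<N}(F; z) = ∑_{α ∈ A_J(N)} f_{J,α}(π_J(z)) z^α / α!`: the part of order `< N` in
`(λ_j)_{j ∈ J}` of `exp (∑_{k ∈ K_J} ∑_i (∏_{j ∈ J} λ_j^{σ a_{jk}}) z^(k)_i)` at `λ = 1`, where each
monomial `z^α` is multiplied by `f_{J,α}`. -/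
def termJ {L p r : ℕ} {n : Option (Fin L ⊕ Fin r) → ℕ}
    (A : Matrix (Fin L ⊕ Fin p) (Fin L ⊕ Fin r) ℚ) (σ : ℚ) (F : Coeffs n A)
    (N : Fin L ⊕ Fin p → ℕ) (J : Finset (Fin L ⊕ Fin p)) (z : Space n) : ℂ :=
  ∑ᶠ α ∈ indicesBelow n A σ J N,
    F J α (projJ A J z) / ((∏ b, ∏ i, (α b i).factorial : ℕ) : ℂ) * ∏ b, ∏ i, z b i ^ α b i

/-- `App^{<N}(F; z) = ∑_{J ≠ ∅} (-1)^{#J+1} T_J^{<N}(F; z)`. -/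
def app {L p r : ℕ} {n : Option (Fin L ⊕ Fin r) → ℕ}
    (A : Matrix (Fin L ⊕ Fin p) (Fin L ⊕ Fin r) ℚ) (σ : ℚ) (F : Coeffs n A)
    (N : Fin L ⊕ Fin p → ℕ) (z : Space n) : ℂ :=
  ∑ J : Finset (Fin L ⊕ Fin p) with J.Nonempty, (-1) ^ (J.card + 1) * termJ A σ F N J z

/-- `f` is multi-asymptotically developable to `F` along `χ` on `S_H(V, {ε})`. -/
def DevelopableTo {L p r : ℕ} {n : Option (Fin L ⊕ Fin r) → ℕ}
    (A : Matrix (Fin L ⊕ Fin p) (Fin L ⊕ Fin r) ℚ) (σ : ℚ)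
    (ζ : (k : Fin L ⊕ Fin r) → Fin (n (some k)) → ℂ) (H : Finset (PairT L r))
    (V : (k : Fin L ⊕ Fin r) → Set (Fin (n (some k)) → ℂ)) (ε : Radii L r)
    (f : Space n → ℂ) (F : Coeffs n A) : Prop :=
  ∀ V' ε', ProperlyContained H ζ V' ε' V ε → ∀ N : Fin L ⊕ Fin p → ℕ, ∃ C : ℝ,
    ∀ z ∈ multicone H V' ε',
      ‖f z - app A σ F N z‖ ≤ C * ∏ j, level A ζ (blockNorm z) j ^ ((N j : ℝ) / (σ : ℝ))

/-- `f` is multi-asymptotically developable along `χ` on `S_H(V, {ε})`. -/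
def Developable {L p r : ℕ} {n : Option (Fin L ⊕ Fin r) → ℕ}
    (A : Matrix (Fin L ⊕ Fin p) (Fin L ⊕ Fin r) ℚ) (σ : ℚ)
    (ζ : (k : Fin L ⊕ Fin r) → Fin (n (some k)) → ℂ) (H : Finset (PairT L r))
    (V : (k : Fin L ⊕ Fin r) → Set (Fin (n (some k)) → ℂ)) (ε : Radii L r)
    (f : Space n → ℂ) : Prop :=
  ∃ F : Coeffs n A, IsTotalFamily A (multicone H V ε) F ∧ DevelopableTo A σ ζ H V ε f F

end MultiAsymptotics

end

/-!
The equivalence is proved as a cycle. The three steps rest on estimates of the geometry of a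
multisector `S` in terms of the level functions.

**Level functions.** Replacing `λ''` by the level functions turns every monomial of `G` into a bounded
function on `S` (`exists_bound_setG`): the level functions are the maximal solutions obtained in a
Fourier-Motzkin elimination of `λ''`, and at its last stage only monomials of the semigroup `𝒢` are
left, which the inequalities defining `S` bound. Hence `|z^(k)| = ratio_k · φ_k(ρ_Λ(z))` with bounded
quotients, which are bounded away from `0` if `ζ^(k) ≠ 0` (`exists_level_bounds`). It follows that
`S` is open, bounded and stable under the actions, that a point of a properly contained multisector
is the centre of a polydisc in `S` of radii proportional to `φ_k(ρ_Λ(z))` (`exists_polydisc`), and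
that two points of a properly contained multisector are joined in it by a path of length comparable
to their distance (`exists_ctrl_multicone`).

**From the expansion to bounded derivatives** (`hasBoundedDerivs_liftCoeff`). With `f` as the term
for `J = ∅`, the remainder of the expansion is an alternating sum over all `J`. A mixed difference of
the remainders in the directions of `J`, with respect to `N`, leaves only the terms for sets
containing `J`, and in those the weights for `J` are prescribed. It is of the order of
`∏_j ρ_{Λ,j}^{N_j/σ}`, so by Cauchy's estimates on the polydiscs its derivatives of weight `N` are
bounded. One of them is a given derivative of `f_{J,α}`, up to the terms for larger sets, which are
bounded by downward induction on `J`.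

**From bounded derivatives to smooth extensions** (`exists_contDiff_extension`). This is Whitney's
extension theorem for a bounded open set whose inner distance is comparable with the Euclidean one.
The extension is the limit of functions glued from Taylor polynomials of increasing order.

**From smooth extensions to the expansion** (`HasSmoothExtensions.developable`). The coefficients
`f_{J,α}` are the boundary values on `Z_J` of `∂^α f`, which are holomorphic because the derivative of
a smooth extension stays complex linear in the limit. The derivatives of the remainder are
remainders for the derivatives of `f`, with respect to smaller `N`, and as long as `N_j > 0` the
remainder tends to `0` along the action `μ_j`, as the terms for `J` and `J ∪ {j}` cancel each other.
Integration along the orbits then gives the estimate (`exists_bound_of_flat`).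
-/

open scoped NNReal ContDiff

noncomputable section

namespace MultiAsymptotics

open Metric Set Filter Topology

/-! ### Holomorphic functions of several variables -/

section Holomorphic

variable {E : Type*} [NormedAddCommGroup E] [NormedSpace ℂ E]

/-- Cauchy's estimate for the total derivative of a bounded holomorphic function. -/
theorem norm_fderiv_le_of_bounded {f : E → ℂ} {z : E} {R M : ℝ} (hR : 0 < R)
    (hf : DifferentiableOn ℂ f (ball z R)) (hM : ∀ w ∈ ball z R, ‖f w‖ ≤ M) :
    ‖fderiv ℂ f z‖ ≤ (2 * M + 1) / R := by
  have hM0 : 0 ≤ M := (norm_nonneg _).trans (hM z (mem_ball_self hR))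
  refine Complex.norm_fderiv_le_div_of_mapsTo_ball hf (fun w hw => ?_) hR
  rw [mem_closedBall, dist_eq_norm]
  calc ‖f w - f z‖ ≤ ‖f w‖ + ‖f z‖ := norm_sub_le _ _
    _ ≤ 2 * M + 1 := by linarith [hM w hw, hM z (mem_ball_self hR)]

/-- A directional derivative of a holomorphic function of several variables is holomorphic: it is a
Cauchy integral, which may be differentiated under the integral sign. -/
theorem differentiableOn_fderiv_apply [FiniteDimensional ℂ E] {f : E → ℂ} {U : Set E}
    (hU : IsOpen U) (hf : DifferentiableOn ℂ f U) (v : E) :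
    DifferentiableOn ℂ (fun z => fderiv ℂ f z v) U := by
  borelize E
  have : ProperSpace E := FiniteDimensional.proper_rclike ℂ E
  intro z₀ hz₀
  apply DifferentiableAt.differentiableWithinAt
  -- a ball on which `f` is bounded
  obtain ⟨M, R, hR, hRU, hM⟩ : ∃ M R : ℝ, 0 < R ∧ ball z₀ (4 * R) ⊆ U ∧
      ∀ w ∈ ball z₀ (4 * R), ‖f w‖ ≤ M := by
    have hc : ContinuousAt f z₀ := (hf.differentiableAt (hU.mem_nhds hz₀)).continuousAt
    have h1 : ∀ᶠ w in 𝓝 z₀, ‖f w‖ < ‖f z₀‖ + 1 :=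
      hc.norm.eventually (gt_mem_nhds (by linarith))
    obtain ⟨r, hr, h⟩ := Metric.eventually_nhds_iff_ball.1 (h1.and (hU.mem_nhds hz₀))
    exact ⟨‖f z₀‖ + 1, r / 4, by linarith, fun w hw => (h w (by convert hw using 2; ring)).2,
      fun w hw => (h w (by convert hw using 2; ring)).1.le⟩
  obtain ⟨s, hs, hsv⟩ : ∃ s : ℝ, 0 < s ∧ s * ‖v‖ ≤ R := by
    refine ⟨R / (‖v‖ + 1), by positivity, ?_⟩
    rw [div_mul_eq_mul_div, div_le_iff₀ (by positivity)]
    nlinarith [norm_nonneg v]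
  have hmem : ∀ z ∈ ball z₀ R, ∀ t : ℂ, ‖t‖ ≤ s → z + t • v ∈ ball z₀ (2 * R) := by
    intro z hz t ht
    rw [mem_ball, dist_eq_norm] at hz ⊢
    calc ‖z + t • v - z₀‖ = ‖(z - z₀) + t • v‖ := by congr 1; abel
      _ ≤ ‖z - z₀‖ + ‖t‖ * ‖v‖ := (norm_add_le _ _).trans (by rw [norm_smul])
      _ < 2 * R := by nlinarith [norm_nonneg v, mul_le_mul_of_nonneg_right ht (norm_nonneg v)]
  have hsub : ball z₀ (2 * R) ⊆ ball z₀ (4 * R) := ball_subset_ball (by linarith)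
  have hdiff : ∀ w ∈ ball z₀ (2 * R), DifferentiableAt ℂ f w := fun w hw =>
    hf.differentiableAt (hU.mem_nhds (hRU (hsub hw)))
  have hfd : ∀ w ∈ ball z₀ (2 * R), ‖fderiv ℂ f w‖ ≤ (2 * M + 1) / R := by
    intro w hw
    have hsub' : ball w R ⊆ ball z₀ (4 * R) := by
      refine ball_subset_ball' ?_
      rw [mem_ball] at hw
      linarith
    exact norm_fderiv_le_of_bounded hR (hf.mono (hsub'.trans hRU)) fun u hu => hM u (hsub' hu)
  -- the Cauchy integral
  have hcauchy : ∀ z ∈ ball z₀ R, fderiv ℂ f z v =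
      (2 * Real.pi * Complex.I : ℂ)⁻¹ • ∮ t in C(0, s), (1 / (t - 0) ^ 2) • f (z + t • v) := by
    intro z hz
    have hline : ∀ t : ℂ, HasDerivAt (fun t : ℂ => z + t • v) v t := fun t => by
      simpa using ((hasDerivAt_id t).smul_const v).const_add z
    have hpi : (2 * Real.pi * Complex.I : ℂ) ≠ 0 := by
      simp [Real.pi_ne_zero, Complex.I_ne_zero]
    rw [DiffContOnCl.deriv_eq_smul_circleIntegral (f := fun t => f (z + t • v)) hs, inv_smul_smul₀ hpi]
    · have h0 : DifferentiableAt ℂ f (z + (0 : ℂ) • v) := hdiff _ (hmem z hz 0 (by simp [hs.le]))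
      have := (h0.hasFDerivAt.comp_hasDerivAt (0 : ℂ) (hline 0)).deriv
      simp only [zero_smul, add_zero] at this
      exact this.symm
    · refine (DifferentiableOn.diffContOnCl_ball (U := closedBall 0 s) ?_ subset_rfl)
      intro t ht
      exact ((hdiff _ (hmem z hz t (by simpa using ht))).comp t
        (hline t).differentiableAt).differentiableWithinAt
  have hev : (fun z => fderiv ℂ f z v) =ᶠ[𝓝 z₀] fun z => (2 * Real.pi * Complex.I : ℂ)⁻¹ •
      ∮ t in C(0, s), (1 / (t - 0) ^ 2) • f (z + t • v) :=
    Filter.eventuallyEq_of_mem (ball_mem_nhds z₀ hR) hcauchy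
  refine DifferentiableAt.congr_of_eventuallyEq ?_ hev
  refine DifferentiableAt.fun_const_smul ?_ _
  have hnorm : ∀ θ : ℝ, ‖circleMap 0 s θ‖ = s := fun θ => by simp [abs_of_pos hs]
  have hcm : ∀ z ∈ ball z₀ R, ∀ θ : ℝ, z + circleMap 0 s θ • v ∈ ball z₀ (2 * R) :=
    fun z hz θ => hmem z hz _ (hnorm θ).le
  have hne : ∀ θ : ℝ, circleMap 0 s θ ≠ 0 := fun θ h => by
    have := hnorm θ; rw [h, norm_zero] at this; exact hs.ne this
  have hcont : ∀ z ∈ ball z₀ R, Continuous fun θ : ℝ =>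
      deriv (circleMap 0 s) θ • ((1 / (circleMap 0 s θ - 0) ^ 2) • f (z + circleMap 0 s θ • v)) := by
    intro z hz
    have h1 : Continuous fun θ : ℝ => f (z + circleMap 0 s θ • v) := by
      rw [continuous_iff_continuousAt]
      intro θ
      have hg : Continuous fun θ : ℝ => z + circleMap 0 s θ • v := by fun_prop
      exact ContinuousAt.comp (f := fun θ : ℝ => z + circleMap 0 s θ • v)
        (hdiff _ (hcm z hz θ)).continuousAt hg.continuousAt
    have h2 : Continuous fun θ : ℝ => 1 / (circleMap 0 s θ - 0) ^ 2 := by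
      refine continuous_const.div (by fun_prop) fun θ => ?_
      simpa using hne θ
    have h3 : Continuous fun θ : ℝ => deriv (circleMap 0 s) θ := by
      simp only [deriv_circleMap]; fun_prop
    exact h3.smul (h2.smul h1)
  set F' : E → ℝ → E →L[ℂ] ℂ := fun z θ =>
    (deriv (circleMap 0 s) θ * (1 / (circleMap 0 s θ - 0) ^ 2)) •
      fderiv ℂ f (z + circleMap 0 s θ • v) with hF'
  have key := intervalIntegral.hasFDerivAt_integral_of_dominated_of_fderiv_le (𝕜 := ℂ)
    (μ := MeasureTheory.volume) (a := 0) (b := 2 * Real.pi)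
    (F := fun z θ => deriv (circleMap 0 s) θ •
      ((1 / (circleMap 0 s θ - 0) ^ 2) • f (z + circleMap 0 s θ • v)))
    (F' := F') (x₀ := z₀) (s := ball z₀ R) (bound := fun _ => s * (1 / s ^ 2) * ((2 * M + 1) / R))
    (ball_mem_nhds z₀ hR) ?_ ?_ ?_ ?_ ?_ ?_
  · exact key.differentiableAt
  · filter_upwards [ball_mem_nhds z₀ hR] with z hz
    exact (hcont z hz).aestronglyMeasurable
  · exact (hcont z₀ (mem_ball_self hR)).intervalIntegrable _ _
  · have h3 : Measurable fun θ : ℝ => deriv (circleMap 0 s) θ * (1 / (circleMap 0 s θ - 0) ^ 2) := by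
      have : Continuous fun θ : ℝ => deriv (circleMap 0 s) θ * (1 / (circleMap 0 s θ - 0) ^ 2) := by
        have h5 : Continuous fun θ : ℝ => deriv (circleMap 0 s) θ := by
          simp only [deriv_circleMap]; fun_prop
        refine h5.mul ?_
        refine continuous_const.div (by fun_prop) fun θ => ?_
        simpa using hne θ
      exact this.measurable
    have h4 : Measurable fun θ : ℝ => fderiv ℂ f (z₀ + circleMap 0 s θ • v) :=
      (measurable_fderiv ℂ f).comp (Continuous.measurable (by fun_prop))
    exact (h3.smul h4).aestronglyMeasurable
  · refine Filter.Eventually.of_forall fun θ _ z hz => ?_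
    rw [hF']
    simp only [norm_smul, norm_mul, norm_div, norm_pow, norm_one, sub_zero, hnorm, deriv_circleMap, Complex.norm_I,
      mul_one]
    gcongr
    exact hfd _ (hcm z hz θ)
  · exact intervalIntegrable_const
  · refine Filter.Eventually.of_forall fun θ _ z hz => ?_
    have h1 : HasFDerivAt (fun z => f (z + circleMap 0 s θ • v))
        (fderiv ℂ f (z + circleMap 0 s θ • v)) z := by
      have := (hdiff _ (hcm z hz θ)).hasFDerivAt.comp z
        ((hasFDerivAt_id z).add_const (circleMap 0 s θ • v))
      rwa [ContinuousLinearMap.comp_id] at this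
    have h2 := h1.const_smul (deriv (circleMap 0 s) θ * (1 / (circleMap 0 s θ - 0) ^ 2))
    refine h2.congr_of_eventuallyEq (Filter.Eventually.of_forall fun w => ?_)
    simp only [Pi.smul_apply, smul_smul]

end Holomorphic

section Partial

variable {L r : ℕ} {n : Option (Fin L ⊕ Fin r) → ℕ}

/-- The index set of the coordinates of `Space n`. -/
abbrev Coord (n : Option (Fin L ⊕ Fin r) → ℕ) : Type :=
  (b : Option (Fin L ⊕ Fin r)) × Fin (n b)

/-- The coordinate vectors of `Space n`. -/
abbrev coordVec (i : Coord n) : Space n := Pi.single i.1 (Pi.single i.2 1)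

theorem coordVec_apply (i j : Coord n) : coordVec i j.1 j.2 = if j = i then (1 : ℂ) else 0 := by
  obtain ⟨b, k⟩ := i
  obtain ⟨b', k'⟩ := j
  by_cases h : b' = b
  · subst h
    by_cases h' : k' = k
    · subst h'; simp
    · simp [h']
  · simp [h]

theorem eq_sum_coordVec (v : Space n) : v = ∑ i : Coord n, v i.1 i.2 • coordVec i := by
  funext b k
  simp only [Finset.sum_apply, Pi.smul_apply, smul_eq_mul]
  rw [Finset.sum_eq_single ⟨b, k⟩]
  · simp
  · intro i _ hi
    have := coordVec_apply i ⟨b, k⟩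
    simp only [hi.symm, if_false] at this
    rw [this, mul_zero]
  · simp

theorem norm_coord_le (z : Space n) (i : Coord n) : ‖z i.1 i.2‖ ≤ ‖z‖ :=
  (norm_le_pi_norm (z i.1) i.2).trans (norm_le_pi_norm z i.1)

/-- The total derivative in terms of the partial derivatives. -/
theorem fderiv_eq_sum_partialD (f : Space n → ℂ) (z v : Space n) :
    fderiv ℂ f z v = ∑ i : Coord n, v i.1 i.2 * partialD i f z := by
  conv_lhs => rw [eq_sum_coordVec v]
  simp [partialD]

theorem norm_fderiv_le_of_partialD {f : Space n → ℂ} {z : Space n} {B : ℝ} (hB : 0 ≤ B)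
    (h : ∀ i : Coord n, ‖partialD i f z‖ ≤ B) :
    ‖fderiv ℂ f z‖ ≤ Fintype.card (Coord n) * B := by
  refine ContinuousLinearMap.opNorm_le_bound _ (by positivity) fun v => ?_
  rw [fderiv_eq_sum_partialD]
  refine (norm_sum_le _ _).trans ?_
  have : ∀ i ∈ (Finset.univ : Finset (Coord n)), ‖v i.1 i.2 * partialD i f z‖ ≤ ‖v‖ * B := by
    intro i _
    rw [norm_mul]
    exact mul_le_mul (norm_coord_le v i) (h i) (norm_nonneg _) (norm_nonneg _)
  refine (Finset.sum_le_sum this).trans (le_of_eq ?_)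
  simp only [Finset.sum_const, Finset.card_univ, nsmul_eq_mul]
  ring

theorem differentiableOn_partialD {f : Space n → ℂ} {U : Set (Space n)} (hU : IsOpen U)
    (hf : DifferentiableOn ℂ f U) (i : Coord n) : DifferentiableOn ℂ (partialD i f) U :=
  differentiableOn_fderiv_apply hU hf _

theorem differentiableOn_iterPartialD {f : Space n → ℂ} {U : Set (Space n)} (hU : IsOpen U)
    (hf : DifferentiableOn ℂ f U) (l : List (Coord n)) :
    DifferentiableOn ℂ (iterPartialD l f) U := by
  induction l with
  | nil => exact hf
  | cons i l ih => exact differentiableOn_partialD hU ih i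

theorem differentiableOn_fderiv {f : Space n → ℂ} {U : Set (Space n)} (hU : IsOpen U)
    (hf : DifferentiableOn ℂ f U) : DifferentiableOn ℂ (fderiv ℂ f) U := by
  have : fderiv ℂ f = fun z => ∑ i : Coord n, partialD i f z •
      ((ContinuousLinearMap.proj (R := ℂ) (φ := fun _ => ℂ) i.2).comp
        (ContinuousLinearMap.proj (R := ℂ) (φ := fun b => Fin (n b) → ℂ) i.1)) := by
    funext z
    ext v
    rw [fderiv_eq_sum_partialD]
    simp only [sum_apply, smul_apply, smul_eq_mul]
    exact Finset.sum_congr rfl fun i _ => mul_comm _ _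
  rw [this]
  exact DifferentiableOn.fun_sum fun i _ => (differentiableOn_partialD hU hf i).smul_const _

theorem partialD_comm {f : Space n → ℂ} {U : Set (Space n)} (hU : IsOpen U)
    (hf : DifferentiableOn ℂ f U) (i j : Coord n) {z : Space n} (hz : z ∈ U) :
    partialD i (partialD j f) z = partialD j (partialD i f) z := by
  have h1 : ∀ᶠ y in 𝓝 z, HasFDerivAt f (fderiv ℂ f y) y := by
    filter_upwards [hU.mem_nhds hz] with y hy
    exact (hf.differentiableAt (hU.mem_nhds hy)).hasFDerivAt
  have h2 := ((differentiableOn_fderiv hU hf).differentiableAt (hU.mem_nhds hz)).hasFDerivAt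
  have h3 := second_derivative_symmetric_of_eventually (𝕜 := ℂ) h1 h2
  have h4 : ∀ i j : Coord n, partialD i (partialD j f) z =
      fderiv ℂ (fderiv ℂ f) z (coordVec i) (coordVec j) := by
    intro i j
    have := (h2.clm_apply (hasFDerivAt_const (coordVec j) z)).fderiv
    have h5 : partialD i (partialD j f) z =
        fderiv ℂ (fun y => fderiv ℂ f y (coordVec j)) z (coordVec i) := rfl
    rw [h5, this]
    simp
  rw [h4, h4, h3]

theorem partialD_congr {f g : Space n → ℂ} {U : Set (Space n)} (hU : IsOpen U)
    (h : EqOn f g U) (i : Coord n) : EqOn (partialD i f) (partialD i g) U := fun z hz => by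
  have : f =ᶠ[𝓝 z] g := Filter.eventuallyEq_of_mem (hU.mem_nhds hz) h
  simp only [partialD, this.fderiv_eq]

theorem iterPartialD_congr {f g : Space n → ℂ} {U : Set (Space n)} (hU : IsOpen U)
    (h : EqOn f g U) (l : List (Coord n)) : EqOn (iterPartialD l f) (iterPartialD l g) U := by
  induction l with
  | nil => exact h
  | cons i l ih => exact partialD_congr hU ih i

theorem iterPartialD_append (l l' : List (Coord n)) (f : Space n → ℂ) :
    iterPartialD (l ++ l') f = iterPartialD l (iterPartialD l' f) := by
  induction l with
  | nil => rfl
  | cons i l ih => simp [iterPartialD, ih]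

theorem iterPartialD_perm {f : Space n → ℂ} {U : Set (Space n)} (hU : IsOpen U)
    (hf : DifferentiableOn ℂ f U) {l l' : List (Coord n)} (h : l.Perm l') :
    EqOn (iterPartialD l f) (iterPartialD l' f) U := by
  induction h with
  | nil => exact fun _ _ => rfl
  | cons i _ ih => exact partialD_congr hU ih i
  | swap i j l => exact fun z hz => partialD_comm hU (differentiableOn_iterPartialD hU hf l) _ _ hz
  | trans _ _ ih1 ih2 => exact ih1.trans ih2

theorem partialD_sum {κ : Type*} {s : Finset κ} {f : κ → Space n → ℂ} {U : Set (Space n)}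
    (hU : IsOpen U) (hf : ∀ k ∈ s, DifferentiableOn ℂ (f k) U) (i : Coord n) :
    EqOn (partialD i fun z => ∑ k ∈ s, f k z) (fun z => ∑ k ∈ s, partialD i (f k) z) U := by
  intro z hz
  simp only [partialD]
  rw [fderiv_fun_sum fun k hk => (hf k hk).differentiableAt (hU.mem_nhds hz)]
  simp

theorem partialD_const_mul {f : Space n → ℂ} {U : Set (Space n)}
    (hU : IsOpen U) (hf : DifferentiableOn ℂ f U) (c : ℂ) (i : Coord n) :
    EqOn (partialD i fun z => c * f z) (fun z => c * partialD i f z) U := by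
  intro z hz
  simp only [partialD]
  rw [fderiv_const_mul (hf.differentiableAt (hU.mem_nhds hz))]
  simp

theorem partialD_mul {f g : Space n → ℂ} {U : Set (Space n)}
    (hU : IsOpen U) (hf : DifferentiableOn ℂ f U) (hg : DifferentiableOn ℂ g U) (i : Coord n) :
    EqOn (partialD i fun z => f z * g z)
      (fun z => f z * partialD i g z + partialD i f z * g z) U := by
  intro z hz
  simp only [partialD]
  rw [fderiv_fun_mul (hf.differentiableAt (hU.mem_nhds hz)) (hg.differentiableAt (hU.mem_nhds hz))]
  simp [mul_comm]

theorem iterPartialD_sum {κ : Type*} {s : Finset κ} {f : κ → Space n → ℂ} {U : Set (Space n)}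
    (hU : IsOpen U) (hf : ∀ k ∈ s, DifferentiableOn ℂ (f k) U) (l : List (Coord n)) :
    EqOn (iterPartialD l fun z => ∑ k ∈ s, f k z) (fun z => ∑ k ∈ s, iterPartialD l (f k) z) U := by
  induction l with
  | nil => exact fun _ _ => rfl
  | cons i l ih =>
    exact (partialD_congr hU ih i).trans
      (partialD_sum hU (fun k hk => differentiableOn_iterPartialD hU (hf k hk) l) i)

theorem iterPartialD_const_mul {f : Space n → ℂ} {U : Set (Space n)}
    (hU : IsOpen U) (hf : DifferentiableOn ℂ f U) (c : ℂ) (l : List (Coord n)) :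
    EqOn (iterPartialD l fun z => c * f z) (fun z => c * iterPartialD l f z) U := by
  induction l with
  | nil => exact fun _ _ => rfl
  | cons i l ih =>
    exact (partialD_congr hU ih i).trans
      (partialD_const_mul hU (differentiableOn_iterPartialD hU hf l) c i)

theorem iterPartialD_sub {f g : Space n → ℂ} {U : Set (Space n)}
    (hU : IsOpen U) (hf : DifferentiableOn ℂ f U) (hg : DifferentiableOn ℂ g U)
    (l : List (Coord n)) :
    EqOn (iterPartialD l fun z => f z - g z)
      (fun z => iterPartialD l f z - iterPartialD l g z) U := by
  induction l with
  | nil => exact fun _ _ => rfl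
  | cons i l ih =>
    refine (partialD_congr hU ih i).trans fun z hz => ?_
    simp only [partialD, iterPartialD]
    rw [fderiv_fun_sub ((differentiableOn_iterPartialD hU hf l).differentiableAt (hU.mem_nhds hz))
      ((differentiableOn_iterPartialD hU hg l).differentiableAt (hU.mem_nhds hz))]
    simp

end Partial

/-! ### Multi-indices and polynomials -/

section Polynomials

variable {L r : ℕ} {n : Option (Fin L ⊕ Fin r) → ℕ}

/-- The multi-index with a single entry `1`, at the coordinate `i`. -/
abbrev unitIdx (i : Coord n) : MultiIndex n := Pi.single i.1 (Pi.single i.2 1)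

theorem unitIdx_apply (i j : Coord n) : unitIdx i j.1 j.2 = if j = i then 1 else 0 := by
  obtain ⟨b, k⟩ := i
  obtain ⟨b', k'⟩ := j
  by_cases h : b' = b
  · subst h
    by_cases h' : k' = k
    · subst h'; simp
    · simp [h']
  · simp [h]

theorem multiIndex_ext {α β : MultiIndex n} (h : ∀ i : Coord n, α i.1 i.2 = β i.1 i.2) : α = β :=
  funext fun b => funext fun k => h ⟨b, k⟩

/-- The multi-index counting the coordinates in a list. -/
def idxOf (l : List (Coord n)) : MultiIndex n := fun b k => l.count ⟨b, k⟩

/-- A list of coordinates with a given multi-index. -/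
def listOf (α : MultiIndex n) : List (Coord n) :=
  (∑ i : Coord n, α i.1 i.2 • ({i} : Multiset (Coord n))).toList

theorem idxOf_listOf (α : MultiIndex n) : idxOf (listOf α) = α := by
  refine multiIndex_ext fun i => ?_
  have : idxOf (listOf α) i.1 i.2 = Multiset.count i (listOf α : Multiset (Coord n)) := by
    rw [Multiset.coe_count]; rfl
  rw [this, listOf, Multiset.coe_toList, Multiset.count_sum']
  simp [Multiset.count_singleton]

theorem perm_of_idxOf_eq {l l' : List (Coord n)} (h : idxOf l = idxOf l') : l.Perm l' := by
  rw [List.perm_iff_count]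
  exact fun i => congrFun (congrFun h i.1) i.2

theorem idxOf_nil : idxOf ([] : List (Coord n)) = 0 := rfl

theorem idxOf_cons (i : Coord n) (l : List (Coord n)) : idxOf (i :: l) = idxOf l + unitIdx i := by
  refine multiIndex_ext fun j => ?_
  simp only [idxOf, List.count_cons, Pi.add_apply, unitIdx_apply, beq_iff_eq]
  simp only [eq_comm (a := i)]

theorem idxOf_append (l l' : List (Coord n)) : idxOf (l ++ l') = idxOf l + idxOf l' := by
  refine multiIndex_ext fun j => ?_
  simp [idxOf, List.count_append]

/-- A weighted degree of multi-indices. -/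
def wdeg {M : Type*} [AddCommMonoid M] (w : Coord n → M) (α : MultiIndex n) : M :=
  ∑ i : Coord n, α i.1 i.2 • w i

theorem wdeg_add {M : Type*} [AddCommMonoid M] (w : Coord n → M) (α β : MultiIndex n) :
    wdeg w (α + β) = wdeg w α + wdeg w β := by
  simp [wdeg, add_smul, Finset.sum_add_distrib]

theorem wdeg_zero {M : Type*} [AddCommMonoid M] (w : Coord n → M) :
    wdeg w (0 : MultiIndex n) = 0 := by
  simp [wdeg]

theorem wdeg_unitIdx {M : Type*} [AddCommMonoid M] (w : Coord n → M) (i : Coord n) :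
    wdeg w (unitIdx i) = w i := by
  unfold wdeg
  rw [Finset.sum_eq_single i]
  · rw [unitIdx_apply]; simp
  · intro j _ hj; rw [unitIdx_apply]; simp [hj]
  · simp

/-- The function `z ^ α / α!`. -/
def divMono (α : MultiIndex n) (z : Space n) : ℂ :=
  ∏ i : Coord n, (z i.1 i.2 ^ α i.1 i.2 / (α i.1 i.2).factorial)

theorem divMono_eq (α : MultiIndex n) (z : Space n) :
    divMono α z = (∏ b, ∏ i, z b i ^ α b i) / ((∏ b, ∏ i, (α b i).factorial : ℕ) : ℂ) := by
  unfold divMono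
  rw [Finset.prod_div_distrib, Fintype.prod_sigma, Fintype.prod_sigma]
  push_cast
  rfl

theorem divMono_zero (z : Space n) : divMono 0 z = 1 := by simp [divMono]

theorem divMono_at_zero {α : MultiIndex n} (hα : α ≠ 0) : divMono α (0 : Space n) = 0 := by
  obtain ⟨i, hi⟩ : ∃ i : Coord n, α i.1 i.2 ≠ 0 := by
    by_contra! h
    exact hα (multiIndex_ext h)
  exact Finset.prod_eq_zero (Finset.mem_univ i) (by simp [hi])

theorem contDiff_divMono {𝕜 : Type*} [NontriviallyNormedField 𝕜] [NormedAlgebra 𝕜 ℂ]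
    (α : MultiIndex n) :
    ContDiff 𝕜 ∞ (divMono α) := by
  unfold divMono
  refine contDiff_prod fun i _ => ?_
  have h : ContDiff 𝕜 ∞ fun z : Space n => z i.1 i.2 :=
    contDiff_pi.1 (contDiff_pi.1 contDiff_id i.1) i.2
  exact (h.pow _).div_const _

theorem differentiable_divMono (α : MultiIndex n) : Differentiable ℂ (divMono α) :=
  (contDiff_divMono α).differentiable (by simp)

theorem partialD_eq_deriv {f : Space n → ℂ} {z : Space n} (hf : DifferentiableAt ℂ f z)
    (i : Coord n) : partialD i f z = deriv (fun t : ℂ => f (z + t • coordVec i)) 0 := by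
  have h1 : HasDerivAt (fun t : ℂ => z + t • coordVec i) (coordVec i) 0 := by
    simpa using ((hasDerivAt_id (0 : ℂ)).smul_const (coordVec i)).const_add z
  have h2 : DifferentiableAt ℂ f (z + (0 : ℂ) • coordVec i) := by simpa using hf
  have := (h2.hasFDerivAt.comp_hasDerivAt (0 : ℂ) h1).deriv
  simp only [zero_smul, add_zero] at this
  exact this.symm

theorem partialD_divMono (α : MultiIndex n) (i : Coord n) (z : Space n) :
    partialD i (divMono α) z = if α i.1 i.2 = 0 then 0 else divMono (α - unitIdx i) z := by
  rw [partialD_eq_deriv (differentiable_divMono α z)]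
  have h1 : ∀ t : ℂ, divMono α (z + t • coordVec i) =
      ((z i.1 i.2 + t) ^ α i.1 i.2 / (α i.1 i.2).factorial) *
        ∏ j ∈ Finset.univ.erase i, (z j.1 j.2 ^ α j.1 j.2 / (α j.1 j.2).factorial : ℂ) := by
    intro t
    rw [divMono, ← Finset.mul_prod_erase _ _ (Finset.mem_univ i)]
    congr 1
    · have := coordVec_apply i i
      simp only [if_true] at this
      simp only [Pi.add_apply, Pi.smul_apply, this, smul_eq_mul, mul_one]
    · refine Finset.prod_congr rfl fun j hj => ?_
      have := coordVec_apply i j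
      simp only [Finset.ne_of_mem_erase hj, if_false] at this
      simp only [Pi.add_apply, Pi.smul_apply, this, smul_eq_mul, mul_zero, add_zero]
  simp only [h1]
  have h2 : HasDerivAt (fun t : ℂ => (z i.1 i.2 + t) ^ α i.1 i.2 / (α i.1 i.2).factorial *
      ∏ j ∈ Finset.univ.erase i, (z j.1 j.2 ^ α j.1 j.2 / (α j.1 j.2).factorial : ℂ))
      (((α i.1 i.2 : ℂ) * (z i.1 i.2) ^ (α i.1 i.2 - 1)) / (α i.1 i.2).factorial *
      ∏ j ∈ Finset.univ.erase i, (z j.1 j.2 ^ α j.1 j.2 / (α j.1 j.2).factorial : ℂ)) 0 := by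
    have h3 := (((hasDerivAt_id (0 : ℂ)).const_add (z i.1 i.2)).pow (α i.1 i.2)).div_const
      ((α i.1 i.2).factorial : ℂ)
    refine (h3.mul_const _).congr_deriv ?_
    simp
  rw [h2.deriv]
  split_ifs with h
  · simp [h]
  · rw [divMono, ← Finset.mul_prod_erase _ _ (Finset.mem_univ i)]
    congr 1
    · have h4 := unitIdx_apply i i
      simp only [if_true] at h4
      simp only [Pi.sub_apply, h4]
      obtain ⟨a, ha⟩ := Nat.exists_eq_succ_of_ne_zero h
      rw [ha, Nat.factorial_succ]
      have : (a.factorial : ℂ) ≠ 0 := by exact_mod_cast a.factorial_ne_zero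
      have h5 : ((a : ℂ) + 1) ≠ 0 := by exact_mod_cast a.succ_ne_zero
      simp only [Nat.succ_eq_add_one, Nat.add_sub_cancel]
      push_cast
      field_simp
    · refine Finset.prod_congr rfl fun j hj => ?_
      have h4 := unitIdx_apply i j
      simp only [Finset.ne_of_mem_erase hj, if_false] at h4
      simp only [Pi.sub_apply, h4, Nat.sub_zero]

theorem sub_unitIdx_add {α : MultiIndex n} {i : Coord n} (h : α i.1 i.2 ≠ 0) :
    α - unitIdx i + unitIdx i = α := by
  refine multiIndex_ext fun j => ?_
  simp only [Pi.add_apply, Pi.sub_apply, unitIdx_apply]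
  split_ifs with hj
  · subst hj; omega
  · rfl

/-- Reindexing of the derivative of a sum of multiples of the functions `z ^ α / α!`. -/
theorem sum_partialD_divMono (c : MultiIndex n → ℂ) {s t : Finset (MultiIndex n)} (i : Coord n)
    (hst : ∀ β, β ∈ t ↔ β + unitIdx i ∈ s) (z : Space n) :
    ∑ α ∈ s, c α * partialD i (divMono α) z = ∑ β ∈ t, c (β + unitIdx i) * divMono β z := by
  simp only [partialD_divMono]
  symm
  refine Finset.sum_bij_ne_zero (fun β _ _ => β + unitIdx i) ?_ ?_ ?_ ?_
  · intro β hβ _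
    exact (hst β).1 hβ
  · intro β _ _ β' _ _ h
    exact add_right_cancel h
  · intro α hα hne
    have h0 : α i.1 i.2 ≠ 0 := fun h => hne (by simp [h])
    refine ⟨α - unitIdx i, ?_, ?_, sub_unitIdx_add h0⟩
    · rw [hst, sub_unitIdx_add h0]; exact hα
    · rw [sub_unitIdx_add h0]
      simpa [h0] using hne
  · intro β hβ _
    have h1 : (β + unitIdx i) i.1 i.2 ≠ 0 := by
      have := unitIdx_apply i i
      simp only [Pi.add_apply, this]
      simp
    rw [if_neg h1]
    congr 2
    exact (add_tsub_cancel_right β (unitIdx i)).symm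

theorem iterPartialD_poly (c : MultiIndex n → ℂ) (l : List (Coord n)) (s t : Finset (MultiIndex n))
    (hst : ∀ β, β ∈ t ↔ β + idxOf l ∈ s) (z : Space n) :
    iterPartialD l (fun z => ∑ α ∈ s, c α * divMono α z) z =
      ∑ β ∈ t, c (β + idxOf l) * divMono β z := by
  classical
  induction l generalizing t z with
  | nil =>
    have : t = s := by ext β; simpa [idxOf_nil] using hst β
    simp [iterPartialD, this, idxOf_nil]
  | cons i l ih =>
    -- the intermediate index set
    set u : Finset (MultiIndex n) := (s.filter fun α => idxOf l ≤ α).image fun α => α - idxOf l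
      with hu
    have hu' : ∀ β, β ∈ u ↔ β + idxOf l ∈ s := by
      intro β
      simp only [hu, Finset.mem_image, Finset.mem_filter]
      constructor
      · rintro ⟨α, ⟨h1, h2⟩, rfl⟩
        rwa [tsub_add_cancel_of_le h2]
      · intro h
        exact ⟨β + idxOf l, ⟨h, le_add_self⟩, add_tsub_cancel_right _ _⟩
    have h1 : iterPartialD l (fun z => ∑ α ∈ s, c α * divMono α z) =
        fun z => ∑ β ∈ u, c (β + idxOf l) * divMono β z := funext fun z => ih u hu' z
    have h2 : partialD i (fun z => ∑ β ∈ u, c (β + idxOf l) * divMono β z) z =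
        ∑ β ∈ u, c (β + idxOf l) * partialD i (divMono β) z := by
      have hd : ∀ β ∈ u, DifferentiableOn ℂ (fun z : Space n => c (β + idxOf l) * divMono β z)
          univ := fun β _ => ((differentiable_divMono β).const_mul _).differentiableOn
      rw [partialD_sum isOpen_univ hd i (mem_univ z)]
      refine Finset.sum_congr rfl fun β _ => ?_
      exact partialD_const_mul isOpen_univ (differentiable_divMono β).differentiableOn _ i
        (mem_univ z)
    show partialD i (iterPartialD l (fun z => ∑ α ∈ s, c α * divMono α z)) z = _
    rw [h1, h2, sum_partialD_divMono (fun β => c (β + idxOf l)) (t := t) i]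
    · refine Finset.sum_congr rfl fun β _ => ?_
      rw [idxOf_cons, add_assoc, add_comm (unitIdx i)]
    · intro β
      rw [hst, hu', idxOf_cons, add_assoc, add_comm (unitIdx i)]

theorem iterPartialD_comp_sub (f : Space n → ℂ) (p : Space n) (l : List (Coord n)) :
    iterPartialD l (fun z => f (z - p)) = fun z => iterPartialD l f (z - p) := by
  induction l with
  | nil => rfl
  | cons i l ih =>
    funext z
    simp only [iterPartialD, ih, partialD]
    rw [fderiv_comp_sub]

theorem length_eq_wdeg (l : List (Coord n)) : l.length = wdeg (fun _ => 1) (idxOf l) := by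
  induction l with
  | nil => simp [idxOf_nil, wdeg_zero]
  | cons i l ih => rw [idxOf_cons, wdeg_add, ← ih, wdeg_unitIdx, List.length_cons]

theorem finite_wdeg_le (m : ℕ) : {α : MultiIndex n | wdeg (fun _ => 1) α ≤ m}.Finite := by
  refine (Set.finite_Iic (fun (b : Option (Fin L ⊕ Fin r)) (_ : Fin (n b)) => m)).subset ?_
  intro α hα b k
  refine le_trans ?_ hα
  simp only [wdeg, smul_eq_mul, mul_one]
  exact Finset.single_le_sum (f := fun i : Coord n => α i.1 i.2) (fun _ _ => Nat.zero_le _)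
    (Finset.mem_univ ⟨b, k⟩)

/-- The Taylor polynomial with a prescribed symmetric jet of order `m` at `p`. -/
theorem exists_taylor_polynomial (c : List (Coord n) → ℂ) (hc : ∀ l l', l.Perm l' → c l = c l')
    (m : ℕ) (p : Space n) :
    ∃ P : Space n → ℂ, Differentiable ℂ P ∧ ContDiff ℝ ∞ P ∧
      (∀ l, l.length ≤ m → iterPartialD l P p = c l) ∧
      ∀ l, m < l.length → ∀ z, iterPartialD l P z = 0 := by
  classical
  set s : Finset (MultiIndex n) := (finite_wdeg_le m).toFinset with hs
  have hs' : ∀ α, α ∈ s ↔ wdeg (fun _ => 1) α ≤ m := by simp [hs]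
  set Q : Space n → ℂ := fun z => ∑ α ∈ s, c (listOf α) * divMono α z with hQ
  have hD : ∀ (l : List (Coord n)) (z : Space n), iterPartialD l (fun z => Q (z - p)) z =
      ∑ β ∈ s.filter (fun β => β + idxOf l ∈ s), c (listOf (β + idxOf l)) * divMono β (z - p) := by
    intro l z
    rw [iterPartialD_comp_sub]
    refine iterPartialD_poly (fun α => c (listOf α)) l s _ ?_ _
    intro β
    simp only [Finset.mem_filter, and_iff_right_iff_imp]
    intro h
    rw [hs', wdeg_add] at h
    rw [hs']
    omega
  refine ⟨fun z => Q (z - p), ?_, ?_, ?_, ?_⟩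
  · refine Differentiable.comp (g := Q) ?_ (differentiable_id.sub_const p)
    exact Differentiable.fun_sum fun α _ => (differentiable_divMono α).const_mul _
  · refine ContDiff.comp (g := Q) ?_ (contDiff_id.sub contDiff_const)
    exact ContDiff.sum fun α _ => contDiff_const.mul (contDiff_divMono α)
  · intro l hl
    rw [hD, Finset.sum_eq_single 0]
    · rw [divMono_zero, mul_one, zero_add]
      exact hc _ _ (perm_of_idxOf_eq (idxOf_listOf _))
    · intro β _ hβ
      rw [sub_self, divMono_at_zero hβ, mul_zero]
    · intro h
      exfalso
      apply h
      rw [Finset.mem_filter, hs', hs', zero_add, ← length_eq_wdeg, wdeg_zero]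
      exact ⟨Nat.zero_le _, hl⟩
  · intro l hl z
    rw [hD]
    refine Finset.sum_eq_zero fun β hβ => ?_
    exfalso
    have := (Finset.mem_filter.1 hβ).2
    rw [hs', wdeg_add, ← length_eq_wdeg] at this
    omega

end Polynomials

/-! ### Comparison of Taylor polynomials -/

section Taylor

variable {L r : ℕ} {n : Option (Fin L ⊕ Fin r) → ℕ}

/-- The points of `Γ ⊆ Ω` are joined to `y` inside `Γ` at a cost at most `Λ`, as measured by the mean
value inequality: `‖h p - h y‖ ≤ B Λ` on `Γ` for all holomorphic functions `h` on `Ω` whose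
derivative is bounded by `B` on `Γ`. This is what is used of a family of paths of length at most `Λ`. -/
def CtrlOn (Ω Γ : Set (Space n)) (y : Space n) (Λ : ℝ) : Prop :=
  Γ ⊆ Ω ∧ ∀ h : Space n → ℂ, DifferentiableOn ℂ h Ω → ∀ B : ℝ, 0 ≤ B →
    (∀ p ∈ Γ, ‖fderiv ℂ h p‖ ≤ B) → ∀ p ∈ Γ, ‖h p - h y‖ ≤ B * Λ

/-- The points `y` and `x` are joined inside `Ω` at a cost at most `Λ`. -/
def Ctrl (Ω : Set (Space n)) (y x : Space n) (Λ : ℝ) : Prop :=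
  ∃ Γ, y ∈ Γ ∧ x ∈ Γ ∧ CtrlOn Ω Γ y Λ

theorem ctrlOn_closedBall (p : Space n) {R : ℝ} (hR : 0 ≤ R) :
    CtrlOn univ (closedBall p R) p R := by
  refine ⟨subset_univ _, fun h hh B hB hb x hx => ?_⟩
  have h1 := (convex_closedBall p R).norm_image_sub_le_of_norm_fderiv_le (𝕜 := ℂ) (f := h) (C := B)
    (fun y _ => hh.differentiableAt univ_mem) hb (mem_closedBall_self hR) hx
  refine h1.trans ?_
  gcongr
  rwa [mem_closedBall, dist_eq_norm] at hx

/-- Estimates of the derivatives of order at most `m` along a path, from estimates at its starting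
point and an estimate of the derivatives of order `m + 1`. -/
theorem norm_iterPartialD_le_of_ctrlOn {Ω Γ : Set (Space n)} (hΩ : IsOpen Ω) {y : Space n}
    {Λ η M : ℝ} (hΓ : CtrlOn Ω Γ y Λ) (hΛ : Λ ≤ η) (hη : 0 ≤ η) (hM : 0 ≤ M)
    {h : Space n → ℂ} (hh : DifferentiableOn ℂ h Ω) (m : ℕ)
    (h0 : ∀ l : List (Coord n), l.length ≤ m → ‖iterPartialD l h y‖ ≤ M * η ^ (m + 1 - l.length))
    (h1 : ∀ l : List (Coord n), l.length = m + 1 → ∀ p ∈ Γ, ‖iterPartialD l h p‖ ≤ M)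
    (l : List (Coord n)) (hl : l.length ≤ m + 1) {p : Space n} (hp : p ∈ Γ) :
    ‖iterPartialD l h p‖ ≤ M * ((1 + Fintype.card (Coord n)) * η) ^ (m + 1 - l.length) := by
  set d : ℝ := (Fintype.card (Coord n) : ℝ) with hd
  have hd0 : 0 ≤ d := Nat.cast_nonneg _
  obtain ⟨k, hk⟩ : ∃ k, l.length + k = m + 1 := ⟨m + 1 - l.length, by omega⟩
  have hk' : m + 1 - l.length = k := by omega
  rw [hk']
  clear hk'
  induction k generalizing l p with
  | zero => simpa using h1 l hk p hp
  | succ k ih =>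
    have hB : 0 ≤ M * ((1 + d) * η) ^ k := by positivity
    have h2 : ∀ q ∈ Γ, ‖fderiv ℂ (iterPartialD l h) q‖ ≤ d * (M * ((1 + d) * η) ^ k) := by
      intro q hq
      refine norm_fderiv_le_of_partialD hB fun i => ?_
      refine ih (i :: l) ?_ hq ?_
      · simp only [List.length_cons]; omega
      · simp only [List.length_cons]; omega
    have h3 := hΓ.2 _ (differentiableOn_iterPartialD hΩ hh l) _ (by positivity) h2 p hp
    have h4 := h0 l (by omega)
    rw [show m + 1 - l.length = k + 1 by omega] at h4
    have h5 : (1 : ℝ) ≤ (1 + d) ^ k := one_le_pow₀ (by linarith)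
    calc ‖iterPartialD l h p‖
        ≤ ‖iterPartialD l h p - iterPartialD l h y‖ + ‖iterPartialD l h y‖ := by
          simpa using norm_add_le (iterPartialD l h p - iterPartialD l h y) (iterPartialD l h y)
      _ ≤ d * (M * ((1 + d) * η) ^ k) * η + M * η ^ (k + 1) := by
          refine add_le_add (h3.trans ?_) h4
          gcongr
      _ = M * η ^ (k + 1) * (d * (1 + d) ^ k + 1) := by rw [mul_pow]; ring
      _ ≤ M * η ^ (k + 1) * (d * (1 + d) ^ k + (1 + d) ^ k) := by gcongr
      _ = M * ((1 + d) * η) ^ (k + 1) := by rw [mul_pow]; ring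

/-- The data of Whitney's extension theorem: at every point of `Ω` there are Taylor polynomials of
`f` of all orders, which agree with each other up to the expected errors. -/
theorem exists_compatible_polynomials {Ω : Set (Space n)} (hΩ : IsOpen Ω)
    (hbd : Bornology.IsBounded Ω) {C : ℝ} (hC : ∀ x ∈ Ω, ∀ y ∈ Ω, Ctrl Ω y x (C * ‖x - y‖))
    {f : Space n → ℂ} (hf : DifferentiableOn ℂ f Ω)
    (hfb : ∀ l : List (Coord n), ∃ B : ℝ, ∀ z ∈ Ω, ‖iterPartialD l f z‖ ≤ B) :
    ∃ (P : Space n → ℕ → Space n → ℂ) (K : ℕ → ℝ), (∀ m, 0 ≤ K m) ∧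
      (∀ p m, Differentiable ℂ (P p m)) ∧ (∀ p m, ContDiff ℝ ∞ (P p m)) ∧
      (∀ p ∈ Ω, ∀ m, P p m p = f p) ∧
      ∀ p ∈ Ω, ∀ q ∈ Ω, ∀ m m₁, m ≤ m₁ → ∀ δ : ℝ, 0 < δ → δ ≤ 1 → ‖p - q‖ ≤ 8 * δ →
        ∀ x, ‖x - p‖ ≤ 8 * δ → ∀ l : List (Coord n), l.length ≤ m →
          ‖iterPartialD l (fun z => P p m₁ z - P q m z) x‖ ≤ K m₁ * δ ^ (m + 1 - l.length) := by
  classical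
  set d : ℝ := (Fintype.card (Coord n) : ℝ) with hd
  have hd0 : 0 ≤ d := Nat.cast_nonneg _
  choose! B hB using hfb
  -- outside `Ω` any polynomial will do
  have hP : ∀ p : Space n, ∀ m : ℕ, ∃ P : Space n → ℂ, Differentiable ℂ P ∧ ContDiff ℝ ∞ P ∧
      (p ∈ Ω → ∀ l, l.length ≤ m → iterPartialD l P p = iterPartialD l f p) ∧
      ∀ l, m < l.length → ∀ z, iterPartialD l P z = 0 := by
    intro p m
    by_cases hp : p ∈ Ω
    · obtain ⟨P, h1, h2, h3, h4⟩ := exists_taylor_polynomial (fun l => iterPartialD l f p)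
        (fun l l' hl => iterPartialD_perm hΩ hf hl hp) m p
      exact ⟨P, h1, h2, fun _ => h3, h4⟩
    · obtain ⟨P, h1, h2, h3, h4⟩ := exists_taylor_polynomial (n := n) (fun l => 0)
        (fun l l' hl => rfl) m p
      exact ⟨P, h1, h2, fun h => absurd h hp, h4⟩
  choose P hP1 hP2 hP3 hP4 using hP
  -- bounds of the derivatives of `f` of order at most `m`
  obtain ⟨b, hb0, hb⟩ : ∃ b : ℕ → ℝ, (∀ m, 0 ≤ b m) ∧ ∀ m, ∀ l : List (Coord n), l.length ≤ m →
      ∀ z ∈ Ω, ‖iterPartialD l f z‖ ≤ b m := by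
    have : ∀ m : ℕ, ∃ b : ℝ, 0 ≤ b ∧ ∀ l : List (Coord n), l.length ≤ m →
        ∀ z ∈ Ω, ‖iterPartialD l f z‖ ≤ b := by
      intro m
      have hfin := List.finite_length_le (Coord n) m
      refine ⟨∑ l ∈ hfin.toFinset, |B l|, Finset.sum_nonneg fun _ _ => abs_nonneg _, ?_⟩
      intro l hl z hz
      refine ((hB l z hz).trans (le_abs_self _)).trans ?_
      exact Finset.single_le_sum (f := fun l => |B l|) (fun _ _ => abs_nonneg _)
        (hfin.mem_toFinset.2 hl)
    choose b hb0 hb using this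
    exact ⟨b, hb0, hb⟩
  obtain ⟨R, hR8, hR⟩ : ∃ R : ℝ, 8 ≤ R ∧ ∀ x ∈ Ω, ∀ y ∈ Ω, ‖x - y‖ ≤ R := by
    obtain ⟨R, hR⟩ := hbd.exists_norm_le
    refine ⟨max 8 (R + R), le_max_left _ _, fun x hx y hy => ?_⟩
    exact ((norm_sub_le _ _).trans (add_le_add (hR x hx) (hR y hy))).trans (le_max_right _ _)
  -- bounds of the derivatives of the Taylor polynomials
  set b' : ℕ → ℝ := fun m => b m * ((1 + d) * (2 * R)) ^ (m + 1) with hb'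
  have hb'0 : ∀ m, 0 ≤ b' m := fun m => mul_nonneg (hb0 m) (by positivity)
  have hPb : ∀ p ∈ Ω, ∀ m, ∀ l : List (Coord n), ∀ x ∈ closedBall p (2 * R),
      ‖iterPartialD l (P p m) x‖ ≤ b' m := by
    intro p hp m l x hx
    by_cases hl : l.length ≤ m
    · have h1 := norm_iterPartialD_le_of_ctrlOn isOpen_univ
        (ctrlOn_closedBall p (R := 2 * R) (by linarith)) le_rfl (by linarith) (hb0 m)
        (hP1 p m).differentiableOn m ?_ ?_ l (by omega) hx
      · refine h1.trans ?_
        have : (1 : ℝ) ≤ (1 + Fintype.card (Coord n)) * (2 * R) := by nlinarith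
        exact mul_le_mul_of_nonneg_left (pow_le_pow_right₀ this (by omega)) (hb0 m)
      · intro l' hl'
        rw [hP3 p m hp l' hl']
        refine (hb m l' hl' p hp).trans ?_
        exact le_mul_of_one_le_right (hb0 m) (one_le_pow₀ (by linarith))
      · intro l' hl' q _
        rw [hP4 p m l' (by omega), norm_zero]
        exact hb0 m
    · rw [hP4 p m l (by omega), norm_zero]
      exact hb'0 m
  -- a power of `C'` is lost on the way from `q` to `p` inside `Ω` and then on the segment from `p`
  -- to `x`; the sum in `K m` dominates the constants of all orders up to `m + 1`
  set C' : ℝ := (1 + d) * (8 * ((1 + d) * |C|) + 8) with hC'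
  have hC'1 : 1 ≤ C' := by
    have : 0 ≤ (1 + d) * |C| := by positivity
    nlinarith
  set k : ℕ → ℝ := fun m => (b m + b' m) + (b' m + b' m) with hk
  have hk0 : ∀ m, 0 ≤ k m := fun m => by have := hb0 m; have := hb'0 m; simp only [hk]; linarith
  set K : ℕ → ℝ := fun m => (∑ i ∈ Finset.range (m + 2), k i) * C' ^ (m + 1) with hK
  have hsum0 : ∀ m, 0 ≤ ∑ i ∈ Finset.range m, k i := fun m => Finset.sum_nonneg fun i _ => hk0 i
  refine ⟨P, K, fun m => mul_nonneg (hsum0 _) (by positivity), hP1, hP2, ?_, ?_⟩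
  · intro p hp m
    exact hP3 p m hp [] (Nat.zero_le _)
  intro p hp q hq m m₁ hm δ hδ hδ1 hpq x hx l hl
  set M : ℝ := ∑ i ∈ Finset.range (m₁ + 2), k i with hM
  have hM0 : 0 ≤ M := hsum0 _
  have hkM : ∀ i, i ≤ m₁ + 1 → k i ≤ M := fun i hi =>
    Finset.single_le_sum (f := k) (fun i _ => hk0 i) (Finset.mem_range.2 (by omega))
  have hkey : ∀ i, 0 ≤ b i ∧ 0 ≤ b' i := fun i => ⟨hb0 i, hb'0 i⟩
  obtain ⟨Γ, hqΓ, hpΓ, hΓ⟩ := hC p hp q hq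
  -- the remainder `f - P q m` along a path from `q` to `p`
  have hrem : ∀ l : List (Coord n), l.length ≤ m →
      ‖iterPartialD l (fun z => f z - P q m z) p‖ ≤
        M * ((1 + d) * (|C| * (8 * δ))) ^ (m + 1 - l.length) := by
    intro l hl
    refine norm_iterPartialD_le_of_ctrlOn hΩ hΓ ?_ (by positivity) hM0
      (hf.fun_sub (hP1 q m).differentiableOn) m ?_ ?_ l (by omega) hpΓ
    · calc C * ‖p - q‖ ≤ |C| * ‖p - q‖ := by gcongr; exact le_abs_self C
        _ ≤ |C| * (8 * δ) := by gcongr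
    · intro l' hl'
      rw [iterPartialD_sub hΩ hf (hP1 q m).differentiableOn l' hq]
      dsimp only
      rw [hP3 q m hq l' hl', sub_self,
        norm_zero]
      positivity
    · intro l' hl' y hy
      have hyΩ := hΓ.1 hy
      rw [iterPartialD_sub hΩ hf (hP1 q m).differentiableOn l' hyΩ]
      refine (norm_sub_le _ _).trans ?_
      have e1 := hb (m + 1) l' hl'.le y hyΩ
      have e2 := hP4 q m l' (by omega) y
      rw [e2, norm_zero, add_zero]
      refine e1.trans (le_trans ?_ (hkM (m + 1) (by omega)))
      have := hkey (m + 1)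
      simp only [hk]; linarith
  have hD : DifferentiableOn ℂ (fun z => P p m₁ z - P q m z) univ :=
    ((hP1 p m₁).sub (hP1 q m)).differentiableOn
  have hx' : x ∈ closedBall p (8 * δ) := by rwa [mem_closedBall, dist_eq_norm]
  have hη0 : 0 ≤ (8 * ((1 + d) * |C|) + 8) * δ := by positivity
  have h1 := norm_iterPartialD_le_of_ctrlOn isOpen_univ (η := (8 * ((1 + d) * |C|) + 8) * δ)
    (ctrlOn_closedBall p (R := 8 * δ) (by positivity)) ?_ hη0 hM0 hD m ?_ ?_ l (by omega) hx'
  · refine h1.trans ?_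
    rw [show (1 + (Fintype.card (Coord n) : ℝ)) * ((8 * ((1 + d) * |C|) + 8) * δ) = C' * δ by
      rw [hC']; ring, mul_pow, ← mul_assoc]
    simp only [hK]
    refine mul_le_mul_of_nonneg_right ?_ (by positivity)
    exact mul_le_mul_of_nonneg_left (pow_le_pow_right₀ hC'1 (by omega)) hM0
  · have : 0 ≤ (1 + d) * |C| := by positivity
    nlinarith
  · intro l' hl'
    have e1 : iterPartialD l' (fun z => P p m₁ z - P q m z) p =
        iterPartialD l' (fun z => f z - P q m z) p := by
      rw [iterPartialD_sub isOpen_univ (hP1 p m₁).differentiableOn (hP1 q m).differentiableOn l'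
        (mem_univ p), iterPartialD_sub hΩ hf (hP1 q m).differentiableOn l' hp]
      dsimp only
      rw [hP3 p m₁ hp l' (by omega)]
    rw [e1]
    refine (hrem l' hl').trans (mul_le_mul_of_nonneg_left ?_ hM0)
    refine pow_le_pow_left₀ (by positivity) ?_ _
    nlinarith
  · intro l' hl' y hy
    rw [iterPartialD_sub isOpen_univ (hP1 p m₁).differentiableOn (hP1 q m).differentiableOn l'
      (mem_univ y)]
    refine (norm_sub_le _ _).trans ?_
    rw [hP4 q m l' (by omega), norm_zero, add_zero]
    have hy' : y ∈ closedBall p (2 * R) := closedBall_subset_closedBall (by linarith) hy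
    refine (hPb p hp m₁ l' y hy').trans (le_trans ?_ (hkM m₁ (by omega)))
    have := hkey m₁
    simp only [hk]; linarith

end Taylor

/-! ### Whitney's extension theorem for holomorphic functions -/

section Bump

variable {L r : ℕ} {n : Option (Fin L ⊕ Fin r) → ℕ}

/-- The coordinate `z ↦ z i`, as a real linear map. -/
def coordCLM (i : Coord n) : Space n →L[ℝ] ℂ :=
  (ContinuousLinearMap.proj (R := ℝ) (φ := fun _ => ℂ) i.2).comp
    (ContinuousLinearMap.proj (R := ℝ) (φ := fun b => Fin (n b) → ℂ) i.1)

theorem coordCLM_apply (i : Coord n) (z : Space n) : coordCLM i z = z i.1 i.2 := rfl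

theorem norm_coordCLM_le (i : Coord n) : ‖coordCLM i‖ ≤ 1 :=
  ContinuousLinearMap.opNorm_le_bound _ zero_le_one fun z => by
    rw [one_mul]; exact norm_coord_le z i

theorem fderiv_real_eq {F : Space n → ℂ} (hF : Differentiable ℂ F) :
    fderiv ℝ F = fun z => ∑ i : Coord n,
      (ContinuousLinearMap.lsmul ℝ ℂ (E := Space n →L[ℝ] ℂ)).flip (coordCLM i) (partialD i F z) := by
  funext z
  ext v
  have h1 : fderiv ℝ F z v = fderiv ℂ F z v := by
    rw [((hF z).hasFDerivAt.restrictScalars ℝ).fderiv]; rfl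
  rw [h1, fderiv_eq_sum_partialD, sum_apply]
  refine Finset.sum_congr rfl fun i _ => ?_
  simp only [ContinuousLinearMap.flip_apply, ContinuousLinearMap.lsmul_apply, smul_apply,
    smul_eq_mul, coordCLM_apply]
  ring

theorem contDiff_of_differentiable {F : Space n → ℂ} (hF : Differentiable ℂ F) (k : ℕ) :
    ContDiff ℝ k F := by
  induction k generalizing F with
  | zero => exact contDiff_zero.2 hF.continuous
  | succ k ih =>
    rw [Nat.cast_add, Nat.cast_one, contDiff_succ_iff_fderiv]
    refine ⟨hF.restrictScalars ℝ, by simp, ?_⟩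
    rw [fderiv_real_eq hF]
    refine ContDiff.sum fun i _ => ?_
    refine ContDiff.comp (ContinuousLinearMap.contDiff _) (ih ?_)
    exact differentiableOn_univ.1 (differentiableOn_partialD isOpen_univ hF.differentiableOn i)

/-- The real iterated derivatives of an entire function are controlled by its partial derivatives. -/
theorem norm_iteratedFDeriv_le_of_iterPartialD {F : Space n → ℂ} (hF : Differentiable ℂ F) (k : ℕ)
    (x : Space n) {B : ℝ}
    (h : ∀ l : List (Coord n), l.length = k → ‖iterPartialD l F x‖ ≤ B) :
    ‖iteratedFDeriv ℝ k F x‖ ≤ (Fintype.card (Coord n) : ℝ) ^ k * B := by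
  induction k generalizing F with
  | zero => simpa [iterPartialD] using h [] rfl
  | succ k ih =>
    have hpd : ∀ i : Coord n, Differentiable ℂ (partialD i F) := fun i =>
      differentiableOn_univ.1 (differentiableOn_partialD isOpen_univ hF.differentiableOn i)
    have key : ∀ i : Coord n, ‖iteratedFDeriv ℝ k (fun z =>
        (ContinuousLinearMap.lsmul ℝ ℂ (E := Space n →L[ℝ] ℂ)).flip (coordCLM i)
          (partialD i F z)) x‖ ≤ (Fintype.card (Coord n) : ℝ) ^ k * B := by
      intro i
      have h1 := ((ContinuousLinearMap.lsmul ℝ ℂ (E := Space n →L[ℝ] ℂ)).flip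
        (coordCLM i)).norm_iteratedFDeriv_comp_left (f := partialD i F) (x := x) (n := k)
        ((contDiff_of_differentiable (hpd i) k).contDiffAt) le_rfl
      refine h1.trans ?_
      have h2 : ‖(ContinuousLinearMap.lsmul ℝ ℂ (E := Space n →L[ℝ] ℂ)).flip (coordCLM i)‖ ≤ 1 := by
        refine ContinuousLinearMap.opNorm_le_bound _ zero_le_one fun c => ?_
        rw [ContinuousLinearMap.flip_apply, ContinuousLinearMap.lsmul_apply, norm_smul, one_mul]
        exact mul_le_of_le_one_right (norm_nonneg _) (norm_coordCLM_le i)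
      have h3 := ih (F := partialD i F) (hpd i) fun l hl => by
        have h4 := h (l ++ [i]) (by simp [hl])
        rwa [iterPartialD_append] at h4
      calc _ ≤ 1 * ‖iteratedFDeriv ℝ k (partialD i F) x‖ := by gcongr
        _ ≤ _ := by rw [one_mul]; exact h3
    rw [← norm_iteratedFDeriv_fderiv, fderiv_real_eq hF]
    have h5 : iteratedFDeriv ℝ k (fun z => ∑ i : Coord n,
        (ContinuousLinearMap.lsmul ℝ ℂ (E := Space n →L[ℝ] ℂ)).flip (coordCLM i) (partialD i F z)) x
        = ∑ i : Coord n, iteratedFDeriv ℝ k (fun z =>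
          (ContinuousLinearMap.lsmul ℝ ℂ (E := Space n →L[ℝ] ℂ)).flip (coordCLM i)
            (partialD i F z)) x := by
      rw [← iteratedFDeriv_sum_apply]
      · congr 1
        funext z
        rw [Finset.sum_apply]
      · intro i _
        exact ((ContinuousLinearMap.contDiff _).comp
          (contDiff_of_differentiable (hpd i) k)).contDiffAt
    rw [h5]
    refine (norm_sum_le _ _).trans ((Finset.sum_le_sum fun i _ => key i).trans (le_of_eq ?_))
    rw [Finset.sum_const, Finset.card_univ, nsmul_eq_mul, pow_succ]
    ring

/-- Leibniz rule for two functions whose derivatives grow by a factor `s` with each order. -/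
theorem norm_iteratedFDeriv_mul_le_of_scale {E : Type*} [NormedAddCommGroup E] [NormedSpace ℝ E]
    {u v : E → ℂ} (hu : ContDiff ℝ ∞ u) (hv : ContDiff ℝ ∞ v) {x : E} {k : ℕ} {A B s : ℝ}
    (hs : 0 ≤ s) (hA : 0 ≤ A)
    (h1 : ∀ a ≤ k, ‖iteratedFDeriv ℝ a u x‖ ≤ A * s ^ a)
    (h2 : ∀ a ≤ k, ‖iteratedFDeriv ℝ a v x‖ ≤ B * s ^ a) :
    ‖iteratedFDeriv ℝ k (fun y => u y * v y) x‖ ≤ 2 ^ k * (A * B) * s ^ k := by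
  refine (norm_iteratedFDeriv_mul_le (N := ∞) hu hv x (by exact_mod_cast le_top)).trans ?_
  have : ∀ i ∈ Finset.range (k + 1), (k.choose i : ℝ) * ‖iteratedFDeriv ℝ i u x‖ *
      ‖iteratedFDeriv ℝ (k - i) v x‖ ≤ (k.choose i : ℝ) * (A * B * s ^ k) := by
    intro i hi
    have hik : i ≤ k := by rw [Finset.mem_range] at hi; omega
    rw [mul_assoc]
    refine mul_le_mul_of_nonneg_left ?_ (Nat.cast_nonneg _)
    calc ‖iteratedFDeriv ℝ i u x‖ * ‖iteratedFDeriv ℝ (k - i) v x‖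
        ≤ (A * s ^ i) * (B * s ^ (k - i)) :=
          mul_le_mul (h1 i hik) (h2 _ (by omega)) (norm_nonneg _) (by positivity)
      _ = A * B * s ^ k := by
          rw [← Nat.add_sub_cancel' hik, pow_add]
          simp only [Nat.add_sub_cancel_left]; ring
  refine (Finset.sum_le_sum this).trans (le_of_eq ?_)
  rw [← Finset.sum_mul, ← Nat.cast_sum, Nat.sum_range_choose]
  push_cast
  ring

/-- A smooth function on the line supported in `[-1, 1]`, whose integer translates sum to `1`. -/
def bumpLine (x : ℝ) : ℝ := Real.smoothTransition (x + 1) - Real.smoothTransition x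

theorem sum_bumpLine {x : ℝ} {N : ℕ} (hx : |x| ≤ N) :
    ∑ k ∈ Finset.range (2 * N + 1), bumpLine (x - (k - N)) = 1 := by
  have h : ∀ k : ℕ, bumpLine (x - (k - N)) =
      (fun k : ℕ => -Real.smoothTransition (x - k + N + 1)) (k + 1) -
        (fun k : ℕ => -Real.smoothTransition (x - k + N + 1)) k := by
    intro k
    simp only [bumpLine]
    push_cast
    ring_nf
  rw [Finset.sum_congr rfl fun k _ => h k,
    Finset.sum_range_sub fun k : ℕ => -Real.smoothTransition (x - k + N + 1)]
  have h1 := abs_le.1 hx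
  rw [Real.smoothTransition.zero_of_nonpos, Real.smoothTransition.one_of_one_le]
  · simp
  · push_cast; linarith [h1.1]
  · push_cast; linarith [h1.2]

theorem abs_le_of_bumpLine_ne_zero {x : ℝ} (h : bumpLine x ≠ 0) : |x| ≤ 1 := by
  by_contra hx
  apply h
  rw [not_le, lt_abs] at hx
  unfold bumpLine
  rcases hx with hx | hx
  · rw [Real.smoothTransition.one_of_one_le (by linarith),
      Real.smoothTransition.one_of_one_le (by linarith), sub_self]
  · rw [Real.smoothTransition.zero_of_nonpos (by linarith),
      Real.smoothTransition.zero_of_nonpos (by linarith), sub_self]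

/-- The real coordinates of `Space n`: the real and imaginary parts of the coordinates. -/
def realCoord (i : Coord n × Bool) : Space n →L[ℝ] ℝ :=
  (if i.2 then Complex.reCLM else Complex.imCLM).comp (coordCLM i.1)

theorem abs_realCoord_le (i : Coord n × Bool) (z : Space n) : |realCoord i z| ≤ ‖z‖ := by
  unfold realCoord
  refine le_trans ?_ (norm_coord_le z i.1)
  cases i.2
  · simpa [coordCLM_apply] using Complex.abs_im_le_norm (z i.1.1 i.1.2)
  · simpa [coordCLM_apply] using Complex.abs_re_le_norm (z i.1.1 i.1.2)

theorem norm_le_of_realCoord {z : Space n} {B : ℝ} (hB : 0 ≤ B) (h : ∀ i, |realCoord i z| ≤ B) :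
    ‖z‖ ≤ 2 * B := by
  refine (pi_norm_le_iff_of_nonneg (by positivity)).2 fun b => ?_
  refine (pi_norm_le_iff_of_nonneg (by positivity)).2 fun k => ?_
  have h1 := h (⟨b, k⟩, true)
  have h2 := h (⟨b, k⟩, false)
  simp only [realCoord, if_true, ContinuousLinearMap.comp_apply, coordCLM_apply,
    Complex.reCLM_apply] at h1 h2
  refine (Complex.norm_le_abs_re_add_abs_im _).trans ?_
  simp only [Bool.false_eq_true, if_false, Complex.imCLM_apply] at h2
  linarith

/-- A smooth function of compact support on `Space n`, whose translates by the Gaussian integer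
points sum to `1`. -/
def bump (z : Space n) : ℂ := ((∏ i : Coord n × Bool, bumpLine (realCoord i z) : ℝ) : ℂ)

theorem contDiff_bump : ContDiff ℝ ∞ (bump (n := n)) := by
  unfold bump
  refine Complex.ofRealCLM.contDiff.comp ?_
  refine contDiff_prod fun i _ => ?_
  unfold bumpLine
  exact (Real.smoothTransition.contDiff.comp
    ((realCoord i).contDiff.add contDiff_const)).sub
      (Real.smoothTransition.contDiff.comp (realCoord i).contDiff)

theorem norm_le_of_bump_ne_zero {z : Space n} (h : bump z ≠ 0) : ‖z‖ ≤ 2 := by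
  have := norm_le_of_realCoord (z := z) zero_le_one fun i => ?_
  · linarith
  · refine abs_le_of_bumpLine_ne_zero fun h0 => h ?_
    rw [bump, Finset.prod_eq_zero (Finset.mem_univ i) h0]
    simp

theorem exists_bound_iteratedFDeriv_bump (k : ℕ) :
    ∃ B : ℝ, 0 ≤ B ∧ ∀ a ≤ k, ∀ x : Space n, ‖iteratedFDeriv ℝ a (bump (n := n)) x‖ ≤ B := by
  have hcs : HasCompactSupport (bump (n := n)) := by
    refine HasCompactSupport.of_support_subset_isCompact (isCompact_closedBall (0 : Space n) 2) ?_
    intro z hz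
    rw [mem_closedBall, dist_zero_right]
    exact norm_le_of_bump_ne_zero hz
  have : ∀ a : ℕ, ∃ B : ℝ, ∀ x : Space n, ‖iteratedFDeriv ℝ a (bump (n := n)) x‖ ≤ B := fun a =>
    (hcs.iteratedFDeriv (𝕜 := ℝ) a).exists_bound_of_continuous
      (contDiff_bump.continuous_iteratedFDeriv (by exact_mod_cast le_top))
  choose B hB using this
  refine ⟨∑ a ∈ Finset.range (k + 1), |B a|, Finset.sum_nonneg fun _ _ => abs_nonneg _, ?_⟩
  intro a ha x
  refine ((hB a x).trans (le_abs_self _)).trans ?_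
  exact Finset.single_le_sum (f := fun a => |B a|) (fun _ _ => abs_nonneg _)
    (Finset.mem_range.2 (by omega))

/-- The point of `Space n` with given real and imaginary parts of the coordinates. -/
def ofRealCoord (y : Coord n × Bool → ℝ) : Space n := fun b k =>
  ⟨y (⟨b, k⟩, true), y (⟨b, k⟩, false)⟩

theorem realCoord_ofRealCoord (y : Coord n × Bool → ℝ) (i : Coord n × Bool) :
    realCoord i (ofRealCoord y) = y i := by
  obtain ⟨⟨b, k⟩, c⟩ := i
  cases c <;> simp [realCoord, coordCLM_apply, ofRealCoord]

/-- The members of the partition of unity of mesh `1 / s` on the box of size `N / s`. -/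
def cell (s : ℝ) (N : ℕ) (c : Coord n × Bool → ℕ) (z : Space n) : ℂ :=
  bump (s • z - ofRealCoord fun i => (c i : ℝ) - N)

/-- The index set of the cells. -/
def cells (n : Option (Fin L ⊕ Fin r) → ℕ) (N : ℕ) : Finset (Coord n × Bool → ℕ) :=
  Fintype.piFinset fun _ => Finset.range (2 * N + 1)

theorem card_cells (N : ℕ) :
    (cells n N).card = (2 * N + 1) ^ Fintype.card (Coord n × Bool) := by
  simp [cells]

theorem sum_cell {s : ℝ} {N : ℕ} {z : Space n} (h : ∀ i, |s * realCoord i z| ≤ N) :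
    ∑ c ∈ cells n N, cell s N c z = 1 := by
  have h1 : ∀ c : Coord n × Bool → ℕ, cell s N c z =
      ((∏ i, bumpLine (s * realCoord i z - (c i - N)) : ℝ) : ℂ) := by
    intro c
    unfold cell bump
    congr 1
    refine Finset.prod_congr rfl fun i _ => ?_
    rw [map_sub, map_smul, realCoord_ofRealCoord, smul_eq_mul]
  rw [Finset.sum_congr rfl fun c _ => h1 c, ← Complex.ofReal_sum, cells,
    ← Finset.prod_univ_sum (fun _ => Finset.range (2 * N + 1))
      fun i (k : ℕ) => bumpLine (s * realCoord i z - (k - N))]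
  rw [Finset.prod_congr rfl fun i _ => sum_bumpLine (h i)]
  simp

theorem contDiff_cell (s : ℝ) (N : ℕ) (c : Coord n × Bool → ℕ) : ContDiff ℝ ∞ (cell s N c) := by
  unfold cell
  exact contDiff_bump.comp ((contDiff_id.const_smul s).sub contDiff_const)

theorem norm_iteratedFDeriv_cell_le {s : ℝ} (hs : 0 ≤ s) (N : ℕ) (c : Coord n × Bool → ℕ) {k : ℕ}
    {B : ℝ} (hB : ∀ x : Space n, ‖iteratedFDeriv ℝ k (bump (n := n)) x‖ ≤ B) (x : Space n) :
    ‖iteratedFDeriv ℝ k (cell s N c) x‖ ≤ B * s ^ k := by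
  set g : Space n →L[ℝ] Space n := s • ContinuousLinearMap.id ℝ (Space n) with hg
  have hgn : ‖g‖ ≤ s := by
    refine ContinuousLinearMap.opNorm_le_bound _ hs fun z => ?_
    simp [hg, norm_smul, abs_of_nonneg hs]
  set q := ofRealCoord (n := n) fun i => (c i : ℝ) - N with hq
  have h1 : cell s N c = (fun z => bump (z - q)) ∘ g := by
    funext z
    simp [cell, hg, hq]
  have h2 : ContDiff ℝ k fun z : Space n => bump (z - q) :=
    (contDiff_bump.comp (contDiff_id.sub contDiff_const)).of_le (by exact_mod_cast le_top)
  rw [h1, g.iteratedFDeriv_comp_right h2 x le_rfl]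
  refine (ContinuousMultilinearMap.norm_compContinuousLinearMap_le _ _).trans ?_
  rw [Finset.prod_const, Finset.card_univ, Fintype.card_fin]
  refine mul_le_mul ?_ (pow_le_pow_left₀ (norm_nonneg _) hgn k) (by positivity)
    ((norm_nonneg _).trans (hB 0))
  rw [iteratedFDeriv_comp_sub]
  exact hB _

/-- Points of the closed support of the same cell are close to each other. -/
theorem norm_sub_le_of_mem_cell {s : ℝ} (hs : 0 < s) {N : ℕ} {c : Coord n × Bool → ℕ}
    {z w : Space n} (hz : z ∈ tsupport (cell s N c)) (hw : w ∈ tsupport (cell s N c)) :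
    ‖z - w‖ ≤ 4 * s⁻¹ := by
  set q := ofRealCoord (n := n) fun i => (c i : ℝ) - N with hq
  have key : ∀ z ∈ tsupport (cell s N c), ‖s • z - q‖ ≤ 2 := by
    intro z hz
    have hcl : IsClosed {z : Space n | ‖s • z - q‖ ≤ 2} :=
      isClosed_le (by fun_prop) continuous_const
    refine closure_minimal (fun y hy => ?_) hcl hz
    exact norm_le_of_bump_ne_zero hy
  have h1 : s • (z - w) = (s • z - q) - (s • w - q) := by rw [smul_sub]; abel
  have h2 : s * ‖z - w‖ ≤ 4 := by
    rw [← abs_of_pos hs, ← Real.norm_eq_abs, ← norm_smul, h1]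
    exact (norm_sub_le _ _).trans (by linarith [key z hz, key w hw])
  rw [← div_eq_mul_inv, le_div_iff₀ hs]
  linarith

end Bump

section Whitney

variable {L r : ℕ} {n : Option (Fin L ⊕ Fin r) → ℕ}

/-- A monotone sequence of constants `K` is dominated by `2 ^ j` along a sequence of orders which
tends to infinity slowly enough. -/
theorem exists_slow_order (K : ℕ → ℝ) :
    ∃ m : ℕ → ℕ, Monotone m ∧ (∀ a, ∀ᶠ j in atTop, a ≤ m j) ∧ ∀ᶠ j in atTop, K (m j) ≤ 2 ^ j := by
  classical
  have hpow : ∀ B : ℝ, ∀ᶠ j : ℕ in atTop, B ≤ 2 ^ j := fun B =>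
    (tendsto_pow_atTop_atTop_of_one_lt one_lt_two).eventually_ge_atTop B
  refine ⟨fun j => Nat.findGreatest (fun a => K a ≤ 2 ^ j) j, ?_, fun a => ?_, ?_⟩
  · intro i j hij
    refine Nat.findGreatest_mono (fun a ha => ?_) hij
    exact le_trans ha (pow_le_pow_right₀ one_le_two hij)
  · filter_upwards [hpow (K a), eventually_ge_atTop a] with j hj haj
    exact Nat.le_findGreatest haj hj
  · filter_upwards [hpow (K 0)] with j hj
    exact Nat.findGreatest_spec (P := fun a => K a ≤ 2 ^ j) (Nat.zero_le j) hj

theorem pow_mul_inv_pow_le {T : ℝ} (hT : 1 ≤ T) {D k m : ℕ} (h : 2 * D + k + 1 ≤ m) :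
    (T ^ D) ^ 2 * T * T ^ k * T⁻¹ ^ (m + 1) ≤ T⁻¹ := by
  have h0 : 0 < T := by linarith
  have h1 : T⁻¹ ^ (m + 1) ≤ T⁻¹ ^ (2 * D + k + 2) :=
    pow_le_pow_of_le_one (by positivity) (inv_le_one_of_one_le₀ hT) (by omega)
  have h2 : 0 ≤ (T ^ D) ^ 2 * T * T ^ k := by positivity
  refine (mul_le_mul_of_nonneg_left h1 h2).trans (le_of_eq ?_)
  have h3 : (T ^ D) ^ 2 * T * T ^ k = T ^ (2 * D + k + 1) := by ring
  rw [h3, show 2 * D + k + 2 = (2 * D + k + 1) + 1 by ring, pow_succ (T⁻¹), ← mul_assoc, ← mul_pow,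
    mul_inv_cancel₀ h0.ne', one_pow, one_mul]

set_option maxHeartbeats 1600000 in
/-- **Whitney's extension theorem** for a holomorphic function with bounded derivatives on a bounded
open set in which the distance is comparable with the length of paths. The extension is the limit of
the functions obtained by gluing Taylor polynomials with a partition of unity of mesh `2 ^ (-j)`,
where the order of the polynomials tends to infinity with `j`. -/
theorem exists_contDiff_extension {Ω : Set (Space n)} (hΩ : IsOpen Ω)
    (hbd : Bornology.IsBounded Ω) {C : ℝ} (hC : ∀ x ∈ Ω, ∀ y ∈ Ω, Ctrl Ω y x (C * ‖x - y‖))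
    {f : Space n → ℂ} (hf : DifferentiableOn ℂ f Ω)
    (hfb : ∀ l : List (Coord n), ∃ B : ℝ, ∀ z ∈ Ω, ‖iterPartialD l f z‖ ≤ B) :
    ∃ g : Space n → ℂ, ContDiff ℝ ∞ g ∧ EqOn g f Ω := by
  classical
  obtain ⟨P, K, hK0, hP1, hP2, hPf, hPc⟩ :=
    exists_compatible_polynomials hΩ hbd hC hf hfb
  obtain ⟨m, hmm, hminf, hmK⟩ := exists_slow_order K
  obtain ⟨R, hR⟩ : ∃ R : ℕ, ∀ z ∈ Ω, ‖z‖ ≤ R := by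
    obtain ⟨R, hR⟩ := hbd.exists_norm_le
    obtain ⟨N, hN⟩ := exists_nat_ge R
    exact ⟨N, fun z hz => (hR z hz).trans hN⟩
  set T : ℕ → ℝ := fun j => 2 ^ j with hT
  have hT0 : ∀ j, 0 < T j := fun j => by positivity
  have hT1 : ∀ j, 1 ≤ T j := fun j => one_le_pow₀ one_le_two
  have hTs : ∀ j, T (j + 1) = 2 * T j := fun j => by simp only [hT]; ring
  have hTle : ∀ j, T j ≤ T (j + 1) := fun j => by rw [hTs]; linarith [hT0 j]
  set N : ℕ → ℕ := fun j => R * 2 ^ j with hN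
  set φ : ℕ → (Coord n × Bool → ℕ) → Space n → ℂ := fun j c => cell (T j) (N j) c with hφ
  -- the cells which meet `Ω`, and a point of `Ω` in each of them
  set G : ℕ → Finset (Coord n × Bool → ℕ) := fun j =>
    (cells n (N j)).filter fun c => ∃ p ∈ Ω, φ j c p ≠ 0 with hG
  have hGp : ∀ j c, c ∈ G j → ∃ p ∈ Ω, φ j c p ≠ 0 := fun j c hc => (Finset.mem_filter.1 hc).2
  choose! p hpΩ hpφ using hGp
  have hsum : ∀ j, ∀ z ∈ Ω, ∑ c ∈ G j, φ j c z = 1 := by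
    intro j z hz
    rw [← sum_cell (s := T j) (N := N j) (z := z)]
    · refine Finset.sum_subset (Finset.filter_subset _ _) fun c hc hc' => ?_
      by_contra h
      exact hc' (Finset.mem_filter.2 ⟨hc, z, hz, h⟩)
    · intro i
      rw [abs_mul, abs_of_pos (hT0 j), hN]
      push_cast
      rw [mul_comm]
      exact mul_le_mul_of_nonneg_right ((abs_realCoord_le i z).trans (hR z hz)) (hT0 j).le
  have hsupp : ∀ j c z, φ j c z ≠ 0 → z ∈ tsupport (φ j c) := fun j c z h => subset_closure h
  -- `t j` is the term `h (j + 1) - h j` of the telescoping series, written in such a way that it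
  -- only involves differences of Taylor polynomials at points which are close to each other; the two
  -- agree on `Ω`, and only the second is small outside
  set h : ℕ → Space n → ℂ := fun j z => ∑ c ∈ G j, φ j c z * P (p j c) (m j) z with hh
  set e : ℕ → (Coord n × Bool → ℕ) → (Coord n × Bool → ℕ) → Space n → ℂ := fun j c c' z =>
    P (p (j + 1) c) (m (j + 1)) z - P (p j c') (m j) z with he
  set t : ℕ → Space n → ℂ := fun j z =>
    ∑ c ∈ G (j + 1), ∑ c' ∈ G j, φ (j + 1) c z * (φ j c' z * e j c c' z) with ht
  have hφs : ∀ j c, ContDiff ℝ ∞ (φ j c) := fun j c => contDiff_cell _ _ _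
  have hes : ∀ j c c', ContDiff ℝ ∞ (e j c c') := fun j c c' => (hP2 _ _).sub (hP2 _ _)
  have hts : ∀ j, ContDiff ℝ ∞ (t j) := fun j =>
    ContDiff.sum fun c _ => ContDiff.sum fun c' _ => (hφs _ c).mul ((hφs _ c').mul (hes j c c'))
  have hhs : ∀ j, ContDiff ℝ ∞ (h j) := fun j =>
    ContDiff.sum fun c _ => (hφs _ c).mul (hP2 _ _)
  have htel : ∀ j, ∀ z ∈ Ω, t j z = h (j + 1) z - h j z := by
    intro j z hz
    have e1 : ∀ c ∈ G (j + 1), ∑ c' ∈ G j, φ (j + 1) c z * (φ j c' z * e j c c' z) =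
        φ (j + 1) c z * P (p (j + 1) c) (m (j + 1)) z - φ (j + 1) c z * h j z := by
      intro c _
      rw [← Finset.mul_sum, ← mul_sub]
      congr 1
      simp only [he, mul_sub, Finset.sum_sub_distrib, ← Finset.sum_mul, hsum j z hz, one_mul, hh]
    simp only [ht]
    rw [Finset.sum_congr rfl e1, Finset.sum_sub_distrib, ← Finset.sum_mul, hsum (j + 1) z hz,
      one_mul]
  -- the number of pairs of cells is at most a power of `T j`, and so is the effect of `k`
  -- derivatives; both are compensated as soon as the order `m j` is large enough
  set d : ℝ := (Fintype.card (Coord n) : ℝ) with hd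
  have hd0 : 0 ≤ d := Nat.cast_nonneg _
  set D : ℕ := Fintype.card (Coord n × Bool) with hD
  have hcard : ∀ j, ((G j).card : ℝ) ≤ ((4 * R + 1) * T j) ^ D := by
    intro j
    have h1 : (G j).card ≤ (2 * N j + 1) ^ D := by
      rw [hD, ← card_cells]; exact Finset.card_le_card (Finset.filter_subset _ _)
    calc ((G j).card : ℝ) ≤ ((2 * N j + 1) ^ D : ℕ) := by exact_mod_cast h1
      _ = (2 * (R * T j) + 1) ^ D := by simp only [hN, hT]; push_cast; ring
      _ ≤ ((4 * R + 1) * T j) ^ D := by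
          refine pow_le_pow_left₀ (by positivity) ?_ _
          have : 0 ≤ (R : ℝ) * T j := by positivity
          nlinarith [hT1 j]
  have hcard' : ∀ j, ((G (j + 1)).card : ℝ) ≤ ((4 * R + 1) * T j) ^ D := by
    intro j
    have h1 : (G (j + 1)).card ≤ (2 * N (j + 1) + 1) ^ D := by
      rw [hD, ← card_cells]; exact Finset.card_le_card (Finset.filter_subset _ _)
    calc ((G (j + 1)).card : ℝ) ≤ ((2 * N (j + 1) + 1) ^ D : ℕ) := by exact_mod_cast h1
      _ = (4 * (R * T j) + 1) ^ D := by simp only [hN, hT]; push_cast; ring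
      _ ≤ ((4 * R + 1) * T j) ^ D := by
          refine pow_le_pow_left₀ (by positivity) ?_ _
          nlinarith [hT1 j]
  choose B hB0 hB using fun k : ℕ => exists_bound_iteratedFDeriv_bump (n := n) k
  set A : ℕ → ℝ := fun k => ((4 * R + 1) ^ D) ^ 2 *
    (2 ^ k * (B k * (2 ^ k * (B k * ((1 + d) ^ k * 2)))) * 2 ^ k) with hA
  have hA0 : ∀ k, 0 ≤ A k := fun k => by have := hB0 k; positivity
  have hinv : ∀ j k, 2 * D + k + 1 ≤ m j →
      (T j ^ D) ^ 2 * T j * T j ^ k * (T j)⁻¹ ^ (m j + 1) ≤ (T j)⁻¹ := by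
    exact fun j k hjk => pow_mul_inv_pow_le (hT1 j) hjk
  have hbound : ∀ k : ℕ, ∀ᶠ j in atTop, ∀ x, ‖iteratedFDeriv ℝ k (t j) x‖ ≤ A k * (T j)⁻¹ := by
    intro k
    filter_upwards [hminf (2 * D + k + 1), (tendsto_add_atTop_nat 1).eventually hmK] with j hj hKj x
    have hkm : k ≤ m j := by omega
    set E : ℝ := (1 + d) ^ k * (K (m (j + 1)) * (T j)⁻¹ ^ (m j + 1)) with hE
    have hE0 : 0 ≤ E := by have := hT0 j; have := hK0 (m (j + 1)); positivity
    have hterm : ∀ c ∈ G (j + 1), ∀ c' ∈ G j,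
        ‖iteratedFDeriv ℝ k (fun z => φ (j + 1) c z * (φ j c' z * e j c c' z)) x‖ ≤
          2 ^ k * (B k * (2 ^ k * (B k * E))) * T (j + 1) ^ k := by
      intro c hc c' hc'
      by_cases hx : x ∈ tsupport (φ (j + 1) c) ∧ x ∈ tsupport (φ j c')
      · have hxp : ‖x - p (j + 1) c‖ ≤ 4 * (T j)⁻¹ := by
          refine (norm_sub_le_of_mem_cell (hT0 (j + 1)) hx.1 (hsupp _ _ _ (hpφ _ _ hc))).trans ?_
          have := inv_anti₀ (hT0 j) (hTle j)
          linarith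
        have hxp' : ‖x - p j c'‖ ≤ 4 * (T j)⁻¹ :=
          norm_sub_le_of_mem_cell (hT0 j) hx.2 (hsupp _ _ _ (hpφ _ _ hc'))
        have hδ : 0 < (T j)⁻¹ := inv_pos.2 (hT0 j)
        have hpp : ‖p (j + 1) c - p j c'‖ ≤ 8 * (T j)⁻¹ := by
          have : p (j + 1) c - p j c' = (x - p j c') - (x - p (j + 1) c) := by abel
          rw [this]
          exact (norm_sub_le _ _).trans (by linarith)
        have hed : ∀ a ≤ k, ‖iteratedFDeriv ℝ a (e j c c') x‖ ≤ E * T (j + 1) ^ a := by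
          intro a ha
          have h1 := norm_iteratedFDeriv_le_of_iterPartialD ((hP1 (p (j + 1) c) (m (j + 1))).sub
            (hP1 (p j c') (m j))) a x (B := K (m (j + 1)) * (T j)⁻¹ ^ (m j + 1 - a)) ?_
          · refine h1.trans ?_
            have h2 : (T j)⁻¹ ^ (m j + 1 - a) = (T j)⁻¹ ^ (m j + 1) * T j ^ a := by
              have h3 : T j ≠ 0 := (hT0 j).ne'
              rw [pow_sub₀ _ (inv_ne_zero h3) (by omega), inv_pow (T j) a, inv_inv]
            have h4 : d ^ a ≤ (1 + d) ^ k :=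
              (pow_le_pow_left₀ hd0 (by linarith) a).trans
                (pow_le_pow_right₀ (by linarith) ha)
            have h5 : T j ^ a ≤ T (j + 1) ^ a := pow_le_pow_left₀ (hT0 j).le (hTle j) a
            have h6 := hK0 (m (j + 1))
            rw [h2, hE]
            calc d ^ a * (K (m (j + 1)) * ((T j)⁻¹ ^ (m j + 1) * T j ^ a))
                ≤ (1 + d) ^ k * (K (m (j + 1)) * ((T j)⁻¹ ^ (m j + 1) * T (j + 1) ^ a)) := by
                  gcongr
              _ = _ := by ring
          · intro l hl
            subst hl
            exact hPc _ (hpΩ _ _ hc) _ (hpΩ _ _ hc') _ _ (hmm (Nat.le_succ j)) _ hδ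
              (inv_le_one_of_one_le₀ (hT1 j)) hpp x (by linarith) l (by omega)
        have hB' := hB0 k
        refine norm_iteratedFDeriv_mul_le_of_scale (hφs _ _) ((hφs _ _).mul (hes _ _ _))
          (hT0 (j + 1)).le hB' ?_ ?_
        · intro a ha
          exact norm_iteratedFDeriv_cell_le (hT0 _).le _ _ (hB k a ha) x
        · intro a ha
          refine (norm_iteratedFDeriv_mul_le_of_scale (hφs _ _) (hes _ _ _)
            (hT0 (j + 1)).le hB' (k := a) ?_ fun b hb => hed b (hb.trans ha)).trans ?_
          · intro b hb
            refine (norm_iteratedFDeriv_cell_le (hT0 j).le _ _ (hB k b (hb.trans ha)) x).trans ?_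
            exact mul_le_mul_of_nonneg_left (pow_le_pow_left₀ (hT0 j).le (hTle j) b) hB'
          · have h7 : (2 : ℝ) ^ a ≤ 2 ^ k := pow_le_pow_right₀ one_le_two ha
            have h8 : 0 ≤ B k * E := by positivity
            exact mul_le_mul_of_nonneg_right (mul_le_mul_of_nonneg_right h7 h8)
              (pow_nonneg (hT0 _).le a)
      · have hz : iteratedFDeriv ℝ k (fun z => φ (j + 1) c z * (φ j c' z * e j c c' z)) x = 0 := by
          by_contra hne
          apply hx
          have h1 := support_iteratedFDeriv_subset (𝕜 := ℝ) k (Function.mem_support.2 hne)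
          refine ⟨closure_mono (fun y hy => ?_) h1, closure_mono (fun y hy => ?_) h1⟩
          · exact left_ne_zero_of_mul hy
          · exact left_ne_zero_of_mul (right_ne_zero_of_mul hy)
        rw [hz, norm_zero]
        have := hB0 k
        have := hT0 (j + 1)
        positivity
    have hdiff : iteratedFDeriv ℝ k (t j) x = ∑ c ∈ G (j + 1), ∑ c' ∈ G j,
        iteratedFDeriv ℝ k (fun z => φ (j + 1) c z * (φ j c' z * e j c c' z)) x := by
      have hk : ∀ c c', ContDiffAt ℝ k (fun z => φ (j + 1) c z * (φ j c' z * e j c c' z)) x :=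
        fun c c' => (((hφs _ c).mul ((hφs _ c').mul (hes j c c'))).of_le
          (by exact_mod_cast le_top)).contDiffAt
      have e1 : t j = ∑ c ∈ G (j + 1), ∑ c' ∈ G j,
          fun z => φ (j + 1) c z * (φ j c' z * e j c c' z) := by
        funext z
        simp only [ht, Finset.sum_apply]
      rw [e1, iteratedFDeriv_sum_apply]
      · refine Finset.sum_congr rfl fun c _ => ?_
        rw [iteratedFDeriv_sum_apply]
        exact fun c' _ => hk c c'
      · intro c _
        have : (∑ c' ∈ G j, fun z => φ (j + 1) c z * (φ j c' z * e j c c' z)) =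
            fun z => ∑ c' ∈ G j, φ (j + 1) c z * (φ j c' z * e j c c' z) := by
          funext z; simp only [Finset.sum_apply]
        rw [this]
        exact ContDiffAt.sum fun c' _ => hk c c'
    rw [hdiff]
    have hsum1 : ‖∑ c ∈ G (j + 1), ∑ c' ∈ G j,
        iteratedFDeriv ℝ k (fun z => φ (j + 1) c z * (φ j c' z * e j c c' z)) x‖ ≤
        ∑ c ∈ G (j + 1), ∑ c' ∈ G j, 2 ^ k * (B k * (2 ^ k * (B k * E))) * T (j + 1) ^ k :=
      (norm_sum_le _ _).trans (Finset.sum_le_sum fun c hc =>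
        (norm_sum_le _ _).trans (Finset.sum_le_sum fun c' hc' => hterm c hc c' hc'))
    refine hsum1.trans ?_
    simp only [Finset.sum_const, nsmul_eq_mul]
    have hBk := hB0 k
    have hTj := hT0 j
    have hTj' := hT0 (j + 1)
    have hKj' : K (m (j + 1)) ≤ 2 * T j := by rw [← hTs]; exact hKj
    have hE1 : E ≤ (1 + d) ^ k * (2 * T j * (T j)⁻¹ ^ (m j + 1)) := by
      rw [hE]; gcongr
    calc ((G (j + 1)).card : ℝ) *
          (((G j).card : ℝ) * (2 ^ k * (B k * (2 ^ k * (B k * E))) * T (j + 1) ^ k))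
        ≤ ((4 * R + 1) * T j) ^ D * (((4 * R + 1) * T j) ^ D * (2 ^ k * (B k * (2 ^ k * (B k *
            ((1 + d) ^ k * (2 * T j * (T j)⁻¹ ^ (m j + 1)))))) * T (j + 1) ^ k)) := by
          gcongr
          · exact hcard' j
          · exact hcard j
      _ = A k * ((T j ^ D) ^ 2 * T j * T j ^ k * (T j)⁻¹ ^ (m j + 1)) := by
          simp only [hA, hTs, mul_pow]
          generalize (4 * (R : ℝ) + 1) ^ D = v
          generalize (T j)⁻¹ ^ (m j + 1) = w
          generalize T j = τ
          ring
      _ ≤ A k * (T j)⁻¹ := mul_le_mul_of_nonneg_left (hinv j k hj) (hA0 k)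
  have hsumm : Summable fun j => (T j)⁻¹ := by
    have : (fun j => (T j)⁻¹) = fun j : ℕ => ((2 : ℝ)⁻¹) ^ j := by
      funext j; simp only [hT, inv_pow]
    rw [this]
    exact summable_geometric_of_lt_one (by norm_num) (by norm_num)
  have hTlim : Tendsto (fun j => (T j)⁻¹) atTop (𝓝 0) := hsumm.tendsto_atTop_zero
  -- on `Ω` the glued functions converge to `f`, so the sum of the series is `f - h 0` there
  have hlim : ∀ z ∈ Ω, Tendsto (fun j => h j z) atTop (𝓝 (f z)) := by
    intro z hz
    rw [tendsto_iff_norm_sub_tendsto_zero]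
    have hbd0 : ∀ᶠ j in atTop, ‖h j z - f z‖ ≤ (4 * R + 1) ^ D * B 0 * (T j)⁻¹ := by
      filter_upwards [hminf (2 * D + 0 + 1), hmK] with j hj hKj
      have e1 : h j z - f z = ∑ c ∈ G j, φ j c z * (P (p j c) (m j) z - P z (m j) z) := by
        simp only [mul_sub, Finset.sum_sub_distrib, ← Finset.sum_mul, hsum j z hz, one_mul, hh,
          hPf z hz]
      have hTj := hT0 j
      have hB00 := hB0 0
      have e2 : ∀ c ∈ G j, ‖φ j c z * (P (p j c) (m j) z - P z (m j) z)‖ ≤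
          B 0 * (T j * (T j)⁻¹ ^ (m j + 1)) := by
        intro c hc
        by_cases h0 : φ j c z = 0
        · rw [h0, zero_mul, norm_zero]; positivity
        rw [norm_mul]
        have e3 : ‖φ j c z‖ ≤ B 0 := by
          have := norm_iteratedFDeriv_cell_le hTj.le (N j) c (hB 0 0 le_rfl) z
          simpa using this
        have e4 : ‖p j c - z‖ ≤ 4 * (T j)⁻¹ :=
          norm_sub_le_of_mem_cell (hT0 j) (hsupp _ _ _ (hpφ _ _ hc)) (hsupp _ _ _ h0)
        have hδ : 0 < (T j)⁻¹ := inv_pos.2 (hT0 j)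
        have e5 := hPc _ (hpΩ _ _ hc) z hz (m j) (m j) le_rfl _ hδ
          (inv_le_one_of_one_le₀ (hT1 j)) (by linarith) z (by rw [norm_sub_rev]; linarith) []
          (Nat.zero_le _)
        refine mul_le_mul e3 (e5.trans ?_) (norm_nonneg _) hB00
        exact mul_le_mul_of_nonneg_right hKj (by positivity)
      rw [e1]
      refine (norm_sum_le _ _).trans ((Finset.sum_le_sum e2).trans ?_)
      rw [Finset.sum_const, nsmul_eq_mul]
      have e6 := hinv j 0 hj
      have e7 : T j ^ D ≤ (T j ^ D) ^ 2 := by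
        rw [pow_two]; exact le_mul_of_one_le_left (by positivity) (one_le_pow₀ (hT1 j))
      calc ((G j).card : ℝ) * (B 0 * (T j * (T j)⁻¹ ^ (m j + 1)))
          ≤ ((4 * R + 1) * T j) ^ D * (B 0 * (T j * (T j)⁻¹ ^ (m j + 1))) := by
            gcongr; exact hcard j
        _ = (4 * R + 1) ^ D * B 0 * (T j ^ D * T j * T j ^ 0 * (T j)⁻¹ ^ (m j + 1)) := by
            rw [mul_pow]
            generalize (4 * (R : ℝ) + 1) ^ D = v
            ring
        _ ≤ (4 * R + 1) ^ D * B 0 * ((T j ^ D) ^ 2 * T j * T j ^ 0 * (T j)⁻¹ ^ (m j + 1)) := by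
            gcongr
        _ ≤ (4 * R + 1) ^ D * B 0 * (T j)⁻¹ := by gcongr
    refine squeeze_zero' (Eventually.of_forall fun _ => norm_nonneg _) hbd0 ?_
    simpa using hTlim.const_mul ((4 * R + 1 : ℝ) ^ D * B 0)
  refine ⟨fun z => h 0 z + ∑' j, t j z, ?_, ?_⟩
  · refine (hhs 0).add ?_
    refine contDiff_tsum_of_eventually (v := fun k j => A k * (T j)⁻¹) hts
      (fun k _ => hsumm.mul_left _) fun k _ => ?_
    rw [Nat.cofinite_eq_atTop]
    exact hbound k
  · intro z hz
    have hs : Summable fun j => t j z := by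
      refine Summable.of_norm_bounded_eventually_nat (g := fun j => A 0 * (T j)⁻¹)
        (hsumm.mul_left _) ?_
      filter_upwards [hbound 0] with j hj
      simpa using hj z
    have h1 := hs.hasSum.tendsto_sum_nat
    have h2 : (fun J => ∑ j ∈ Finset.range J, t j z) = fun J => h J z - h 0 z := by
      funext J
      rw [← Finset.sum_range_sub (fun j => h j z)]
      exact Finset.sum_congr rfl fun j _ => htel j z hz
    rw [h2] at h1
    have h3 := tendsto_nhds_unique h1 ((hlim z hz).sub_const (h 0 z))
    simp only [h3]
    ring

end Whitney

/-! ### Monomials and their exponents -/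

section Evaluation

variable {L p r : ℕ}

/-- The logarithm of the monomial with exponent `e`, as a `ℚ`-linear function of `e`: the arguments
`u` and `v` are the logarithms of `τ` and of `λ''`. -/
def logMono (u : Fin L ⊕ Fin r → ℝ) (v : Fin p → ℝ) : Expo L p r →ₗ[ℚ] ℝ :=
  AddMonoidHom.toRatLinearMap
    { toFun := fun e => (∑ k, ((e.1 k : ℚ) : ℝ) * u k) + ∑ s, ((e.2 s : ℚ) : ℝ) * v s
      map_zero' := by simp
      map_add' := fun e e' => by
        simp only [Prod.fst_add, Prod.snd_add, Pi.add_apply, Rat.cast_add, add_mul,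
          Finset.sum_add_distrib]
        ring }

lemma logMono_apply (u : Fin L ⊕ Fin r → ℝ) (v : Fin p → ℝ) (e : Expo L p r) :
    logMono u v e = (∑ k, ((e.1 k : ℚ) : ℝ) * u k) + ∑ s, ((e.2 s : ℚ) : ℝ) * v s := rfl

lemma evalTL_eq_exp {e : Expo L p r} {τ : Fin L ⊕ Fin r → ℝ} {lam : Fin p → ℝ}
    (hτ : ∀ k, 0 < τ k ∨ e.1 k = 0) (hlam : ∀ s, 0 < lam s) :
    evalTL e τ lam = Real.exp (logMono (fun k => Real.log (τ k)) (fun s => Real.log (lam s)) e) := by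
  rw [logMono_apply, Real.exp_add, Real.exp_sum, Real.exp_sum, evalTL]
  congr 1
  · refine Finset.prod_congr rfl fun k _ => ?_
    rcases hτ k with h | h
    · rw [Real.rpow_def_of_pos h, mul_comm]
    · simp [h]
  · exact Finset.prod_congr rfl fun s _ => by rw [Real.rpow_def_of_pos (hlam s), mul_comm]

lemma evalTL_pos {e : Expo L p r} {τ : Fin L ⊕ Fin r → ℝ} {lam : Fin p → ℝ}
    (hτ : ∀ k, 0 < τ k ∨ e.1 k = 0) (hlam : ∀ s, 0 < lam s) : 0 < evalTL e τ lam := by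
  rw [evalTL_eq_exp hτ hlam]
  exact Real.exp_pos _

lemma evalTL_nonneg (e : Expo L p r) {τ : Fin L ⊕ Fin r → ℝ} {lam : Fin p → ℝ}
    (hτ : ∀ k, 0 ≤ τ k) (hlam : ∀ s, 0 ≤ lam s) : 0 ≤ evalTL e τ lam :=
  mul_nonneg (Finset.prod_nonneg fun k _ => Real.rpow_nonneg (hτ k) _)
    (Finset.prod_nonneg fun s _ => Real.rpow_nonneg (hlam s) _)

lemma evalTL_add {e e' : Expo L p r} {τ : Fin L ⊕ Fin r → ℝ} {lam : Fin p → ℝ}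
    (hτ : ∀ k, 0 < τ k ∨ (τ k = 0 ∧ 0 ≤ e.1 k ∧ 0 ≤ e'.1 k)) (hlam : ∀ s, 0 < lam s) :
    evalTL (e + e') τ lam = evalTL e τ lam * evalTL e' τ lam := by
  simp only [evalTL]
  rw [mul_mul_mul_comm, ← Finset.prod_mul_distrib, ← Finset.prod_mul_distrib]
  congr 1 <;> refine Finset.prod_congr rfl fun k _ => ?_
  · rw [Prod.fst_add, Pi.add_apply, Rat.cast_add]
    rcases hτ k with h | ⟨h, h1, h2⟩
    · exact Real.rpow_add h _ _
    · exact Real.rpow_add_of_nonneg h.ge (by exact_mod_cast h1) (by exact_mod_cast h2)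
  · rw [Prod.snd_add, Pi.add_apply, Rat.cast_add]
    exact Real.rpow_add (hlam k) _ _

lemma evalTL_of_snd_eq_zero {e : Expo L p r} (he : e.2 = 0) (τ : Fin L ⊕ Fin r → ℝ)
    (lam : Fin p → ℝ) : evalTL e τ lam = evalT (Multiplicative.ofAdd e.1) τ := by
  simp [evalTL, evalT, he]

lemma evalTL_lamVar (s : Fin p) (τ : Fin L ⊕ Fin r → ℝ) (lam : Fin p → ℝ) :
    evalTL (lamVar s : Expo L p r) τ lam = lam s := by
  have : ∏ x, lam x ^ (((Pi.single s (1 : ℚ) : Fin p → ℚ) x : ℚ) : ℝ) = lam s := by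
    rw [Finset.prod_eq_single s]
    · simp
    · intro b _ hb; simp [hb]
    · simp
  simpa [evalTL, lamVar] using this

lemma evalT_nonneg (f : Multiplicative (Fin L ⊕ Fin r → ℚ)) {τ : Fin L ⊕ Fin r → ℝ}
    (hτ : ∀ k, 0 ≤ τ k) : 0 ≤ evalT f τ :=
  Finset.prod_nonneg fun k _ => Real.rpow_nonneg (hτ k) _

lemma evalT_pow (f : Multiplicative (Fin L ⊕ Fin r → ℚ)) (N : ℕ) {τ : Fin L ⊕ Fin r → ℝ}
    (hτ : ∀ k, 0 ≤ τ k) : evalT (f ^ N) τ = evalT f τ ^ N := by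
  simp only [evalT, ← Finset.prod_pow]
  refine Finset.prod_congr rfl fun k _ => ?_
  rw [← Real.rpow_natCast, ← Real.rpow_mul (hτ k), toAdd_pow]
  simp [mul_comm]

lemma evalT_mul {f g : Multiplicative (Fin L ⊕ Fin r → ℚ)} {τ : Fin L ⊕ Fin r → ℝ}
    (hτ : ∀ k, 0 < τ k ∨
      (τ k = 0 ∧ 0 ≤ Multiplicative.toAdd f k ∧ 0 ≤ Multiplicative.toAdd g k)) :
    evalT (f * g) τ = evalT f τ * evalT g τ := by
  simp only [evalT, ← Finset.prod_mul_distrib]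
  refine Finset.prod_congr rfl fun k _ => ?_
  rw [toAdd_mul, Pi.add_apply, Rat.cast_add]
  rcases hτ k with h | ⟨h, h1, h2⟩
  · exact Real.rpow_add h _ _
  · exact Real.rpow_add_of_nonneg h.ge (by exact_mod_cast h1) (by exact_mod_cast h2)

lemma evalT_mul_arg (f : Multiplicative (Fin L ⊕ Fin r → ℚ)) {τ τ' : Fin L ⊕ Fin r → ℝ}
    (hτ : ∀ k, 0 ≤ τ k) (hτ' : ∀ k, 0 ≤ τ' k) :
    evalT f (fun k => τ k * τ' k) = evalT f τ * evalT f τ' := by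
  simp only [evalT, ← Finset.prod_mul_distrib]
  exact Finset.prod_congr rfl fun k _ => Real.mul_rpow (hτ k) (hτ' k)

end Evaluation

section Exponents

variable {L p r : ℕ} {A : Matrix (Fin L ⊕ Fin p) (Fin L ⊕ Fin r) ℚ}

/-- As the rank of `A` is the size of its invertible upper left block, the columns of `A` are
combinations of the first `L` ones; hence `ψ_k` does not involve `λ''`. -/
lemma psi_snd (hrank : A.rank = L) (hdet : A.toBlocks₁₁.det ≠ 0) (k : Fin r) :
    (psi A k).2 = 0 := by
  have hu : IsUnit A.toBlocks₁₁.det := hdet.isUnit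
  -- the first `L` columns are independent, hence span the column space
  have hli : LinearIndependent ℚ fun k : Fin L => A.col (Sum.inl k) := by
    have h1 : LinearIndependent ℚ A.toBlocks₁₁.col :=
      Matrix.linearIndependent_cols_of_isUnit ((Matrix.isUnit_iff_isUnit_det _).2 hu)
    refine LinearIndependent.of_comp (LinearMap.funLeft ℚ ℚ (Sum.inl : Fin L → Fin L ⊕ Fin p)) ?_
    exact h1
  have hspan : Submodule.span ℚ (Set.range fun k : Fin L => A.col (Sum.inl k))
      = Submodule.span ℚ (Set.range A.col) := by
    refine Submodule.eq_of_le_of_finrank_eq (Submodule.span_mono ?_) ?_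
    · rintro _ ⟨k, rfl⟩; exact ⟨_, rfl⟩
    · rw [finrank_span_eq_card hli, ← Matrix.rank_eq_finrank_span_cols, hrank, Fintype.card_fin]
  have hmem : A.col (Sum.inr k) ∈ Submodule.span ℚ (Set.range fun k : Fin L => A.col (Sum.inl k)) := by
    rw [hspan]; exact Submodule.subset_span ⟨_, rfl⟩
  obtain ⟨c, hc⟩ := (Submodule.mem_span_range_iff_exists_fun ℚ).1 hmem
  have hA : ∀ j, A j (Sum.inr k) = ∑ i, c i * A j (Sum.inl i) := fun j => by
    have := congrFun hc j
    simpa [Matrix.col] using this.symm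
  have hinv : ∀ i j, ∑ l : Fin L, (A.toBlocks₁₁)⁻¹ i l * A (Sum.inl l) (Sum.inl j)
      = if i = j then 1 else 0 := fun i j => by
    have := congrFun (congrFun (Matrix.nonsing_inv_mul A.toBlocks₁₁ hu) i) j
    rw [Matrix.mul_apply, Matrix.one_apply] at this
    exact this
  funext s
  simp only [psi, phiInv, lamVar, Prod.snd_sub, Prod.snd_add, Prod.snd_sum, Prod.smul_snd,
    Pi.sub_apply, Pi.add_apply, Finset.sum_apply, Pi.smul_apply, smul_eq_mul, Pi.zero_apply]
  have h2 : ∑ j : Fin L, A (Sum.inl j) (Sum.inr k) *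
      -∑ i, A.toBlocks₂₁ s i * (A.toBlocks₁₁)⁻¹ i j = - A (Sum.inr s) (Sum.inr k) := by
    calc _ = -∑ i, A (Sum.inr s) (Sum.inl i) * ∑ l, c l *
          ∑ j, (A.toBlocks₁₁)⁻¹ i j * A (Sum.inl j) (Sum.inl l) := by
          simp only [mul_neg, Finset.sum_neg_distrib, Finset.mul_sum]
          rw [Finset.sum_comm]
          congr 1
          refine Finset.sum_congr rfl fun i _ => ?_
          rw [Finset.sum_comm]
          refine Finset.sum_congr rfl fun j _ => ?_
          rw [hA (Sum.inl j), Finset.sum_mul]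
          refine Finset.sum_congr rfl fun l _ => ?_
          simp only [Matrix.toBlocks₂₁, Matrix.of_apply]
          ring
      _ = _ := by
          simp only [hinv, mul_ite, mul_one, mul_zero, Finset.sum_ite_eq, Finset.mem_univ, if_true]
          rw [hA (Sum.inr s)]
          simp [mul_comm]
  rw [h2]
  simp [Pi.single_apply]

lemma phiInv_fst_inr (j : Fin L) (k : Fin r) : (phiInv A j).1 (Sum.inr k) = 0 := rfl

lemma psi_fst_inr (k k' : Fin r) : (psi A k).1 (Sum.inr k') = if k' = k then 1 else 0 := by
  simp [psi, phiInv, lamVar, Prod.fst_sum, Finset.sum_apply, Pi.single_apply]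

/-- The monomials `φ_j^{-1}` solve the system `τ_k = φ_k(λ)`, `k ≤ L`. -/
lemma sum_phiInv_inl (hdet : A.toBlocks₁₁.det ≠ 0) (k : Fin L) :
    (∑ j : Fin L, A (Sum.inl j) (Sum.inl k) • phiInv A j)
      + ∑ s : Fin p, A (Sum.inr s) (Sum.inl k) • (lamVar s : Expo L p r)
      = (Pi.single (Sum.inl k) 1, 0) := by
  have hu : IsUnit A.toBlocks₁₁.det := hdet.isUnit
  have hinv : ∀ i j, ∑ l : Fin L, (A.toBlocks₁₁)⁻¹ i l * A (Sum.inl l) (Sum.inl j)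
      = if i = j then 1 else 0 := fun i j => by
    have := congrFun (congrFun (Matrix.nonsing_inv_mul A.toBlocks₁₁ hu) i) j
    rw [Matrix.mul_apply, Matrix.one_apply] at this
    exact this
  ext x
  · rcases x with x | x
    · simp only [phiInv, lamVar, Prod.fst_add, Prod.fst_sum, Prod.smul_fst, Pi.add_apply,
        Finset.sum_apply, Pi.smul_apply, smul_eq_mul, Sum.elim_inl, Pi.zero_apply, mul_zero,
        Finset.sum_const_zero, add_zero, Pi.single_apply, Sum.inl.injEq]
      rw [← hinv x k]
      exact Finset.sum_congr rfl fun j _ => mul_comm _ _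
    · simp [phiInv, lamVar, Prod.fst_sum, Finset.sum_apply]
  · simp only [phiInv, lamVar, Prod.snd_add, Prod.snd_sum, Prod.smul_snd, Pi.add_apply,
      Finset.sum_apply, Pi.smul_apply, smul_eq_mul, Pi.zero_apply, Pi.single_apply, mul_ite,
      mul_one, mul_zero, Finset.sum_ite_eq, Finset.mem_univ, if_true]
    have : ∑ j : Fin L, A (Sum.inl j) (Sum.inl k) * -∑ i, A.toBlocks₂₁ x i * (A.toBlocks₁₁)⁻¹ i j
        = -∑ i, A.toBlocks₂₁ x i * ∑ j, (A.toBlocks₁₁)⁻¹ i j * A (Sum.inl j) (Sum.inl k) := by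
      simp only [mul_neg, Finset.sum_neg_distrib, Finset.mul_sum]
      rw [Finset.sum_comm]
      congr 1
      exact Finset.sum_congr rfl fun i _ => Finset.sum_congr rfl fun j _ => by ring
    rw [this]
    simp [hinv, Matrix.toBlocks₂₁]

lemma sum_phiInv_inr (k : Fin r) :
    ((∑ j : Fin L, A (Sum.inl j) (Sum.inr k) • phiInv A j)
      + ∑ s : Fin p, A (Sum.inr s) (Sum.inr k) • (lamVar s : Expo L p r)) + psi A k
      = (Pi.single (Sum.inr k) 1, 0) := by
  rw [psi]; abel

end Exponents

/-! ### Elimination of the parameters -/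

section Elimination

variable {L p r : ℕ} {n : Option (Fin L ⊕ Fin r) → ℕ}
  {A : Matrix (Fin L ⊕ Fin p) (Fin L ⊕ Fin r) ℚ} {ζ : (k : Fin L ⊕ Fin r) → Fin (n (some k)) → ℂ}

lemma mem_setG {x : PairTL L p r} : x ∈ setG A ζ ↔
    (∃ j, x = (Multiplicative.ofAdd (phiInv A j), 0)) ∨
    (∃ k, x = (Multiplicative.ofAdd (psi A k), nval A ζ k)) ∨
    (∃ s, x = (Multiplicative.ofAdd (lamVar s), 0)) ∨
    (∃ k, nval A ζ k ≠ 0 ∧ x = (Multiplicative.ofAdd (-psi A k), (nval A ζ k)⁻¹)) := by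
  classical
  simp only [setG, fractions, Finset.mem_union, Finset.mem_image, Finset.mem_univ, true_and,
    Finset.mem_filter]
  constructor
  · rintro (((⟨j, rfl⟩ | ⟨k, rfl⟩) | ⟨s, rfl⟩) | ⟨y, ⟨((⟨j, rfl⟩ | ⟨k, rfl⟩) | ⟨s, rfl⟩), hy⟩, rfl⟩)
    · exact Or.inl ⟨j, rfl⟩
    · exact Or.inr (Or.inl ⟨k, rfl⟩)
    · exact Or.inr (Or.inr (Or.inl ⟨s, rfl⟩))
    · exact absurd rfl hy
    · exact Or.inr (Or.inr (Or.inr ⟨k, hy, by rw [ofAdd_neg]⟩))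
    · exact absurd rfl hy
  · rintro (⟨j, rfl⟩ | ⟨k, rfl⟩ | ⟨s, rfl⟩ | ⟨k, hk, rfl⟩)
    · exact Or.inl (Or.inl (Or.inl ⟨j, rfl⟩))
    · exact Or.inl (Or.inl (Or.inr ⟨k, rfl⟩))
    · exact Or.inl (Or.inr ⟨s, rfl⟩)
    · exact Or.inr ⟨_, ⟨Or.inl (Or.inr ⟨k, rfl⟩), hk⟩, by rw [ofAdd_neg]⟩

lemma lamExp_pow_mul_pow (s : Fin p) (x y : PairTL L p r) (a b : ℕ) :
    lamExp s (x ^ a * y ^ b) = a * lamExp s x + b * lamExp s y := by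
  simp [lamExp, toAdd_mul, toAdd_pow]

lemma of_mem_eliminate {s : Fin p} {F : Finset (PairTL L p r)} {x : PairTL L p r}
    (hx : x ∈ eliminate s F) : (x ∈ F ∧ lamExp s x = 0) ∨
      ∃ y ∈ F, ∃ z ∈ F, lamExp s y ≠ 0 ∧ lamExp s z ≠ 0 ∧ lamExp s x = 0 ∧
        ∃ a b : ℕ, x = y ^ a * z ^ b := by
  classical
  simp only [eliminate, Finset.mem_union, Finset.mem_filter, Finset.mem_image,
    Finset.mem_product] at hx
  rcases hx with hx | ⟨⟨y, z⟩, ⟨⟨hy, hz⟩, hy0, hz0⟩, rfl⟩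
  · exact Or.inl hx
  · refine Or.inr ⟨y, hy, z, hz, hy0.ne', hz0.ne, ?_, _, _, rfl⟩
    rw [lamExp_pow_mul_pow]
    simp only at hy0 hz0 ⊢
    have h : 0 < |lamExp s z| / |lamExp s y| := div_pos (abs_pos.2 hz0.ne) (abs_pos.2 hy0.ne')
    have hnum : (((|lamExp s z| / |lamExp s y|).num.natAbs : ℕ) : ℚ)
        = ((|lamExp s z| / |lamExp s y|).num : ℚ) := by
      rw [← Int.cast_natCast, Int.natAbs_of_nonneg (Rat.num_pos.2 h).le]
    have hq := Rat.num_div_den (|lamExp s z| / |lamExp s y|)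
    have hd : ((|lamExp s z| / |lamExp s y|).den : ℚ) ≠ 0 := by
      exact_mod_cast (|lamExp s z| / |lamExp s y|).den_ne_zero
    rw [hnum]
    rw [div_eq_iff hd] at hq
    rw [hq, abs_of_neg hz0, abs_of_pos hy0]
    field_simp
    ring

lemma exists_mem_eliminate {s : Fin p} {F : Finset (PairTL L p r)} {y z : PairTL L p r}
    (hy : y ∈ F) (hz : z ∈ F) (hy0 : 0 < lamExp s y) (hz0 : lamExp s z < 0) :
    ∃ a b : ℕ, 0 < a ∧ 0 < b ∧ y ^ a * z ^ b ∈ eliminate s F := by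
  classical
  have h : 0 < |lamExp s z| / |lamExp s y| := div_pos (abs_pos.2 hz0.ne) (abs_pos.2 hy0.ne')
  refine ⟨_, _, Int.natAbs_pos.2 (Rat.num_pos.2 h).ne', Rat.den_pos _,
    Finset.mem_union_right _ (Finset.mem_image.2 ⟨(y, z), ?_, rfl⟩)⟩
  simp [hy, hz, hy0, hz0]

lemma stage_succ {t : ℕ} (ht : t < p) :
    stage A ζ (t + 1) = eliminate ⟨t, ht⟩ (stage A ζ t) := by
  simp [stage, ht]

lemma stage_subset_closure {t : ℕ} (ht : t ≤ p) {x : PairTL L p r} (hx : x ∈ stage A ζ t) :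
    x ∈ Submonoid.closure (setG A ζ : Set (PairTL L p r)) := by
  induction t generalizing x with
  | zero => exact Submonoid.subset_closure hx
  | succ t ih =>
    rw [stage_succ ht] at hx
    rcases of_mem_eliminate hx with ⟨hx, -⟩ | ⟨y, hy, z, hz, -, -, -, a, b, rfl⟩
    · exact ih (by omega) hx
    · exact mul_mem (pow_mem (ih (by omega) hy) _) (pow_mem (ih (by omega) hz) _)

lemma lamExp_eq_zero_of_mem_stage {t : ℕ} (ht : t ≤ p) {x : PairTL L p r} (hx : x ∈ stage A ζ t)
    {s : Fin p} (hs : (s : ℕ) < t) : lamExp s x = 0 := by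
  induction t generalizing x with
  | zero => omega
  | succ t ih =>
    rw [stage_succ ht] at hx
    rcases of_mem_eliminate hx with ⟨hx, h0⟩ | ⟨y, hy, z, hz, -, -, h0, a, b, rfl⟩
    · rcases Nat.lt_succ_iff_lt_or_eq.1 hs with h | h
      · exact ih (by omega) hx h
      · convert h0
    · rcases Nat.lt_succ_iff_lt_or_eq.1 hs with h | h
      · rw [lamExp_pow_mul_pow, ih (by omega) hy h, ih (by omega) hz h]; simp
      · convert h0

/-- A monomial met during the elimination either contains no `λ''` at all, or none of the variables
`τ_k`, `k > L`. -/
lemma fst_inr_eq_zero_of_mem_stage (hrank : A.rank = L) (hdet : A.toBlocks₁₁.det ≠ 0) {t : ℕ}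
    (ht : t ≤ p) {x : PairTL L p r} (hx : x ∈ stage A ζ t) {s : Fin p} (hs : lamExp s x ≠ 0)
    (k : Fin r) : (Multiplicative.toAdd x.1).1 (Sum.inr k) = 0 := by
  induction t generalizing x s with
  | zero =>
    rcases mem_setG.1 hx with ⟨j, rfl⟩ | ⟨k, rfl⟩ | ⟨s, rfl⟩ | ⟨k, -, rfl⟩
    · rfl
    · simp [lamExp, psi_snd hrank hdet] at hs
    · rfl
    · simp [lamExp, psi_snd hrank hdet] at hs
  | succ t ih =>
    rw [stage_succ ht] at hx
    rcases of_mem_eliminate hx with ⟨hx, h0⟩ | ⟨y, hy, z, hz, hy0, hz0, -, a, b, rfl⟩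
    · exact ih (by omega) hx hs
    · simp [toAdd_mul, toAdd_pow, ih (by omega) hy hy0, ih (by omega) hz hz0]

/-- The one-dimensional case of Fourier-Motzkin elimination. -/
lemma exists_between_of_forall_le {ι κ : Type*} (s : Finset ι) (t : Finset κ) (f : ι → ℚ)
    (g : κ → ℚ) (h : ∀ i ∈ s, ∀ j ∈ t, f i ≤ g j) :
    ∃ c, (∀ i ∈ s, f i ≤ c) ∧ ∀ j ∈ t, c ≤ g j := by
  classical
  rcases s.eq_empty_or_nonempty with rfl | hs
  · rcases t.eq_empty_or_nonempty with rfl | ht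
    · exact ⟨0, by simp, by simp⟩
    · exact ⟨t.inf' ht g, by simp, fun j hj => Finset.inf'_le _ hj⟩
  · exact ⟨s.sup' hs f, fun i hi => Finset.le_sup' _ hi, fun j hj => Finset.sup'_le _ _ fun i hi =>
      h i hi j hj⟩

/-- The derivative of the logarithm of a monomial in the direction `d` of the variables `λ''`. -/
def lamPairing (d : Fin p → ℚ) : Expo L p r →ₗ[ℚ] ℚ where
  toFun e := ∑ s, e.2 s * d s
  map_add' e e' := by simp [add_mul, Finset.sum_add_distrib]
  map_smul' c e := by simp [mul_assoc, Finset.mul_sum]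

/-- Fourier-Motzkin elimination: if no negative power of `λ_{L+t}` is left when `λ_{L+t}` is to be
eliminated, there is a direction, of component `-1` at `λ_{L+t}`, in which no monomial
increases. -/
lemma exists_direction_of_stage (t : Fin p) (hneg : ∀ x ∈ stage A ζ t, 0 ≤ lamExp t x) (i : ℕ)
    (hi : i ≤ t) : ∃ d : Fin p → ℚ, d t = -1 ∧
      ∀ x ∈ stage A ζ i, ∑ s, lamExp s x * d s ≤ 0 := by
  classical
  induction hi using Nat.decreasingInduction with
  | self =>
    refine ⟨-Pi.single t 1, by simp, fun x hx => ?_⟩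
    rw [Finset.sum_eq_single t (fun b _ hb => by simp [hb]) (by simp)]
    simpa using hneg x hx
  | of_succ i hi ih =>
    obtain ⟨d, hdt, hd⟩ := ih
    have hip : i < p := hi.trans t.2
    set s0 : Fin p := ⟨i, hip⟩ with hs0
    have hne : t ≠ s0 := fun h => by rw [h] at hi; exact lt_irrefl _ hi
    rw [stage_succ hip] at hd
    -- the rest of the linear form, without the variable to be eliminated
    set q : PairTL L p r → ℚ := fun x => ∑ s ∈ Finset.univ.erase s0, lamExp s x * d s with hq
    have hsum : ∀ (x : PairTL L p r) (c : ℚ), ∑ s, lamExp s x * Function.update d s0 c s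
        = lamExp s0 x * c + q x := fun x c => by
      rw [← Finset.add_sum_erase _ _ (Finset.mem_univ s0), Function.update_self]
      congr 1
      exact Finset.sum_congr rfl fun s hs => by
        rw [Function.update_of_ne (Finset.ne_of_mem_erase hs)]
    have hsum' : ∀ x : PairTL L p r, ∑ s, lamExp s x * d s = lamExp s0 x * d s0 + q x := fun x => by
      rw [← hsum, Function.update_eq_self]
    obtain ⟨c, hc1, hc2⟩ := exists_between_of_forall_le
      ((stage A ζ i).filter fun x => lamExp s0 x < 0) ((stage A ζ i).filter fun x => 0 < lamExp s0 x)
      (fun x => q x / -lamExp s0 x) (fun x => -q x / lamExp s0 x) (by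
        intro x hx y hy
        rw [Finset.mem_filter] at hx hy
        obtain ⟨a, b, ha, hb, hab⟩ := exists_mem_eliminate hy.1 hx.1 hy.2 hx.2
        have h0 : lamExp s0 (y ^ a * x ^ b) = 0 := by
          rcases of_mem_eliminate hab with h | ⟨_, _, _, _, _, _, h, _⟩
          · exact h.2
          · exact h
        have h1 := hd _ hab
        rw [hsum', h0, zero_mul, zero_add] at h1
        have hq' : q (y ^ a * x ^ b) = a * q y + b * q x := by
          simp only [hq, lamExp_pow_mul_pow, add_mul, Finset.sum_add_distrib, Finset.mul_sum,
            mul_assoc]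
        rw [lamExp_pow_mul_pow] at h0
        rw [hq'] at h1
        have ha' : (0 : ℚ) < a := by exact_mod_cast ha
        have hb' : (0 : ℚ) < b := by exact_mod_cast hb
        rw [div_le_div_iff₀ (neg_pos.2 hx.2) hy.2]
        have e1 : a * lamExp s0 y = b * -lamExp s0 x := by linarith
        have e2 : b * q x ≤ a * -q y := by linarith
        have e3 : (b * q x) * (a * lamExp s0 y) ≤ (a * -q y) * (a * lamExp s0 y) :=
          mul_le_mul_of_nonneg_right e2 (mul_pos ha' hy.2).le
        have e4 : a * b * (q x * lamExp s0 y) ≤ a * b * (-q y * -lamExp s0 x) := by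
          calc a * b * (q x * lamExp s0 y) = (b * q x) * (a * lamExp s0 y) := by ring
            _ ≤ _ := e3
            _ = a * b * (-q y * -lamExp s0 x) := by rw [e1]; ring
        exact le_of_mul_le_mul_left e4 (mul_pos ha' hb'))
    refine ⟨Function.update d s0 c, by rw [Function.update_of_ne hne, hdt], fun x hx => ?_⟩
    rw [hsum]
    rcases lt_trichotomy (lamExp s0 x) 0 with h | h | h
    · have := hc1 x (Finset.mem_filter.2 ⟨hx, h⟩)
      rw [div_le_iff₀ (neg_pos.2 h)] at this
      linarith
    · have := hd x (Finset.mem_union_left _ (Finset.mem_filter.2 ⟨hx, h⟩))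
      rw [hsum', h] at this
      rw [h]
      linarith
    · have := hc2 x (Finset.mem_filter.2 ⟨hx, h⟩)
      rw [le_div_iff₀ h] at this
      linarith

/-- If no negative power of `λ_{L+t}` is left when `λ_{L+t}` is to be eliminated, then `λ_{L+t}`
does not occur in `φ`: the combinations `τ_k = φ_k(λ)` of the monomials of `G` are constant in the
direction of `exists_direction_of_stage`. -/
lemma row_eq_zero_of_stage (hrank : A.rank = L) (hdet : A.toBlocks₁₁.det ≠ 0)
    (hA : ∀ j k, 0 ≤ A j k) (t : Fin p) (hneg : ∀ x ∈ stage A ζ t, 0 ≤ lamExp t x) (k) :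
    A (Sum.inr t) k = 0 := by
  obtain ⟨d, hdt, hd⟩ := exists_direction_of_stage t hneg 0 (Nat.zero_le _)
  set D : Expo L p r →ₗ[ℚ] ℚ := lamPairing d with hDdef
  have hD : ∀ e : Expo L p r, D e = ∑ s, e.2 s * d s := fun e => rfl
  have h1 : ∀ j, D (phiInv A j) ≤ 0 := fun j => by
    rw [hD]; exact hd (Multiplicative.ofAdd (phiInv A j), 0) (mem_setG.2 (Or.inl ⟨j, rfl⟩))
  have h2 : ∀ s, D (lamVar s) ≤ 0 := fun s => by
    rw [hD]; exact hd (Multiplicative.ofAdd (lamVar s), 0)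
      (mem_setG.2 (Or.inr (Or.inr (Or.inl ⟨s, rfl⟩))))
  have h3 : D (lamVar t) = -1 := by
    rw [hD, Finset.sum_eq_single t (fun b _ hb => by simp [lamVar, hb]) (by simp)]
    simp [lamVar, hdt]
  have h4 : (∑ j, A (Sum.inl j) k * D (phiInv A j)) + ∑ s, A (Sum.inr s) k * D (lamVar s) = 0 := by
    have : D ((∑ j : Fin L, A (Sum.inl j) k • phiInv A j)
      + ∑ s : Fin p, A (Sum.inr s) k • (lamVar s : Expo L p r)) = 0 := by
      rcases k with k | k
      · rw [sum_phiInv_inl hdet, hD]; simp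
      · have := sum_phiInv_inr (A := A) k
        rw [← eq_sub_iff_add_eq] at this
        rw [this, hD]
        simp [psi_snd hrank hdet]
    simpa [map_add, map_sum] using this
  have h5 : ∑ j, A (Sum.inl j) k * D (phiInv A j) ≤ 0 :=
    Finset.sum_nonpos fun j _ => mul_nonpos_of_nonneg_of_nonpos (hA _ _) (h1 j)
  have h6 : ∑ s, A (Sum.inr s) k * D (lamVar s) ≤ A (Sum.inr t) k * D (lamVar t) := by
    rw [← Finset.add_sum_erase _ _ (Finset.mem_univ t)]
    have : ∑ s ∈ Finset.univ.erase t, A (Sum.inr s) k * D (lamVar s) ≤ 0 :=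
      Finset.sum_nonpos fun j _ => mul_nonpos_of_nonneg_of_nonpos (hA _ _) (h2 j)
    linarith
  rw [h3] at h6
  have := hA (Sum.inr t) k
  linarith

/-- If the row of `λ_{L+t}` in `A` vanishes, then only the element `(λ_{L+t}, 0)` of `G` contains
this variable, and no elimination of the preceding variables produces another one. -/
lemma eq_lamVar_of_row_eq_zero (hrank : A.rank = L) (hdet : A.toBlocks₁₁.det ≠ 0) {t : Fin p}
    (ht : ∀ k, A (Sum.inr t) k = 0) {i : ℕ} (hi : i ≤ t) {x : PairTL L p r}
    (hx : x ∈ stage A ζ i) (h0 : lamExp t x ≠ 0) : x = (Multiplicative.ofAdd (lamVar t), 0) := by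
  induction i generalizing x with
  | zero =>
    rcases mem_setG.1 hx with ⟨j, rfl⟩ | ⟨k, rfl⟩ | ⟨s, rfl⟩ | ⟨k, -, rfl⟩
    · refine absurd ?_ h0
      simp [lamExp, phiInv, Matrix.toBlocks₂₁, ht]
    · simp [lamExp, psi_snd hrank hdet] at h0
    · by_cases h : t = s
      · rw [h]
      · simp [lamExp, lamVar, h] at h0
    · simp [lamExp, psi_snd hrank hdet] at h0
  | succ i ih =>
    rw [stage_succ (lt_of_lt_of_le hi t.2.le)] at hx
    have hne : (⟨i, lt_of_lt_of_le hi t.2.le⟩ : Fin p) ≠ t := fun h => by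
      have : (t : ℕ) = i := by rw [← h]
      omega
    rcases of_mem_eliminate hx with ⟨hx, -⟩ | ⟨y, hy, z, hz, hy0, hz0, -, a, b, rfl⟩
    · exact ih (by omega) hx h0
    · have aux : ∀ w ∈ stage A ζ i, lamExp ⟨i, lt_of_lt_of_le hi t.2.le⟩ w ≠ 0 →
          lamExp t w = 0 := fun w hw hw0 => by
        by_contra h
        rw [ih (by omega) hw h] at hw0
        simp [lamExp, lamVar, hne] at hw0
      rw [lamExp_pow_mul_pow, aux y hy hy0, aux z hz hz0] at h0
      simp at h0

end Elimination

/-! ### Bounds for the level functions -/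

lemma exists_upper_bound {ι : Type*} (s : Finset ι) (f : ι → ℝ) :
    ∃ M, 0 < M ∧ ∀ i ∈ s, f i ≤ M :=
  ⟨∑ i ∈ s, |f i| + 1, by positivity, fun i hi =>
    ((le_abs_self _).trans (Finset.single_le_sum (f := fun i => |f i|) (fun _ _ => abs_nonneg _)
      hi)).trans (by simp)⟩

section LevelBounds

variable {L p r : ℕ} {n : Option (Fin L ⊕ Fin r) → ℕ}
  {A : Matrix (Fin L ⊕ Fin p) (Fin L ⊕ Fin r) ℚ} {ζ : (k : Fin L ⊕ Fin r) → Fin (n (some k)) → ℂ}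

/-- The point `λ''` at which `ρ_{L+s}` is evaluated in the recursive definition of `rhoLast`. -/
def lamAfter (R : Fin p → ℝ) (s : Fin p) : Fin p → ℝ := fun s' => if s < s' then R s' else 1

lemma lamAfter_pos {R : Fin p → ℝ} {s : Fin p} (h : ∀ s', s < s' → 0 < R s') (s' : Fin p) :
    0 < lamAfter R s s' := by
  rw [lamAfter]
  split_ifs with h'
  exacts [h s' h', one_pos]

lemma rhoLast_eq (τ : Fin L ⊕ Fin r → ℝ) (s : Fin p) :
    rhoLast A ζ τ s = rho A ζ s τ (lamAfter (rhoLast A ζ τ) s) := by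
  rw [rhoLast]; rfl

lemma sol_lamAfter (s : Fin p) (x : PairTL L p r) (τ : Fin L ⊕ Fin r → ℝ) (R : Fin p → ℝ) :
    sol s x τ (lamAfter R s)
      = evalTL (Multiplicative.toAdd x.1) τ (lamAfter R s) ^ (1 / ((|lamExp s x| : ℚ) : ℝ)) := by
  simp [sol, lamAfter]

/-- A monomial met before the elimination of `λ_{L+s}` does not contain the variables of `λ''`
before `λ_{L+s}`. -/
lemma evalTL_eq_lamAfter_mul {s : Fin p} {x : PairTL L p r} (hx : x ∈ stage A ζ s)
    (τ : Fin L ⊕ Fin r → ℝ) (R : Fin p → ℝ) :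
    evalTL (Multiplicative.toAdd x.1) τ R
      = evalTL (Multiplicative.toAdd x.1) τ (lamAfter R s) * R s ^ ((lamExp s x : ℚ) : ℝ) := by
  have h : ∏ s', R s' ^ ((((Multiplicative.toAdd x.1).2 s' : ℚ)) : ℝ)
      = (∏ s', lamAfter R s s' ^ ((((Multiplicative.toAdd x.1).2 s' : ℚ)) : ℝ)) *
        ∏ s', if s' = s then R s ^ ((lamExp s x : ℚ) : ℝ) else 1 := by
    rw [← Finset.prod_mul_distrib]
    refine Finset.prod_congr rfl fun s' _ => ?_
    rcases lt_trichotomy s' s with h | h | h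
    · have h0 : (Multiplicative.toAdd x.1).2 s' = 0 :=
        lamExp_eq_zero_of_mem_stage s.2.le hx (s := s') h
      simp [h0, h.ne]
    · subst h; simp [lamAfter, lamExp]
    · simp [lamAfter, h, h.ne']
  rw [evalTL, evalTL, h, Finset.prod_ite_eq' Finset.univ s]
  simp [mul_assoc]

lemma rhoLast_pos (hrank : A.rank = L) (hdet : A.toBlocks₁₁.det ≠ 0) {τ : Fin L ⊕ Fin r → ℝ}
    (hτ : ∀ k, 0 < τ (Sum.inl k)) (s : Fin p) : 0 < rhoLast A ζ τ s := by
  induction hk : p - (s : ℕ) using Nat.strong_induction_on generalizing s with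
  | _ N ih =>
    have hl : ∀ s', 0 < lamAfter (rhoLast A ζ τ) s s' := lamAfter_pos fun s' hs' =>
      ih (p - s') (by have := s'.2; have : (s : ℕ) < s' := hs'; omega) s' rfl
    rw [rhoLast_eq, rho]
    split_ifs with h
    · obtain ⟨x, hx⟩ := h
      refine lt_of_lt_of_le ?_ (Finset.le_sup' _ hx)
      rw [Finset.mem_filter] at hx
      rw [sol_lamAfter]
      refine Real.rpow_pos_of_pos (evalTL_pos (fun k => ?_) hl) _
      rcases k with k | k
      · exact Or.inl (hτ k)
      · exact Or.inr (fst_inr_eq_zero_of_mem_stage hrank hdet s.2.le hx.1 hx.2.ne k)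
    · exact one_pos

lemma evalTL_lamAfter_nonneg {τ : Fin L ⊕ Fin r → ℝ} {R : Fin p → ℝ} (hτ : ∀ k, 0 ≤ τ k)
    (hR : ∀ s, 0 < R s) (e : Expo L p r) (s : Fin p) : 0 ≤ evalTL e τ (lamAfter R s) :=
  evalTL_nonneg _ hτ fun _ => (lamAfter_pos (fun _ _ => hR _) _).le

/-- By the choice of `ρ_{L+s}` as a maximum, the monomials with a negative exponent in `λ_{L+s}` are
at most `1` at the level functions. -/
lemma evalTL_rhoLast_le_one (hrank : A.rank = L) (hdet : A.toBlocks₁₁.det ≠ 0)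
    {τ : Fin L ⊕ Fin r → ℝ} (hτ0 : ∀ k, 0 ≤ τ k) (hτ : ∀ k, 0 < τ (Sum.inl k)) {s : Fin p}
    {x : PairTL L p r} (hx : x ∈ stage A ζ s) (hneg : lamExp s x < 0) :
    evalTL (Multiplicative.toAdd x.1) τ (rhoLast A ζ τ) ≤ 1 := by
  have hR := rhoLast_pos (ζ := ζ) hrank hdet hτ
  have hmem : x ∈ (stage A ζ s).filter fun x => lamExp s x < 0 := Finset.mem_filter.2 ⟨hx, hneg⟩
  have hν : (0 : ℝ) < ((|lamExp s x| : ℚ) : ℝ) := by exact_mod_cast abs_pos.2 hneg.ne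
  have h1 : evalTL (Multiplicative.toAdd x.1) τ (lamAfter (rhoLast A ζ τ) s)
      ≤ rhoLast A ζ τ s ^ ((|lamExp s x| : ℚ) : ℝ) := by
    have : sol s x τ (lamAfter (rhoLast A ζ τ) s) ≤ rhoLast A ζ τ s := by
      rw [rhoLast_eq (s := s), rho, dif_pos ⟨x, hmem⟩]
      exact Finset.le_sup' (fun x => sol s x τ (lamAfter (rhoLast A ζ τ) s)) hmem
    rw [sol_lamAfter] at this
    have h2 := Real.rpow_le_rpow (Real.rpow_nonneg (evalTL_lamAfter_nonneg hτ0 hR _ _) _) this hν.le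
    rwa [← Real.rpow_mul (evalTL_lamAfter_nonneg hτ0 hR _ _), one_div_mul_cancel hν.ne',
      Real.rpow_one] at h2
  rw [evalTL_eq_lamAfter_mul hx]
  calc _ ≤ rhoLast A ζ τ s ^ ((|lamExp s x| : ℚ) : ℝ) * rhoLast A ζ τ s ^ ((lamExp s x : ℚ) : ℝ) :=
        mul_le_mul_of_nonneg_right h1 (Real.rpow_nonneg (hR s).le _)
    _ = 1 := by
        rw [← Real.rpow_add (hR s), ← Rat.cast_add, abs_of_neg hneg]; simp

/-- The maximum defining `ρ_{L+s}` is attained, by a monomial with the value `1`. -/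
lemma exists_evalTL_rhoLast_eq_one (hrank : A.rank = L) (hdet : A.toBlocks₁₁.det ≠ 0)
    {τ : Fin L ⊕ Fin r → ℝ} (hτ0 : ∀ k, 0 ≤ τ k) (hτ : ∀ k, 0 < τ (Sum.inl k)) {s : Fin p}
    (hne : ∃ x ∈ stage A ζ s, lamExp s x < 0) : ∃ x ∈ stage A ζ s, lamExp s x < 0 ∧
      evalTL (Multiplicative.toAdd x.1) τ (rhoLast A ζ τ) = 1 := by
  have hR := rhoLast_pos (ζ := ζ) hrank hdet hτ
  have hne' : ((stage A ζ s).filter fun x => lamExp s x < 0).Nonempty := by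
    obtain ⟨x, hx, hx0⟩ := hne
    exact ⟨x, Finset.mem_filter.2 ⟨hx, hx0⟩⟩
  obtain ⟨x, hx, hmax⟩ := Finset.exists_mem_eq_sup' hne'
    fun x => sol s x τ (lamAfter (rhoLast A ζ τ) s)
  have hmem := Finset.mem_filter.1 hx
  have hneg := hmem.2
  have hν : (0 : ℝ) < ((|lamExp s x| : ℚ) : ℝ) := by exact_mod_cast abs_pos.2 hneg.ne
  refine ⟨x, hmem.1, hneg, ?_⟩
  have h1 : rhoLast A ζ τ s = sol s x τ (lamAfter (rhoLast A ζ τ) s) := by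
    rw [← hmax, rhoLast_eq (s := s), rho, dif_pos hne']
  rw [sol_lamAfter] at h1
  have h2 : rhoLast A ζ τ s ^ ((|lamExp s x| : ℚ) : ℝ)
      = evalTL (Multiplicative.toAdd x.1) τ (lamAfter (rhoLast A ζ τ) s) := by
    conv_lhs => rw [h1]
    rw [← Real.rpow_mul (evalTL_lamAfter_nonneg hτ0 hR _ _), one_div_mul_cancel hν.ne',
      Real.rpow_one]
  rw [evalTL_eq_lamAfter_mul hmem.1, ← h2, ← Real.rpow_add (hR s), ← Rat.cast_add,
    abs_of_neg hneg]
  simp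

/-- If the monomials of the generated semigroup which do not contain `λ''` are bounded on `T`, then
all the monomials of `G` are bounded on `T` when `λ''` is replaced by the level functions. The bounds are carried back through
the stages of the elimination: a monomial with a positive exponent in the eliminated variable is
multiplied by one with a negative exponent and the value `1`, and the product is a monomial of the
next stage. -/
theorem exists_bound_setG (hrank : A.rank = L) (hdet : A.toBlocks₁₁.det ≠ 0)
    (hA : ∀ j k, 0 ≤ A j k) (T : Set (Fin L ⊕ Fin r → ℝ)) (hT0 : ∀ τ ∈ T, ∀ k, 0 ≤ τ k)
    (hT1 : ∀ τ ∈ T, ∀ k, 0 < τ (Sum.inl k))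
    (hT : ∀ x ∈ Submonoid.closure (setG A ζ : Set (PairTL L p r)),
      (Multiplicative.toAdd x.1).2 = 0 →
        ∃ C, ∀ τ ∈ T, evalTL (Multiplicative.toAdd x.1) τ (rhoLast A ζ τ) ≤ C)
    {x : PairTL L p r} (hx : x ∈ setG A ζ) :
    ∃ C, ∀ τ ∈ T, evalTL (Multiplicative.toAdd x.1) τ (rhoLast A ζ τ) ≤ C := by
  have key : ∀ t : ℕ, t ≤ p → ∀ x ∈ stage A ζ t,
      ∃ C, ∀ τ ∈ T, evalTL (Multiplicative.toAdd x.1) τ (rhoLast A ζ τ) ≤ C := by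
    intro t ht
    induction ht using Nat.decreasingInduction with
    | self =>
      exact fun x hx => hT x (stage_subset_closure le_rfl hx)
        (funext fun s => lamExp_eq_zero_of_mem_stage le_rfl hx s.2)
    | of_succ t ht ih =>
      intro x hx
      have htp : t < p := ht
      rw [stage_succ htp] at ih
      set s : Fin p := ⟨t, htp⟩ with hs
      rcases lt_trichotomy (lamExp s x) 0 with h | h | h
      · exact ⟨1, fun τ hτ => evalTL_rhoLast_le_one hrank hdet (hT0 τ hτ) (hT1 τ hτ) (s := s) hx h⟩
      · exact ih x (Finset.mem_union_left _ (Finset.mem_filter.2 ⟨hx, h⟩))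
      · by_cases hne : ∃ y ∈ stage A ζ s, lamExp s y < 0
        · -- one bound for the products of `x` with all the negative elements
          have hb : ∀ y ∈ stage A ζ s, ∃ C, lamExp s y < 0 → ∀ τ ∈ T,
              evalTL (Multiplicative.toAdd y.1) τ (rhoLast A ζ τ) = 1 →
              evalTL (Multiplicative.toAdd x.1) τ (rhoLast A ζ τ) ≤ C := by
            intro y hy
            by_cases hy0 : lamExp s y < 0
            swap
            · exact ⟨0, fun h => absurd h hy0⟩
            obtain ⟨a, b, ha, hb, hab⟩ := exists_mem_eliminate hx hy h hy0
            obtain ⟨C, hC⟩ := ih _ hab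
            refine ⟨max C 1, fun _ τ hτ h1 => ?_⟩
            have hR := rhoLast_pos (ζ := ζ) hrank hdet (hT1 τ hτ)
            have h2 := hC τ hτ
            have hxk : ∀ k, 0 < τ k ∨ (Multiplicative.toAdd x.1).1 k = 0 := by
              rintro (k | k)
              · exact Or.inl (hT1 τ hτ k)
              · exact Or.inr (fst_inr_eq_zero_of_mem_stage hrank hdet ht.le hx h.ne' k)
            have hyk : ∀ k, 0 < τ k ∨ (Multiplicative.toAdd y.1).1 k = 0 := by
              rintro (k | k)
              · exact Or.inl (hT1 τ hτ k)
              · exact Or.inr (fst_inr_eq_zero_of_mem_stage hrank hdet ht.le hy hy0.ne k)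
            have hxyk : ∀ k, 0 < τ k ∨ (Multiplicative.toAdd (x ^ a * y ^ b).1).1 k = 0 := by
              intro k
              rcases hxk k with h | h
              · exact Or.inl h
              · rcases hyk k with h' | h'
                · exact Or.inl h'
                · exact Or.inr (by simp [h, h'])
            have e1 : Multiplicative.toAdd (x ^ a * y ^ b).1
                = a • Multiplicative.toAdd x.1 + b • Multiplicative.toAdd y.1 := rfl
            rw [evalTL_eq_exp hyk hR, Real.exp_eq_one_iff] at h1
            rw [evalTL_eq_exp hxyk hR, e1, map_add, map_nsmul, map_nsmul, h1, smul_zero, add_zero,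
              nsmul_eq_mul, Real.exp_nat_mul, ← evalTL_eq_exp hxk hR] at h2
            by_contra hcon
            rw [not_le, max_lt_iff] at hcon
            have := le_self_pow₀ hcon.2.le ha.ne'
            linarith [hcon.1]
          choose! C hC using hb
          obtain ⟨M, -, hM⟩ := exists_upper_bound (stage A ζ s) C
          refine ⟨M, fun τ hτ => ?_⟩
          obtain ⟨y, hy, hy0, hy1⟩ :=
            exists_evalTL_rhoLast_eq_one hrank hdet (hT0 τ hτ) (hT1 τ hτ) hne
          exact (hC y hy hy0 τ hτ hy1).trans (hM y hy)
        · -- without negative elements, `x` can only be `λ_{L+t}` itself, whose value is `1`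
          have hneg : ∀ y ∈ stage A ζ s, 0 ≤ lamExp s y := fun y hy => by
            by_contra hlt
            exact hne ⟨y, hy, not_le.1 hlt⟩
          have hrow := row_eq_zero_of_stage hrank hdet hA s hneg
          have hxs := eq_lamVar_of_row_eq_zero hrank hdet hrow le_rfl hx h.ne'
          refine ⟨1, fun τ hτ => ?_⟩
          have h1 : rhoLast A ζ τ s = 1 := by
            rw [rhoLast_eq, rho, dif_neg]
            rintro ⟨y, hy⟩
            exact hne ⟨y, Finset.mem_filter.1 hy⟩
          rw [hxs, toAdd_ofAdd, evalTL_lamVar, h1]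
  exact key 0 (Nat.zero_le _) x hx

end LevelBounds

/-! ### Monomials on a multicone -/

section Multicone

variable {L p r : ℕ} {n : Option (Fin L ⊕ Fin r) → ℕ}
  {A : Matrix (Fin L ⊕ Fin p) (Fin L ⊕ Fin r) ℚ} {ζ : (k : Fin L ⊕ Fin r) → Fin (n (some k)) → ℂ}

/-- The monomials `φ_k(λ) = ∏_j λ_j ^ a_{jk}`. -/
def phiVal (A : Matrix (Fin L ⊕ Fin p) (Fin L ⊕ Fin r) ℚ) (lam : Fin L ⊕ Fin p → ℝ)
    (k : Fin L ⊕ Fin r) : ℝ :=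
  ∏ j, lam j ^ ((A j k : ℚ) : ℝ)

/-- The values of the monomials `ψ_k` at `τ`. -/
def psiVal (A : Matrix (Fin L ⊕ Fin p) (Fin L ⊕ Fin r) ℚ) (τ : Fin L ⊕ Fin r → ℝ) (k : Fin r) : ℝ :=
  evalT (Multiplicative.ofAdd (psi A k).1) τ

lemma phiVal_pos {lam : Fin L ⊕ Fin p → ℝ} (h : ∀ j, 0 < lam j) (k : Fin L ⊕ Fin r) :
    0 < phiVal A lam k :=
  Finset.prod_pos fun j _ => Real.rpow_pos_of_pos (h j) _

lemma log_phiVal {lam : Fin L ⊕ Fin p → ℝ} (h : ∀ j, 0 < lam j) (k : Fin L ⊕ Fin r) :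
    Real.log (phiVal A lam k) = ∑ j, ((A j k : ℚ) : ℝ) * Real.log (lam j) := by
  rw [phiVal, Real.log_prod fun j _ => (Real.rpow_pos_of_pos (h j) _).ne']
  exact Finset.sum_congr rfl fun j _ => Real.log_rpow (h j) _

lemma phiVal_mono (hA : ∀ j k, 0 ≤ A j k) {lam lam' : Fin L ⊕ Fin p → ℝ} (h : ∀ j, 0 ≤ lam j)
    (h' : ∀ j, lam j ≤ lam' j) (k : Fin L ⊕ Fin r) : phiVal A lam k ≤ phiVal A lam' k :=
  Finset.prod_le_prod (fun j _ => Real.rpow_nonneg (h j) _) fun j _ =>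
    Real.rpow_le_rpow (h j) (h' j) (by exact_mod_cast hA j k)

/-- The monomials `φ_j^{-1}` invert `φ`. -/
lemma evalTL_phiInv_phiVal (hdet : A.toBlocks₁₁.det ≠ 0) {lam : Fin L ⊕ Fin p → ℝ}
    (h : ∀ j, 0 < lam j) (j : Fin L) :
    evalTL (phiInv A j) (phiVal A lam) (fun s => lam (Sum.inr s)) = lam (Sum.inl j) := by
  have hu : IsUnit A.toBlocks₁₁.det := hdet.isUnit
  have hinv : ∀ i j, ∑ l : Fin L, A (Sum.inl i) (Sum.inl l) * (A.toBlocks₁₁)⁻¹ l j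
      = if i = j then 1 else 0 := fun i j => by
    have := congrFun (congrFun (Matrix.mul_nonsing_inv A.toBlocks₁₁ hu) i) j
    rw [Matrix.mul_apply, Matrix.one_apply] at this
    exact this
  rw [evalTL_eq_exp (fun k => Or.inl (phiVal_pos h k)) fun s => h _, logMono_apply]
  simp only [log_phiVal h, phiInv, Fintype.sum_sum_type, Sum.elim_inl, Sum.elim_inr, Pi.zero_apply,
    Rat.cast_zero, zero_mul, Finset.sum_const_zero, add_zero]
  have h1 : ∑ x, (((A.toBlocks₁₁)⁻¹ x j : ℚ) : ℝ) *
      ∑ i, ((A (Sum.inl i) (Sum.inl x) : ℚ) : ℝ) * Real.log (lam (Sum.inl i))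
      = Real.log (lam (Sum.inl j)) := by
    simp only [Finset.mul_sum]
    rw [Finset.sum_comm]
    have : ∀ i, ∑ x, (((A.toBlocks₁₁)⁻¹ x j : ℚ) : ℝ) *
        (((A (Sum.inl i) (Sum.inl x) : ℚ) : ℝ) * Real.log (lam (Sum.inl i)))
        = (if i = j then 1 else 0) * Real.log (lam (Sum.inl i)) := fun i => by
      have h2 := congrArg (fun q : ℚ => (q : ℝ)) (hinv i j)
      simp only [Rat.cast_sum, Rat.cast_mul] at h2
      rw [show (((if i = j then 1 else 0 : ℚ)) : ℝ) = if i = j then 1 else 0 by split_ifs <;> simp]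
        at h2
      rw [← h2, Finset.sum_mul]
      exact Finset.sum_congr rfl fun x _ => by ring
    simp [this]
  have h2 : ∑ x, (((A.toBlocks₁₁)⁻¹ x j : ℚ) : ℝ) *
      ∑ s, ((A (Sum.inr s) (Sum.inl x) : ℚ) : ℝ) * Real.log (lam (Sum.inr s))
      = -∑ s, (((-∑ i, A.toBlocks₂₁ s i * (A.toBlocks₁₁)⁻¹ i j : ℚ)) : ℝ) *
        Real.log (lam (Sum.inr s)) := by
    simp only [Finset.mul_sum]
    rw [Finset.sum_comm, ← Finset.sum_neg_distrib]
    refine Finset.sum_congr rfl fun s _ => ?_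
    push_cast
    rw [neg_mul, neg_neg, Finset.sum_mul]
    refine Finset.sum_congr rfl fun x _ => ?_
    simp only [Matrix.toBlocks₂₁, Matrix.of_apply]
    ring
  simp only [mul_add, Finset.sum_add_distrib]
  rw [h1, h2, neg_add_cancel_right, Real.exp_log (h _)]

lemma evalTL_psi_phiVal (hdet : A.toBlocks₁₁.det ≠ 0)
    {lam : Fin L ⊕ Fin p → ℝ} (h : ∀ j, 0 < lam j) (k : Fin r) :
    evalTL (psi A k) (phiVal A lam) (fun s => lam (Sum.inr s)) = 1 := by
  have hpos := fun k => phiVal_pos (A := A) h k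
  rw [evalTL_eq_exp (fun k => Or.inl (hpos k)) fun s => h _, Real.exp_eq_one_iff, psi, map_sub,
    map_add, map_sum, map_sum]
  have h1 : ∀ j, logMono (fun k => Real.log (phiVal A lam k)) (fun s => Real.log (lam (Sum.inr s)))
      (phiInv A j) = Real.log (lam (Sum.inl j)) := fun j => by
    rw [← evalTL_phiInv_phiVal hdet h j,
      evalTL_eq_exp (fun k => Or.inl (hpos k)) fun s => h _, Real.log_exp]
  have h2 : ∀ s, logMono (fun k => Real.log (phiVal A lam k)) (fun s => Real.log (lam (Sum.inr s)))
      (lamVar s : Expo L p r) = Real.log (lam (Sum.inr s)) := fun s => by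
    rw [logMono_apply, Finset.sum_eq_zero (by simp [lamVar]), zero_add,
      Finset.sum_eq_single s (fun b _ hb => by simp [lamVar, hb]) (by simp)]
    simp [lamVar]
  have h3 : logMono (fun k => Real.log (phiVal A lam k)) (fun s => Real.log (lam (Sum.inr s)))
      ((Pi.single (Sum.inr k) 1, 0) : Expo L p r) = Real.log (phiVal A lam (Sum.inr k)) := by
    rw [logMono_apply, Finset.sum_eq_single (Sum.inr k) (fun b _ hb => by simp [hb]) (by simp)]
    simp
  simp only [map_rat_smul, h1, h2, h3, Rat.smul_def]
  rw [log_phiVal h, Fintype.sum_sum_type, sub_self]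

/-- The value of a pair of the semigroup generated by `G` at `τ = φ(λ)` is a monomial in `λ`. -/
lemma exists_evalTL_phiVal (hdet : A.toBlocks₁₁.det ≠ 0) {x : PairTL L p r}
    (hx : x ∈ Submonoid.closure (setG A ζ : Set (PairTL L p r))) :
    ∃ m : Fin L ⊕ Fin p → ℕ, (x.2 ≠ 0 → m = 0) ∧ ∀ lam : Fin L ⊕ Fin p → ℝ, (∀ j, 0 < lam j) →
      evalTL (Multiplicative.toAdd x.1) (phiVal A lam) (fun s => lam (Sum.inr s))
        = ∏ j, lam j ^ m j := by
  induction hx using Submonoid.closure_induction with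
  | mem x hx =>
    rcases mem_setG.1 (Finset.mem_coe.1 hx) with ⟨j, rfl⟩ | ⟨k, rfl⟩ | ⟨s, rfl⟩ | ⟨k, -, rfl⟩
    · refine ⟨Pi.single (Sum.inl j) 1, by simp, fun lam h => ?_⟩
      rw [toAdd_ofAdd, evalTL_phiInv_phiVal hdet h,
        Finset.prod_eq_single (Sum.inl j) (fun b _ hb => by simp [hb]) (by simp)]
      simp
    · refine ⟨0, by simp, fun lam h => ?_⟩
      rw [toAdd_ofAdd, evalTL_psi_phiVal hdet h]
      simp
    · refine ⟨Pi.single (Sum.inr s) 1, by simp, fun lam h => ?_⟩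
      rw [toAdd_ofAdd, evalTL_lamVar,
        Finset.prod_eq_single (Sum.inr s) (fun b _ hb => by simp [hb]) (by simp)]
      simp
    · refine ⟨0, by simp, fun lam h => ?_⟩
      have := evalTL_psi_phiVal hdet h k
      rw [evalTL_eq_exp (fun k => Or.inl (phiVal_pos h k)) fun s => h _,
        Real.exp_eq_one_iff] at this
      rw [toAdd_ofAdd, evalTL_eq_exp (fun k => Or.inl (phiVal_pos h k)) fun s => h _, map_neg, this]
      simp
  | one => exact ⟨0, by simp, fun lam h => by simp [evalTL]⟩
  | mul x y _ _ hx hy =>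
    obtain ⟨m, hm0, hm⟩ := hx
    obtain ⟨m', hm0', hm'⟩ := hy
    refine ⟨m + m', fun h => ?_, fun lam h => ?_⟩
    · rw [Prod.snd_mul] at h
      rw [hm0 (left_ne_zero_of_mul h), hm0' (right_ne_zero_of_mul h), add_zero]
    · rw [Prod.fst_mul, toAdd_mul, evalTL_add (fun k => Or.inl (phiVal_pos h k)) fun s => h _,
        hm lam h, hm' lam h, ← Finset.prod_mul_distrib]
      exact Finset.prod_congr rfl fun j _ => by rw [Pi.add_apply, pow_add]

lemma evalTL_toTL (g : PairT L r) (τ : Fin L ⊕ Fin r → ℝ) (lam : Fin p → ℝ) :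
    evalTL (Multiplicative.toAdd (g.toTL p).1) τ lam = evalT g.1 τ := by
  simp [PairT.toTL, evalTL, evalT]

/-- The monomials of the family `H` defining the multicones have non-negative exponents when they
are written in the parameters `λ`. -/
lemma exists_evalT_phiVal (hdet : A.toBlocks₁₁.det ≠ 0)
    {H : Set (PairT L r)} (hH : Equivalent H (semigroupG A ζ)) {h : PairT L r} (hh : h ∈ H) :
    ∃ q : Fin L ⊕ Fin p → ℝ, (∀ j, 0 ≤ q j) ∧ (h.2 ≠ 0 → q = 0) ∧
      ∀ lam : Fin L ⊕ Fin p → ℝ, (∀ j, 0 < lam j) →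
        evalT h.1 (phiVal A lam) = ∏ j, lam j ^ q j := by
  obtain ⟨N₁, N₂, h1, h2, hsub, -⟩ := hH
  obtain ⟨g, hg, hgh⟩ := hsub ⟨h, hh, rfl⟩
  obtain ⟨m, hm0, hm⟩ := exists_evalTL_phiVal hdet hg
  have hN₁ : (N₁ : ℝ) ≠ 0 := by exact_mod_cast h1.ne'
  refine ⟨fun j => m j * N₂ / N₁, fun j => by positivity, fun hne => ?_, fun lam hlam => ?_⟩
  · have : g.2 ≠ 0 := fun h0 => by
      have := congrArg Prod.snd hgh
      simp only [Prod.pow_snd, h0, zero_pow h2.ne'] at this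
      exact hne (pow_eq_zero_iff h1.ne' |>.1 this.symm)
    rw [hm0 this]
    funext j
    simp
  · have hp : ∀ k, 0 ≤ phiVal A lam k := fun k => (phiVal_pos hlam k).le
    have e1 : evalT h.1 (phiVal A lam) ^ N₁ = (∏ j, lam j ^ m j) ^ N₂ := by
      rw [← hm lam hlam, evalTL_toTL, ← evalT_pow _ _ hp, ← evalT_pow _ _ hp]
      have := congrArg Prod.fst hgh
      simp only [Prod.pow_fst] at this
      rw [this]
    have e2 : (∏ j, lam j ^ ((m j : ℝ) * N₂ / N₁)) ^ N₁ = (∏ j, lam j ^ m j) ^ N₂ := by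
      rw [← Finset.prod_pow, ← Finset.prod_pow]
      refine Finset.prod_congr rfl fun j _ => ?_
      rw [← Real.rpow_natCast, ← Real.rpow_mul (hlam j).le, div_mul_cancel₀ _ hN₁, ← pow_mul,
        ← Real.rpow_natCast]
      push_cast
      rfl
    exact (pow_left_inj₀ (evalT_nonneg _ hp)
      (Finset.prod_nonneg fun j _ => Real.rpow_nonneg (hlam j).le _) h1.ne').1 (e1.trans e2.symm)

lemma nval_eq_zero_iff (hζ : ∀ k : Fin L, ζ (Sum.inl k) ≠ 0) (k : Fin r) : nval A ζ k = 0 ↔ ζ (Sum.inr k) = 0 := by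
  rw [nval, Real.toNNReal_eq_zero]
  constructor
  · intro h
    by_contra h0
    refine absurd h (not_le.2 (evalTL_pos (fun k' => ?_) fun _ => one_pos))
    rcases k' with k' | k'
    · exact Or.inl (norm_pos_iff.2 (hζ k'))
    · by_cases hk : k' = k
      · subst hk; exact Or.inl (norm_pos_iff.2 h0)
      · exact Or.inr (by simp [psi_fst_inr, hk])
  · intro h
    refine le_of_eq ?_
    rw [evalTL, Finset.prod_eq_zero (Finset.mem_univ (Sum.inr k)), zero_mul]
    simp [psi_fst_inr, h]

/-- If `ζ^(k) = 0`, then `τ_k` occurs only with non-negative exponents. -/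
lemma expo_inr_of_mem_closure (hζ : ∀ k : Fin L, ζ (Sum.inl k) ≠ 0) {x : PairTL L p r}
    (hx : x ∈ Submonoid.closure (setG A ζ : Set (PairTL L p r))) {k : Fin r}
    (hk : ζ (Sum.inr k) = 0) : 0 ≤ (Multiplicative.toAdd x.1).1 (Sum.inr k) := by
  induction hx using Submonoid.closure_induction with
  | mem x hx =>
    rcases mem_setG.1 (Finset.mem_coe.1 hx) with ⟨j, rfl⟩ | ⟨k', rfl⟩ | ⟨s, rfl⟩ | ⟨k', h, rfl⟩
    · rw [toAdd_ofAdd, phiInv_fst_inr]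
    · rw [toAdd_ofAdd, psi_fst_inr]; split_ifs <;> norm_num
    · rfl
    · rw [toAdd_ofAdd, Prod.fst_neg, Pi.neg_apply, psi_fst_inr, if_neg, neg_zero]
      rintro rfl
      exact h ((nval_eq_zero_iff hζ _).2 hk)
  | one => exact le_rfl
  | mul x y _ _ hx hy => exact add_nonneg hx hy

/-- The statement of `expo_inr_of_mem_closure` for a semigroup which is merely equivalent to `𝒢`:
the exponents differ by positive factors. -/
lemma expo_inr_of_equivalent (hζ : ∀ k : Fin L, ζ (Sum.inl k) ≠ 0) {H : Set (PairT L r)}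
    (hH : Equivalent H (semigroupG A ζ)) {h : PairT L r} (hh : h ∈ H) {k : Fin L ⊕ Fin r}
    (hk : ζ k = 0) : 0 ≤ Multiplicative.toAdd h.1 k := by
  obtain ⟨N₁, N₂, h1, h2, hsub, -⟩ := hH
  obtain ⟨g, hg, hgh⟩ := hsub ⟨h, hh, rfl⟩
  rcases k with k | k
  · exact absurd hk (hζ k)
  · have := expo_inr_of_mem_closure hζ hg hk
    have e : (N₂ : ℚ) * Multiplicative.toAdd g.1 (Sum.inr k)
        = N₁ * Multiplicative.toAdd h.1 (Sum.inr k) := by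
      have := congrArg (fun y : PairT L r => Multiplicative.toAdd y.1 (Sum.inr k)) hgh
      simpa [toAdd_pow] using this
    have h3 : 0 ≤ (N₁ : ℚ) * Multiplicative.toAdd h.1 (Sum.inr k) := by
      rw [← e]; exact mul_nonneg (Nat.cast_nonneg _) this
    exact nonneg_of_mul_nonneg_right h3 (by exact_mod_cast h1)

end Multicone

/-! ### The level functions on a multicone -/

section LevelOnMulticone

variable {L p r : ℕ} {n : Option (Fin L ⊕ Fin r) → ℕ}
  {A : Matrix (Fin L ⊕ Fin p) (Fin L ⊕ Fin r) ℚ} {ζ : (k : Fin L ⊕ Fin r) → Fin (n (some k)) → ℂ}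
  {H : Finset (PairT L r)} {V : (k : Fin L ⊕ Fin r) → Set (Fin (n (some k)) → ℂ)} {ε : Radii L r}

/-- The standing assumptions on the exponent matrix, the direction `ζ` and the finite set `H`. -/
structure Admissible (A : Matrix (Fin L ⊕ Fin p) (Fin L ⊕ Fin r) ℚ)
    (ζ : (k : Fin L ⊕ Fin r) → Fin (n (some k)) → ℂ) (H : Finset (PairT L r)) : Prop where
  nonneg : ∀ j k, 0 ≤ A j k
  rank : A.rank = L
  det : A.toBlocks₁₁.det ≠ 0
  ne_zero : ∀ k : Fin L, ζ (Sum.inl k) ≠ 0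
  equiv : Equivalent (Submonoid.closure (H : Set (PairT L r)) : Set (PairT L r)) (semigroupG A ζ)

lemma level_pos (hs : Admissible A ζ H) {τ : Fin L ⊕ Fin r → ℝ} (hτ : ∀ k, 0 < τ (Sum.inl k))
    (j : Fin L ⊕ Fin p) : 0 < level A ζ τ j := by
  have hR := rhoLast_pos (ζ := ζ) hs.rank hs.det hτ
  rcases j with j | j
  · refine evalTL_pos (fun k => ?_) hR
    rcases k with k | k
    · exact Or.inl (hτ k)
    · exact Or.inr (phiInv_fst_inr j k)
  · exact hR j

lemma psiVal_eq_evalTL (hs : Admissible A ζ H) (τ : Fin L ⊕ Fin r → ℝ) (lam : Fin p → ℝ)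
    (k : Fin r) : psiVal A τ k = evalTL (psi A k) τ lam :=
  (evalTL_of_snd_eq_zero (psi_snd hs.rank hs.det k) τ lam).symm

/-- The quotients `τ_k / φ_k(ρ_Λ(τ))`: they are `1` for `k ≤ L`, and `ψ_k(τ)` for `k > L`. -/
def ratio (A : Matrix (Fin L ⊕ Fin p) (Fin L ⊕ Fin r) ℚ) (τ : Fin L ⊕ Fin r → ℝ) :
    Fin L ⊕ Fin r → ℝ :=
  Sum.elim 1 (psiVal A τ)

lemma ratio_nonneg {τ : Fin L ⊕ Fin r → ℝ} (hτ : ∀ k, 0 ≤ τ k) (k : Fin L ⊕ Fin r) :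
    0 ≤ ratio A τ k := by
  rcases k with k | k
  · exact zero_le_one
  · exact evalT_nonneg _ hτ

lemma eq_ratio_mul_phiVal (hs : Admissible A ζ H) {τ : Fin L ⊕ Fin r → ℝ}
    (hτ0 : ∀ k, 0 ≤ τ k) (hτ : ∀ k, 0 < τ (Sum.inl k)) (k : Fin L ⊕ Fin r) :
    τ k = ratio A τ k * phiVal A (level A ζ τ) k := by
  have hR := rhoLast_pos (ζ := ζ) hs.rank hs.det hτ
  have hl := level_pos hs hτ
  set u : Fin L ⊕ Fin r → ℝ := fun k => Real.log (τ k) with hu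
  set v : Fin p → ℝ := fun s => Real.log (rhoLast A ζ τ s) with hv
  have h1 : ∀ j, logMono u v (phiInv A j) = Real.log (level A ζ τ (Sum.inl j)) := fun j => by
    rw [level, Sum.elim_inl, evalTL_eq_exp (fun k => ?_) hR, Real.log_exp]
    rcases k with k | k
    · exact Or.inl (hτ k)
    · exact Or.inr (phiInv_fst_inr j k)
  have h2 : ∀ s, logMono u v (lamVar s : Expo L p r) = Real.log (level A ζ τ (Sum.inr s)) := fun s => by
    rw [logMono_apply, Finset.sum_eq_zero (by simp [lamVar]), zero_add,
      Finset.sum_eq_single s (fun b _ hb => by simp [lamVar, hb]) (by simp)]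
    simp [lamVar, level, hv]
  have h3 : ∀ k, logMono u v ((Pi.single k 1, 0) : Expo L p r) = u k := fun k => by
    rw [logMono_apply, Finset.sum_eq_single k (fun b _ hb => by simp [hb]) (by simp)]
    simp
  rcases k with k | k
  · have h4 := congrArg (logMono u v) (sum_phiInv_inl hs.det k)
    rw [h3, map_add, map_sum, map_sum] at h4
    simp only [map_rat_smul, h1, h2, Rat.smul_def] at h4
    have h5 := log_phiVal (A := A) hl (Sum.inl k)
    rw [Fintype.sum_sum_type, h4] at h5
    simpa [ratio] using (Real.log_injOn_pos (hτ k) (phiVal_pos hl _) h5.symm)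
  · rcases (hτ0 (Sum.inr k)).eq_or_lt with h0 | h0
    · have : psiVal A τ k = 0 := by
        refine Finset.prod_eq_zero (Finset.mem_univ (Sum.inr k : Fin L ⊕ Fin r)) ?_
        simp [psi_fst_inr, ← h0]
      simp [ratio, this, ← h0]
    · have hpk : ∀ k', 0 < τ k' ∨ (psi A k).1 k' = 0 := by
        rintro (k' | k')
        · exact Or.inl (hτ k')
        · by_cases h : k' = k
          · subst h; exact Or.inl h0
          · exact Or.inr (by simp [psi_fst_inr, h])
      have h4 := congrArg (logMono u v) (sum_phiInv_inr (A := A) k)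
      rw [h3, map_add, map_add, map_sum, map_sum] at h4
      simp only [map_rat_smul, h1, h2, Rat.smul_def] at h4
      have h5 := log_phiVal (A := A) hl (Sum.inr k)
      rw [Fintype.sum_sum_type] at h5
      rw [← h5] at h4
      have h6 : psiVal A τ k = Real.exp (logMono u v (psi A k)) := by
        rw [psiVal_eq_evalTL hs τ (rhoLast A ζ τ), evalTL_eq_exp hpk hR]
      have h7 : τ (Sum.inr k) = Real.exp (u (Sum.inr k)) := (Real.exp_log h0).symm
      rw [h7, ← h4, Real.exp_add, Real.exp_log (phiVal_pos hl _), ratio, Sum.elim_inr, h6, mul_comm]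

lemma blockNorm_nonneg (z : Space n) (k) : 0 ≤ blockNorm z k := norm_nonneg _

lemma blockNorm_pos (hV : IsConeAt ζ V) {z : Space n} (hz : z ∈ multicone H V ε)
    {k : Fin L ⊕ Fin r} (hk : ζ k ≠ 0) : 0 < blockNorm z k := by
  refine norm_pos_iff.2 fun h => ?_
  have := hz.1 k
  rw [h] at this
  exact ((hV k).1 hk).2.2.2.1 this

lemma blockNorm_inl_pos (hs : Admissible A ζ H) (hV : IsConeAt ζ V) {z : Space n}
    (hz : z ∈ multicone H V ε) (k : Fin L) : 0 < blockNorm z (Sum.inl k) :=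
  blockNorm_pos hV hz (hs.ne_zero k)

lemma exists_bound_closure (hs : Admissible A ζ H) (hV : IsConeAt ζ V) (ε : Radii L r)
    {h : PairT L r} (hh : h ∈ Submonoid.closure (H : Set (PairT L r))) :
    ∃ C, ∀ z ∈ multicone H V ε, evalT h.1 (blockNorm z) ≤ C := by
  induction hh using Submonoid.closure_induction with
  | mem h hh => exact ⟨_, fun z hz => (hz.2.2 h hh).2.le⟩
  | one => exact ⟨1, fun z hz => by simp [evalT]⟩
  | mul f g hf hg h1 h2 =>
    obtain ⟨C, hC⟩ := h1
    obtain ⟨D, hD⟩ := h2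
    refine ⟨C * D, fun z hz => ?_⟩
    rw [Prod.fst_mul, evalT_mul]
    · exact mul_le_mul (hC z hz) (hD z hz) (evalT_nonneg _ (blockNorm_nonneg z))
        ((evalT_nonneg _ (blockNorm_nonneg z)).trans (hC z hz))
    · intro k
      by_cases hk : ζ k = 0
      · rcases (blockNorm_nonneg z k).lt_or_eq with h | h
        · exact Or.inl h
        · exact Or.inr ⟨h.symm, expo_inr_of_equivalent hs.ne_zero hs.equiv hf hk,
            expo_inr_of_equivalent hs.ne_zero hs.equiv hg hk⟩
      · exact Or.inl (blockNorm_pos hV hz hk)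

/-- All the monomials of `G` are bounded on a multicone when `λ''` is replaced by the level
functions. -/
lemma exists_bound_setG_multicone (hs : Admissible A ζ H) (hV : IsConeAt ζ V) (ε : Radii L r)
    {x : PairTL L p r} (hx : x ∈ setG A ζ) : ∃ C, ∀ z ∈ multicone H V ε,
      evalTL (Multiplicative.toAdd x.1) (blockNorm z) (rhoLast A ζ (blockNorm z)) ≤ C := by
  obtain ⟨C, hC⟩ := exists_bound_setG hs.rank hs.det hs.nonneg (blockNorm '' multicone H V ε)
    (by rintro _ ⟨z, -, rfl⟩; exact blockNorm_nonneg z)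
    (by rintro _ ⟨z, hz, rfl⟩; exact blockNorm_inl_pos hs hV hz)
    (by
      intro y hy hy0
      obtain ⟨N₁, N₂, h1, h2, -, hsub⟩ := hs.equiv
      let g : PairT L r := (Multiplicative.ofAdd (Multiplicative.toAdd y.1).1, y.2)
      have hg : g.toTL p = y := by
        refine Prod.ext ?_ rfl
        exact congrArg Multiplicative.ofAdd (Prod.ext rfl hy0.symm)
      have hgG : g ∈ semigroupG A ζ := by rw [semigroupG, mem_ofPred_eq, hg]; exact hy
      obtain ⟨C, hC⟩ := exists_bound_closure hs hV ε (hsub ⟨g, hgG, rfl⟩)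
      refine ⟨max C 1, ?_⟩
      rintro _ ⟨z, hz, rfl⟩
      have h3 := hC z hz
      rw [Prod.pow_fst, evalT_pow _ _ (blockNorm_nonneg z)] at h3
      rw [← hg, evalTL_toTL]
      by_contra hcon
      rw [not_le, max_lt_iff] at hcon
      have := le_self_pow₀ hcon.2.le h2.ne'
      linarith [hcon.1]) hx
  exact ⟨C, fun z hz => hC _ ⟨z, hz, rfl⟩⟩

/-- On a multicone the level functions are bounded, the `ψ_k` are bounded, and those with
`ζ^(k) ≠ 0` are bounded away from `0`. -/
theorem exists_level_bounds (hs : Admissible A ζ H) (hV : IsConeAt ζ V) (ε : Radii L r) :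
    ∃ C, 1 ≤ C ∧ ∀ z ∈ multicone H V ε, (∀ j, level A ζ (blockNorm z) j ≤ C) ∧
      (∀ k, ratio A (blockNorm z) k ≤ C) ∧ ∀ k, ζ k ≠ 0 → C⁻¹ ≤ ratio A (blockNorm z) k := by
  choose! C hC using fun x (hx : x ∈ setG A ζ) => exists_bound_setG_multicone hs hV ε hx
  obtain ⟨M, hM0, hM⟩ := exists_upper_bound (setG A ζ) C
  have hb : ∀ x ∈ setG A ζ, ∀ z ∈ multicone H V ε, evalTL (Multiplicative.toAdd x.1) (blockNorm z)
      (rhoLast A ζ (blockNorm z)) ≤ max M 1 := fun x hx z hz =>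
    ((hC x hx z hz).trans (hM x hx)).trans (le_max_left _ _)
  refine ⟨max M 1, le_max_right _ _, fun z hz => ⟨?_, ?_, ?_⟩⟩
  · rintro (j | s)
    · exact hb (Multiplicative.ofAdd (phiInv A j), 0) (mem_setG.2 (Or.inl ⟨j, rfl⟩)) z hz
    · have := hb (Multiplicative.ofAdd (lamVar s), 0)
        (mem_setG.2 (Or.inr (Or.inr (Or.inl ⟨s, rfl⟩)))) z hz
      rwa [toAdd_ofAdd, evalTL_lamVar] at this
  · rintro (k | k)
    · exact le_max_right _ _
    · rw [ratio, Sum.elim_inr, psiVal_eq_evalTL hs _ (rhoLast A ζ (blockNorm z))]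
      exact hb (Multiplicative.ofAdd (psi A k), nval A ζ k)
        (mem_setG.2 (Or.inr (Or.inl ⟨k, rfl⟩))) z hz
  · rintro (k | k) hk
    · exact inv_le_one_of_one_le₀ (le_max_right _ _)
    · have h1 := hb (Multiplicative.ofAdd (-psi A k), (nval A ζ k)⁻¹)
        (mem_setG.2 (Or.inr (Or.inr (Or.inr ⟨k, fun h => hk ((nval_eq_zero_iff hs.ne_zero k).1 h),
          rfl⟩)))) z hz
      have hR := rhoLast_pos (ζ := ζ) hs.rank hs.det (blockNorm_inl_pos hs hV hz)
      have hpk : ∀ k', 0 < blockNorm z k' ∨ (psi A k).1 k' = 0 := by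
        rintro (k' | k')
        · exact Or.inl (blockNorm_inl_pos hs hV hz k')
        · by_cases h : k' = k
          · subst h; exact Or.inl (blockNorm_pos hV hz hk)
          · exact Or.inr (by simp [psi_fst_inr, h])
      rw [toAdd_ofAdd, evalTL_eq_exp (fun k' => by simpa using hpk k') hR, map_neg,
        Real.exp_neg] at h1
      rw [ratio, Sum.elim_inr, psiVal_eq_evalTL hs _ (rhoLast A ζ (blockNorm z)),
        evalTL_eq_exp hpk hR]
      exact inv_le_of_inv_le₀ (Real.exp_pos _) h1

/-- A monomial in the `τ_k`, `k ≤ L`, and `λ''` changes by at most a bounded factor when its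
arguments do. -/
lemma exists_evalTL_le_mul (e : Expo L p r) (he : ∀ k, e.1 (Sum.inr k) = 0) (c : ℝ) :
    ∃ C, 0 < C ∧ ∀ τ τ' : Fin L ⊕ Fin r → ℝ, ∀ lam lam' : Fin p → ℝ,
      (∀ k, 0 < τ (Sum.inl k)) → (∀ k, 0 < τ' (Sum.inl k)) → (∀ s, 0 < lam s) →
      (∀ s, 0 < lam' s) →
      (∀ k, |Real.log (τ (Sum.inl k)) - Real.log (τ' (Sum.inl k))| ≤ c) →
      (∀ s, |Real.log (lam s) - Real.log (lam' s)| ≤ c) →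
      |Real.log (evalTL e τ lam) - Real.log (evalTL e τ' lam')| ≤ C := by
  refine ⟨(∑ k, |((e.1 k : ℚ) : ℝ)| * |c|) + (∑ s, |((e.2 s : ℚ) : ℝ)| * |c|) + 1,
    by positivity, fun τ τ' lam lam' hτ hτ' hl hl' h1 h2 => ?_⟩
  have hk : ∀ τ : Fin L ⊕ Fin r → ℝ, (∀ k, 0 < τ (Sum.inl k)) → ∀ k, 0 < τ k ∨ e.1 k = 0 := by
    rintro τ hτ (k | k)
    · exact Or.inl (hτ k)
    · exact Or.inr (he k)
  rw [evalTL_eq_exp (hk τ hτ) hl, evalTL_eq_exp (hk τ' hτ') hl', Real.log_exp, Real.log_exp,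
    logMono_apply, logMono_apply, add_sub_add_comm, ← Finset.sum_sub_distrib,
    ← Finset.sum_sub_distrib]
  simp only [← mul_sub]
  refine (abs_add_le _ _).trans ((add_le_add ((Finset.abs_sum_le_sum_abs _ _).trans
    (Finset.sum_le_sum (g := fun k => |((e.1 k : ℚ) : ℝ)| * |c|) fun k _ => ?_))
    ((Finset.abs_sum_le_sum_abs _ _).trans
    (Finset.sum_le_sum (g := fun s => |((e.2 s : ℚ) : ℝ)| * |c|) fun s _ => ?_))).trans
    (by linarith))
  · rw [abs_mul]
    rcases k with k | k
    · exact mul_le_mul_of_nonneg_left ((h1 k).trans (le_abs_self c)) (abs_nonneg _)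
    · simp [he k]
  · rw [abs_mul]
    exact mul_le_mul_of_nonneg_left ((h2 s).trans (le_abs_self c)) (abs_nonneg _)

/-- The level functions change by at most a bounded factor when the `τ_k`, `k ≤ L`, do. -/
theorem exists_level_le_mul (hs : Admissible A ζ H) (c : ℝ) :
    ∃ C, 0 < C ∧ ∀ τ τ' : Fin L ⊕ Fin r → ℝ, (∀ k, 0 ≤ τ k) → (∀ k, 0 ≤ τ' k) →
      (∀ k, 0 < τ (Sum.inl k)) → (∀ k, 0 < τ' (Sum.inl k)) →
      (∀ k, |Real.log (τ (Sum.inl k)) - Real.log (τ' (Sum.inl k))| ≤ c) →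
      ∀ j, level A ζ τ j ≤ C * level A ζ τ' j := by
  have hR := fun (τ : Fin L ⊕ Fin r → ℝ) => rhoLast_pos (ζ := ζ) (τ := τ) hs.rank hs.det
  have key : ∀ s : Fin p, ∃ D, 0 < D ∧ ∀ τ τ' : Fin L ⊕ Fin r → ℝ,
      (∀ k, 0 ≤ τ k) → (∀ k, 0 ≤ τ' k) → (∀ k, 0 < τ (Sum.inl k)) → (∀ k, 0 < τ' (Sum.inl k)) →
      (∀ k, |Real.log (τ (Sum.inl k)) - Real.log (τ' (Sum.inl k))| ≤ c) →
      |Real.log (rhoLast A ζ τ s) - Real.log (rhoLast A ζ τ' s)| ≤ D := by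
    intro s
    induction hk : p - (s : ℕ) using Nat.strong_induction_on generalizing s with
    | _ N ih =>
      have ih' : ∀ s' : Fin p, ∃ D, 0 < D ∧ (s < s' → ∀ τ τ' : Fin L ⊕ Fin r → ℝ,
          (∀ k, 0 ≤ τ k) → (∀ k, 0 ≤ τ' k) →
          (∀ k, 0 < τ (Sum.inl k)) → (∀ k, 0 < τ' (Sum.inl k)) →
          (∀ k, |Real.log (τ (Sum.inl k)) - Real.log (τ' (Sum.inl k))| ≤ c) →
          |Real.log (rhoLast A ζ τ s') - Real.log (rhoLast A ζ τ' s')| ≤ D) := fun s' => by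
        by_cases h : s < s'
        · obtain ⟨D, hD0, hD⟩ := ih (p - s') (by have := s'.2; have : (s : ℕ) < s' := h; omega)
            s' rfl
          exact ⟨D, hD0, fun _ => hD⟩
        · exact ⟨1, one_pos, fun h' => absurd h' h⟩
      choose D hD0 hD using ih'
      obtain ⟨M, hM0, hM⟩ := exists_upper_bound Finset.univ D
      have hx : ∀ x ∈ stage A ζ s, ∃ E, lamExp s x < 0 → ∀ τ τ' : Fin L ⊕ Fin r → ℝ,
          (∀ k, 0 ≤ τ k) → (∀ k, 0 ≤ τ' k) →
          (∀ k, 0 < τ (Sum.inl k)) → (∀ k, 0 < τ' (Sum.inl k)) →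
          (∀ k, |Real.log (τ (Sum.inl k)) - Real.log (τ' (Sum.inl k))| ≤ c) →
          sol s x τ (lamAfter (rhoLast A ζ τ) s) ≤
            Real.exp E * sol s x τ' (lamAfter (rhoLast A ζ τ') s) := by
        intro x hx
        by_cases hneg : lamExp s x < 0
        swap
        · exact ⟨0, fun h => absurd h hneg⟩
        have hinr := fst_inr_eq_zero_of_mem_stage hs.rank hs.det s.2.le hx hneg.ne
        obtain ⟨C, hC0, hC⟩ := exists_evalTL_le_mul (Multiplicative.toAdd x.1) hinr (max c M)
        refine ⟨C * (1 / ((|lamExp s x| : ℚ) : ℝ)), fun _ τ τ' h0 h0' h1 h1' h => ?_⟩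
        have hl := fun τ h1 => lamAfter_pos (s := s) fun s' _ => hR τ h1 s'
        have h2 := hC τ τ' (lamAfter (rhoLast A ζ τ) s) (lamAfter (rhoLast A ζ τ') s) h1 h1'
          (hl τ h1) (hl τ' h1') (fun k => (h k).trans (le_max_left _ _)) (fun s' => by
            by_cases hss : s < s'
            · simp only [lamAfter, hss, if_true]
              exact ((hD s' hss τ τ' h0 h0' h1 h1' h).trans (hM s' (Finset.mem_univ _))).trans
                (le_max_right _ _)
            · simp only [lamAfter, hss, if_false, sub_self, abs_zero]
              exact hM0.le.trans (le_max_right _ _))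
        have hpos : ∀ τ : Fin L ⊕ Fin r → ℝ, (∀ k, 0 < τ (Sum.inl k)) →
            0 < evalTL (Multiplicative.toAdd x.1) τ (lamAfter (rhoLast A ζ τ) s) := fun τ h1 =>
          evalTL_pos (fun k => by
            rcases k with k | k
            · exact Or.inl (h1 k)
            · exact Or.inr (hinr k)) (hl τ h1)
        rw [sol_lamAfter, sol_lamAfter, Real.exp_mul, ← Real.mul_rpow (Real.exp_pos _).le
          (hpos τ' h1').le]
        refine Real.rpow_le_rpow (hpos τ h1).le ?_ (by positivity)
        rw [← Real.exp_log (hpos τ h1), ← Real.exp_log (hpos τ' h1'), ← Real.exp_add,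
          Real.exp_le_exp]
        linarith [(abs_le.1 h2).2]
      choose! E hE using hx
      obtain ⟨M', hM'0, hM'⟩ := exists_upper_bound (stage A ζ s) E
      have hle : ∀ τ τ' : Fin L ⊕ Fin r → ℝ, (∀ k, 0 ≤ τ k) → (∀ k, 0 ≤ τ' k) →
          (∀ k, 0 < τ (Sum.inl k)) → (∀ k, 0 < τ' (Sum.inl k)) →
          (∀ k, |Real.log (τ (Sum.inl k)) - Real.log (τ' (Sum.inl k))| ≤ c) →
          rhoLast A ζ τ s ≤ Real.exp M' * rhoLast A ζ τ' s := by
        intro τ τ' h0 h0' h1 h1' h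
        rw [rhoLast_eq, rhoLast_eq (τ := τ'), rho, rho]
        split_ifs with hne
        · refine Finset.sup'_le _ _ fun x hx => ?_
          obtain ⟨hx1, hx2⟩ := Finset.mem_filter.1 hx
          refine (hE x hx1 hx2 τ τ' h0 h0' h1 h1' h).trans ?_
          have h3 : sol s x τ' (lamAfter (rhoLast A ζ τ') s) ≤
            ((stage A ζ s).filter fun x => lamExp s x < 0).sup' hne
              fun x => sol s x τ' (lamAfter (rhoLast A ζ τ') s) :=
            Finset.le_sup' (fun x => sol s x τ' (lamAfter (rhoLast A ζ τ') s)) hx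
          refine mul_le_mul (Real.exp_le_exp.2 (hM' x hx1)) h3 ?_ (Real.exp_pos _).le
          rw [sol_lamAfter]
          exact Real.rpow_nonneg (evalTL_lamAfter_nonneg h0' (hR τ' h1') _ _) _
        · rw [mul_one]; exact Real.one_le_exp hM'0.le
      refine ⟨M', hM'0, fun τ τ' h0 h0' h1 h1' h => abs_sub_le_iff.2 ⟨?_, ?_⟩⟩
      · have := Real.log_le_log (hR τ h1 s) (hle τ τ' h0 h0' h1 h1' h)
        rw [Real.log_mul (Real.exp_pos _).ne' (hR τ' h1' s).ne', Real.log_exp] at this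
        linarith
      · have := Real.log_le_log (hR τ' h1' s)
          (hle τ' τ h0' h0 h1' h1 fun k => by rw [abs_sub_comm]; exact h k)
        rw [Real.log_mul (Real.exp_pos _).ne' (hR τ h1 s).ne', Real.log_exp] at this
        linarith
  choose D hD0 hD using key
  obtain ⟨M, hM0, hM⟩ := exists_upper_bound Finset.univ D
  have hj : ∀ j : Fin L ⊕ Fin p, ∃ E, ∀ τ τ' : Fin L ⊕ Fin r → ℝ, (∀ k, 0 ≤ τ k) →
      (∀ k, 0 ≤ τ' k) → (∀ k, 0 < τ (Sum.inl k)) → (∀ k, 0 < τ' (Sum.inl k)) →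
      (∀ k, |Real.log (τ (Sum.inl k)) - Real.log (τ' (Sum.inl k))| ≤ c) →
      Real.log (level A ζ τ j) - Real.log (level A ζ τ' j) ≤ E := by
    rintro (j | s)
    · obtain ⟨C, -, hC⟩ := exists_evalTL_le_mul (phiInv A j) (phiInv_fst_inr j) (max c M)
      refine ⟨C, fun τ τ' h0 h0' h1 h1' h => (le_abs_self _).trans (hC τ τ' _ _ h1 h1' (hR τ h1)
        (hR τ' h1') (fun k => (h k).trans (le_max_left _ _)) fun s => ?_)⟩
      exact ((hD s τ τ' h0 h0' h1 h1' h).trans (hM s (Finset.mem_univ _))).trans (le_max_right _ _)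
    · exact ⟨D s, fun τ τ' h0 h0' h1 h1' h => (le_abs_self _).trans (hD s τ τ' h0 h0' h1 h1' h)⟩
  choose E hE using hj
  obtain ⟨M', hM'0, hM'⟩ := exists_upper_bound Finset.univ E
  refine ⟨Real.exp M', Real.exp_pos _, fun τ τ' h0 h0' h1 h1' h j => ?_⟩
  have h2 := (hE j τ τ' h0 h0' h1 h1' h).trans (hM' j (Finset.mem_univ _))
  rw [← Real.exp_log (level_pos hs h1 j), ← Real.exp_log (level_pos hs h1' j), ← Real.exp_add,
    Real.exp_le_exp]
  linarith

end LevelOnMulticone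

/-! ### Elementary geometry of multicones -/

section Geometry

variable {L p r : ℕ} {n : Option (Fin L ⊕ Fin r) → ℕ}
  {A : Matrix (Fin L ⊕ Fin p) (Fin L ⊕ Fin r) ℚ} {ζ : (k : Fin L ⊕ Fin r) → Fin (n (some k)) → ℂ}
  {H : Finset (PairT L r)} {V V' : (k : Fin L ⊕ Fin r) → Set (Fin (n (some k)) → ℂ)}
  {ε ε' : Radii L r}

lemma Admissible.expo_nonneg (hs : Admissible A ζ H) {h : PairT L r} (hh : h ∈ H)
    {k : Fin L ⊕ Fin r} (hk : ζ k = 0) : 0 ≤ Multiplicative.toAdd h.1 k :=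
  expo_inr_of_equivalent hs.ne_zero hs.equiv (Submonoid.subset_closure (Finset.mem_coe.2 hh)) hk

lemma expo_inr_eq_zero_of_mem_closure (hζ : ∀ k : Fin L, ζ (Sum.inl k) ≠ 0) {x : PairTL L p r}
    (hx : x ∈ Submonoid.closure (setG A ζ : Set (PairTL L p r))) (hx0 : x.2 ≠ 0) {k : Fin r}
    (hk : ζ (Sum.inr k) = 0) : (Multiplicative.toAdd x.1).1 (Sum.inr k) = 0 := by
  induction hx using Submonoid.closure_induction with
  | mem x hx =>
    rcases mem_setG.1 (Finset.mem_coe.1 hx) with ⟨j, rfl⟩ | ⟨k', rfl⟩ | ⟨s, rfl⟩ | ⟨k', h, rfl⟩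
    · exact absurd rfl hx0
    · rw [toAdd_ofAdd, psi_fst_inr, if_neg]
      rintro rfl
      exact hx0 ((nval_eq_zero_iff hζ _).2 hk)
    · exact absurd rfl hx0
    · rw [toAdd_ofAdd, Prod.fst_neg, Pi.neg_apply, psi_fst_inr, if_neg, neg_zero]
      rintro rfl
      exact h ((nval_eq_zero_iff hζ _).2 hk)
  | one => rfl
  | mul x y _ _ hx hy =>
    rw [Prod.snd_mul] at hx0
    simp [toAdd_mul, hx (left_ne_zero_of_mul hx0), hy (right_ne_zero_of_mul hx0)]

lemma Admissible.expo_eq_zero (hs : Admissible A ζ H) {h : PairT L r} (hh : h ∈ H) (h0 : h.2 ≠ 0)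
    {k : Fin L ⊕ Fin r} (hk : ζ k = 0) : Multiplicative.toAdd h.1 k = 0 := by
  obtain ⟨N₁, N₂, h1, h2, hsub, -⟩ := hs.equiv
  obtain ⟨g, hg, hgh⟩ := hsub ⟨h, Submonoid.subset_closure (Finset.mem_coe.2 hh), rfl⟩
  rcases k with k | k
  · exact absurd hk (hs.ne_zero k)
  · have hg0 : g.2 ≠ 0 := fun h' => by
      have := congrArg Prod.snd hgh
      simp only [Prod.pow_snd, h', zero_pow h2.ne'] at this
      exact h0 (pow_eq_zero_iff h1.ne' |>.1 this.symm)
    have h3 : Multiplicative.toAdd g.1 (Sum.inr k) = 0 :=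
      expo_inr_eq_zero_of_mem_closure hs.ne_zero hg hg0 hk
    have e : (N₂ : ℚ) * Multiplicative.toAdd g.1 (Sum.inr k)
        = N₁ * Multiplicative.toAdd h.1 (Sum.inr k) := by
      have := congrArg (fun y : PairT L r => Multiplicative.toAdd y.1 (Sum.inr k)) hgh
      simpa [toAdd_pow] using this
    rw [h3, mul_zero] at e
    rcases mul_eq_zero.1 e.symm with h4 | h4
    · exact absurd h4 (by exact_mod_cast h1.ne')
    · exact h4

/-- A monomial of `H` is continuous where the blocks in the cones do not vanish. -/
lemma continuousAt_evalT (hs : Admissible A ζ H) {h : PairT L r} (hh : h ∈ H)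
    {τ : Fin L ⊕ Fin r → ℝ} (hτ : ∀ k, ζ k ≠ 0 → τ k ≠ 0) : ContinuousAt (evalT h.1) τ := by
  refine tendsto_finsetProd _ fun k _ => ?_
  refine ContinuousAt.comp (f := fun τ : Fin L ⊕ Fin r → ℝ => τ k)
    (Real.continuousAt_rpow_const _ _ ?_) (continuous_apply k).continuousAt
  by_cases hk : ζ k = 0
  · exact Or.inr (by exact_mod_cast hs.expo_nonneg hh hk)
  · exact Or.inl (hτ k hk)

lemma isOpen_multicone (hs : Admissible A ζ H) (hV : IsConeAt ζ V) :
    IsOpen (multicone H V ε) := by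
  have hVo : ∀ k, IsOpen (V k) := fun k => by
    by_cases hk : ζ k = 0
    · rw [(hV k).2 hk]; exact isOpen_univ
    · exact ((hV k).1 hk).1
  rw [isOpen_iff_mem_nhds]
  intro z hz
  have h1 : ∀ᶠ w : Space n in 𝓝 z, ∀ k, w (some k) ∈ V k := by
    refine eventually_all.2 fun k => ?_
    exact (continuous_apply (some k)).continuousAt.eventually_mem ((hVo k).mem_nhds (hz.1 k))
  have h2 : ∀ᶠ w : Space n in 𝓝 z, ‖w none‖ < ε.eps0 :=
    (continuous_apply none).norm.continuousAt.eventually_lt continuousAt_const hz.2.1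
  have hb : ContinuousAt (fun w : Space n => blockNorm w) z :=
    continuousAt_pi.2 fun k => ((continuous_apply (some k)).norm).continuousAt
  have h3 : ∀ᶠ w : Space n in 𝓝 z, ∀ h ∈ H, (h.2 : ℝ) - ε.minus h < evalT h.1 (blockNorm w) ∧
      evalT h.1 (blockNorm w) < (h.2 : ℝ) + ε.plus h := by
    refine (Finset.eventually_all H).2 fun h hh => ?_
    have hc : ContinuousAt (fun w : Space n => evalT h.1 (blockNorm w)) z :=
      ContinuousAt.comp (f := fun w : Space n => blockNorm w)
        (continuousAt_evalT hs hh fun k hk => (blockNorm_pos hV hz hk).ne') hb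
    exact (continuousAt_const.eventually_lt hc (hz.2.2 h hh).1).and
      (hc.eventually_lt continuousAt_const (hz.2.2 h hh).2)
  filter_upwards [h1, h2, h3] with w hw1 hw2 hw3
  exact ⟨hw1, hw2, hw3⟩

/-- `φ_k(ρ_Λ(z))`, the size of the block `z^(k)`; it is `1` for the block `z^(0)`. -/
def blockSize (A : Matrix (Fin L ⊕ Fin p) (Fin L ⊕ Fin r) ℚ)
    (ζ : (k : Fin L ⊕ Fin r) → Fin (n (some k)) → ℂ) (z : Space n) :
    Option (Fin L ⊕ Fin r) → ℝ
  | none => 1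
  | some k => phiVal A (level A ζ (blockNorm z)) k

/-- The weight of a block with respect to the action `μ_j`. -/
def weight (A : Matrix (Fin L ⊕ Fin p) (Fin L ⊕ Fin r) ℚ) (j : Fin L ⊕ Fin p) :
    Option (Fin L ⊕ Fin r) → ℚ
  | none => 0
  | some k => A j k

lemma blockSize_eq (z : Space n) (b : Option (Fin L ⊕ Fin r)) :
    blockSize A ζ z b = ∏ j, level A ζ (blockNorm z) j ^ ((weight A j b : ℚ) : ℝ) := by
  cases b <;> simp [blockSize, weight, phiVal]

lemma level_pos_of_mem (hs : Admissible A ζ H) (hV : IsConeAt ζ V) {z : Space n}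
    (hz : z ∈ multicone H V ε) (j : Fin L ⊕ Fin p) : 0 < level A ζ (blockNorm z) j :=
  level_pos hs (blockNorm_inl_pos hs hV hz) j

lemma blockNorm_eq (hs : Admissible A ζ H) (hV : IsConeAt ζ V) {z : Space n}
    (hz : z ∈ multicone H V ε) (k : Fin L ⊕ Fin r) :
    blockNorm z k = ratio A (blockNorm z) k * phiVal A (level A ζ (blockNorm z)) k :=
  eq_ratio_mul_phiVal hs (blockNorm_nonneg z) (blockNorm_inl_pos hs hV hz) k

lemma exists_norm_le_blockSize (hs : Admissible A ζ H) (hV : IsConeAt ζ V) (ε : Radii L r) :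
    ∃ C, 0 < C ∧ ∀ z ∈ multicone H V ε, ∀ b, ‖z b‖ ≤ C * blockSize A ζ z b := by
  obtain ⟨C, hC1, hC⟩ := exists_level_bounds hs hV ε
  refine ⟨max C |ε.eps0|, lt_of_lt_of_le (by linarith) (le_max_left _ _), fun z hz b => ?_⟩
  rcases b with _ | k
  · rw [blockSize, mul_one]
    exact (hz.2.1.le.trans (le_abs_self _)).trans (le_max_right _ _)
  · have h1 := blockNorm_eq hs hV hz k
    rw [blockNorm] at h1
    rw [h1, blockSize]
    exact mul_le_mul_of_nonneg_right (((hC z hz).2.1 k).trans (le_max_left _ _))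
      (phiVal_pos (level_pos_of_mem hs hV hz) k).le

lemma isBounded_multicone (hs : Admissible A ζ H) (hV : IsConeAt ζ V) :
    Bornology.IsBounded (multicone H V ε) := by
  obtain ⟨C, hC1, hC⟩ := exists_level_bounds hs hV ε
  obtain ⟨D, hD0, hD⟩ := exists_norm_le_blockSize hs hV ε
  obtain ⟨M, hM0, hM⟩ := exists_upper_bound Finset.univ fun k => phiVal A (fun _ => C) k
  refine isBounded_iff_forall_norm_le.2 ⟨D * (max M 1), fun z hz => ?_⟩
  refine (pi_norm_le_iff_of_nonneg (by positivity)).2 fun b => (hD z hz b).trans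
    (mul_le_mul_of_nonneg_left ?_ hD0.le)
  rcases b with _ | k
  · exact le_max_right _ _
  · refine le_trans ?_ (le_max_left _ _)
    refine le_trans ?_ (hM k (Finset.mem_univ _))
    exact phiVal_mono hs.nonneg (fun j => (level_pos_of_mem hs hV hz j).le) (hC z hz).1 k

lemma ProperlyContained.subset (h : ProperlyContained H ζ V' ε' V ε) (hV : IsConeAt ζ V) :
    multicone H V' ε' ⊆ multicone H V ε := by
  obtain ⟨hV', -, hcl, h0, hε⟩ := h
  rintro z ⟨h1, h2, h3⟩
  refine ⟨fun k => ?_, h2.trans h0, fun h hh => ?_⟩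
  · by_cases hk : ζ k = 0
    · rw [(hV k).2 hk]; trivial
    · refine hcl k ⟨subset_closure (h1 k), fun h => ?_⟩
      rw [mem_singleton_iff] at h
      exact ((hV' k).1 hk).2.2.2.1 (h ▸ h1 k)
  · have := h3 h hh
    have := hε h hh
    constructor <;> linarith

/-- Membership in a multicone depends only on the norms of the blocks, and those which are not in a
proper cone may be shrunk. -/
lemma mem_multicone_of_norm_le (hs : Admissible A ζ H) (hV : IsConeAt ζ V) (hε : ε.Pos H)
    {z w : Space n} (hz : z ∈ multicone H V ε) (h0 : ‖w none‖ < ε.eps0)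
    (hcone : ∀ k, ζ k ≠ 0 → w (some k) ∈ V k ∧ ‖w (some k)‖ = ‖z (some k)‖)
    (hfree : ∀ k, ζ k = 0 → ‖w (some k)‖ ≤ ‖z (some k)‖) : w ∈ multicone H V ε := by
  refine ⟨fun k => ?_, h0, fun h hh => ⟨?_, ?_⟩⟩
  · by_cases hk : ζ k = 0
    · rw [(hV k).2 hk]; trivial
    · exact (hcone k hk).1
  · by_cases hv : h.2 = 0
    · have := evalT_nonneg h.1 (blockNorm_nonneg w)
      have := (hε.2 h hh).2
      rw [hv, NNReal.coe_zero]
      linarith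
    · have : evalT h.1 (blockNorm w) = evalT h.1 (blockNorm z) := by
        refine Finset.prod_congr rfl fun k _ => ?_
        by_cases hk : ζ k = 0
        · simp [hs.expo_eq_zero hh hv hk]
        · simp only [blockNorm, (hcone k hk).2]
      rw [this]
      exact (hz.2.2 h hh).1
  · refine lt_of_le_of_lt ?_ (hz.2.2 h hh).2
    refine Finset.prod_le_prod (fun k _ => Real.rpow_nonneg (blockNorm_nonneg w k) _) fun k _ => ?_
    by_cases hk : ζ k = 0
    · exact Real.rpow_le_rpow (blockNorm_nonneg w k) (hfree k hk)
        (by exact_mod_cast hs.expo_nonneg hh hk)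
    · simp only [blockNorm, (hcone k hk).2, le_refl]

/-- The action of the family `(μ_j)_j` on `X`. -/
def scaleAct (A : Matrix (Fin L ⊕ Fin p) (Fin L ⊕ Fin r) ℚ) (t : Fin L ⊕ Fin p → ℝ)
    (z : Space n) : Space n
  | none => z none
  | some k => phiVal A t k • z (some k)

lemma scaleAct_mem (hs : Admissible A ζ H) (hV : IsConeAt ζ V) (hε : ε.Pos H)
    {t : Fin L ⊕ Fin p → ℝ} (ht0 : ∀ j, 0 < t j) (ht1 : ∀ j, t j ≤ 1) {z : Space n}
    (hz : z ∈ multicone H V ε) : scaleAct A t z ∈ multicone H V ε := by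
  have hφ := phiVal_pos (A := A) ht0
  have hb : blockNorm (scaleAct A t z) = fun k => phiVal A t k * blockNorm z k := by
    funext k
    rw [blockNorm, scaleAct, norm_smul, Real.norm_of_nonneg (hφ k).le, blockNorm]
  refine ⟨fun k => ?_, hz.2.1, fun h hh => ?_⟩
  · by_cases hk : ζ k = 0
    · rw [(hV k).2 hk]; trivial
    · exact ((hV k).1 hk).2.2.1 _ (hφ k) _ (hz.1 k)
  · rw [hb, evalT_mul_arg _ (fun k => (hφ k).le) (blockNorm_nonneg z)]
    obtain ⟨q, hq0, hq1, hq⟩ := exists_evalT_phiVal hs.det hs.equiv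
      (Submonoid.subset_closure (Finset.mem_coe.2 hh))
    rw [hq t ht0]
    have h1 := hz.2.2 h hh
    have h2 := evalT_nonneg h.1 (blockNorm_nonneg z)
    by_cases hv : h.2 = 0
    · have h3 : ∏ j, t j ^ q j ≤ 1 := Finset.prod_le_one
        (fun j _ => Real.rpow_nonneg (ht0 j).le _)
        fun j _ => Real.rpow_le_one (ht0 j).le (ht1 j) (hq0 j)
      have h4 : 0 ≤ ∏ j, t j ^ q j := Finset.prod_nonneg fun j _ => Real.rpow_nonneg (ht0 j).le _
      have h5 := (hε.2 h hh).2
      rw [hv, NNReal.coe_zero] at h1 ⊢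
      constructor
      · have := mul_nonneg h4 h2
        linarith
      · have := mul_le_mul_of_nonneg_right h3 h2
        linarith
    · rw [hq1 hv]
      simpa using h1

end Geometry

/-! ### Shrinking cones and multicones -/

section Cones

/-- A compact subset of an open convex set has a convex open neighbourhood which is relatively
compact in the set. -/
lemma exists_convex_between {E : Type*} [NormedAddCommGroup E] [NormedSpace ℝ E]
    [FiniteDimensional ℝ E] {V K : Set E} (hVo : IsOpen V) (hVc : Convex ℝ V) (hK : IsCompact K)
    (hKV : K ⊆ V) : ∃ U D : Set E, IsOpen U ∧ Convex ℝ U ∧ IsCompact D ∧ Convex ℝ D ∧ K ⊆ U ∧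
      U ⊆ D ∧ D ⊆ V := by
  obtain ⟨δ, hδ, hδV⟩ := hK.exists_cthickening_subset_open hVo hKV
  obtain ⟨F, hFK, hFfin, hF⟩ := hK.finite_cover_balls hδ
  have hcomp : IsCompact (convexHull ℝ F) := hFfin.isCompact_convexHull ℝ
  refine ⟨thickening δ (convexHull ℝ F), cthickening δ (convexHull ℝ F), isOpen_thickening,
    (convex_convexHull ℝ F).thickening δ, hcomp.cthickening, (convex_convexHull ℝ F).cthickening δ,
    ?_, thickening_subset_cthickening _ _, ?_⟩
  · intro x hx
    obtain ⟨y, hy, hxy⟩ := mem_iUnion₂.1 (hF hx)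
    exact mem_thickening_iff.2 ⟨y, subset_convexHull ℝ F hy, hxy⟩
  · rw [hcomp.cthickening_eq_biUnion_closedBall hδ.le]
    intro x hx
    obtain ⟨y, hy, hxy⟩ := mem_iUnion₂.1 hx
    have hconv : Convex ℝ ((fun w => w + (x - y)) ⁻¹' V) := hVc.translate_preimage_left (x - y)
    have h1 : y ∈ (fun w => w + (x - y)) ⁻¹' V := by
      refine (convexHull_min (fun f hf => ?_) hconv :
        convexHull ℝ F ⊆ (fun w => w + (x - y)) ⁻¹' V) hy
      refine hδV (mem_cthickening_of_dist_le _ f _ _ (hFK hf) ?_)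
      rw [dist_eq_norm, add_sub_cancel_left, ← dist_eq_norm]
      exact hxy
    rwa [mem_preimage, add_sub_cancel] at h1

/-- A compact subset of an open convex proper cone lies in a properly smaller cone: the one over a
convex neighbourhood of its convex hull. -/
lemma exists_cone_between {E : Type*} [NormedAddCommGroup E] [NormedSpace ℝ E]
    [FiniteDimensional ℝ E] {V K : Set E} (hVo : IsOpen V) (hVc : Convex ℝ V)
    (hVs : ∀ t : ℝ, 0 < t → ∀ x ∈ V, t • x ∈ V) (hV0 : (0 : E) ∉ V) (hK : IsCompact K)
    (hKV : K ⊆ V) : ∃ W : Set E, IsOpen W ∧ Convex ℝ W ∧ (∀ t : ℝ, 0 < t → ∀ x ∈ W, t • x ∈ W) ∧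
      (0 : E) ∉ W ∧ K ⊆ W ∧ closure W \ {0} ⊆ V := by
  obtain ⟨U, D, hUo, hUc, hD, hDc, hKU, hUD, hDV⟩ := exists_convex_between hVo hVc hK hKV
  let W : Set E := {x | ∃ t : ℝ, 0 < t ∧ t • x ∈ U}
  have hWD : ∀ x ∈ W, ∃ t : ℝ, 0 < t ∧ t⁻¹ • x ∈ D := by
    rintro x ⟨t, ht, hx⟩
    exact ⟨t⁻¹, inv_pos.2 ht, by rw [inv_inv]; exact hUD hx⟩
  refine ⟨W, ?_, ?_, ?_, ?_, fun x hx => ⟨1, one_pos, by simpa using hKU hx⟩, ?_⟩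
  · rw [show W = ⋃ (t : ℝ) (_ : 0 < t), (fun x => t • x) ⁻¹' U by ext; simp [W]]
    exact isOpen_iUnion fun t => isOpen_iUnion fun _ => hUo.preimage (continuous_const_smul t)
  · rintro x ⟨t, ht, hx⟩ y ⟨s, hs, hy⟩ a b ha hb hab
    have hpos : 0 < a * s + b * t := by
      rcases ha.lt_or_eq with h | h
      · have := mul_pos h hs; have := mul_nonneg hb ht.le; linarith
      · have : b = 1 := by linarith
        rw [← h, this]; linarith
    refine ⟨s * t / (a * s + b * t), by positivity, ?_⟩
    have h1 := hUc hx hy (a := a * s / (a * s + b * t)) (b := b * t / (a * s + b * t))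
      (by positivity) (by positivity) (by field_simp)
    convert h1 using 1
    simp only [smul_add, smul_smul]
    congr 2 <;> ring
  · rintro c hc x ⟨t, ht, hx⟩
    exact ⟨t * c⁻¹, by positivity, by rwa [smul_smul, inv_mul_cancel_right₀ hc.ne']⟩
  · rintro ⟨t, ht, hx⟩
    rw [smul_zero] at hx
    exact hV0 (hDV (hUD hx))
  · rintro y ⟨hy, hy0⟩
    rcases D.eq_empty_or_nonempty with hDe | hDn
    · have : W = ∅ := by
        refine eq_empty_of_forall_notMem fun x hx => ?_
        obtain ⟨t, -, h⟩ := hWD x hx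
        rw [hDe] at h
        exact h
      rw [this, closure_empty] at hy
      exact hy.elim
    obtain ⟨d, hdD, hd⟩ := hD.exists_isMinOn hDn continuous_norm.continuousOn
    have hd0 : 0 < ‖d‖ := norm_pos_iff.2 fun h => hV0 (h ▸ hDV hdD)
    -- near `y`, the cone is the image of a compact set of dilations
    set T := (‖y‖ + 1) / ‖d‖ with hT
    have hcomp : IsCompact ((fun q : ℝ × E => q.1 • q.2) '' (Icc 0 T ×ˢ D)) :=
      (isCompact_Icc.prod hD).image (continuous_fst.smul continuous_snd)
    have hsub : W ∩ ball 0 (‖y‖ + 1) ⊆ (fun q : ℝ × E => q.1 • q.2) '' (Icc 0 T ×ˢ D) := by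
      rintro x ⟨hx, hxb⟩
      obtain ⟨t, ht, hxD⟩ := hWD x hx
      refine ⟨(t, t⁻¹ • x), ⟨⟨ht.le, ?_⟩, hxD⟩, by simp [smul_smul, ht.ne']⟩
      have h1 : ‖d‖ ≤ ‖t⁻¹ • x‖ := hd hxD
      rw [norm_smul, norm_inv, Real.norm_of_nonneg ht.le, ← div_eq_inv_mul, le_div_iff₀ ht] at h1
      rw [hT, le_div_iff₀ hd0]
      have := mem_ball_zero_iff.1 hxb
      nlinarith
    have hycl : y ∈ closure (W ∩ ball 0 (‖y‖ + 1)) :=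
      (isOpen_ball.closure_inter ⟨hy, mem_ball_zero_iff.2 (lt_add_one _)⟩)
    obtain ⟨⟨t, x⟩, ⟨ht, hx⟩, rfl⟩ := hcomp.isClosed.closure_subset_iff.2 hsub hycl
    have ht0 : t ≠ 0 := fun h => hy0 (by simp [h])
    exact hVs t (lt_of_le_of_ne ht.1 ht0.symm) x (hDV hx)

end Cones

section Exhaustion

variable {L p r : ℕ} {n : Option (Fin L ⊕ Fin r) → ℕ}
  {ζ : (k : Fin L ⊕ Fin r) → Fin (n (some k)) → ℂ}
  {H : Finset (PairT L r)} {V V' : (k : Fin L ⊕ Fin r) → Set (Fin (n (some k)) → ℂ)}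
  {ε ε' : Radii L r}

lemma exists_isConeAt_between (hV : IsConeAt ζ V)
    (K : (k : Fin L ⊕ Fin r) → Set (Fin (n (some k)) → ℂ))
    (hK : ∀ k, ζ k ≠ 0 → IsCompact (K k) ∧ K k ⊆ V k) :
    ∃ W : (k : Fin L ⊕ Fin r) → Set (Fin (n (some k)) → ℂ), IsConeAt ζ W ∧
      (∀ k, closure (W k) \ {0} ⊆ V k) ∧ ∀ k, K k ⊆ W k := by
  have h : ∀ k, ∃ W : Set (Fin (n (some k)) → ℂ),
      ((ζ k ≠ 0 → IsOpen W ∧ Convex ℝ W ∧ (∀ t : ℝ, 0 < t → ∀ x ∈ W, t • x ∈ W) ∧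
      0 ∉ W ∧ ζ k ∈ W) ∧ (ζ k = 0 → W = Set.univ)) ∧ closure W \ {0} ⊆ V k ∧ K k ⊆ W := by
    intro k
    by_cases hk : ζ k = 0
    · exact ⟨univ, ⟨fun h => absurd hk h, fun _ => rfl⟩, by rw [(hV k).2 hk]; exact subset_univ _,
        subset_univ _⟩
    · obtain ⟨h1, h2, h3, h4, h5⟩ := (hV k).1 hk
      obtain ⟨W, hW1, hW2, hW3, hW4, hW5, hW6⟩ := exists_cone_between h1 h2 h3 h4
        ((hK k hk).1.insert (ζ k)) (insert_subset h5 (hK k hk).2)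
      exact ⟨W, ⟨fun _ => ⟨hW1, hW2, hW3, hW4, hW5 (mem_insert _ _)⟩, fun h => absurd h hk⟩, hW6,
        (subset_insert _ _).trans hW5⟩
  choose W hW using h
  exact ⟨W, fun k => (hW k).1, fun k => (hW k).2.1, fun k => (hW k).2.2⟩

/-- Any two points of a multicone lie in a common properly contained one. -/
lemma exists_properlyContained_of_mem (hV : IsConeAt ζ V) (hε : ε.Pos H) {z w : Space n}
    (hz : z ∈ multicone H V ε) (hw : w ∈ multicone H V ε) :
    ∃ V' ε', ProperlyContained H ζ V' ε' V ε ∧ z ∈ multicone H V' ε' ∧ w ∈ multicone H V' ε' := by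
  obtain ⟨W, hW1, hW2, hW3⟩ := exists_isConeAt_between hV (fun k => {z (some k), w (some k)})
    fun k _ => ⟨(Set.toFinite _).isCompact, by
      rintro x (rfl | rfl)
      exacts [hz.1 k, hw.1 k]⟩
  let mid : ℝ → ℝ → ℝ → ℝ := fun a b e => (max 0 (max a b) + e) / 2
  have hmid : ∀ a b e, 0 < e → a < e → b < e → 0 < mid a b e ∧ mid a b e < e ∧ a < mid a b e ∧
      b < mid a b e := by
    intro a b e h0 ha hb
    have h1 : max 0 (max a b) < e := max_lt h0 (max_lt ha hb)
    have h2 : 0 ≤ max 0 (max a b) := le_max_left _ _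
    have h3 : a ≤ max 0 (max a b) := (le_max_left _ _).trans (le_max_right _ _)
    have h4 : b ≤ max 0 (max a b) := (le_max_right _ _).trans (le_max_right _ _)
    simp only [mid]
    refine ⟨?_, ?_, ?_, ?_⟩ <;> linarith
  let ε₁ : Radii L r :=
    { eps0 := mid ‖z none‖ ‖w none‖ ε.eps0
      plus := fun h => mid (evalT h.1 (blockNorm z) - h.2) (evalT h.1 (blockNorm w) - h.2) (ε.plus h)
      minus := fun h =>
        mid (h.2 - evalT h.1 (blockNorm z)) (h.2 - evalT h.1 (blockNorm w)) (ε.minus h) }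
  have h0 := hmid _ _ _ hε.1 hz.2.1 hw.2.1
  have hp := fun (h : PairT L r) (hh : h ∈ H) =>
    hmid (evalT h.1 (blockNorm z) - h.2) (evalT h.1 (blockNorm w) - h.2) (ε.plus h) (hε.2 h hh).1
      (by linarith [(hz.2.2 h hh).2]) (by linarith [(hw.2.2 h hh).2])
  have hm := fun (h : PairT L r) (hh : h ∈ H) =>
    hmid (h.2 - evalT h.1 (blockNorm z)) (h.2 - evalT h.1 (blockNorm w)) (ε.minus h) (hε.2 h hh).2
      (by linarith [(hz.2.2 h hh).1]) (by linarith [(hw.2.2 h hh).1])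
  refine ⟨W, ε₁, ⟨hW1, ⟨h0.1, fun h hh => ⟨(hp h hh).1, (hm h hh).1⟩⟩, hW2, h0.2.1,
    fun h hh => ⟨(hp h hh).2.1, (hm h hh).2.1⟩⟩, ⟨fun k => hW3 k (by simp), h0.2.2.1,
    fun h hh => ⟨?_, ?_⟩⟩, ⟨fun k => hW3 k (by simp), h0.2.2.2, fun h hh => ⟨?_, ?_⟩⟩⟩
  · linarith [(hm h hh).2.2.1]
  · linarith [(hp h hh).2.2.1]
  · linarith [(hm h hh).2.2.2]
  · linarith [(hp h hh).2.2.2]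

/-- The directions of a properly contained cone form a relatively compact set. -/
lemma isCompact_directions {k : Fin L ⊕ Fin r} (hcl : closure (V' k) \ {0} ⊆ V k) :
    IsCompact (closure (V' k) ∩ sphere 0 1) ∧ closure (V' k) ∩ sphere 0 1 ⊆ V k := by
  refine ⟨(isCompact_sphere _ _).inter_left isClosed_closure, fun x hx => hcl ⟨hx.1, fun h => ?_⟩⟩
  have := mem_sphere_zero_iff_norm.1 hx.2
  rw [mem_singleton_iff.1 h] at this
  simp at this

lemma exists_properlyContained_between (hV : IsConeAt ζ V)
    (hP : ProperlyContained H ζ V' ε' V ε) :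
    ∃ V₁ ε₁, ProperlyContained H ζ V' ε' V₁ ε₁ ∧ ProperlyContained H ζ V₁ ε₁ V ε := by
  obtain ⟨hV', hε', hcl, h0, hε⟩ := hP
  obtain ⟨W, hW1, hW2, hW3⟩ := exists_isConeAt_between hV (fun k => closure (V' k) ∩ sphere 0 1)
    fun k _ => isCompact_directions (hcl k)
  refine ⟨W, ⟨(ε'.eps0 + ε.eps0) / 2, fun h => (ε'.plus h + ε.plus h) / 2,
    fun h => (ε'.minus h + ε.minus h) / 2⟩, ⟨hV', hε', fun k x hx => ?_, ?_, fun h hh => ⟨?_, ?_⟩⟩,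
    ⟨hW1, ⟨?_, fun h hh => ⟨?_, ?_⟩⟩, hW2, ?_, fun h hh => ⟨?_, ?_⟩⟩⟩
  · by_cases hk : ζ k = 0
    · rw [(hW1 k).2 hk]; trivial
    · have hx0 : x ≠ 0 := fun h => hx.2 (by simp [h])
      have hn : 0 < ‖x‖ := norm_pos_iff.2 hx0
      have h1 : ‖x‖⁻¹ • x ∈ closure (V' k) := by
        have hc : Continuous fun y : Fin (n (some k)) → ℂ => ‖x‖⁻¹ • y := continuous_const_smul _
        exact map_mem_closure hc hx.1 fun y hy => ((hV' k).1 hk).2.2.1 _ (inv_pos.2 hn) y hy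
      have h2 : ‖x‖⁻¹ • x ∈ W k := hW3 k ⟨h1, by
        rw [mem_sphere_zero_iff_norm, norm_smul, norm_inv, norm_norm, inv_mul_cancel₀ hn.ne']⟩
      have := ((hW1 k).1 hk).2.2.1 _ hn _ h2
      rwa [smul_smul, mul_inv_cancel₀ hn.ne', one_smul] at this
  · simp only; linarith
  · simp only; linarith [hε h hh]
  · simp only; linarith [hε h hh]
  · simp only; linarith [hε'.1]
  · simp only; linarith [hε h hh, hε'.2 h hh]
  · simp only; linarith [hε h hh, hε'.2 h hh]
  · simp only; linarith
  · simp only; linarith [hε h hh]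
  · simp only; linarith [hε h hh]

end Exhaustion

/-! ### Polydiscs in multicones -/

lemma exists_pos_lower_bound {ι : Type*} (s : Finset ι) (f : ι → ℝ) (hf : ∀ i ∈ s, 0 < f i) :
    ∃ δ, 0 < δ ∧ ∀ i ∈ s, δ ≤ f i := by
  obtain ⟨M, hM0, hM⟩ := exists_upper_bound s fun i => (f i)⁻¹
  exact ⟨M⁻¹, inv_pos.2 hM0, fun i hi => inv_le_of_inv_le₀ (hf i hi) (hM i hi)⟩

section Polydisc

variable {L p r : ℕ} {n : Option (Fin L ⊕ Fin r) → ℕ}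
  {A : Matrix (Fin L ⊕ Fin p) (Fin L ⊕ Fin r) ℚ} {ζ : (k : Fin L ⊕ Fin r) → Fin (n (some k)) → ℂ}
  {H : Finset (PairT L r)} {V V' : (k : Fin L ⊕ Fin r) → Set (Fin (n (some k)) → ℂ)}
  {ε ε' : Radii L r}

/-- The distance from a point of a properly contained cone to the complement of the cone is at least
proportional to the norm of the point. -/
lemma exists_cone_margin (hV' : IsConeAt ζ V') (hV : IsConeAt ζ V) {k : Fin L ⊕ Fin r}
    (hk : ζ k ≠ 0) (hcl : closure (V' k) \ {0} ⊆ V k) :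
    ∃ d, 0 < d ∧ ∀ x ∈ V' k, ∀ y, ‖y - x‖ ≤ d * ‖x‖ → y ∈ V k := by
  obtain ⟨hK, hKV⟩ := isCompact_directions (V := V) hcl
  obtain ⟨d, hd, hdV⟩ := hK.exists_cthickening_subset_open ((hV k).1 hk).1 hKV
  refine ⟨d, hd, fun x hx y hy => ?_⟩
  have hx0 : x ≠ 0 := fun h => ((hV' k).1 hk).2.2.2.1 (h ▸ hx)
  have hn : 0 < ‖x‖ := norm_pos_iff.2 hx0
  have h1 : ‖x‖⁻¹ • x ∈ closure (V' k) ∩ sphere 0 1 :=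
    ⟨subset_closure (((hV' k).1 hk).2.2.1 _ (inv_pos.2 hn) x hx), by
      rw [mem_sphere_zero_iff_norm, norm_smul, norm_inv, norm_norm, inv_mul_cancel₀ hn.ne']⟩
  have h2 : ‖x‖⁻¹ • y ∈ V k := by
    refine hdV (mem_cthickening_of_dist_le _ _ _ _ h1 ?_)
    rw [dist_eq_norm, ← smul_sub, norm_smul, norm_inv, norm_norm, inv_mul_le_iff₀ hn, mul_comm]
    exact hy
  have := ((hV k).1 hk).2.2.1 _ hn _ h2
  rwa [smul_smul, mul_inv_cancel₀ hn.ne', one_smul] at this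

lemma evalT_eq_mul_ratio (hs : Admissible A ζ H) (h : PairT L r) (hV : IsConeAt ζ V)
    {z : Space n} (hz : z ∈ multicone H V ε) {τ : Fin L ⊕ Fin r → ℝ} (hτ : ∀ k, 0 ≤ τ k) :
    evalT h.1 τ = evalT h.1 (phiVal A (level A ζ (blockNorm z))) *
      evalT h.1 (fun k => τ k / phiVal A (level A ζ (blockNorm z)) k) := by
  have hφ := phiVal_pos (A := A) (level_pos_of_mem hs hV hz)
  rw [← evalT_mul_arg _ (fun k => (hφ k).le) fun k => div_nonneg (hτ k) (hφ k).le]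
  congr 1
  funext k
  rw [mul_div_cancel₀ _ (hφ k).ne']

/-- In terms of the quotients `|z^(k)| / φ_k(ρ_Λ(z))`, the monomials of `H` are uniformly continuous
on a multicone. -/
lemma exists_evalT_margin (hs : Admissible A ζ H) (hV : IsConeAt ζ V) (ε : Radii L r)
    {h : PairT L r} (hh : h ∈ H) {η : ℝ} (hη : 0 < η) :
    ∃ δ, 0 < δ ∧ ∀ z ∈ multicone H V ε, ∀ w : Space n,
      (∀ k, ‖w (some k) - z (some k)‖ ≤ δ * blockSize A ζ z (some k)) →
      |evalT h.1 (blockNorm w) - evalT h.1 (blockNorm z)| < η := by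
  obtain ⟨C, hC1, hC⟩ := exists_level_bounds hs hV ε
  have hC0 : 0 < C := by linarith
  obtain ⟨q, hq0, -, hq⟩ := exists_evalT_phiVal hs.det hs.equiv
    (Submonoid.subset_closure (Finset.mem_coe.2 hh))
  set M := ∏ j, C ^ q j with hM
  have hM0 : 0 < M := Finset.prod_pos fun j _ => Real.rpow_pos_of_pos hC0 _
  set B : Set (Fin L ⊕ Fin r → ℝ) :=
    Set.pi univ fun k => Icc (if ζ k = 0 then 0 else C⁻¹ / 2) (C + 1) with hB
  have hBc : IsCompact B := isCompact_univ_pi fun k => isCompact_Icc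
  have hcont : ContinuousOn (evalT h.1) B := fun τ hτ =>
    (continuousAt_evalT hs hh fun k hk => by
      have := (hτ k (mem_univ k)).1
      rw [if_neg hk] at this
      have : 0 < C⁻¹ := inv_pos.2 hC0
      linarith).continuousWithinAt
  obtain ⟨δ, hδ, hδu⟩ := Metric.uniformContinuousOn_iff.1
    (hBc.uniformContinuousOn_of_continuous hcont) (η / M) (div_pos hη hM0)
  refine ⟨min (δ / 2) (C⁻¹ / 2), lt_min (by linarith) (by positivity), fun z hz w hw => ?_⟩
  have hl := level_pos_of_mem hs hV hz
  set φ := phiVal A (level A ζ (blockNorm z)) with hφdef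
  have hφ : ∀ k, 0 < φ k := phiVal_pos hl
  have hy : (fun k => blockNorm z k / φ k) = ratio A (blockNorm z) := by
    funext k
    rw [div_eq_iff (hφ k).ne']
    exact blockNorm_eq hs hV hz k
  have hdist : ∀ k, |blockNorm w k / φ k - ratio A (blockNorm z) k| ≤ min (δ / 2) (C⁻¹ / 2) := by
    intro k
    rw [← hy, ← sub_div, abs_div, abs_of_pos (hφ k), div_le_iff₀ (hφ k)]
    exact (abs_norm_sub_norm_le _ _).trans (hw k)
  have hCinv : C⁻¹ ≤ 1 := inv_le_one_of_one_le₀ hC1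
  have hCinv0 : 0 < C⁻¹ := inv_pos.2 hC0
  have hzB : ratio A (blockNorm z) ∈ B := fun k _ => by
    refine ⟨?_, ((hC z hz).2.1 k).trans (by linarith)⟩
    split_ifs with hk
    · exact ratio_nonneg (blockNorm_nonneg z) k
    · exact le_trans (by linarith) ((hC z hz).2.2 k hk)
  have hwB : (fun k => blockNorm w k / φ k) ∈ B := fun k _ => by
    have h1 := abs_le.1 ((hdist k).trans (min_le_right _ _))
    refine ⟨?_, by linarith [(hC z hz).2.1 k]⟩
    split_ifs with hk
    · exact div_nonneg (blockNorm_nonneg w k) (hφ k).le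
    · have := (hC z hz).2.2 k hk
      linarith
  have hlt := hδu _ hwB _ hzB (lt_of_le_of_lt ((dist_pi_le_iff (by positivity)).2 fun k => by
    rw [Real.dist_eq]; exact (hdist k).trans (min_le_left _ _)) (by linarith : δ / 2 < δ))
  rw [Real.dist_eq, lt_div_iff₀ hM0] at hlt
  rw [evalT_eq_mul_ratio hs h hV hz (blockNorm_nonneg w),
    evalT_eq_mul_ratio hs h hV hz (blockNorm_nonneg z), ← hφdef, hy, ← mul_sub, abs_mul]
  refine lt_of_le_of_lt ?_ hlt
  rw [mul_comm]
  refine mul_le_mul_of_nonneg_left ?_ (abs_nonneg _)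
  rw [abs_of_nonneg (evalT_nonneg _ fun k => (hφ k).le), hφdef, hq _ hl]
  exact Finset.prod_le_prod (fun j _ => Real.rpow_nonneg (hl j).le _) fun j _ =>
    Real.rpow_le_rpow (hl j).le ((hC z hz).1 j) (hq0 j)

/-- Around each point of a properly contained multicone there is a polydisc, of radii proportional
to the sizes of the blocks, on which the level functions are comparable. -/
theorem exists_polydisc (hs : Admissible A ζ H) (hV : IsConeAt ζ V)
    (hP : ProperlyContained H ζ V' ε' V ε) : ∃ δ, 0 < δ ∧ ∃ C, 0 < C ∧
      ∀ z ∈ multicone H V' ε', ∀ w : Space n, (∀ b, ‖w b - z b‖ ≤ δ * blockSize A ζ z b) →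
        w ∈ multicone H V ε ∧ (∀ j, level A ζ (blockNorm w) j ≤ C * level A ζ (blockNorm z) j) ∧
          ∀ j, level A ζ (blockNorm z) j ≤ C * level A ζ (blockNorm w) j := by
  obtain ⟨hV', hε', hcl, h0, hε⟩ := hP
  obtain ⟨C, hC1, hC⟩ := exists_level_bounds hs hV' ε'
  have hC0 : 0 < C := by linarith
  obtain ⟨D, hD0, hD⟩ := exists_level_le_mul hs 1
  have hd : ∀ k, ∃ d, 0 < d ∧ (ζ k ≠ 0 → ∀ x ∈ V' k, ∀ y, ‖y - x‖ ≤ d * ‖x‖ → y ∈ V k) := by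
    intro k
    by_cases hk : ζ k = 0
    · exact ⟨1, one_pos, fun h => absurd hk h⟩
    · obtain ⟨d, hd0, hd⟩ := exists_cone_margin hV' hV hk (hcl k)
      exact ⟨d, hd0, fun _ => hd⟩
  choose d hd0 hd using hd
  obtain ⟨δ₁, hδ₁0, hδ₁⟩ := exists_pos_lower_bound Finset.univ d fun k _ => hd0 k
  have hg : ∀ h ∈ H, ∃ δ, 0 < δ ∧ ∀ z ∈ multicone H V' ε', ∀ w : Space n,
      (∀ k, ‖w (some k) - z (some k)‖ ≤ δ * blockSize A ζ z (some k)) →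
      |evalT h.1 (blockNorm w) - evalT h.1 (blockNorm z)|
        < min (ε.plus h - ε'.plus h) (ε.minus h - ε'.minus h) := fun h hh =>
    exists_evalT_margin hs hV' ε' hh (lt_min (sub_pos.2 (hε h hh).1) (sub_pos.2 (hε h hh).2))
  choose! g hg0 hg using hg
  obtain ⟨δ₂, hδ₂0, hδ₂⟩ := exists_pos_lower_bound H g hg0
  set δ := min (min (1 / 2) (ε.eps0 - ε'.eps0)) (min (δ₁ * C⁻¹) δ₂) with hδ
  have hδ0 : 0 < δ := lt_min (lt_min (by norm_num) (sub_pos.2 h0)) (lt_min (by positivity) hδ₂0)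
  have hδa : δ ≤ 1 / 2 := (min_le_left _ _).trans (min_le_left _ _)
  have hδb : δ ≤ ε.eps0 - ε'.eps0 := (min_le_left _ _).trans (min_le_right _ _)
  have hδc : δ ≤ δ₁ * C⁻¹ := (min_le_right _ _).trans (min_le_left _ _)
  have hδd : δ ≤ δ₂ := (min_le_right _ _).trans (min_le_right _ _)
  refine ⟨δ, hδ0, D, hD0, fun z hz w hw => ?_⟩
  have hl := level_pos_of_mem hs hV' hz
  have hφ : ∀ k, 0 < blockSize A ζ z (some k) := phiVal_pos hl
  have hmem : w ∈ multicone H V ε := by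
    refine ⟨fun k => ?_, ?_, fun h hh => ?_⟩
    · by_cases hk : ζ k = 0
      · rw [(hV k).2 hk]; trivial
      · refine hd k hk _ (hz.1 k) _ ((hw (some k)).trans ?_)
        have h1 := blockNorm_eq hs hV' hz k
        rw [blockNorm] at h1
        rw [h1, ← mul_assoc]
        refine mul_le_mul_of_nonneg_right (hδc.trans ?_) (hφ k).le
        exact mul_le_mul (hδ₁ k (Finset.mem_univ _)) ((hC z hz).2.2 k hk) (by positivity) (hd0 k).le
    · have h1 := hw none
      rw [blockSize, mul_one] at h1
      have h2 := norm_sub_norm_le (w none) (z none)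
      have h3 := hz.2.1
      linarith
    · have h1 := hg h hh z hz w fun k => (hw (some k)).trans
        (mul_le_mul_of_nonneg_right (hδd.trans (hδ₂ h hh)) (hφ k).le)
      have h2 := abs_lt.1 (h1.trans_le (min_le_left _ _))
      have h3 := abs_lt.1 (h1.trans_le (min_le_right _ _))
      have h4 := hz.2.2 h hh
      constructor <;> linarith
  have hzp := blockNorm_inl_pos hs hV' hz
  have hwp := blockNorm_inl_pos hs hV hmem
  have hlog : ∀ k, |Real.log (blockNorm w (Sum.inl k)) - Real.log (blockNorm z (Sum.inl k))| ≤ 1 := by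
    intro k
    have h1 : blockSize A ζ z (some (Sum.inl k)) = blockNorm z (Sum.inl k) := by
      have := blockNorm_eq hs hV' hz (Sum.inl k)
      rw [this, ratio, Sum.elim_inl, Pi.one_apply, one_mul]
      rfl
    have h2 := (abs_norm_sub_norm_le _ _).trans (hw (some (Sum.inl k)))
    rw [h1] at h2
    have h3 : |blockNorm w (Sum.inl k) - blockNorm z (Sum.inl k)| ≤ 1 / 2 * blockNorm z (Sum.inl k) :=
      h2.trans (mul_le_mul_of_nonneg_right hδa (hzp k).le)
    rw [abs_le] at h3
    rw [← Real.log_div (hwp k).ne' (hzp k).ne', abs_le]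
    have hq : 0 < blockNorm w (Sum.inl k) / blockNorm z (Sum.inl k) := div_pos (hwp k) (hzp k)
    constructor
    · have h4 := Real.one_sub_inv_le_log_of_pos hq
      have h5 : (blockNorm w (Sum.inl k) / blockNorm z (Sum.inl k))⁻¹ ≤ 2 := by
        rw [inv_div, div_le_iff₀ (hwp k)]; linarith
      linarith
    · have h4 := Real.log_le_sub_one_of_pos hq
      have h5 : blockNorm w (Sum.inl k) / blockNorm z (Sum.inl k) ≤ 3 / 2 := by
        rw [div_le_iff₀ (hzp k)]; linarith
      linarith
  exact ⟨hmem, hD _ _ (blockNorm_nonneg w) (blockNorm_nonneg z) hwp hzp hlog,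
    hD _ _ (blockNorm_nonneg z) (blockNorm_nonneg w) hzp hwp fun k => by
      rw [abs_sub_comm]; exact hlog k⟩

end Polydisc

/-! ### Quasi-convexity of multicones -/

section Paths

variable {L r : ℕ} {n : Option (Fin L ⊕ Fin r) → ℕ}

lemma Ctrl.trans {Ω : Set (Space n)} {x y w : Space n} {Λ Λ' : ℝ} (hΛ' : 0 ≤ Λ')
    (h : Ctrl Ω y x Λ) (h' : Ctrl Ω x w Λ') : Ctrl Ω y w (Λ + Λ') := by
  obtain ⟨Γ, hy, hx, hΓ, hb⟩ := h
  obtain ⟨Γ', hx', hw', hΓ', hb'⟩ := h'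
  refine ⟨Γ ∪ Γ', Or.inl hy, Or.inr hw', union_subset hΓ hΓ', fun f hf B hB hfB p hp => ?_⟩
  have h1 := hb f hf B hB fun p hp => hfB p (Or.inl hp)
  have h2 := hb' f hf B hB fun p hp => hfB p (Or.inr hp)
  rcases hp with hp | hp
  · exact (h1 p hp).trans (mul_le_mul_of_nonneg_left (by linarith) hB)
  · calc ‖f p - f y‖ ≤ ‖f p - f x‖ + ‖f x - f y‖ := norm_sub_le_norm_sub_add_norm_sub _ _ _
      _ ≤ B * Λ' + B * Λ := add_le_add (h2 p hp) (h1 x hx)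
      _ = B * (Λ + Λ') := by ring

lemma Ctrl.mono {Ω : Set (Space n)} {x y : Space n} {Λ Λ' : ℝ} (h : Ctrl Ω y x Λ) (hΛ : Λ ≤ Λ') :
    Ctrl Ω y x Λ' := by
  obtain ⟨Γ, hy, hx, hΓ, hb⟩ := h
  exact ⟨Γ, hy, hx, hΓ, fun f hf B hB hfB p hp => (hb f hf B hB hfB p hp).trans
    (mul_le_mul_of_nonneg_left hΛ hB)⟩

lemma ctrl_of_segment {Ω : Set (Space n)} (hΩ : IsOpen Ω) {x y : Space n}
    (h : segment ℝ y x ⊆ Ω) : Ctrl Ω y x ‖x - y‖ := by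
  refine ⟨segment ℝ y x, left_mem_segment _ _ _, right_mem_segment _ _ _, h,
    fun f hf B hB hfB p hp => ?_⟩
  refine (Convex.norm_image_sub_le_of_norm_fderiv_le (𝕜 := ℂ) (fun q hq =>
    hf.differentiableAt (hΩ.mem_nhds (h hq))) hfB (convex_segment y x)
    (left_mem_segment _ _ _) hp).trans (mul_le_mul_of_nonneg_left ?_ hB)
  obtain ⟨a, b, ha, hb, hab, rfl⟩ := hp
  have : a • y + b • x - y = b • (x - y) := by
    rw [smul_sub, show a = 1 - b by linarith, sub_smul, one_smul]; abel
  rw [this, norm_smul, Real.norm_of_nonneg hb]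
  exact mul_le_of_le_one_left (norm_nonneg _) (by linarith)

/-- A path whose increments are dominated by those of a continuous function `v` controls the
increments of holomorphic functions as a path of length `v 1 - v 0` does. -/
lemma ctrl_of_path {Ω : Set (Space n)} (hΩ : IsOpen Ω) (γ : ℝ → Space n) (v : ℝ → ℝ)
    (hv : ContinuousOn v (Icc 0 1)) (hγ : ∀ s ∈ Icc (0 : ℝ) 1, γ s ∈ Ω)
    (hγv : ∀ s ∈ Icc (0 : ℝ) 1, ∀ s' ∈ Icc (0 : ℝ) 1, s ≤ s' → ‖γ s' - γ s‖ ≤ v s' - v s) :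
    Ctrl Ω (γ 0) (γ 1) (v 1 - v 0) := by
  have h0 : (0 : ℝ) ∈ Icc (0 : ℝ) 1 := ⟨le_rfl, zero_le_one⟩
  have h1 : (1 : ℝ) ∈ Icc (0 : ℝ) 1 := ⟨zero_le_one, le_rfl⟩
  have hγc : ContinuousOn γ (Icc 0 1) := by
    intro s hs
    refine tendsto_iff_norm_sub_tendsto_zero.2 ?_
    have hvs : Tendsto (fun s' => |v s' - v s|) (𝓝[Icc 0 1] s) (𝓝 0) := by
      have : Tendsto (fun s' => |v s' - v s|) (𝓝[Icc 0 1] s) (𝓝 |v s - v s|) :=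
        ((hv s hs).sub continuousWithinAt_const).abs
      rwa [sub_self, abs_zero] at this
    refine squeeze_zero' (Eventually.of_forall fun _ => norm_nonneg _) ?_ hvs
    filter_upwards [self_mem_nhdsWithin] with s' hs'
    rcases le_total s s' with h | h
    · exact (hγv s hs s' hs' h).trans (le_abs_self _)
    · rw [norm_sub_rev, abs_sub_comm]
      exact (hγv s' hs' s hs h).trans (le_abs_self _)
  refine ⟨γ '' Icc 0 1, ⟨0, h0, rfl⟩, ⟨1, h1, rfl⟩, ?_, ?_⟩
  · rintro _ ⟨s, hs, rfl⟩
    exact hγ s hs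
  rintro f hf B hB hfB _ ⟨s, hs, rfl⟩
  have hmono : v s - v 0 ≤ v 1 - v 0 := by
    have := (norm_nonneg _).trans (hγv s hs 1 h1 hs.2)
    linarith
  refine le_trans ?_ (mul_le_mul_of_nonneg_left hmono hB)
  have hfc : ContinuousOn (fun s => f (γ s)) (Icc 0 1) := hf.continuousOn.comp hγc hγ
  have key : ∀ B', B < B' → ‖f (γ s) - f (γ 0)‖ ≤ B' * (v s - v 0) := by
    intro B' hB'
    have hsub : Icc (0 : ℝ) 1 ⊆ {s | ‖f (γ s) - f (γ 0)‖ ≤ B' * (v s - v 0)} := by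
      refine IsClosed.Icc_subset_of_forall_exists_gt ?_ (by simp) ?_
      · have hc : ContinuousOn (fun s => ‖f (γ s) - f (γ 0)‖ - B' * (v s - v 0)) (Icc 0 1) :=
          (hfc.sub continuousOn_const).norm.sub
            (continuousOn_const.mul (hv.sub continuousOn_const))
        have := hc.preimage_isClosed_of_isClosed isClosed_Icc (isClosed_Iic (a := (0 : ℝ)))
        convert this using 1
        ext s
        simp [and_comm]
      · rintro s ⟨hs, hs0, hs1⟩ y hy
        have hsI : s ∈ Icc (0 : ℝ) 1 := ⟨hs0, hs1.le⟩
        have hd := (hf.differentiableAt (hΩ.mem_nhds (hγ s hsI))).hasFDerivAt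
        have hev : ∀ᶠ w in 𝓝 (γ s), ‖f w - f (γ s)‖ ≤ B' * ‖w - γ s‖ := by
          have := hd.isLittleO.def (sub_pos.2 hB')
          filter_upwards [this] with w hw
          have h2 := (fderiv ℂ f (γ s)).le_of_opNorm_le (hfB _ ⟨s, hsI, rfl⟩) (w - γ s)
          have h3 := norm_add_le (f w - f (γ s) - fderiv ℂ f (γ s) (w - γ s))
            (fderiv ℂ f (γ s) (w - γ s))
          rw [sub_add_cancel] at h3
          linarith
        have hev' : ∀ᶠ s' in 𝓝[Ioc s (min y 1)] s, ‖f (γ s') - f (γ s)‖ ≤ B' * ‖γ s' - γ s‖ :=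
          ((hγc s hsI).mono fun t ht => ⟨hs0.trans ht.1.le, ht.2.trans (min_le_right _ _)⟩
            ).eventually hev
        have : (𝓝[Ioc s (min y 1)] s).NeBot := left_nhdsWithin_Ioc_neBot (lt_min hy hs1)
        obtain ⟨s', hs', hs'I⟩ := (hev'.and self_mem_nhdsWithin).exists
        have hs'1 : s' ∈ Icc (0 : ℝ) 1 := ⟨hs0.trans hs'I.1.le, hs'I.2.trans (min_le_right _ _)⟩
        refine ⟨s', ?_, hs'I.1, hs'I.2.trans (min_le_left _ _)⟩
        have hs2 : ‖f (γ s) - f (γ 0)‖ ≤ B' * (v s - v 0) := hs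
        have h4 := mul_le_mul_of_nonneg_left (hγv s hsI s' hs'1 hs'I.1.le) (hB.trans hB'.le)
        calc ‖f (γ s') - f (γ 0)‖ ≤ ‖f (γ s') - f (γ s)‖ + ‖f (γ s) - f (γ 0)‖ :=
              norm_sub_le_norm_sub_add_norm_sub _ _ _
          _ ≤ B' * (v s' - v s) + B' * (v s - v 0) := add_le_add (hs'.trans h4) hs2
          _ = B' * (v s' - v 0) := by ring
    exact hsub hs
  have hlim : Tendsto (fun B' => B' * (v s - v 0)) (𝓝[>] B) (𝓝 (B * (v s - v 0))) :=
    (tendsto_id.mul_const _).mono_left nhdsWithin_le_nhds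
  exact ge_of_tendsto hlim (eventually_nhdsWithin_of_forall key)

end Paths

/-- The map `a ↦ a / ‖a‖` is Lipschitz continuous away from `0`. -/
lemma norm_normalize_sub_le {E : Type*} [NormedAddCommGroup E] [NormedSpace ℝ E] {a b : E} {c : ℝ}
    (hc : 0 < c) (ha : c ≤ ‖a‖) (hb : 0 < ‖b‖) :
    ‖‖b‖⁻¹ • b - ‖a‖⁻¹ • a‖ ≤ 2 / c * ‖b - a‖ := by
  have ha0 : 0 < ‖a‖ := hc.trans_le ha
  have h1 : ‖b‖⁻¹ • b - ‖a‖⁻¹ • a = ‖a‖⁻¹ • (b - a) + (‖b‖⁻¹ - ‖a‖⁻¹) • b := by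
    rw [smul_sub, sub_smul]; abel
  have h2 : ‖(‖b‖⁻¹ - ‖a‖⁻¹) • b‖ ≤ ‖a‖⁻¹ * ‖b - a‖ := by
    rw [norm_smul, Real.norm_eq_abs, inv_sub_inv hb.ne' ha0.ne', abs_div,
      abs_of_pos (mul_pos hb ha0), div_mul_eq_mul_div, div_le_iff₀ (mul_pos hb ha0)]
    have := abs_norm_sub_norm_le a b
    rw [norm_sub_rev] at this
    calc |‖a‖ - ‖b‖| * ‖b‖ ≤ ‖b - a‖ * ‖b‖ := mul_le_mul_of_nonneg_right this hb.le
      _ = ‖a‖⁻¹ * ‖b - a‖ * (‖b‖ * ‖a‖) := by field_simp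
  rw [h1]
  refine (norm_add_le _ _).trans ?_
  rw [norm_smul, norm_inv, norm_norm]
  have h3 : ‖a‖⁻¹ ≤ c⁻¹ := inv_anti₀ hc ha
  calc _ ≤ ‖a‖⁻¹ * ‖b - a‖ + ‖a‖⁻¹ * ‖b - a‖ := by linarith
    _ = 2 * ‖a‖⁻¹ * ‖b - a‖ := by ring
    _ ≤ 2 * c⁻¹ * ‖b - a‖ := by gcongr
    _ = _ := by rw [div_eq_mul_inv]

lemma geom_lt {a b U s : ℝ} (ha : 0 ≤ a) (hb : 0 ≤ b) (haU : a < U) (hbU : b < U)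
    (hs : s ∈ Icc (0 : ℝ) 1) : a ^ (1 - s) * b ^ s < U := by
  have h0 : 0 ≤ max a b := ha.trans (le_max_left _ _)
  refine lt_of_le_of_lt ?_ (max_lt haU hbU)
  calc a ^ (1 - s) * b ^ s ≤ max a b ^ (1 - s) * max a b ^ s :=
        mul_le_mul (Real.rpow_le_rpow ha (le_max_left _ _) (by linarith [hs.2]))
          (Real.rpow_le_rpow hb (le_max_right _ _) hs.1) (Real.rpow_nonneg hb _)
          (Real.rpow_nonneg h0 _)
    _ = max a b := by rw [← Real.rpow_add' h0 (by norm_num), sub_add_cancel, Real.rpow_one]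

lemma lt_geom {a b l s : ℝ} (hl : 0 ≤ l) (ha : l < a) (hb : l < b) (hs : s ∈ Icc (0 : ℝ) 1) :
    l < a ^ (1 - s) * b ^ s := by
  have h0 : 0 ≤ min a b := hl.trans (lt_min ha hb).le
  refine lt_of_lt_of_le (lt_min ha hb) ?_
  calc min a b = min a b ^ (1 - s) * min a b ^ s := by
        rw [← Real.rpow_add' h0 (by norm_num), sub_add_cancel, Real.rpow_one]
    _ ≤ a ^ (1 - s) * b ^ s :=
        mul_le_mul (Real.rpow_le_rpow h0 (min_le_left _ _) (by linarith [hs.2]))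
          (Real.rpow_le_rpow h0 (min_le_right _ _) hs.1) (Real.rpow_nonneg h0 _)
          (Real.rpow_nonneg (hl.trans ha.le) _)

section QuasiConvex

variable {L p r : ℕ} {n : Option (Fin L ⊕ Fin r) → ℕ}
  {A : Matrix (Fin L ⊕ Fin p) (Fin L ⊕ Fin r) ℚ} {ζ : (k : Fin L ⊕ Fin r) → Fin (n (some k)) → ℂ}
  {H : Finset (PairT L r)} {V V' : (k : Fin L ⊕ Fin r) → Set (Fin (n (some k)) → ℂ)}
  {ε ε' : Radii L r}

/-- If the norms of the blocks are interpolated geometrically between those of two points of a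
multicone, which agree where `ζ^(k) = 0`, then the monomials of `H` stay in their intervals. -/
lemma mem_multicone_of_geom (hV : IsConeAt ζ V) {x y w : Space n} (hx : x ∈ multicone H V ε) (hy : y ∈ multicone H V ε) {s : ℝ}
    (hs01 : s ∈ Icc (0 : ℝ) 1) (h0 : ‖w none‖ < ε.eps0) (hw : ∀ k, ζ k ≠ 0 → w (some k) ∈ V k)
    (hnorm : ∀ k, ‖w (some k)‖ = ‖y (some k)‖ ^ (1 - s) * ‖x (some k)‖ ^ s) :
    w ∈ multicone H V ε := by
  have hgeo : ∀ h : PairT L r, evalT h.1 (blockNorm w)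
      = evalT h.1 (blockNorm y) ^ (1 - s) * evalT h.1 (blockNorm x) ^ s := by
    intro h
    simp only [evalT]
    rw [← Real.finsetProd_rpow _ _ fun k _ => Real.rpow_nonneg (blockNorm_nonneg y k) _,
      ← Real.finsetProd_rpow _ _ fun k _ => Real.rpow_nonneg (blockNorm_nonneg x k) _,
      ← Finset.prod_mul_distrib]
    refine Finset.prod_congr rfl fun k _ => ?_
    simp only [blockNorm]
    rw [hnorm, Real.mul_rpow (Real.rpow_nonneg (norm_nonneg _) _)
      (Real.rpow_nonneg (norm_nonneg _) _), ← Real.rpow_mul (norm_nonneg _),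
      ← Real.rpow_mul (norm_nonneg _), ← Real.rpow_mul (norm_nonneg _),
      ← Real.rpow_mul (norm_nonneg _), mul_comm (1 - s), mul_comm s]
  refine ⟨fun k => ?_, h0, fun h hh => ?_⟩
  · by_cases hk : ζ k = 0
    · rw [(hV k).2 hk]; trivial
    · exact hw k hk
  · rw [hgeo h]
    have h1 := hx.2.2 h hh
    have h2 := hy.2.2 h hh
    have e1 := evalT_nonneg h.1 (blockNorm_nonneg x)
    have e2 := evalT_nonneg h.1 (blockNorm_nonneg y)
    refine ⟨?_, geom_lt e2 e1 h2.2 h1.2 hs01⟩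
    rcases lt_or_ge ((h.2 : ℝ) - ε.minus h) 0 with hneg | hpos
    · exact hneg.trans_le (mul_nonneg (Real.rpow_nonneg e2 _) (Real.rpow_nonneg e1 _))
    · exact lt_geom hpos h2.1 h1.1 hs01

/-- Convex combinations of directions in a properly contained cone stay away from `0`. -/
lemma exists_pos_le_norm_convex {k : Fin L ⊕ Fin r} (hV : IsConeAt ζ V) (hk : ζ k ≠ 0)
    (hcl : closure (V' k) \ {0} ⊆ V k) : ∃ c, 0 < c ∧ ∀ u ∈ V' k, ∀ u' ∈ V' k, ‖u‖ = 1 → ‖u'‖ = 1 →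
      ∀ s ∈ Icc (0 : ℝ) 1, c ≤ ‖(1 - s) • u + s • u'‖ := by
  obtain ⟨hK, hKV⟩ := isCompact_directions (V := V) hcl
  obtain ⟨h1, h2, h3, h4, h5⟩ := (hV k).1 hk
  obtain ⟨U, D, -, -, hD, hDc, hKU, hUD, hDV⟩ := exists_convex_between h1 h2 hK hKV
  rcases D.eq_empty_or_nonempty with hDe | hDn
  · refine ⟨1, one_pos, fun u hu u' _ hu1 _ s _ => ?_⟩
    have := hUD (hKU ⟨subset_closure hu, mem_sphere_zero_iff_norm.2 hu1⟩)
    rw [hDe] at this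
    exact this.elim
  · obtain ⟨d, hdD, hd⟩ := hD.exists_isMinOn hDn continuous_norm.continuousOn
    refine ⟨‖d‖, norm_pos_iff.2 fun h => h4 (h ▸ hDV hdD), fun u hu u' hu' hu1 hu1' s hs => ?_⟩
    exact hd (hDc (hUD (hKU ⟨subset_closure hu, mem_sphere_zero_iff_norm.2 hu1⟩))
      (hUD (hKU ⟨subset_closure hu', mem_sphere_zero_iff_norm.2 hu1'⟩)) (by linarith [hs.2]) hs.1
      (by ring))

/-- `f` on the blocks with `ζ^(k) = 0`, `g` on the other blocks, and `a` for the block `z^(0)`. -/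
def blockGlue (ζ : (k : Fin L ⊕ Fin r) → Fin (n (some k)) → ℂ) (a : Fin (n none) → ℂ)
    (f g : (k : Fin L ⊕ Fin r) → Fin (n (some k)) → ℂ) : Space n
  | none => a
  | some k => open Classical in if ζ k = 0 then f k else g k

lemma blockGlue_free {a : Fin (n none) → ℂ} {f g : (k : Fin L ⊕ Fin r) → Fin (n (some k)) → ℂ}
    {k : Fin L ⊕ Fin r} (hk : ζ k = 0) : blockGlue ζ a f g (some k) = f k := if_pos hk

lemma blockGlue_cone {a : Fin (n none) → ℂ} {f g : (k : Fin L ⊕ Fin r) → Fin (n (some k)) → ℂ}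
    {k : Fin L ⊕ Fin r} (hk : ζ k ≠ 0) : blockGlue ζ a f g (some k) = g k := if_neg hk

lemma norm_space_le {C : ℝ} (hC : 0 ≤ C) {z : Space n} (h0 : ‖z none‖ ≤ C)
    (h : ∀ k, ‖z (some k)‖ ≤ C) : ‖z‖ ≤ C :=
  (pi_norm_le_iff_of_nonneg hC).2 fun b => by
    rcases b with _ | k
    exacts [h0, h k]

/-- Two points of a properly contained multicone are joined in it by a path of length comparable to
their distance: the blocks with `ζ^(k) = 0` are moved while their norms do not increase, then the
directions of the other blocks are turned at constant norms, then the norms of these blocks are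
interpolated geometrically, and finally the blocks with `ζ^(k) = 0` are expanded. -/
theorem exists_ctrl_multicone (hs : Admissible A ζ H) (hV : IsConeAt ζ V)
    (hP : ProperlyContained H ζ V' ε' V ε) :
    ∃ C, ∀ x ∈ multicone H V' ε', ∀ y ∈ multicone H V' ε',
      Ctrl (multicone H V' ε') y x (C * ‖x - y‖) := by
  obtain ⟨hV', hε', hcl, -, -⟩ := hP
  have hopen : IsOpen (multicone H V' ε') := isOpen_multicone hs hV'
  have hc : ∀ k, ∃ c, 0 < c ∧ (ζ k ≠ 0 → ∀ u ∈ V' k, ∀ u' ∈ V' k, ‖u‖ = 1 → ‖u'‖ = 1 →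
      ∀ s ∈ Icc (0 : ℝ) 1, c ≤ ‖(1 - s) • u + s • u'‖) := fun k => by
    by_cases hk : ζ k = 0
    · exact ⟨1, one_pos, fun h => absurd hk h⟩
    · obtain ⟨c, hc0, hc⟩ := exists_pos_le_norm_convex hV hk (hcl k)
      exact ⟨c, hc0, fun _ => hc⟩
  choose c' hc'0 hc' using hc
  obtain ⟨c, hc0, hcle⟩ := exists_pos_lower_bound Finset.univ c' fun k _ => hc'0 k
  refine ⟨2 + 4 / c + (L + r) + 1, fun x hx y hy => ?_⟩
  set d := ‖x - y‖ with hd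
  have hd0 : 0 ≤ d := norm_nonneg _
  have hdb : ∀ b, ‖x b - y b‖ ≤ d := fun b => norm_le_pi_norm (x - y) b
  have hdn : ∀ b, |‖x b‖ - ‖y b‖| ≤ d := fun b => (abs_norm_sub_norm_le _ _).trans (hdb b)
  have hxp : ∀ k, ζ k ≠ 0 → 0 < ‖x (some k)‖ := fun k hk => blockNorm_pos hV' hx hk
  have hyp : ∀ k, ζ k ≠ 0 → 0 < ‖y (some k)‖ := fun k hk => blockNorm_pos hV' hy hk
  -- the free blocks of `x`, shrunk to the norms of those of `y` if these are smaller
  set m : Fin L ⊕ Fin r → ℝ := fun k => min ‖x (some k)‖ ‖y (some k)‖ with hm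
  have hm0 : ∀ k, 0 ≤ m k := fun k => le_min (norm_nonneg _) (norm_nonneg _)
  set fx : (k : Fin L ⊕ Fin r) → Fin (n (some k)) → ℂ :=
    fun k => (m k / ‖x (some k)‖) • x (some k) with hfx
  have hfxn : ∀ k, ‖fx k‖ = m k := fun k => by
    rw [hfx, norm_smul, Real.norm_of_nonneg (div_nonneg (hm0 k) (norm_nonneg _))]
    rcases (norm_nonneg (x (some k))).eq_or_lt with h | h
    · rw [← h, mul_zero]
      exact le_antisymm (hm0 k) ((min_le_left _ _).trans h.ge)
    · rw [div_mul_cancel₀ _ h.ne']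
  have hfxx : ∀ k, ‖x (some k) - fx k‖ ≤ d := fun k => by
    rcases (norm_nonneg (x (some k))).eq_or_lt with h | h
    · have : x (some k) = 0 := norm_eq_zero.1 h.symm
      rw [hfx]
      simpa [this] using hd0
    · have e : x (some k) - fx k = (1 - m k / ‖x (some k)‖) • x (some k) := by
        rw [sub_smul, one_smul]
      have h1 : m k / ‖x (some k)‖ ≤ 1 := (div_le_one h).2 (min_le_left _ _)
      rw [e, norm_smul, Real.norm_of_nonneg (by linarith), sub_mul, one_mul, div_mul_cancel₀ _ h.ne']
      rcases le_total ‖x (some k)‖ ‖y (some k)‖ with h2 | h2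
      · rw [hm]; simp only [min_eq_left h2]; linarith
      · rw [hm]; simp only [min_eq_right h2]; exact (le_abs_self _).trans (hdn _)
  -- the intermediate points
  set y2 : Space n := blockGlue ζ (x none) fx fun k => y (some k) with hy2
  set u : (k : Fin L ⊕ Fin r) → Fin (n (some k)) → ℂ :=
    fun k => ‖y (some k)‖⁻¹ • y (some k) with hu
  set u' : (k : Fin L ⊕ Fin r) → Fin (n (some k)) → ℂ :=
    fun k => ‖x (some k)‖⁻¹ • x (some k) with hu'
  have hu1 : ∀ k, ζ k ≠ 0 → ‖u k‖ = 1 := fun k hk => by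
    rw [hu, norm_smul, norm_inv, norm_norm, inv_mul_cancel₀ (hyp k hk).ne']
  have hu1' : ∀ k, ζ k ≠ 0 → ‖u' k‖ = 1 := fun k hk => by
    rw [hu', norm_smul, norm_inv, norm_norm, inv_mul_cancel₀ (hxp k hk).ne']
  have huV : ∀ k, ζ k ≠ 0 → u k ∈ V' k := fun k hk =>
    ((hV' k).1 hk).2.2.1 _ (inv_pos.2 (hyp k hk)) _ (hy.1 k)
  have huV' : ∀ k, ζ k ≠ 0 → u' k ∈ V' k := fun k hk =>
    ((hV' k).1 hk).2.2.1 _ (inv_pos.2 (hxp k hk)) _ (hx.1 k)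
  have hyu : ∀ k, ζ k ≠ 0 → ‖y (some k)‖ • u k = y (some k) := fun k hk => by
    rw [hu, smul_smul, mul_inv_cancel₀ (hyp k hk).ne', one_smul]
  have hxu : ∀ k, ζ k ≠ 0 → ‖x (some k)‖ • u' k = x (some k) := fun k hk => by
    rw [hu', smul_smul, mul_inv_cancel₀ (hxp k hk).ne', one_smul]
  set y3 : Space n := blockGlue ζ (x none) fx fun k => ‖y (some k)‖ • u' k with hy3
  set x1 : Space n := blockGlue ζ (x none) fx fun k => x (some k) with hx1
  have hy3mem : y3 ∈ multicone H V' ε' := by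
    refine mem_multicone_of_norm_le hs hV' hε' hy hx.2.1 (fun k hk => ?_) fun k hk => ?_
    · rw [hy3, blockGlue_cone hk]
      refine ⟨((hV' k).1 hk).2.2.1 _ (hyp k hk) _ (huV' k hk), ?_⟩
      rw [norm_smul, norm_norm, hu1' k hk, mul_one]
    · rw [hy3, blockGlue_free hk, hfxn]; exact min_le_right _ _
  have hx1mem : x1 ∈ multicone H V' ε' := by
    refine mem_multicone_of_norm_le hs hV' hε' hx hx.2.1 (fun k hk => ?_) fun k hk => ?_
    · rw [hx1, blockGlue_cone hk]
      exact ⟨hx.1 k, rfl⟩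
    · rw [hx1, blockGlue_free hk, hfxn]; exact min_le_left _ _
  -- moving the free blocks
  have step1 : Ctrl (multicone H V' ε') y y2 (2 * d) := by
    refine (ctrl_of_segment hopen ?_).mono (norm_space_le (by linarith) ?_ fun k => ?_)
    · rintro w ⟨a, b, ha, hb, hab, rfl⟩
      refine mem_multicone_of_norm_le hs hV' hε' hy ?_ (fun k hk => ?_) fun k hk => ?_
      · have : a • y none + b • x none ∈ ball (0 : Fin (n none) → ℂ) ε'.eps0 :=
          (convex_ball _ _) (mem_ball_zero_iff.2 hy.2.1) (mem_ball_zero_iff.2 hx.2.1) ha hb hab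
        exact mem_ball_zero_iff.1 this
      · have : (a • y + b • y2) (some k) = y (some k) := by
          rw [Pi.add_apply, Pi.smul_apply, Pi.smul_apply, hy2, blockGlue_cone hk, ← add_smul, hab,
            one_smul]
        rw [this]
        exact ⟨hy.1 k, rfl⟩
      · rw [Pi.add_apply, Pi.smul_apply, Pi.smul_apply, hy2, blockGlue_free hk]
        refine (norm_add_le _ _).trans ?_
        rw [norm_smul, norm_smul, Real.norm_of_nonneg ha, Real.norm_of_nonneg hb, hfxn]
        have h1 : b * m k ≤ b * ‖y (some k)‖ := mul_le_mul_of_nonneg_left (min_le_right _ _) hb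
        calc _ ≤ a * ‖y (some k)‖ + b * ‖y (some k)‖ := by linarith
          _ = ‖y (some k)‖ := by rw [← add_mul, hab, one_mul]
    · exact (hdb none).trans (by linarith)
    · rw [Pi.sub_apply]
      by_cases hk : ζ k = 0
      · rw [hy2, blockGlue_free hk]
        calc ‖fx k - y (some k)‖ ≤ ‖fx k - x (some k)‖ + ‖x (some k) - y (some k)‖ :=
              norm_sub_le_norm_sub_add_norm_sub _ _ _
          _ ≤ d + d := add_le_add (by rw [norm_sub_rev]; exact hfxx k) (hdb _)
          _ = 2 * d := by ring
      · rw [hy2, blockGlue_cone hk, sub_self, norm_zero]; linarith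
  -- turning the directions
  have step2 : Ctrl (multicone H V' ε') y2 y3 (4 / c * d) := by
    set w : ℝ → (k : Fin L ⊕ Fin r) → Fin (n (some k)) → ℂ :=
      fun s k => (1 - s) • u k + s • u' k with hw
    set γ : ℝ → Space n := fun s => blockGlue ζ (x none) fx
      fun k => ‖y (some k)‖ • (‖w s k‖⁻¹ • w s k) with hγ
    have hwc : ∀ k, ζ k ≠ 0 → ∀ s ∈ Icc (0 : ℝ) 1, c ≤ ‖w s k‖ := fun k hk s hs =>
      (hcle k (Finset.mem_univ _)).trans
        (hc' k hk _ (huV k hk) _ (huV' k hk) (hu1 k hk) (hu1' k hk) s hs)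
    have h0 : γ 0 = y2 := by
      funext b
      rcases b with _ | k
      · rfl
      · by_cases hk : ζ k = 0
        · simp only [hγ, hy2]
          rw [blockGlue_free hk, blockGlue_free hk]
        · have : w 0 k = u k := by simp [hw]
          simp only [hγ, hy2]
          rw [blockGlue_cone hk, blockGlue_cone hk, this, hu1 k hk, inv_one, one_smul, hyu k hk]
    have h1 : γ 1 = y3 := by
      funext b
      rcases b with _ | k
      · rfl
      · by_cases hk : ζ k = 0
        · simp only [hγ, hy3]
          rw [blockGlue_free hk, blockGlue_free hk]
        · have : w 1 k = u' k := by simp [hw]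
          simp only [hγ, hy3]
          rw [blockGlue_cone hk, blockGlue_cone hk, this, hu1' k hk, inv_one, one_smul]
    have := ctrl_of_path hopen γ (fun s => 4 / c * d * s) (by fun_prop) ?_ ?_
    · rw [h0, h1] at this
      simpa using this
    · intro s hs01
      refine mem_multicone_of_norm_le hs hV' hε' hy hx.2.1 (fun k hk => ?_) fun k hk => ?_
      · have hwp : 0 < ‖w s k‖ := hc0.trans_le (hwc k hk s hs01)
        simp only [hγ]
        rw [blockGlue_cone hk]
        refine ⟨?_, ?_⟩
        · refine ((hV' k).1 hk).2.2.1 _ (hyp k hk) _ (((hV' k).1 hk).2.2.1 _ (inv_pos.2 hwp) _ ?_)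
          exact ((hV' k).1 hk).2.1 (huV k hk) (huV' k hk) (by linarith [hs01.2]) hs01.1 (by ring)
        · rw [norm_smul, norm_smul, norm_inv, norm_norm, norm_norm, inv_mul_cancel₀ hwp.ne', mul_one]
      · simp only [hγ]
        rw [blockGlue_free hk, hfxn]; exact min_le_right _ _
    · intro s hs0 s' hs1 hss
      have hnn : 0 ≤ 4 / c * d * s' - 4 / c * d * s := by
        rw [← mul_sub]
        exact mul_nonneg (mul_nonneg (by positivity) hd0) (by linarith)
      refine norm_space_le hnn ?_ fun k => ?_
      · simpa [hγ, blockGlue] using hnn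
      · by_cases hk : ζ k = 0
        · simp only [hγ, Pi.sub_apply]
          rw [blockGlue_free hk, blockGlue_free hk, sub_self, norm_zero]
          exact hnn
        · simp only [hγ, Pi.sub_apply]
          rw [blockGlue_cone hk, blockGlue_cone hk, ← smul_sub, norm_smul, norm_norm]
          have e1 := norm_normalize_sub_le hc0 (hwc k hk s hs0) (hc0.trans_le (hwc k hk s' hs1))
          have e2 : w s' k - w s k = (s' - s) • (u' k - u k) := by
            simp only [hw, sub_smul, smul_sub, one_smul]; abel
          rw [e2, norm_smul, Real.norm_of_nonneg (by linarith : 0 ≤ s' - s)] at e1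
          have e3 : ‖y (some k)‖ * ‖u' k - u k‖ ≤ 2 * d := by
            have e4 : ‖y (some k)‖ • (u' k - u k)
                = (‖y (some k)‖ - ‖x (some k)‖) • u' k + (x (some k) - y (some k)) := by
              rw [smul_sub, hyu k hk, sub_smul, hxu k hk]; abel
            have e5 : ‖y (some k)‖ * ‖u' k - u k‖ = ‖‖y (some k)‖ • (u' k - u k)‖ := by
              rw [norm_smul, norm_norm]
            rw [e5, e4]
            refine (norm_add_le _ _).trans ?_
            rw [norm_smul, hu1' k hk, mul_one, Real.norm_eq_abs, abs_sub_comm]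
            linarith [hdn (some k), hdb (some k)]
          calc _ ≤ ‖y (some k)‖ * (2 / c * ((s' - s) * ‖u' k - u k‖)) :=
                mul_le_mul_of_nonneg_left e1 (norm_nonneg _)
            _ = 2 / c * (s' - s) * (‖y (some k)‖ * ‖u' k - u k‖) := by ring
            _ ≤ 2 / c * (s' - s) * (2 * d) :=
                mul_le_mul_of_nonneg_left e3 (mul_nonneg (by positivity) (by linarith))
            _ = _ := by ring
  -- interpolating the norms
  have step3 : Ctrl (multicone H V' ε') y3 x1 ((L + r) * d) := by
    set N : Fin L ⊕ Fin r → ℝ → ℝ :=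
      fun k s => ‖y (some k)‖ * (‖x (some k)‖ / ‖y (some k)‖) ^ s with hN
    set sg : Fin L ⊕ Fin r → ℝ := fun k => open Classical in
      if ζ k = 0 then 0 else if ‖y (some k)‖ ≤ ‖x (some k)‖ then 1 else -1 with hsg
    have hN0 : ∀ k, N k 0 = ‖y (some k)‖ := fun k => by simp [hN]
    have hN1 : ∀ k, ζ k ≠ 0 → N k 1 = ‖x (some k)‖ := fun k hk => by
      simp only [hN]
      rw [Real.rpow_one, mul_div_cancel₀ _ (hyp k hk).ne']
    have hNm : ∀ k, ζ k ≠ 0 → ∀ s s' : ℝ, s ≤ s' → |N k s' - N k s| = sg k * (N k s' - N k s) := by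
      intro k hk s s' hss
      have hq : 0 < ‖x (some k)‖ / ‖y (some k)‖ := div_pos (hxp k hk) (hyp k hk)
      simp only [hsg, if_neg hk]
      split_ifs with hle
      · rw [one_mul, abs_of_nonneg]
        have := Real.rpow_le_rpow_of_exponent_le ((one_le_div (hyp k hk)).2 hle) hss
        have := mul_le_mul_of_nonneg_left this (hyp k hk).le
        simp only [hN]; linarith
      · rw [neg_one_mul, abs_of_nonpos]
        have := Real.rpow_le_rpow_of_exponent_ge hq ((div_le_one (hyp k hk)).2 (not_le.1 hle).le) hss
        have := mul_le_mul_of_nonneg_left this (hyp k hk).le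
        simp only [hN]; linarith
    have hterm : ∀ k, ∀ s s' : ℝ, s ≤ s' → 0 ≤ sg k * (N k s' - N k s) := by
      intro k s s' hss
      by_cases hk : ζ k = 0
      · simp [hsg, hk]
      · rw [← hNm k hk s s' hss]; exact abs_nonneg _
    have hNpos : ∀ k, ζ k ≠ 0 → ∀ s, 0 < N k s := fun k hk s =>
      mul_pos (hyp k hk) (Real.rpow_pos_of_pos (div_pos (hxp k hk) (hyp k hk)) _)
    set γ : ℝ → Space n := fun s => blockGlue ζ (x none) fx fun k => N k s • u' k with hγ
    have h0 : γ 0 = y3 := by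
      simp only [hγ, hN0]
      rfl
    have h1 : γ 1 = x1 := by
      funext b
      rcases b with _ | k
      · rfl
      · by_cases hk : ζ k = 0
        · simp only [hγ, hx1]
          rw [blockGlue_free hk, blockGlue_free hk]
        · simp only [hγ, hx1]
          rw [blockGlue_cone hk, blockGlue_cone hk, hN1 k hk, hxu k hk]
    have := ctrl_of_path hopen γ (fun s => ∑ k, sg k * N k s) ?_ ?_ ?_
    · rw [h0, h1] at this
      refine this.mono ?_
      rw [← Finset.sum_sub_distrib]
      calc ∑ k, (sg k * N k 1 - sg k * N k 0) ≤ ∑ _k : Fin L ⊕ Fin r, d := by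
            refine Finset.sum_le_sum fun k _ => ?_
            rw [← mul_sub]
            by_cases hk : ζ k = 0
            · simpa [hsg, hk] using hd0
            · rw [← hNm k hk 0 1 zero_le_one, hN0, hN1 k hk]
              exact hdn _
        _ = (L + r) * d := by simp
    · refine continuousOn_finsetSum _ fun k _ => ?_
      by_cases hk : ζ k = 0
      · simpa [hsg, hk] using continuousOn_const
      · exact (continuousOn_const.mul <| continuousOn_const.mul
          (Real.continuous_const_rpow (div_pos (hxp k hk) (hyp k hk)).ne').continuousOn)
    · intro s hs01
      refine mem_multicone_of_geom hV' hx1mem hy3mem hs01 hx.2.1 (fun k hk => ?_) fun k => ?_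
      · simp only [hγ]
        rw [blockGlue_cone hk]
        exact ((hV' k).1 hk).2.2.1 _ (hNpos k hk s) _ (huV' k hk)
      · by_cases hk : ζ k = 0
        · simp only [hγ, hy3, hx1]
          rw [blockGlue_free hk, blockGlue_free hk, blockGlue_free hk, hfxn,
            ← Real.rpow_add' (hm0 k) (by norm_num), sub_add_cancel, Real.rpow_one]
        · simp only [hγ, hy3, hx1]
          have e1 : ‖N k s • u' k‖ = N k s := by
            rw [norm_smul, hu1' k hk, mul_one, Real.norm_of_nonneg (hNpos k hk s).le]
          have e2 : ‖‖y (some k)‖ • u' k‖ = ‖y (some k)‖ := by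
            rw [norm_smul, hu1' k hk, mul_one, norm_norm]
          rw [blockGlue_cone hk, blockGlue_cone hk, blockGlue_cone hk, e1, e2]
          simp only [hN]
          rw [Real.div_rpow (hxp k hk).le (hyp k hk).le, Real.rpow_sub (hyp k hk), Real.rpow_one]
          ring
    · intro s hs0 s' hs1 hss
      rw [← Finset.sum_sub_distrib]
      simp only [← mul_sub]
      have hnn : 0 ≤ ∑ k, sg k * (N k s' - N k s) := Finset.sum_nonneg fun k _ => hterm k s s' hss
      refine norm_space_le hnn ?_ fun k => ?_
      · simpa [hγ, blockGlue] using hnn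
      · by_cases hk : ζ k = 0
        · simp only [hγ, Pi.sub_apply]
          rw [blockGlue_free hk, blockGlue_free hk, sub_self, norm_zero]
          exact hnn
        · simp only [hγ, Pi.sub_apply]
          rw [blockGlue_cone hk, blockGlue_cone hk, ← sub_smul, norm_smul, hu1' k hk, mul_one,
            Real.norm_eq_abs, hNm k hk s s' hss]
          exact Finset.single_le_sum (f := fun k => sg k * (N k s' - N k s))
            (fun k _ => hterm k s s' hss) (Finset.mem_univ k)
  -- expanding the free blocks
  have step4 : Ctrl (multicone H V' ε') x1 x d := by
    refine (ctrl_of_segment hopen ?_).mono (norm_space_le hd0 ?_ fun k => ?_)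
    · rintro w ⟨a, b, ha, hb, hab, rfl⟩
      refine mem_multicone_of_norm_le hs hV' hε' hx ?_ (fun k hk => ?_) fun k hk => ?_
      · have : a • x none + b • x none = x none := by rw [← add_smul, hab, one_smul]
        change ‖a • x none + b • x none‖ < _
        rw [this]
        exact hx.2.1
      · have : (a • x1 + b • x) (some k) = x (some k) := by
          rw [Pi.add_apply, Pi.smul_apply, Pi.smul_apply, hx1, blockGlue_cone hk, ← add_smul, hab,
            one_smul]
        rw [this]
        exact ⟨hx.1 k, rfl⟩
      · rw [Pi.add_apply, Pi.smul_apply, Pi.smul_apply, hx1, blockGlue_free hk]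
        refine (norm_add_le _ _).trans ?_
        have e1 : ‖a • fx k‖ = a * m k := by rw [norm_smul, Real.norm_of_nonneg ha, hfxn]
        have e2 : ‖b • x (some k)‖ = b * ‖x (some k)‖ := by rw [norm_smul, Real.norm_of_nonneg hb]
        rw [e1, e2]
        have h1 : a * m k ≤ a * ‖x (some k)‖ := mul_le_mul_of_nonneg_left (min_le_left _ _) ha
        calc _ ≤ a * ‖x (some k)‖ + b * ‖x (some k)‖ := by linarith
          _ = ‖x (some k)‖ := by rw [← add_mul, hab, one_mul]
    · change ‖x none - x none‖ ≤ d
      rw [sub_self, norm_zero]; exact hd0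
    · rw [Pi.sub_apply]
      by_cases hk : ζ k = 0
      · rw [hx1, blockGlue_free hk]
        exact hfxx k
      · rw [hx1, blockGlue_cone hk, sub_self, norm_zero]; exact hd0
  have h23 : 0 ≤ 4 / c * d := mul_nonneg (by positivity) hd0
  have h34 : 0 ≤ ((L : ℝ) + r) * d := mul_nonneg (by positivity) hd0
  refine (((step1.trans h23 step2).trans h34 step3).trans hd0 step4).mono (le_of_eq ?_)
  ring

end QuasiConvex

/-! ### Weights of multi-indices -/

section Weights

variable {L p r : ℕ} {n : Option (Fin L ⊕ Fin r) → ℕ}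
  {A : Matrix (Fin L ⊕ Fin p) (Fin L ⊕ Fin r) ℚ} {ζ : (k : Fin L ⊕ Fin r) → Fin (n (some k)) → ℂ}
  {H : Finset (PairT L r)} {V V' : (k : Fin L ⊕ Fin r) → Set (Fin (n (some k)) → ℂ)}
  {ε ε' : Radii L r} {σ : ℚ}

/-- The natural numbers `σ a_{jk}`, and `0` for the block `z^(0)`. -/
def natWeight (A : Matrix (Fin L ⊕ Fin p) (Fin L ⊕ Fin r) ℚ) (σ : ℚ) (j : Fin L ⊕ Fin p)
    (b : Option (Fin L ⊕ Fin r)) : ℕ :=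
  ⌊σ * weight A j b⌋₊

lemma natWeight_none (j : Fin L ⊕ Fin p) : natWeight A σ j none = 0 := by
  simp [natWeight, weight]

lemma natWeight_cast (hσ : IsScale A σ) (hA : ∀ j k, 0 ≤ A j k) (j : Fin L ⊕ Fin p)
    (b : Option (Fin L ⊕ Fin r)) : (natWeight A σ j b : ℚ) = σ * weight A j b := by
  rcases b with _ | k
  · simp [natWeight_none, weight]
  · obtain ⟨hσ0, c, hc, -⟩ := hσ
    have h0 : 0 ≤ c j k := by
      have : (0 : ℚ) ≤ c j k := by rw [← hc]; exact mul_nonneg hσ0.le (hA j k)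
      exact_mod_cast this
    obtain ⟨m, hm⟩ := Int.eq_ofNat_of_zero_le h0
    have h1 : σ * A j k = (m : ℚ) := by rw [hc, hm]; simp
    rw [natWeight, weight, h1, Nat.floor_natCast]

lemma natWeight_eq_zero_iff (hσ : IsScale A σ) (hA : ∀ j k, 0 ≤ A j k) (j : Fin L ⊕ Fin p)
    (k : Fin L ⊕ Fin r) : natWeight A σ j (some k) = 0 ↔ A j k = 0 := by
  have h := natWeight_cast hσ hA j (some k)
  rw [← Nat.cast_eq_zero (R := ℚ), h, weight, mul_eq_zero, or_iff_right hσ.1.ne']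

lemma natWeight_eq_zero_of_notMem (hσ : IsScale A σ) (hA : ∀ j k, 0 ≤ A j k)
    {J : Finset (Fin L ⊕ Fin p)} {b : Option (Fin L ⊕ Fin r)} (hb : b ∉ KJ A J)
    {j : Fin L ⊕ Fin p} (hj : j ∈ J) : natWeight A σ j b = 0 := by
  rcases b with _ | k
  · exact natWeight_none j
  · rw [natWeight_eq_zero_iff hσ hA]
    by_contra h
    exact hb ⟨k, rfl, j, hj, h⟩

/-- The weighted degree of a multi-index for the action `μ_j`, multiplied by `σ`. -/
def deg (A : Matrix (Fin L ⊕ Fin p) (Fin L ⊕ Fin r) ℚ) (σ : ℚ) (j : Fin L ⊕ Fin p)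
    (α : MultiIndex n) : ℕ :=
  wdeg (fun i : Coord n => natWeight A σ j i.1) α

lemma deg_add (j : Fin L ⊕ Fin p) (α β : MultiIndex n) :
    deg A σ j (α + β) = deg A σ j α + deg A σ j β := wdeg_add _ _ _

lemma deg_unitIdx (j : Fin L ⊕ Fin p) (i : Coord n) :
    deg A σ j (unitIdx i) = natWeight A σ j i.1 := wdeg_unitIdx _ _

lemma deg_idxOf_cons (j : Fin L ⊕ Fin p) (i : Coord n) (l : List (Coord n)) :
    deg A σ j (idxOf (i :: l)) = deg A σ j (idxOf l) + natWeight A σ j i.1 := by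
  rw [idxOf_cons, deg_add, deg_unitIdx]

lemma mem_indicesBelow (hσ : IsScale A σ) (hA : ∀ j k, 0 ≤ A j k) {J : Finset (Fin L ⊕ Fin p)}
    {N : Fin L ⊕ Fin p → ℕ} {α : MultiIndex n} :
    α ∈ indicesBelow n A σ J N ↔ α ∈ indicesJ n A J ∧ ∀ j ∈ J, deg A σ j α < N j := by
  refine and_congr Iff.rfl (forall₂_congr fun j _ => ?_)
  have h : (deg A σ j α : ℚ) = σ * ∑ k, A j k * ((∑ i, α (some k) i : ℕ) : ℚ) := by
    rw [deg, wdeg, Fintype.sum_sigma, Fintype.sum_option]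
    push_cast
    simp only [smul_eq_mul, Nat.cast_mul, natWeight_cast hσ hA, weight, mul_zero,
      Finset.sum_const_zero, zero_add, Finset.mul_sum]
    exact Finset.sum_congr rfl fun k _ => Finset.sum_congr rfl fun i _ => by ring
  rw [lt_div_iff₀ hσ.1, mul_comm, ← h, Nat.cast_lt]

/-- If the weights of `γ` with respect to `J` vanish, then so does `γ` on the blocks of `K_J`. -/
lemma eq_zero_of_deg_eq_zero (hσ : IsScale A σ) (hA : ∀ j k, 0 ≤ A j k)
    {J : Finset (Fin L ⊕ Fin p)} {γ : MultiIndex n} (hγ : γ ∈ indicesJ n A J)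
    (h : ∀ j ∈ J, deg A σ j γ = 0) : γ = 0 := by
  refine multiIndex_ext fun i => ?_
  by_cases hi : i.1 ∈ KJ A J
  · obtain ⟨k, hk, j, hj, hjk⟩ := hi
    have h1 := h j hj
    rw [deg, wdeg, Finset.sum_eq_zero_iff] at h1
    have h2 := h1 i (Finset.mem_univ i)
    rw [smul_eq_mul, mul_eq_zero] at h2
    rcases h2 with h2 | h2
    · exact h2
    · rw [hk, natWeight_eq_zero_iff hσ hA] at h2
      exact absurd h2 hjk
  · rw [hγ i.1 hi]; rfl

/-- The `σ`-th roots of the level functions. -/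
def root (A : Matrix (Fin L ⊕ Fin p) (Fin L ⊕ Fin r) ℚ)
    (ζ : (k : Fin L ⊕ Fin r) → Fin (n (some k)) → ℂ) (σ : ℚ) (z : Space n) (j : Fin L ⊕ Fin p) : ℝ :=
  level A ζ (blockNorm z) j ^ (1 / (σ : ℝ))

lemma root_pos (hs : Admissible A ζ H) (hV : IsConeAt ζ V) {z : Space n}
    (hz : z ∈ multicone H V ε) (j : Fin L ⊕ Fin p) : 0 < root A ζ σ z j :=
  Real.rpow_pos_of_pos (level_pos_of_mem hs hV hz j) _

lemma root_pow (hs : Admissible A ζ H) (hV : IsConeAt ζ V) {z : Space n}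
    (hz : z ∈ multicone H V ε) (j : Fin L ⊕ Fin p) (m : ℕ) :
    root A ζ σ z j ^ m = level A ζ (blockNorm z) j ^ ((m : ℝ) / σ) := by
  rw [root, ← Real.rpow_natCast, ← Real.rpow_mul (level_pos_of_mem hs hV hz j).le,
    one_div_mul_eq_div]

lemma blockSize_eq_prod_root (hs : Admissible A ζ H) (hσ : IsScale A σ) (hV : IsConeAt ζ V)
    {z : Space n} (hz : z ∈ multicone H V ε) (b : Option (Fin L ⊕ Fin r)) :
    blockSize A ζ z b = ∏ j, root A ζ σ z j ^ natWeight A σ j b := by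
  rw [blockSize_eq]
  refine Finset.prod_congr rfl fun j _ => ?_
  rw [root_pow hs hV hz]
  congr 1
  have h := natWeight_cast hσ hs.nonneg j b
  have hσ0 : (σ : ℝ) ≠ 0 := by exact_mod_cast hσ.1.ne'
  rw [eq_div_iff hσ0]
  have : ((natWeight A σ j b : ℚ) : ℝ) = ((σ * weight A j b : ℚ) : ℝ) := by rw [h]
  push_cast at this
  rw [this, mul_comm]

lemma exists_root_le (hs : Admissible A ζ H) (hσ : IsScale A σ) (hV : IsConeAt ζ V)
    (ε : Radii L r) : ∃ C, 1 ≤ C ∧ ∀ z ∈ multicone H V ε, ∀ j, root A ζ σ z j ≤ C := by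
  obtain ⟨C, hC1, hC⟩ := exists_level_bounds hs hV ε
  have hσ0 : (0 : ℝ) < σ := by exact_mod_cast hσ.1
  exact ⟨C ^ (1 / (σ : ℝ)), Real.one_le_rpow hC1 (by positivity), fun z hz j =>
    Real.rpow_le_rpow (level_pos_of_mem hs hV hz j).le ((hC z hz).1 j) (by positivity)⟩

end Weights

section Remainder

variable {L p r : ℕ} {n : Option (Fin L ⊕ Fin r) → ℕ}
  {A : Matrix (Fin L ⊕ Fin p) (Fin L ⊕ Fin r) ℚ} {σ : ℚ}

/-- The coefficients `f_{J,α}` as functions on `X`, with `f` itself for `J = ∅`. -/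
def liftCoeff (A : Matrix (Fin L ⊕ Fin p) (Fin L ⊕ Fin r) ℚ) (f : Space n → ℂ) (F : Coeffs n A)
    (J : Finset (Fin L ⊕ Fin p)) (α : MultiIndex n) (z : Space n) : ℂ :=
  open Classical in if J.Nonempty then F J α (projJ A J z) else f z

/-- The set `A_J(N)` as a `Finset`. -/
def below (n : Option (Fin L ⊕ Fin r) → ℕ) {A : Matrix (Fin L ⊕ Fin p) (Fin L ⊕ Fin r) ℚ}
    (hA : ∀ j k, 0 ≤ A j k) (σ : ℚ) (J : Finset (Fin L ⊕ Fin p)) (N : Fin L ⊕ Fin p → ℕ) :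
    Finset (MultiIndex n) :=
  (indicesBelow_finite n A hA σ J N).toFinset

lemma mem_below (hσ : IsScale A σ) (hA : ∀ j k, 0 ≤ A j k) {J : Finset (Fin L ⊕ Fin p)}
    {N : Fin L ⊕ Fin p → ℕ} {α : MultiIndex n} :
    α ∈ below n hA σ J N ↔ α ∈ indicesJ n A J ∧ ∀ j ∈ J, deg A σ j α < N j := by
  rw [below, Set.Finite.mem_toFinset, mem_indicesBelow hσ hA]

lemma indicesJ_empty {α : MultiIndex n} : α ∈ indicesJ n A ∅ ↔ α = 0 := by
  constructor
  · intro h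
    exact funext fun b => h b (by rintro ⟨k, -, j, hj, -⟩; simp at hj)
  · rintro rfl
    exact fun b _ => rfl

/-- With `f` as the term for `J = ∅`, the remainder of the expansion is an alternating sum over all
sets of parameters. -/
lemma sub_app_eq (hσ : IsScale A σ) (hA : ∀ j k, 0 ≤ A j k) (f : Space n → ℂ) (F : Coeffs n A)
    (N : Fin L ⊕ Fin p → ℕ) (z : Space n) :
    f z - app A σ F N z = ∑ J : Finset (Fin L ⊕ Fin p), (-1) ^ J.card *
      ∑ α ∈ below n hA σ J N, liftCoeff A f F J α z * divMono α z := by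
  classical
  have h1 : ∀ J : Finset (Fin L ⊕ Fin p), J.Nonempty → termJ A σ F N J z
      = ∑ α ∈ below n hA σ J N, liftCoeff A f F J α z * divMono α z := fun J hJ => by
    rw [termJ, finsum_mem_eq_finite_toFinset_sum _ (indicesBelow_finite n A hA σ J N)]
    refine Finset.sum_congr rfl fun α _ => ?_
    rw [liftCoeff, if_pos hJ, divMono_eq]
    ring
  have h2 : ∑ α ∈ below n hA σ ∅ N, liftCoeff A f F ∅ α z * divMono α z = f z := by
    have : below n hA σ ∅ N = {0} := by
      ext α
      rw [mem_below hσ hA, Finset.mem_singleton, indicesJ_empty]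
      simp
    rw [this, Finset.sum_singleton, liftCoeff, if_neg (by simp), divMono_zero, mul_one]
  rw [app, ← Finset.add_sum_erase Finset.univ _ (Finset.mem_univ (∅ : Finset (Fin L ⊕ Fin p))), h2,
    Finset.card_empty, pow_zero, one_mul, sub_eq_add_neg, ← Finset.sum_neg_distrib]
  congr 1
  refine Finset.sum_congr ?_ fun J hJ => ?_
  · ext J
    simp [Finset.nonempty_iff_ne_empty]
  · have hJ' : J.Nonempty := Finset.nonempty_iff_ne_empty.2 (Finset.ne_of_mem_erase hJ)
    rw [h1 J hJ', pow_succ]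
    ring

end Remainder

/-! ### From the expansion to bounded derivatives -/

lemma iterPartialD_singleton {L r : ℕ} {n : Option (Fin L ⊕ Fin r) → ℕ} (i : Coord n)
    (f : Space n → ℂ) : iterPartialD [i] f = partialD i f := rfl

section Cauchy

variable {L p r : ℕ} {n : Option (Fin L ⊕ Fin r) → ℕ}
  {A : Matrix (Fin L ⊕ Fin p) (Fin L ⊕ Fin r) ℚ} {ζ : (k : Fin L ⊕ Fin r) → Fin (n (some k)) → ℂ}
  {H : Finset (PairT L r)} {V V' : (k : Fin L ⊕ Fin r) → Set (Fin (n (some k)) → ℂ)}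
  {ε ε' : Radii L r} {σ : ℚ}

/-- `P` is bounded by a multiple of `∏_j ρ_{Λ,j}^{x_j/σ}` on each properly contained multicone. -/
def IsBigOLevel (A : Matrix (Fin L ⊕ Fin p) (Fin L ⊕ Fin r) ℚ) (σ : ℚ)
    (ζ : (k : Fin L ⊕ Fin r) → Fin (n (some k)) → ℂ) (H : Finset (PairT L r))
    (V : (k : Fin L ⊕ Fin r) → Set (Fin (n (some k)) → ℂ)) (ε : Radii L r)
    (P : Space n → ℂ) (x : Fin L ⊕ Fin p → ℕ) : Prop :=
  ∀ V' ε', ProperlyContained H ζ V' ε' V ε → ∃ C, ∀ z ∈ multicone H V' ε',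
    ‖P z‖ ≤ C * ∏ j, root A ζ σ z j ^ x j

/-- Cauchy's estimate on discs of radii proportional to the sizes of the blocks. -/
lemma IsBigOLevel.partialD (hs : Admissible A ζ H) (hσ : IsScale A σ) (hV : IsConeAt ζ V)
    {P : Space n → ℂ} (hP : DifferentiableOn ℂ P (multicone H V ε)) {x : Fin L ⊕ Fin p → ℕ}
    {i : Coord n} (h : IsBigOLevel A σ ζ H V ε P fun j => x j + natWeight A σ j i.1) :
    IsBigOLevel A σ ζ H V ε (partialD i P) x := by
  intro V' ε' hpc
  obtain ⟨V₁, ε₁, hpc1, hpc2⟩ := exists_properlyContained_between hV hpc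
  have hV1 : IsConeAt ζ V₁ := hpc2.1
  have hV' : IsConeAt ζ V' := hpc.1
  obtain ⟨δ, hδ, C, hC, hdisc⟩ := exists_polydisc (A := A) hs hV1 hpc1
  obtain ⟨B, hB⟩ := h V₁ ε₁ hpc2
  have hσ0 : (0 : ℝ) < σ := by exact_mod_cast hσ.1
  set D := C ^ (1 / (σ : ℝ)) with hD
  have hD0 : 0 < D := Real.rpow_pos_of_pos hC _
  set y : Fin L ⊕ Fin p → ℕ := fun j => x j + natWeight A σ j i.1 with hy
  refine ⟨|B| * (∏ j, D ^ y j) / δ, fun z hz => ?_⟩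
  have hr := fun j => root_pos (σ := σ) hs hV' hz j
  have hbs : 0 < blockSize A ζ z i.1 := by
    rw [blockSize_eq_prod_root hs hσ hV' hz]
    exact Finset.prod_pos fun j _ => pow_pos (hr j) _
  set R := δ * blockSize A ζ z i.1 with hR
  have hR0 : 0 < R := mul_pos hδ hbs
  have hpt : ∀ w : ℂ, ‖w‖ ≤ R → ∀ b, ‖(z + w • coordVec i) b - z b‖ ≤ δ * blockSize A ζ z b := by
    intro w hw b
    rw [Pi.add_apply, add_sub_cancel_left, Pi.smul_apply, norm_smul]
    by_cases hb : b = i.1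
    · subst hb
      rw [coordVec, Pi.single_eq_same, Pi.norm_single, norm_one, mul_one]
      exact hw
    · rw [coordVec, Pi.single_eq_of_ne hb, norm_zero, mul_zero]
      have : 0 < blockSize A ζ z b := by
        rw [blockSize_eq_prod_root hs hσ hV' hz]
        exact Finset.prod_pos fun j _ => pow_pos (hr j) _
      positivity
  have hbound : ∀ w : ℂ, ‖w‖ ≤ R → ‖P (z + w • coordVec i)‖
      ≤ |B| * (∏ j, D ^ y j) * ∏ j, root A ζ σ z j ^ y j := by
    intro w hw
    obtain ⟨hmem, hl, -⟩ := hdisc z hz _ (hpt w hw)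
    refine (hB _ hmem).trans ?_
    rw [mul_assoc, ← Finset.prod_mul_distrib]
    have hp0 : 0 ≤ ∏ j, root A ζ σ (z + w • coordVec i) j ^ y j :=
      Finset.prod_nonneg fun j _ => pow_nonneg (root_pos hs hV1 hmem j).le _
    refine (mul_le_mul_of_nonneg_right (le_abs_self B) hp0).trans
      (mul_le_mul_of_nonneg_left ?_ (abs_nonneg B))
    refine Finset.prod_le_prod (fun j _ => pow_nonneg (root_pos hs hV1 hmem j).le _) fun j _ => ?_
    rw [← mul_pow]
    refine pow_le_pow_left₀ (root_pos hs hV1 hmem j).le ?_ _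
    rw [root, root, hD, ← Real.mul_rpow hC.le (level_pos_of_mem hs hV' hz j).le]
    exact Real.rpow_le_rpow (level_pos_of_mem hs hV1 hmem j).le (hl j) (by positivity)
  have hSopen : IsOpen (multicone H V ε) := isOpen_multicone hs hV
  have hS : ∀ w : ℂ, ‖w‖ ≤ R → z + w • coordVec i ∈ multicone H V ε := fun w hw =>
    hpc2.subset hV (hdisc z hz _ (hpt w hw)).1
  have hd : ∀ w : ℂ, ‖w‖ ≤ R → DifferentiableAt ℂ (fun w : ℂ => P (z + w • coordVec i)) w := by
    intro w hw
    exact DifferentiableAt.comp w (hP.differentiableAt (hSopen.mem_nhds (hS w hw)))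
      ((differentiableAt_id.smul_const _).const_add z)
  have hz0 : DifferentiableAt ℂ P z := by
    have := hS 0 (by rw [norm_zero]; exact hR0.le)
    rw [zero_smul, add_zero] at this
    exact hP.differentiableAt (hSopen.mem_nhds this)
  rw [partialD_eq_deriv hz0]
  have hdc : DiffContOnCl ℂ (fun w : ℂ => P (z + w • coordVec i)) (ball 0 R) :=
    DifferentiableOn.diffContOnCl fun w hw => (hd w (by
      rw [closure_ball _ hR0.ne'] at hw
      exact mem_closedBall_zero_iff.1 hw)).differentiableWithinAt
  refine (Complex.norm_deriv_le_of_forall_mem_sphere_norm_le hR0 hdc fun w hw =>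
    hbound w (mem_sphere_zero_iff_norm.1 hw).le).trans (le_of_eq ?_)
  have hsplit : ∏ j, root A ζ σ z j ^ y j = (∏ j, root A ζ σ z j ^ x j) * blockSize A ζ z i.1 := by
    rw [blockSize_eq_prod_root hs hσ hV' hz, ← Finset.prod_mul_distrib]
    exact Finset.prod_congr rfl fun j _ => pow_add _ _ _
  rw [hsplit, hR]
  field_simp

lemma IsBigOLevel.iterPartialD (hs : Admissible A ζ H) (hσ : IsScale A σ) (hV : IsConeAt ζ V)
    {P : Space n → ℂ} (hP : DifferentiableOn ℂ P (multicone H V ε)) {x : Fin L ⊕ Fin p → ℕ}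
    {l : List (Coord n)} (h : IsBigOLevel A σ ζ H V ε P fun j => x j + deg A σ j (idxOf l)) :
    IsBigOLevel A σ ζ H V ε (iterPartialD l P) x := by
  induction l generalizing x with
  | nil => simpa [idxOf_nil, deg, wdeg_zero, MultiAsymptotics.iterPartialD] using h
  | cons i l ih =>
    refine IsBigOLevel.partialD hs hσ hV
      (differentiableOn_iterPartialD (isOpen_multicone hs hV) hP l) (ih ?_)
    convert h using 2 with j
    rw [deg_idxOf_cons]
    ring

/-- `g` is holomorphic on the multicone, and all its derivatives are bounded on the properly
contained multicones. -/
def HasBoundedDerivs (ζ : (k : Fin L ⊕ Fin r) → Fin (n (some k)) → ℂ) (H : Finset (PairT L r))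
    (V : (k : Fin L ⊕ Fin r) → Set (Fin (n (some k)) → ℂ)) (ε : Radii L r)
    (g : Space n → ℂ) : Prop :=
  DifferentiableOn ℂ g (multicone H V ε) ∧ ∀ l : List (Coord n), ∀ V' ε',
    ProperlyContained H ζ V' ε' V ε → ∃ C, ∀ z ∈ multicone H V' ε', ‖iterPartialD l g z‖ ≤ C

lemma HasBoundedDerivs.partialD (hs : Admissible A ζ H) (hV : IsConeAt ζ V) {g : Space n → ℂ}
    (h : HasBoundedDerivs ζ H V ε g) (i : Coord n) :
    HasBoundedDerivs ζ H V ε (MultiAsymptotics.partialD i g) := by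
  refine ⟨differentiableOn_partialD (isOpen_multicone hs hV) h.1 i, fun l V' ε' hpc => ?_⟩
  obtain ⟨C, hC⟩ := h.2 (l ++ [i]) V' ε' hpc
  refine ⟨C, fun z hz => ?_⟩
  have := hC z hz
  rwa [iterPartialD_append, iterPartialD_singleton] at this

lemma HasBoundedDerivs.mul (hs : Admissible A ζ H) (hV : IsConeAt ζ V) {g h : Space n → ℂ}
    (hg : HasBoundedDerivs ζ H V ε g) (hh : HasBoundedDerivs ζ H V ε h) :
    HasBoundedDerivs ζ H V ε fun z => g z * h z := by
  have ho : IsOpen (multicone H V ε) := isOpen_multicone hs hV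
  refine ⟨hg.1.mul hh.1, fun l => ?_⟩
  induction l using List.reverseRecOn generalizing g h with
  | nil =>
    intro V' ε' hpc
    obtain ⟨B, hB⟩ := hg.2 [] V' ε' hpc
    obtain ⟨C, hC⟩ := hh.2 [] V' ε' hpc
    refine ⟨B * C, fun z hz => ?_⟩
    change ‖g z * h z‖ ≤ _
    rw [norm_mul]
    exact mul_le_mul (hB z hz) (hC z hz) (norm_nonneg _) ((norm_nonneg _).trans (hB z hz))
  | append_singleton l i ih =>
    intro V' ε' hpc
    have hg' := hg.partialD hs hV i
    have hh' := hh.partialD hs hV i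
    obtain ⟨B, hB⟩ := ih hg hh' V' ε' hpc
    obtain ⟨C, hC⟩ := ih hg' hh V' ε' hpc
    refine ⟨B + C, fun z hz => ?_⟩
    have hzS := hpc.subset hV hz
    have hsum := iterPartialD_sum (s := Finset.univ)
      (f := fun b : Bool => if b then fun z => g z * MultiAsymptotics.partialD i h z
        else fun z => MultiAsymptotics.partialD i g z * h z) ho (by
          rintro (_ | _) -
          · exact hg'.1.mul hh.1
          · exact hg.1.mul hh'.1) l
    rw [iterPartialD_append, iterPartialD_singleton, iterPartialD_congr ho (partialD_mul ho hg.1 hh.1 i) l hzS]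
    have h2 := hsum hzS
    simp only [Fintype.sum_bool, if_true, Bool.false_eq_true, if_false] at h2
    rw [h2]
    exact (norm_add_le _ _).trans (add_le_add (hB z hz) (hC z hz))

lemma hasBoundedDerivs_divMono (hs : Admissible A ζ H) (β : MultiIndex n) :
    HasBoundedDerivs ζ H V ε (divMono β) := by
  refine ⟨(differentiable_divMono β).differentiableOn, fun l V' ε' hpc => ?_⟩
  have hc : Continuous (iterPartialD l (divMono β)) := by
    rw [← continuousOn_univ]
    exact (differentiableOn_iterPartialD isOpen_univ
      (differentiable_divMono β).differentiableOn l).continuousOn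
  have hb : Bornology.IsBounded (multicone H V' ε') := isBounded_multicone hs hpc.1
  obtain ⟨C, hC⟩ := hb.isCompact_closure.exists_bound_of_continuousOn hc.continuousOn
  exact ⟨C, fun z hz => hC z (subset_closure hz)⟩

end Cauchy

section Independent

variable {L r : ℕ} {n : Option (Fin L ⊕ Fin r) → ℕ} {U : Set (Space n)}

lemma iterPartialD_eq_zero_of_mem (hU : IsOpen U) {g : Space n → ℂ} (hg : DifferentiableOn ℂ g U)
    {i : Coord n} (hi : EqOn (partialD i g) 0 U) {l : List (Coord n)} (hl : i ∈ l) :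
    EqOn (iterPartialD l g) 0 U := by
  classical
  have hp : l.Perm (l.erase i ++ [i]) :=
    (List.perm_cons_erase hl).trans (List.perm_append_singleton i _).symm
  intro z hz
  rw [iterPartialD_perm hU hg hp hz, iterPartialD_append, iterPartialD_singleton]
  rw [iterPartialD_congr hU (g := fun _ => 0) hi _ hz]
  have h0 : ∀ l : List (Coord n), iterPartialD l (fun _ : Space n => (0 : ℂ)) = fun _ => 0 := by
    intro l
    induction l with
    | nil => rfl
    | cons j l ih =>
      funext z
      simp [iterPartialD, ih, partialD]
  rw [h0]
  rfl

lemma iterPartialD_mul_of_independent (hU : IsOpen U) {g h : Space n → ℂ}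
    (hg : DifferentiableOn ℂ g U) (hh : DifferentiableOn ℂ h U) {l : List (Coord n)}
    (hl : ∀ i ∈ l, EqOn (partialD i g) 0 U) :
    EqOn (iterPartialD l fun z => g z * h z) (fun z => g z * iterPartialD l h z) U := by
  induction l with
  | nil => exact fun _ _ => rfl
  | cons i l ih =>
    intro z hz
    have h1 := partialD_congr hU (ih fun j hj => hl j (List.mem_cons_of_mem _ hj)) i hz
    rw [iterPartialD, h1, partialD_mul hU hg (differentiableOn_iterPartialD hU hh l) i hz]
    have h2 := hl i List.mem_cons_self hz
    simp [iterPartialD, h2]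

end Independent

section Developable

variable {L p r : ℕ} {n : Option (Fin L ⊕ Fin r) → ℕ}
  {A : Matrix (Fin L ⊕ Fin p) (Fin L ⊕ Fin r) ℚ} {ζ : (k : Fin L ⊕ Fin r) → Fin (n (some k)) → ℂ}
  {H : Finset (PairT L r)} {V V' : (k : Fin L ⊕ Fin r) → Set (Fin (n (some k)) → ℂ)}
  {ε ε' : Radii L r} {σ : ℚ} {f : Space n → ℂ} {F : Coeffs n A}

lemma differentiableOn_liftCoeff (hf : DifferentiableOn ℂ f (multicone H V ε))
    (hF : IsTotalFamily A (multicone H V ε) F) {J : Finset (Fin L ⊕ Fin p)} {α : MultiIndex n}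
    (hα : α ∈ indicesJ n A J) : DifferentiableOn ℂ (liftCoeff A f F J α) (multicone H V ε) := by
  by_cases hJ : J.Nonempty
  · -- the space `ZJ n A J` carries a norm only after the choice of this instance
    let _ : Fintype {b : Option (Fin L ⊕ Fin r) // b ∉ KJ A J} := Fintype.ofFinite _
    let π : Space n →L[ℂ] ZJ n A J := ContinuousLinearMap.pi fun b => ContinuousLinearMap.proj b.1
    have h2 : DifferentiableOn ℂ (fun z => F J α (projJ A J z)) (multicone H V ε) :=
      DifferentiableOn.comp (t := projJ A J '' multicone H V ε) (hF J hJ α hα)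
        (ContinuousLinearMap.differentiableOn π) (mapsTo_image _ _)
    refine h2.congr fun z _ => ?_
    rw [liftCoeff, if_pos hJ]
  · refine hf.congr fun z _ => ?_
    rw [liftCoeff, if_neg hJ]

lemma partialD_liftCoeff {J : Finset (Fin L ⊕ Fin p)} {α : MultiIndex n} {i : Coord n}
    (hi : i.1 ∈ KJ A J) (z : Space n) : partialD i (liftCoeff A f F J α) z = 0 := by
  by_cases hd : DifferentiableAt ℂ (liftCoeff A f F J α) z
  · rw [partialD_eq_deriv hd]
    have hJ : J.Nonempty := by
      obtain ⟨k, -, j, hj, -⟩ := hi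
      exact ⟨j, hj⟩
    have : (fun t : ℂ => liftCoeff A f F J α (z + t • coordVec i))
        = fun _ => liftCoeff A f F J α z := by
      funext t
      rw [liftCoeff, liftCoeff, if_pos hJ, if_pos hJ]
      congr 1
      funext b
      have hb : (b : Option (Fin L ⊕ Fin r)) ≠ i.1 := fun h => b.2 (h ▸ hi)
      simp only [projJ, Pi.add_apply, Pi.smul_apply, coordVec, Pi.single_eq_of_ne hb, smul_zero,
        add_zero]
    rw [this, deriv_const]
  · rw [partialD, fderiv_zero_of_not_differentiableAt hd]
    rfl

lemma alternating_sum_powerset {ι : Type*} [DecidableEq ι] (J : Finset ι) (x y : ι → ℂ) :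
    ∑ E ∈ J.powerset, (-1) ^ E.card * ((∏ j ∈ E, x j) * ∏ j ∈ J \ E, y j)
      = ∏ j ∈ J, (y j - x j) := by
  have h : ∏ j ∈ J, (y j - x j) = ∏ j ∈ J, (-1 * x j + y j) :=
    Finset.prod_congr rfl fun j _ => by ring
  rw [h, Finset.prod_add]
  refine Finset.sum_congr rfl fun E _ => ?_
  rw [Finset.prod_mul_distrib, Finset.prod_const, mul_assoc]

/-- The factors which `j ∈ J` contributes to the mixed difference of the conditions
`deg_j β < N_j` over the set `J'`. -/
def diffFactor (A : Matrix (Fin L ⊕ Fin p) (Fin L ⊕ Fin r) ℚ) (σ : ℚ) (N : Fin L ⊕ Fin p → ℕ)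
    (J' : Finset (Fin L ⊕ Fin p)) (β : MultiIndex n) (j : Fin L ⊕ Fin p) : ℂ :=
  open Classical in if j ∈ J' ∧ deg A σ j β = N j then -1 else 0

/-- The coefficients of the mixed difference in the directions of `J` of the remainders. -/
def diffCoeff (A : Matrix (Fin L ⊕ Fin p) (Fin L ⊕ Fin r) ℚ) (σ : ℚ) (N : Fin L ⊕ Fin p → ℕ)
    (J J' : Finset (Fin L ⊕ Fin p)) (β : MultiIndex n) : ℂ :=
  open Classical in (-1) ^ J'.card * ((if ∀ j ∈ J' \ J, deg A σ j β < N j then 1 else 0) *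
    ∏ j ∈ J, diffFactor A σ N J' β j)

/-- `N` raised by `1` on `E`. -/
def raise (N : Fin L ⊕ Fin p → ℕ) (E : Finset (Fin L ⊕ Fin p)) (j : Fin L ⊕ Fin p) : ℕ :=
  open Classical in N j + if j ∈ E then 1 else 0

/-- The mixed difference with respect to `J` of the remainders of the expansion: only the terms of
the sets `J' ⊇ J` are left, and in those the degrees with respect to `J` are prescribed. -/
lemma mixed_difference (hσ : IsScale A σ) (hA : ∀ j k, 0 ≤ A j k) (f : Space n → ℂ)
    (F : Coeffs n A) (N : Fin L ⊕ Fin p → ℕ) (J : Finset (Fin L ⊕ Fin p)) (z : Space n) :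
    ∑ E ∈ J.powerset, (-1) ^ E.card * (f z - app A σ F (raise N E) z)
      = ∑ J' : Finset (Fin L ⊕ Fin p), ∑ β ∈ below n hA σ J' (fun j => N j + 1),
        diffCoeff A σ N J J' β * (liftCoeff A f F J' β z * divMono β z) := by
  classical
  have hind : ∀ E ∈ J.powerset, ∀ J' : Finset (Fin L ⊕ Fin p),
      ∑ β ∈ below n hA σ J' (raise N E), liftCoeff A f F J' β z * divMono β z
        = ∑ β ∈ below n hA σ J' (fun j => N j + 1),
          ((if ∀ j ∈ J' \ J, deg A σ j β < N j then 1 else 0) *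
            ((∏ j ∈ E, if j ∈ J' → deg A σ j β < N j + 1 then 1 else 0) *
              ∏ j ∈ J \ E, if j ∈ J' → deg A σ j β < N j then 1 else 0)) *
            (liftCoeff A f F J' β z * divMono β z) := by
    intro E hE J'
    rw [Finset.mem_powerset] at hE
    have hsub : below n hA σ J' (raise N E) ⊆ below n hA σ J' (fun j => N j + 1) := by
      intro β hβ
      rw [mem_below hσ hA] at hβ ⊢
      refine ⟨hβ.1, fun j hj => (hβ.2 j hj).trans_le ?_⟩
      rw [raise]
      split_ifs <;> omega
    rw [← Finset.sum_subset_zero_on_sdiff hsub (f := fun β => liftCoeff A f F J' β z * divMono β z)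
      (g := fun β => ((if ∀ j ∈ J' \ J, deg A σ j β < N j then 1 else 0) *
            ((∏ j ∈ E, if j ∈ J' → deg A σ j β < N j + 1 then 1 else 0) *
              ∏ j ∈ J \ E, if j ∈ J' → deg A σ j β < N j then 1 else 0)) *
            (liftCoeff A f F J' β z * divMono β z))]
    · intro β hβ
      rw [Finset.mem_sdiff, mem_below hσ hA, mem_below hσ hA, not_and] at hβ
      have h1 := hβ.2 hβ.1.1
      push Not at h1
      obtain ⟨j, hj, hjd⟩ := h1
      rw [raise] at hjd
      simp only [Finset.prod_ite_zero, Finset.prod_const_one]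
      by_cases hjJ : j ∈ J
      · by_cases hjE : j ∈ E
        · rw [if_pos hjE] at hjd
          have := hβ.1.2 j hj
          omega
        · rw [if_neg hjE] at hjd
          have : ¬ ∀ i ∈ J \ E, i ∈ J' → deg A σ i β < N i := fun h => by
            have := h j (Finset.mem_sdiff.2 ⟨hjJ, hjE⟩) hj
            omega
          rw [if_neg this]; ring
      · have : ¬ ∀ i ∈ J' \ J, deg A σ i β < N i := fun h => by
          have := h j (Finset.mem_sdiff.2 ⟨hj, hjJ⟩)
          split_ifs at hjd <;> omega
        rw [if_neg this]; ring
    · intro β hβ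
      have hβ' := (mem_below hσ hA).1 hβ
      have hr : ∀ j ∈ J', deg A σ j β < N j + if j ∈ E then 1 else 0 := hβ'.2
      simp only [Finset.prod_ite_zero, Finset.prod_const_one]
      rw [if_pos, if_pos, if_pos]
      · ring
      · intro j hj hjJ'
        have := hr j hjJ'
        rw [if_neg (Finset.mem_sdiff.1 hj).2] at this
        exact this
      · intro j hj hjJ'
        have := hr j hjJ'
        rwa [if_pos hj] at this
      · intro j hj
        have := hr j (Finset.mem_sdiff.1 hj).1
        rwa [if_neg fun h => (Finset.mem_sdiff.1 hj).2 (hE h)] at this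
  calc _ = ∑ E ∈ J.powerset, ∑ J' : Finset (Fin L ⊕ Fin p),
        ∑ β ∈ below n hA σ J' (fun j => N j + 1), (-1) ^ E.card * ((-1) ^ J'.card *
          (((if ∀ j ∈ J' \ J, deg A σ j β < N j then 1 else 0) *
            ((∏ j ∈ E, if j ∈ J' → deg A σ j β < N j + 1 then 1 else 0) *
              ∏ j ∈ J \ E, if j ∈ J' → deg A σ j β < N j then 1 else 0)) *
            (liftCoeff A f F J' β z * divMono β z))) := by
        refine Finset.sum_congr rfl fun E hE => ?_
        rw [sub_app_eq hσ hA, Finset.mul_sum]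
        refine Finset.sum_congr rfl fun J' _ => ?_
        rw [hind E hE J', Finset.mul_sum, Finset.mul_sum]
    _ = _ := by
        rw [Finset.sum_comm]
        refine Finset.sum_congr rfl fun J' _ => ?_
        rw [Finset.sum_comm]
        refine Finset.sum_congr rfl fun β hβ => ?_
        have hβ' := ((mem_below hσ hA).1 hβ).2
        have halt := alternating_sum_powerset J
          (fun j => if j ∈ J' → deg A σ j β < N j + 1 then (1 : ℂ) else 0)
          (fun j => if j ∈ J' → deg A σ j β < N j then (1 : ℂ) else 0)
        have hfac : ∀ j, ((if j ∈ J' → deg A σ j β < N j then (1 : ℂ) else 0) -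
            if j ∈ J' → deg A σ j β < N j + 1 then (1 : ℂ) else 0) = diffFactor A σ N J' β j := by
          intro j
          rw [diffFactor]
          by_cases hj : j ∈ J'
          · have h1 := hβ' j hj
            rcases Nat.lt_succ_iff_lt_or_eq.1 h1 with h2 | h2
            · simp [hj, h2, h2.ne, h1]
            · simp [hj, h2]
          · simp [hj]
        rw [Finset.prod_congr rfl fun j _ => hfac j] at halt
        rw [diffCoeff, ← halt, Finset.mul_sum, Finset.mul_sum, Finset.sum_mul]
        exact Finset.sum_congr rfl fun E _ => by ring

lemma diffCoeff_eq_zero {N : Fin L ⊕ Fin p → ℕ} {J J' : Finset (Fin L ⊕ Fin p)} (h : ¬ J ⊆ J')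
    (β : MultiIndex n) : diffCoeff A σ N J J' β = 0 := by
  obtain ⟨j, hj, hj'⟩ := Finset.not_subset.1 h
  rw [diffCoeff, Finset.prod_eq_zero hj (by simp [diffFactor, hj']), mul_zero, mul_zero]

lemma diffCoeff_self {N : Fin L ⊕ Fin p → ℕ} {J : Finset (Fin L ⊕ Fin p)} (β : MultiIndex n) :
    diffCoeff A σ N J J β = open Classical in if ∀ j ∈ J, deg A σ j β = N j then 1 else 0 := by
  classical
  rw [diffCoeff]
  split_ifs with h1 h2 h2
  · rw [Finset.prod_congr rfl fun j hj => show diffFactor A σ N J β j = -1 by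
      rw [diffFactor, if_pos ⟨hj, h2 j hj⟩], Finset.prod_const, one_mul, ← pow_add]
    exact Even.neg_one_pow ⟨_, rfl⟩
  · push Not at h2
    obtain ⟨j, hj, hne⟩ := h2
    rw [Finset.prod_eq_zero hj (by simp [diffFactor, hne]), mul_zero, mul_zero]
  · simp at h1
  · simp at h1

end Developable

section Developable

variable {L p r : ℕ} {n : Option (Fin L ⊕ Fin r) → ℕ}
  {A : Matrix (Fin L ⊕ Fin p) (Fin L ⊕ Fin r) ℚ} {ζ : (k : Fin L ⊕ Fin r) → Fin (n (some k)) → ℂ}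
  {H : Finset (PairT L r)} {V V' : (k : Fin L ⊕ Fin r) → Set (Fin (n (some k)) → ℂ)}
  {ε ε' : Radii L r} {σ : ℚ} {f : Space n → ℂ} {F : Coeffs n A}

/-- Each remainder in a mixed difference has at least the order `N`, as the level functions are
bounded. -/
lemma isBigOLevel_mixed_difference (hs : Admissible A ζ H) (hσ : IsScale A σ)
    (hD : DevelopableTo A σ ζ H V ε f F) (N : Fin L ⊕ Fin p → ℕ) (J : Finset (Fin L ⊕ Fin p)) :
    IsBigOLevel A σ ζ H V ε
      (fun z => ∑ E ∈ J.powerset, (-1) ^ E.card * (f z - app A σ F (raise N E) z)) N := by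
  intro V' ε' hpc
  choose C hC using fun E => hD V' ε' hpc (raise N E)
  obtain ⟨R, hR1, hR⟩ := exists_root_le hs hσ hpc.1 ε'
  refine ⟨∑ E ∈ J.powerset, |C E| * ∏ _j : Fin L ⊕ Fin p, R, fun z hz => ?_⟩
  rw [Finset.sum_mul]
  refine (norm_sum_le _ _).trans (Finset.sum_le_sum fun E _ => ?_)
  rw [norm_mul, norm_pow, norm_neg, norm_one, one_pow, one_mul]
  refine (hC E z hz).trans ?_
  have hr := fun j => root_pos (σ := σ) hs hpc.1 hz j
  have h1 : ∏ j, level A ζ (blockNorm z) j ^ ((raise N E j : ℝ) / (σ : ℝ))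
      = ∏ j, root A ζ σ z j ^ raise N E j :=
    Finset.prod_congr rfl fun j _ => (root_pow hs hpc.1 hz j _).symm
  rw [h1, mul_assoc, ← Finset.prod_mul_distrib]
  have h2 : 0 ≤ ∏ j, root A ζ σ z j ^ raise N E j :=
    Finset.prod_nonneg fun j _ => pow_nonneg (hr j).le _
  refine (mul_le_mul_of_nonneg_right (le_abs_self _) h2).trans
    (mul_le_mul_of_nonneg_left ?_ (abs_nonneg _))
  refine Finset.prod_le_prod (fun j _ => pow_nonneg (hr j).le _) fun j _ => ?_
  rw [raise]
  split_ifs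
  · rw [pow_succ, mul_comm]
    exact mul_le_mul_of_nonneg_right (hR z hz j) (pow_nonneg (hr j).le _)
  · rw [add_zero]
    exact le_mul_of_one_le_left (pow_nonneg (hr j).le _) hR1

lemma deg_idxOf_eq_zero {j : Fin L ⊕ Fin p} {l : List (Coord n)}
    (h : ∀ i ∈ l, natWeight A σ j i.1 = 0) : deg A σ j (idxOf l) = 0 := by
  induction l with
  | nil => rw [idxOf_nil, deg, wdeg_zero]
  | cons i l ih =>
    rw [deg_idxOf_cons, ih fun i hi => h i (List.mem_cons_of_mem _ hi), h i List.mem_cons_self]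

/-- Among the monomials with the same weights for `J` as `α`, only that of `α` has a non-zero
derivative of order `α`. -/
lemma iterPartialD_listOf_divMono (hσ : IsScale A σ) (hA : ∀ j k, 0 ≤ A j k)
    {J : Finset (Fin L ⊕ Fin p)} {α β : MultiIndex n} (hβ : β ∈ indicesJ n A J)
    (h : ∀ j ∈ J, deg A σ j β = deg A σ j α) (z : Space n) :
    iterPartialD (listOf α) (divMono β) z = open Classical in if β = α then 1 else 0 := by
  classical
  have h0 : ∀ γ : MultiIndex n, γ + α = β → γ = 0 := by
    intro γ hγ
    refine eq_zero_of_deg_eq_zero (J := J) hσ hA (fun b hb => ?_) fun j hj => ?_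
    · have h1 := hβ b hb
      rw [← hγ] at h1
      exact (add_eq_zero.1 h1).1
    · have h1 := h j hj
      rw [← hγ, deg_add] at h1
      omega
  have h1 := iterPartialD_poly (n := n) (fun _ => 1) (listOf α) {β} (if β = α then {0} else ∅)
    (fun γ => by
      rw [idxOf_listOf, Finset.mem_singleton]
      constructor
      · intro hγ
        split_ifs at hγ with hβα
        · rw [Finset.mem_singleton] at hγ
          rw [hγ, zero_add, hβα]
        · simp at hγ
      · intro hγ
        have := h0 γ hγ
        rw [this, zero_add] at hγ
        rw [if_pos hγ.symm, this]
        exact Finset.mem_singleton_self _) z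
  simp only [Finset.sum_singleton, one_mul] at h1
  rw [h1]
  split_ifs
  · rw [Finset.sum_singleton, divMono_zero]
  · rw [Finset.sum_empty]

/-- By downward induction on `J`: the mixed difference of the remainders in the directions of `J`,
differentiated as often as the weights allow, is bounded, and it consists of a derivative of
`f_{J,α}` and of terms of the sets strictly larger than `J`. -/
theorem hasBoundedDerivs_liftCoeff (hs : Admissible A ζ H) (hσ : IsScale A σ) (hV : IsConeAt ζ V)
    (hf : DifferentiableOn ℂ f (multicone H V ε)) (hF : IsTotalFamily A (multicone H V ε) F)
    (hD : DevelopableTo A σ ζ H V ε f F) (J : Finset (Fin L ⊕ Fin p)) :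
    ∀ α ∈ indicesJ n A J, HasBoundedDerivs ζ H V ε (liftCoeff A f F J α) := by
  classical
  induction hc : (Finset.univ \ J).card using Nat.strong_induction_on generalizing J with
  | _ c ih =>
  intro α hα
  have hU : IsOpen (multicone (n := n) H V ε) := isOpen_multicone hs hV
  have hA := hs.nonneg
  have hlift : ∀ J' : Finset (Fin L ⊕ Fin p), ∀ β ∈ indicesJ n A J',
      DifferentiableOn ℂ (liftCoeff A f F J' β) (multicone H V ε) :=
    fun J' β hβ => differentiableOn_liftCoeff hf hF hβ
  refine ⟨hlift J α hα, fun l V' ε' hpc => ?_⟩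
  by_cases hl : ∃ i ∈ l, i.1 ∈ KJ A J
  · obtain ⟨i, hil, hi⟩ := hl
    refine ⟨0, fun z hz => ?_⟩
    rw [iterPartialD_eq_zero_of_mem hU (hlift J α hα) (fun z _ => partialD_liftCoeff hi z) hil
      (hpc.subset hV hz)]
    simp
  push Not at hl
  -- `N` is such that the derivative of order `m` of the mixed difference, which is
  -- `O(∏_j ρ_{Λ,j}^{N_j/σ})`, is bounded; on `J`, where `l` has weight `0`, it is the weight of `α`
  set m := l ++ listOf α with hm
  set N : Fin L ⊕ Fin p → ℕ := fun j => deg A σ j (idxOf m) with hN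
  have hNJ : ∀ j ∈ J, N j = deg A σ j α := by
    intro j hj
    rw [hN]
    simp only
    rw [hm, idxOf_append, deg_add, idxOf_listOf, deg_idxOf_eq_zero fun i hi =>
      natWeight_eq_zero_of_notMem hσ hA (hl i hi) hj, zero_add]
  have hprod : ∀ J' : Finset (Fin L ⊕ Fin p), ∀ β ∈ below n hA σ J' (fun j => N j + 1),
      DifferentiableOn ℂ (fun z => liftCoeff A f F J' β z * divMono β z) (multicone H V ε) :=
    fun J' β hβ => (hlift J' β ((mem_below hσ hA).1 hβ).1).mul
      (differentiable_divMono β).differentiableOn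
  set P : Space n → ℂ := fun z => ∑ J' : Finset (Fin L ⊕ Fin p),
    ∑ β ∈ below n hA σ J' (fun j => N j + 1),
      diffCoeff A σ N J J' β * (liftCoeff A f F J' β z * divMono β z) with hP
  have hPd : DifferentiableOn ℂ P (multicone H V ε) :=
    DifferentiableOn.fun_sum fun J' _ => DifferentiableOn.fun_sum fun β hβ =>
      (hprod J' β hβ).const_mul _
  have hPbig : IsBigOLevel A σ ζ H V ε P fun j => 0 + N j := by
    have := isBigOLevel_mixed_difference hs hσ hD N J
    simp only [zero_add]
    convert this using 2 with z
    rw [hP, mixed_difference hσ hA]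
  obtain ⟨B, hB⟩ := IsBigOLevel.iterPartialD (x := fun _ => 0) hs hσ hV hPd hPbig V' ε' hpc
  simp only [pow_zero, Finset.prod_const_one, mul_one] at hB
  set Q : Finset (Fin L ⊕ Fin p) → MultiIndex n → Space n → ℂ := fun J' β =>
    iterPartialD m fun z => liftCoeff A f F J' β z * divMono β z with hQ
  have hPm : ∀ z ∈ multicone H V ε, iterPartialD m P z = ∑ J' : Finset (Fin L ⊕ Fin p),
      ∑ β ∈ below n hA σ J' (fun j => N j + 1), diffCoeff A σ N J J' β * Q J' β z := by
    intro z hz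
    rw [hP, iterPartialD_sum hU (fun J' _ => DifferentiableOn.fun_sum fun β hβ =>
      (hprod J' β hβ).const_mul _) m hz]
    refine Finset.sum_congr rfl fun J' _ => ?_
    rw [iterPartialD_sum hU (fun β hβ => (hprod J' β hβ).const_mul _) m hz]
    exact Finset.sum_congr rfl fun β hβ => iterPartialD_const_mul hU (hprod J' β hβ) _ m hz
  -- the terms for `J` itself: `∂^α` removes all monomials of the weight of `α` but that of `α`
  have hself : ∀ z ∈ multicone H V ε, ∑ β ∈ below n hA σ J (fun j => N j + 1),
      diffCoeff A σ N J J β * Q J β z = iterPartialD l (liftCoeff A f F J α) z := by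
    intro z hz
    have hαm : α ∈ below n hA σ J (fun j => N j + 1) :=
      (mem_below hσ hA).2 ⟨hα, fun j hj => by rw [hNJ j hj]; exact Nat.lt_succ_self _⟩
    have hQz : ∀ β ∈ below n hA σ J (fun j => N j + 1), (∀ j ∈ J, deg A σ j β = N j) →
        Q J β z = if β = α then iterPartialD l (liftCoeff A f F J α) z else 0 := by
      intro β hβ hdeg
      have hβJ := ((mem_below hσ hA).1 hβ).1
      rw [hQ]
      simp only
      rw [hm, iterPartialD_append]
      have h1 : EqOn (iterPartialD (listOf α) fun z => liftCoeff A f F J β z * divMono β z)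
          (fun z => (if β = α then 1 else 0) * liftCoeff A f F J β z) (multicone H V ε) := by
        intro w hw
        rw [iterPartialD_mul_of_independent hU (hlift J β hβJ)
          (differentiable_divMono β).differentiableOn (l := listOf α) (fun i hi w _ => ?_) hw]
        · simp only
          rw [iterPartialD_listOf_divMono hσ hA hβJ fun j hj => (hdeg j hj).trans (hNJ j hj),
            mul_comm]
        · refine partialD_liftCoeff ?_ w
          by_contra hcon
          have h2 := congrFun (hα i.1 hcon) i.2
          have h3 : 0 < idxOf (listOf α) i.1 i.2 := List.count_pos_iff.2 hi
          rw [idxOf_listOf, h2] at h3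
          exact lt_irrefl _ h3
      rw [iterPartialD_congr hU h1 l hz, iterPartialD_const_mul hU (hlift J β hβJ) _ l hz]
      beta_reduce
      split_ifs with hβα
      · rw [one_mul, hβα]
      · rw [zero_mul]
    rw [Finset.sum_eq_single_of_mem α hαm]
    · rw [diffCoeff_self, if_pos fun j hj => (hNJ j hj).symm, one_mul,
        hQz α hαm fun j hj => (hNJ j hj).symm, if_pos rfl]
    · intro β hβ hne
      rw [diffCoeff_self]
      split_ifs with hdeg
      · rw [hQz β hβ hdeg, if_neg hne, mul_zero]
      · rw [zero_mul]
  have hother : ∀ J' : Finset (Fin L ⊕ Fin p), ∃ C, J' ≠ J → ∀ z ∈ multicone H V' ε',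
      ‖∑ β ∈ below n hA σ J' (fun j => N j + 1), diffCoeff A σ N J J' β * Q J' β z‖ ≤ C := by
    intro J'
    by_cases hJJ : J ⊆ J'
    · by_cases hne : J' = J
      · exact ⟨0, fun h => absurd hne h⟩
      · have hss : J ⊂ J' := Finset.ssubset_iff_subset_ne.2 ⟨hJJ, Ne.symm hne⟩
        have hcard : (Finset.univ \ J').card < c := by
          rw [← hc]
          refine Finset.card_lt_card (Finset.ssubset_iff_subset_ne.2
            ⟨Finset.sdiff_subset_sdiff le_rfl hJJ, fun heq => ?_⟩)
          obtain ⟨j, hj, hj'⟩ := Finset.exists_of_ssubset hss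
          have : j ∈ Finset.univ \ J' := heq ▸ Finset.mem_sdiff.2 ⟨Finset.mem_univ _, hj'⟩
          exact (Finset.mem_sdiff.1 this).2 hj
        have hb : ∀ β : MultiIndex n, ∃ C, β ∈ below n hA σ J' (fun j => N j + 1) →
            ∀ z ∈ multicone H V' ε', ‖Q J' β z‖ ≤ C := by
          intro β
          by_cases hβ : β ∈ below n hA σ J' (fun j => N j + 1)
          · obtain ⟨C, hC⟩ := ((ih _ hcard J' rfl β ((mem_below hσ hA).1 hβ).1).mul hs hV
              (hasBoundedDerivs_divMono hs β)).2 m V' ε' hpc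
            exact ⟨C, fun _ => hC⟩
          · exact ⟨0, fun h => absurd h hβ⟩
        choose C hC using hb
        refine ⟨∑ β ∈ below n hA σ J' (fun j => N j + 1), ‖diffCoeff A σ N J J' β‖ * C β,
          fun _ z hz => (norm_sum_le _ _).trans (Finset.sum_le_sum fun β hβ => ?_)⟩
        rw [norm_mul]
        exact mul_le_mul_of_nonneg_left (hC β hβ z hz) (norm_nonneg _)
    · refine ⟨0, fun _ z _ => le_of_eq ?_⟩
      rw [norm_eq_zero]
      exact Finset.sum_eq_zero fun β _ => by rw [diffCoeff_eq_zero hJJ, zero_mul]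
  choose C hC using hother
  refine ⟨B + ∑ J' ∈ Finset.univ.erase J, C J', fun z hz => ?_⟩
  have hzS := hpc.subset hV hz
  have h1 := hPm z hzS
  rw [← Finset.add_sum_erase Finset.univ _ (Finset.mem_univ J), hself z hzS] at h1
  rw [← sub_eq_iff_eq_add.2 h1]
  refine (norm_sub_le _ _).trans (add_le_add (hB z hz) ((norm_sum_le _ _).trans
    (Finset.sum_le_sum fun J' hJ' => hC J' (Finset.ne_of_mem_erase hJ') z hz)))

/-- An asymptotic expansion bounds all derivatives. -/
theorem DevelopableTo.hasBoundedDerivs (hs : Admissible A ζ H) (hσ : IsScale A σ)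
    (hV : IsConeAt ζ V) (hf : DifferentiableOn ℂ f (multicone H V ε))
    (hF : IsTotalFamily A (multicone H V ε) F) (hD : DevelopableTo A σ ζ H V ε f F) :
    HasBoundedDerivs ζ H V ε f := by
  have h := hasBoundedDerivs_liftCoeff hs hσ hV hf hF hD ∅ 0 (indicesJ_empty.2 rfl)
  have : liftCoeff A f F ∅ 0 = f := funext fun z => by rw [liftCoeff, if_neg (by simp)]
  rwa [this] at h

end Developable

/-! ### Boundary values along the actions -/

section Scale

variable {L p r : ℕ} {n : Option (Fin L ⊕ Fin r) → ℕ}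
  {A : Matrix (Fin L ⊕ Fin p) (Fin L ⊕ Fin r) ℚ} {ζ : (k : Fin L ⊕ Fin r) → Fin (n (some k)) → ℂ}
  {H : Finset (PairT L r)} {V V' : (k : Fin L ⊕ Fin r) → Set (Fin (n (some k)) → ℂ)}
  {ε ε' : Radii L r} {σ : ℚ}

/-- The action of `μ_j` for all `j ∈ J` with the same parameter `s^σ`, so that all exponents are
natural numbers. For `s = 0` it is the projection to `Z_J`, seen as a subspace of `X`. -/
def scaleSet (A : Matrix (Fin L ⊕ Fin p) (Fin L ⊕ Fin r) ℚ) (σ : ℚ) (J : Finset (Fin L ⊕ Fin p))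
    (s : ℝ) (z : Space n) : Space n :=
  fun b => s ^ (∑ j ∈ J, natWeight A σ j b) • z b

lemma scaleSet_mem (hs : Admissible A ζ H) (hσ : IsScale A σ) (hV : IsConeAt ζ V) (hε : ε.Pos H)
    (J : Finset (Fin L ⊕ Fin p)) {s : ℝ} (hs0 : 0 < s) (hs1 : s ≤ 1) {z : Space n}
    (hz : z ∈ multicone H V ε) : scaleSet A σ J s z ∈ multicone H V ε := by
  classical
  have hσ0 : (0 : ℝ) < σ := by exact_mod_cast hσ.1
  have h : scaleSet A σ J s z = scaleAct A (fun j => if j ∈ J then s ^ (σ : ℝ) else 1) z := by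
    funext b
    rcases b with _ | k
    · simp [scaleSet, scaleAct, natWeight_none]
    · rw [scaleSet, scaleAct]
      congr 1
      rw [phiVal, ← Finset.prod_pow_eq_pow_sum, ← Finset.prod_subset (Finset.subset_univ J)]
      · refine Finset.prod_congr rfl fun j hj => ?_
        rw [if_pos hj, ← Real.rpow_mul hs0.le, ← Real.rpow_natCast]
        congr 1
        have := natWeight_cast hσ hs.nonneg j (some k)
        rw [weight] at this
        exact_mod_cast congrArg (fun q : ℚ => (q : ℝ)) this
      · intro j _ hj
        rw [if_neg hj, Real.one_rpow]
  rw [h]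
  refine scaleAct_mem hs hV hε (fun j => ?_) (fun j => ?_) hz
  · split_ifs
    exacts [Real.rpow_pos_of_pos hs0 _, one_pos]
  · split_ifs
    exacts [Real.rpow_le_one hs0.le hs1 hσ0.le, le_rfl]

lemma continuous_scaleSet (J : Finset (Fin L ⊕ Fin p)) :
    Continuous fun q : ℝ × Space n => scaleSet A σ J q.1 q.2 := by
  unfold scaleSet
  fun_prop

lemma tendsto_scaleSet (J : Finset (Fin L ⊕ Fin p)) (z : Space n) :
    Tendsto (fun s => scaleSet A σ J s z) (𝓝[>] 0) (𝓝 (scaleSet A σ J 0 z)) := by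
  have h : Continuous fun s : ℝ => scaleSet A σ J s z :=
    (continuous_scaleSet J).comp (Continuous.prodMk_left z)
  exact (h.tendsto 0).mono_left nhdsWithin_le_nhds

lemma scaleSet_empty (s : ℝ) (z : Space n) : scaleSet A σ ∅ s z = z := by
  funext b
  simp [scaleSet]

lemma scaleSet_zero_apply_of_notMem (hσ : IsScale A σ) (hA : ∀ j k, 0 ≤ A j k)
    {J : Finset (Fin L ⊕ Fin p)} {b : Option (Fin L ⊕ Fin r)} (hb : b ∉ KJ A J) (s : ℝ)
    (z : Space n) : scaleSet A σ J s z b = z b := by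
  rw [scaleSet, Finset.sum_eq_zero fun j hj => natWeight_eq_zero_of_notMem hσ hA hb hj, pow_zero,
    one_smul]

lemma scaleSet_zero_apply_of_mem (hσ : IsScale A σ) (hA : ∀ j k, 0 ≤ A j k)
    {J : Finset (Fin L ⊕ Fin p)} {b : Option (Fin L ⊕ Fin r)} (hb : b ∈ KJ A J)
    (z : Space n) : scaleSet A σ J 0 z b = 0 := by
  obtain ⟨k, rfl, j, hj, hjk⟩ := hb
  rw [scaleSet, zero_pow, zero_smul]
  intro h
  rw [Finset.sum_eq_zero_iff] at h
  exact hjk ((natWeight_eq_zero_iff hσ hA j k).1 (h j hj))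

lemma scaleSet_zero_insert [DecidableEq (Fin L ⊕ Fin p)] {J : Finset (Fin L ⊕ Fin p)}
    {j : Fin L ⊕ Fin p} (hj : j ∉ J) (z : Space n) :
    scaleSet A σ J 0 (scaleSet A σ {j} 0 z) = scaleSet A σ (insert j J) 0 z := by
  funext b
  rw [scaleSet, scaleSet, scaleSet, smul_smul, ← pow_add, Finset.sum_singleton,
    Finset.sum_insert hj, add_comm]

lemma scaleSet_zero_eq_of_projJ_eq (hσ : IsScale A σ) (hA : ∀ j k, 0 ≤ A j k)
    {J : Finset (Fin L ⊕ Fin p)} {z w : Space n} (h : projJ A J z = projJ A J w) :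
    scaleSet A σ J 0 z = scaleSet A σ J 0 w := by
  funext b
  by_cases hb : b ∈ KJ A J
  · rw [scaleSet_zero_apply_of_mem hσ hA hb, scaleSet_zero_apply_of_mem hσ hA hb]
  · rw [scaleSet_zero_apply_of_notMem hσ hA hb, scaleSet_zero_apply_of_notMem hσ hA hb]
    exact congrFun h ⟨b, hb⟩

/-- `scaleSet` for a fixed parameter as a linear map. -/
def scaleSetL (A : Matrix (Fin L ⊕ Fin p) (Fin L ⊕ Fin r) ℚ) (σ : ℚ) (J : Finset (Fin L ⊕ Fin p))
    (s : ℝ) : Space n →L[ℂ] Space n :=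
  ContinuousLinearMap.pi fun b =>
    ((s : ℂ) ^ (∑ j ∈ J, natWeight A σ j b)) • ContinuousLinearMap.proj b

lemma scaleSetL_apply (J : Finset (Fin L ⊕ Fin p)) (s : ℝ) (z : Space n) :
    scaleSetL A σ J s z = scaleSet A σ J s z := by
  funext b i
  simp [scaleSetL, scaleSet]

lemma scaleSet_zero_coordVec (hσ : IsScale A σ) (hA : ∀ j k, 0 ≤ A j k)
    (J : Finset (Fin L ⊕ Fin p)) (i : Coord n) :
    scaleSet A σ J 0 (coordVec i) = open Classical in if i.1 ∈ KJ A J then 0 else coordVec i := by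
  classical
  split_ifs with hi
  · funext b
    by_cases hb : b = i.1
    · subst hb
      rw [scaleSet_zero_apply_of_mem hσ hA hi]; rfl
    · rw [scaleSet, coordVec, Pi.single_eq_of_ne hb, smul_zero]; rfl
  · funext b
    by_cases hb : b = i.1
    · subst hb
      rw [scaleSet_zero_apply_of_notMem hσ hA hi]
    · rw [scaleSet, coordVec, Pi.single_eq_of_ne hb, smul_zero]

end Scale

section Extension

variable {L p r : ℕ} {n : Option (Fin L ⊕ Fin r) → ℕ}
  {A : Matrix (Fin L ⊕ Fin p) (Fin L ⊕ Fin r) ℚ} {ζ : (k : Fin L ⊕ Fin r) → Fin (n (some k)) → ℂ}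
  {H : Finset (PairT L r)} {V V' : (k : Fin L ⊕ Fin r) → Set (Fin (n (some k)) → ℂ)}
  {ε ε' : Radii L r} {σ : ℚ} {g h : Space n → ℂ}

/-- `g` is holomorphic on the multicone, and its restrictions to the properly contained multicones
have smooth extensions. -/
def HasSmoothExtensions (ζ : (k : Fin L ⊕ Fin r) → Fin (n (some k)) → ℂ) (H : Finset (PairT L r))
    (V : (k : Fin L ⊕ Fin r) → Set (Fin (n (some k)) → ℂ)) (ε : Radii L r)
    (g : Space n → ℂ) : Prop :=
  DifferentiableOn ℂ g (multicone H V ε) ∧ ∀ V' ε', ProperlyContained H ζ V' ε' V ε →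
    ∃ G : Space n → ℂ, ContDiff ℝ ∞ G ∧ EqOn G g (multicone H V' ε')

lemma fderiv_eq_of_eqOn {U : Set (Space n)} (hU : IsOpen U) {G : Space n → ℂ}
    (hg : DifferentiableOn ℂ g U) (h : EqOn G g U) {z : Space n} (hz : z ∈ U) :
    fderiv ℝ G z = (fderiv ℂ g z).restrictScalars ℝ := by
  rw [((h.eventuallyEq_of_mem (hU.mem_nhds hz)).fderiv_eq),
    (hg.differentiableAt (hU.mem_nhds hz)).fderiv_restrictScalars ℝ]

lemma HasSmoothExtensions.partialD (hs : Admissible A ζ H) (hV : IsConeAt ζ V)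
    (h : HasSmoothExtensions ζ H V ε g) (i : Coord n) :
    HasSmoothExtensions ζ H V ε (MultiAsymptotics.partialD i g) := by
  refine ⟨differentiableOn_partialD (isOpen_multicone hs hV) h.1 i, fun V' ε' hpc => ?_⟩
  obtain ⟨G, hG, hGg⟩ := h.2 V' ε' hpc
  refine ⟨fun z => fderiv ℝ G z (coordVec i),
    (hG.fderiv_right (m := ∞) (by simp)).clm_apply contDiff_const, fun z hz => ?_⟩
  simp only
  rw [fderiv_eq_of_eqOn (isOpen_multicone hs hpc.1) (h.1.mono (hpc.subset hV)) hGg hz]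
  rfl

lemma HasSmoothExtensions.iterPartialD (hs : Admissible A ζ H) (hV : IsConeAt ζ V)
    (h : HasSmoothExtensions ζ H V ε g) (l : List (Coord n)) :
    HasSmoothExtensions ζ H V ε (MultiAsymptotics.iterPartialD l g) := by
  induction l with
  | nil => exact h
  | cons i l ih => exact ih.partialD hs hV i

lemma HasSmoothExtensions.exists_bound (hs : Admissible A ζ H)
    (h : HasSmoothExtensions ζ H V ε g) (hpc : ProperlyContained H ζ V' ε' V ε) :
    ∃ C, ∀ z ∈ multicone H V' ε', ‖g z‖ ≤ C := by
  obtain ⟨G, hG, hGg⟩ := h.2 V' ε' hpc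
  have hb : Bornology.IsBounded (multicone H V' ε') := isBounded_multicone hs hpc.1
  obtain ⟨C, hC⟩ := hb.isCompact_closure.exists_bound_of_continuousOn hG.continuous.continuousOn
  exact ⟨C, fun z hz => hGg hz ▸ hC z (subset_closure hz)⟩

/-- The boundary value on `Z_J` of `g`, as a function on `X`. -/
def bdryValue (A : Matrix (Fin L ⊕ Fin p) (Fin L ⊕ Fin r) ℚ) (σ : ℚ) (g : Space n → ℂ)
    (J : Finset (Fin L ⊕ Fin p)) (z : Space n) : ℂ :=
  limUnder (𝓝[>] (0 : ℝ)) fun s => g (scaleSet A σ J s z)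

lemma bdryValue_eq (hs : Admissible A ζ H) (hσ : IsScale A σ)
    (hpc : ProperlyContained H ζ V' ε' V ε) {G : Space n → ℂ} (hG : Continuous G)
    (hGg : EqOn G g (multicone H V' ε')) (J : Finset (Fin L ⊕ Fin p)) {z : Space n}
    (hz : z ∈ multicone H V' ε') : bdryValue A σ g J z = G (scaleSet A σ J 0 z) := by
  refine Tendsto.limUnder_eq (((hG.tendsto _).comp (tendsto_scaleSet J z)).congr' ?_)
  filter_upwards [Ioo_mem_nhdsGT (zero_lt_one' ℝ)] with s hs'
  exact hGg (scaleSet_mem hs hσ hpc.1 hpc.2.1 J hs'.1 hs'.2.le hz)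

lemma bdryValue_congr (hs : Admissible A ζ H) (hσ : IsScale A σ) (hV : IsConeAt ζ V)
    (hε : ε.Pos H) (hgh : EqOn g h (multicone H V ε)) (J : Finset (Fin L ⊕ Fin p)) {z : Space n}
    (hz : z ∈ multicone H V ε) : bdryValue A σ g J z = bdryValue A σ h J z := by
  rw [bdryValue, bdryValue, limUnder, limUnder]
  congr 1
  refine Filter.map_congr ?_
  filter_upwards [Ioo_mem_nhdsGT (zero_lt_one' ℝ)] with s hs'
  exact hgh (scaleSet_mem hs hσ hV hε J hs'.1 hs'.2.le hz)

lemma bdryValue_eq_of_projJ_eq (hs : Admissible A ζ H) (hσ : IsScale A σ) (hV : IsConeAt ζ V)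
    (hε : ε.Pos H) (hg : HasSmoothExtensions ζ H V ε g) {J : Finset (Fin L ⊕ Fin p)}
    {z w : Space n} (hz : z ∈ multicone H V ε) (hw : w ∈ multicone H V ε)
    (h : projJ A J z = projJ A J w) : bdryValue A σ g J z = bdryValue A σ g J w := by
  obtain ⟨V', ε', hpc, hz', hw'⟩ := exists_properlyContained_of_mem hV hε hz hw
  obtain ⟨G, hG, hGg⟩ := hg.2 V' ε' hpc
  rw [bdryValue_eq hs hσ hpc hG.continuous hGg J hz', bdryValue_eq hs hσ hpc hG.continuous hGg J hw',
    scaleSet_zero_eq_of_projJ_eq hσ hs.nonneg h]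

/-- Boundary values may be taken successively. -/
lemma tendsto_bdryValue_scaleSet [DecidableEq (Fin L ⊕ Fin p)] (hs : Admissible A ζ H)
    (hσ : IsScale A σ) (hV : IsConeAt ζ V)
    (hε : ε.Pos H) (hg : HasSmoothExtensions ζ H V ε g) {J : Finset (Fin L ⊕ Fin p)}
    {j : Fin L ⊕ Fin p} (hj : j ∉ J) {z : Space n} (hz : z ∈ multicone H V ε) :
    Tendsto (fun s => bdryValue A σ g J (scaleSet A σ {j} s z)) (𝓝[>] 0)
      (𝓝 (bdryValue A σ g (insert j J) z)) := by
  obtain ⟨V', ε', hpc, hz', -⟩ := exists_properlyContained_of_mem hV hε hz hz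
  obtain ⟨G, hG, hGg⟩ := hg.2 V' ε' hpc
  rw [bdryValue_eq hs hσ hpc hG.continuous hGg _ hz', ← scaleSet_zero_insert hj]
  have hc : Continuous fun w : Space n => G (scaleSet A σ J 0 w) :=
    hG.continuous.comp ((continuous_scaleSet J).comp (Continuous.prodMk_right 0))
  refine ((hc.tendsto _).comp (tendsto_scaleSet {j} z)).congr' ?_
  filter_upwards [Ioo_mem_nhdsGT (zero_lt_one' ℝ)] with s hs'
  exact (bdryValue_eq hs hσ hpc hG.continuous hGg J
    (scaleSet_mem hs hσ hpc.1 hpc.2.1 {j} hs'.1 hs'.2.le hz')).symm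

lemma bdryValue_empty (z : Space n) : bdryValue A σ g ∅ z = g z := by
  rw [bdryValue]
  simp only [scaleSet_empty]
  exact tendsto_const_nhds.limUnder_eq

/-- The boundary values are holomorphic, since the derivative of a smooth extension remains complex
linear in the limit. -/
lemma differentiableAt_bdryValue (hs : Admissible A ζ H) (hσ : IsScale A σ) (hV : IsConeAt ζ V)
    (hε : ε.Pos H) (hg : HasSmoothExtensions ζ H V ε g) (J : Finset (Fin L ⊕ Fin p)) {z : Space n}
    (hz : z ∈ multicone H V ε) : DifferentiableAt ℂ (bdryValue A σ g J) z ∧ ∀ i,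
      partialD i (bdryValue A σ g J) z =
        open Classical in if i.1 ∈ KJ A J then 0 else bdryValue A σ (partialD i g) J z := by
  classical
  obtain ⟨V', ε', hpc, hz', -⟩ := exists_properlyContained_of_mem hV hε hz hz
  obtain ⟨G, hG, hGg⟩ := hg.2 V' ε' hpc
  have hU : IsOpen (multicone H V' ε') := isOpen_multicone hs hpc.1
  have hG1 : ContDiff ℝ ∞ (fderiv ℝ G) := hG.fderiv_right (m := ∞) (by simp)
  have hgU := hg.1.mono (hpc.subset hV)
  have heq : ∀ w ∈ multicone H V' ε', bdryValue A σ g J w = G (scaleSetL A σ J 0 w) := fun w hw => by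
    rw [bdryValue_eq hs hσ hpc hG.continuous hGg J hw, scaleSetL_apply]
  have hlim : ∀ v, Tendsto (fun s => fderiv ℂ g (scaleSet A σ J s z) v) (𝓝[>] 0)
      (𝓝 (fderiv ℝ G (scaleSet A σ J 0 z) v)) := by
    intro v
    have hc : Continuous fun w => fderiv ℝ G w v := (hG1.clm_apply contDiff_const).continuous
    refine ((hc.tendsto _).comp (tendsto_scaleSet J z)).congr' ?_
    filter_upwards [Ioo_mem_nhdsGT (zero_lt_one' ℝ)] with s hs'
    rw [Function.comp_apply, fderiv_eq_of_eqOn hU hgU hGg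
      (scaleSet_mem hs hσ hpc.1 hpc.2.1 J hs'.1 hs'.2.le hz')]
    rfl
  have hlin : ∀ (c : ℂ) v, fderiv ℝ G (scaleSet A σ J 0 z) (c • v)
      = c • fderiv ℝ G (scaleSet A σ J 0 z) v := by
    intro c v
    refine tendsto_nhds_unique (hlim (c • v)) ?_
    simpa only [map_smul] using (hlim v).const_smul c
  let D : Space n →L[ℂ] ℂ :=
    { toFun := fderiv ℝ G (scaleSet A σ J 0 z)
      map_add' := map_add _
      map_smul' := hlin
      cont := (fderiv ℝ G (scaleSet A σ J 0 z)).continuous }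
  have hD : HasFDerivAt G D (scaleSetL A σ J 0 z) := by
    rw [scaleSetL_apply]
    exact hasFDerivAt_of_restrictScalars ℝ
      ((hG.differentiable (by simp) _).hasFDerivAt) (by ext v; rfl)
  have hcomp := hD.comp z (scaleSetL A σ J 0).hasFDerivAt
  have hfd : HasFDerivAt (bdryValue A σ g J) (D.comp (scaleSetL A σ J 0)) z :=
    hcomp.congr_of_eventuallyEq (by
      filter_upwards [hU.mem_nhds hz'] with w hw
      exact heq w hw)
  refine ⟨hfd.differentiableAt, fun i => ?_⟩
  change fderiv ℂ (bdryValue A σ g J) z (coordVec i) = _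
  rw [hfd.fderiv, ContinuousLinearMap.comp_apply, scaleSetL_apply,
    scaleSet_zero_coordVec hσ hs.nonneg]
  split_ifs with hi
  · rw [map_zero]
  · exact (hlim (coordVec i)).limUnder_eq.symm

lemma HasSmoothExtensions.differentiableOn_bdryValue (hs : Admissible A ζ H) (hσ : IsScale A σ) (hV : IsConeAt ζ V)
    (hε : ε.Pos H) (hg : HasSmoothExtensions ζ H V ε g) (J : Finset (Fin L ⊕ Fin p)) :
    DifferentiableOn ℂ (bdryValue A σ g J) (multicone H V ε) :=
  fun _ hz => (differentiableAt_bdryValue hs hσ hV hε hg J hz).1.differentiableWithinAt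

end Extension

/-! ### Flat functions -/

section Flat

variable {L p r : ℕ} {n : Option (Fin L ⊕ Fin r) → ℕ}
  {A : Matrix (Fin L ⊕ Fin p) (Fin L ⊕ Fin r) ℚ} {σ : ℚ} {Ω : Set (Space n)}

lemma pow_add_tsub_le {x c : ℝ} (hx : 0 ≤ x) (hxc : x ≤ c) (hc : 1 ≤ c) (e m : ℕ) :
    x ^ e * x ^ (m - e) ≤ c ^ e * x ^ m := by
  rcases le_total e m with h | h
  · rw [← pow_add, Nat.add_sub_cancel' h]
    exact le_mul_of_one_le_left (pow_nonneg hx _) (one_le_pow₀ hc)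
  · rw [Nat.sub_eq_zero_of_le h, pow_zero, mul_one]
    obtain ⟨d, rfl⟩ := Nat.exists_eq_add_of_le h
    rw [pow_add, mul_comm]
    refine mul_le_mul_of_nonneg_right ?_ (pow_nonneg hx _)
    exact (pow_le_pow_left₀ hx hxc d).trans (pow_le_pow_right₀ hc (Nat.le_add_left _ _))

lemma hasDerivAt_scaleSet (j : Fin L ⊕ Fin p) (z : Space n) (s : ℝ) :
    HasDerivAt (fun s : ℝ => scaleSet A σ {j} s z)
      (fun b => ((natWeight A σ j b : ℝ) * s ^ (natWeight A σ j b - 1)) • z b) s := by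
  rw [hasDerivAt_pi]
  intro b
  simp only [scaleSet, Finset.sum_singleton]
  exact (hasDerivAt_pow _ s).smul_const (z b)

/-- A function whose derivatives of weight less than `N_j` tend to `0` along the action `μ_j`, for
each `j`, is bounded by a multiple of `∏_j ρ_j^{N_j}` on the polydiscs of radii `∏_j ρ_j^{σ a_{jk}}`:
one integrates successively along the orbits. -/
theorem exists_bound_of_flat (hΩ : IsOpen Ω)
    (hst : ∀ j, ∀ s : ℝ, 0 < s → s ≤ 1 → ∀ z ∈ Ω, scaleSet A σ {j} s z ∈ Ω)
    {C₀ C₁ : ℝ} (hC₀ : 0 ≤ C₀) (hC₁ : 1 ≤ C₁) (N : Fin L ⊕ Fin p → ℕ) {Ψ : Space n → ℂ}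
    (hΨ : DifferentiableOn ℂ Ψ Ω) (hb : ∀ l, ∃ B, ∀ z ∈ Ω, ‖iterPartialD l Ψ z‖ ≤ B)
    (hflat : ∀ l j, deg A σ j (idxOf l) < N j → ∀ z ∈ Ω,
      Tendsto (fun s => iterPartialD l Ψ (scaleSet A σ {j} s z)) (𝓝[>] 0) (𝓝 0)) :
    ∃ C, 0 ≤ C ∧ ∀ ρ : Fin L ⊕ Fin p → ℝ, (∀ j, 0 ≤ ρ j) → (∀ j, ρ j ≤ C₁) → ∀ z ∈ Ω,
      (∀ b, ‖z b‖ ≤ C₀ * ∏ j, ρ j ^ natWeight A σ j b) → ‖Ψ z‖ ≤ C * ∏ j, ρ j ^ N j := by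
  induction hN : ∑ j, N j using Nat.strong_induction_on generalizing N Ψ with
  | _ c ih =>
  by_cases h0 : ∀ j, N j = 0
  · obtain ⟨B, hB⟩ := hb []
    refine ⟨|B|, abs_nonneg B, fun ρ _ _ z hz _ => ?_⟩
    simp only [h0, pow_zero, Finset.prod_const_one, mul_one]
    exact (hB z hz).trans (le_abs_self B)
  push Not at h0
  obtain ⟨j, hj⟩ := h0
  -- the induction hypothesis for the derivatives which occur in `d/ds Ψ(μ_j(s) z)`
  have hex : ∀ i : Coord n, ∃ C, 0 ≤ C ∧ (natWeight A σ j i.1 ≠ 0 →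
      ∀ ρ : Fin L ⊕ Fin p → ℝ, (∀ j, 0 ≤ ρ j) → (∀ j, ρ j ≤ C₁) → ∀ z ∈ Ω,
      (∀ b, ‖z b‖ ≤ C₀ * ∏ j, ρ j ^ natWeight A σ j b) →
        ‖partialD i Ψ z‖ ≤ C * ∏ k, ρ k ^ (N k - natWeight A σ k i.1)) := by
    intro i
    by_cases hi : natWeight A σ j i.1 = 0
    · exact ⟨0, le_rfl, fun h => absurd hi h⟩
    have happ : ∀ l, iterPartialD l (partialD i Ψ) = iterPartialD (l ++ [i]) Ψ := fun l => by
      rw [iterPartialD_append, iterPartialD_singleton]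
    obtain ⟨C, hC, h⟩ := ih (∑ k, (N k - natWeight A σ k i.1)) (by
        rw [← hN]
        refine Finset.sum_lt_sum (fun k _ => Nat.sub_le _ _) ⟨j, Finset.mem_univ j, ?_⟩
        omega) (fun k => N k - natWeight A σ k i.1) (differentiableOn_partialD hΩ hΨ i)
      (fun l => by rw [happ]; exact hb _) (fun l k hk => by
        rw [happ]
        refine hflat _ k ?_
        rw [idxOf_append, deg_add, deg_idxOf_cons, idxOf_nil, deg, deg, wdeg_zero]
        rw [deg] at hk
        omega) rfl
    exact ⟨C, hC, fun _ => h⟩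
  choose C hC hCb using hex
  set K : ℝ := ∑ i : Coord n, (natWeight A σ j i.1 : ℝ) * (C₀ * C i *
    ∏ k, C₁ ^ natWeight A σ k i.1) with hK
  have hK0 : 0 ≤ K := Finset.sum_nonneg fun i _ => mul_nonneg (Nat.cast_nonneg _)
    (mul_nonneg (mul_nonneg hC₀ (hC i)) (Finset.prod_nonneg fun k _ => by positivity))
  refine ⟨K, hK0, fun ρ hρ0 hρ1 z hz hzb => ?_⟩
  have hP0 : 0 ≤ ∏ k, ρ k ^ N k := Finset.prod_nonneg fun k _ => pow_nonneg (hρ0 k) _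
  have hderiv : ∀ s ∈ Ioc (0 : ℝ) 1, HasDerivWithinAt (fun s => Ψ (scaleSet A σ {j} s z))
      (fderiv ℂ Ψ (scaleSet A σ {j} s z)
        (fun b => ((natWeight A σ j b : ℝ) * s ^ (natWeight A σ j b - 1)) • z b)) (Ioc 0 1) s := by
    intro s hs
    have h1 := (hΨ.differentiableAt (hΩ.mem_nhds (hst j s hs.1 hs.2 z hz))).hasFDerivAt
    exact ((h1.restrictScalars ℝ).comp_hasDerivAt s (hasDerivAt_scaleSet j z s)).hasDerivWithinAt
  have hbound : ∀ s ∈ Ioc (0 : ℝ) 1, ‖fderiv ℂ Ψ (scaleSet A σ {j} s z)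
        (fun b => ((natWeight A σ j b : ℝ) * s ^ (natWeight A σ j b - 1)) • z b)‖
      ≤ K * ∏ k, ρ k ^ N k := by
    intro s hs
    rw [fderiv_eq_sum_partialD, hK, Finset.sum_mul]
    refine (norm_sum_le _ _).trans (Finset.sum_le_sum fun i _ => ?_)
    rw [norm_mul, Pi.smul_apply, norm_smul, norm_mul, norm_pow, Real.norm_natCast,
      Real.norm_of_nonneg hs.1.le]
    by_cases hi : natWeight A σ j i.1 = 0
    · simp [hi]
    have hsz : ∀ b, ‖scaleSet A σ {j} s z b‖ ≤ C₀ * ∏ j, ρ j ^ natWeight A σ j b := by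
      intro b
      refine le_trans ?_ (hzb b)
      rw [scaleSet, norm_smul, norm_pow, Real.norm_of_nonneg hs.1.le]
      exact mul_le_of_le_one_left (norm_nonneg _) (pow_le_one₀ hs.1.le hs.2)
    have h1 := hCb i hi ρ hρ0 hρ1 _ (hst j s hs.1 hs.2 z hz) hsz
    have h2 : ‖z i.1 i.2‖ ≤ C₀ * ∏ j, ρ j ^ natWeight A σ j i.1 :=
      (norm_le_pi_norm (z i.1) i.2).trans (hzb i.1)
    have hs1 : s ^ (natWeight A σ j i.1 - 1) ≤ 1 := pow_le_one₀ hs.1.le hs.2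
    have hQ0 : 0 ≤ ∏ k, ρ k ^ natWeight A σ k i.1 :=
      Finset.prod_nonneg fun k _ => pow_nonneg (hρ0 k) _
    calc (natWeight A σ j i.1 : ℝ) * s ^ (natWeight A σ j i.1 - 1) * ‖z i.1 i.2‖
          * ‖partialD i Ψ (scaleSet A σ {j} s z)‖
        ≤ (natWeight A σ j i.1 : ℝ) * 1 * (C₀ * ∏ j, ρ j ^ natWeight A σ j i.1)
          * (C i * ∏ k, ρ k ^ (N k - natWeight A σ k i.1)) := by
          gcongr
      _ = (natWeight A σ j i.1 : ℝ) * (C₀ * C i *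
          ∏ k, (ρ k ^ natWeight A σ k i.1 * ρ k ^ (N k - natWeight A σ k i.1))) := by
          rw [Finset.prod_mul_distrib]
          ring
      _ ≤ (natWeight A σ j i.1 : ℝ) * (C₀ * C i *
          ∏ k, (C₁ ^ natWeight A σ k i.1 * ρ k ^ N k)) := by
          refine mul_le_mul_of_nonneg_left (mul_le_mul_of_nonneg_left (Finset.prod_le_prod
            (fun k _ => mul_nonneg (pow_nonneg (hρ0 k) _) (pow_nonneg (hρ0 k) _))
            fun k _ => pow_add_tsub_le (hρ0 k) (hρ1 k) hC₁ _ _) (mul_nonneg hC₀ (hC i)))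
            (Nat.cast_nonneg _)
      _ = _ := by
          rw [Finset.prod_mul_distrib]
          ring
  have hone : scaleSet A σ {j} 1 z = z := by
    funext b
    simp [scaleSet]
  have hlim := hflat [] j (by
    rw [idxOf_nil, deg, wdeg_zero]
    exact Nat.pos_of_ne_zero hj) z hz
  have hlim2 := (tendsto_const_nhds (x := Ψ z)).sub hlim
  rw [sub_zero] at hlim2
  refine le_of_tendsto hlim2.norm ?_
  filter_upwards [Ioo_mem_nhdsGT (zero_lt_one' ℝ)] with s hs
  have hmv := (convex_Ioc (0 : ℝ) 1).norm_image_sub_le_of_norm_hasDerivWithin_le hderiv hbound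
    ⟨hs.1, hs.2.le⟩ ⟨zero_lt_one, le_rfl⟩
  rw [hone] at hmv
  refine hmv.trans (mul_le_of_le_one_right (mul_nonneg hK0 hP0) ?_)
  rw [Real.norm_of_nonneg (by linarith [hs.2])]
  linarith [hs.1]

end Flat

/-! ### The expansion attached to smooth extensions -/

section Expansion

variable {L p r : ℕ} {n : Option (Fin L ⊕ Fin r) → ℕ}
  {A : Matrix (Fin L ⊕ Fin p) (Fin L ⊕ Fin r) ℚ} {ζ : (k : Fin L ⊕ Fin r) → Fin (n (some k)) → ℂ}
  {H : Finset (PairT L r)} {V V' : (k : Fin L ⊕ Fin r) → Set (Fin (n (some k)) → ℂ)}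
  {ε ε' : Radii L r} {σ : ℚ} {g h : Space n → ℂ}

/-- The Taylor polynomial of `g` along `Z_J` truncated at the weights `N`, with the derivative
`∂^α g` restricted to `Z_J` as its coefficients. -/
def taylorTerm (hA : ∀ j k, 0 ≤ A j k) (σ : ℚ) (N : Fin L ⊕ Fin p → ℕ)
    (J : Finset (Fin L ⊕ Fin p)) (g : Space n → ℂ) (z : Space n) : ℂ :=
  ∑ α ∈ below n hA σ J N, bdryValue A σ (iterPartialD (listOf α) g) J z * divMono α z

/-- The alternating sum of the Taylor polynomials; the one for `J = ∅` is `g` itself. -/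
def taylorRemainder (hA : ∀ j k, 0 ≤ A j k) (σ : ℚ) (N : Fin L ⊕ Fin p → ℕ) (g : Space n → ℂ)
    (z : Space n) : ℂ :=
  ∑ J : Finset (Fin L ⊕ Fin p), (-1) ^ J.card * taylorTerm hA σ N J g z

lemma differentiableOn_taylorTerm (hs : Admissible A ζ H) (hσ : IsScale A σ) (hV : IsConeAt ζ V)
    (hε : ε.Pos H) (hg : HasSmoothExtensions ζ H V ε g) (N : Fin L ⊕ Fin p → ℕ)
    (J : Finset (Fin L ⊕ Fin p)) :
    DifferentiableOn ℂ (taylorTerm hs.nonneg σ N J g) (multicone H V ε) :=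
  DifferentiableOn.fun_sum fun α _ =>
    ((hg.iterPartialD hs hV (listOf α)).differentiableOn_bdryValue hs hσ hV hε J).mul
      (differentiable_divMono α).differentiableOn

/-- Partial derivatives only depend on the multi-index, since they commute. -/
lemma iterPartialD_eq_of_idxOf_eq {U : Set (Space n)} (hU : IsOpen U) (hg : DifferentiableOn ℂ g U)
    {l l' : List (Coord n)} (h : idxOf l = idxOf l') :
    EqOn (iterPartialD l g) (iterPartialD l' g) U :=
  iterPartialD_perm hU hg (perm_of_idxOf_eq h)

/-- Differentiation of a Taylor polynomial lowers the truncation by the weights of the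
coordinate. -/
lemma partialD_taylorTerm (hs : Admissible A ζ H) (hσ : IsScale A σ) (hV : IsConeAt ζ V)
    (hε : ε.Pos H) (hg : HasSmoothExtensions ζ H V ε g) (N : Fin L ⊕ Fin p → ℕ)
    (J : Finset (Fin L ⊕ Fin p)) (i : Coord n) :
    EqOn (partialD i (taylorTerm hs.nonneg σ N J g))
      (taylorTerm hs.nonneg σ (fun j => N j - natWeight A σ j i.1) J (partialD i g))
      (multicone H V ε) := by
  classical
  intro z hz
  have hA := hs.nonneg
  have hU : IsOpen (multicone (n := n) H V ε) := isOpen_multicone hs hV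
  have hbd : ∀ α : MultiIndex n, DifferentiableOn ℂ
      (bdryValue A σ (iterPartialD (listOf α) g) J) (multicone H V ε) := fun α =>
    (hg.iterPartialD hs hV (listOf α)).differentiableOn_bdryValue hs hσ hV hε J
  have hmd : ∀ α : MultiIndex n, DifferentiableOn ℂ (divMono α) (multicone H V ε) := fun α =>
    (differentiable_divMono α).differentiableOn
  have hsum : partialD i (taylorTerm hA σ N J g) z = ∑ α ∈ below n hA σ J N,
      (bdryValue A σ (iterPartialD (listOf α) g) J z * partialD i (divMono α) z +
        partialD i (bdryValue A σ (iterPartialD (listOf α) g) J) z * divMono α z) := by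
    have h1 := partialD_sum (s := below n hA σ J N) (f := fun α z =>
      bdryValue A σ (iterPartialD (listOf α) g) J z * divMono α z) hU
      (fun α _ => (hbd α).mul (hmd α)) i hz
    refine h1.trans (Finset.sum_congr rfl fun α _ => ?_)
    exact partialD_mul hU (hbd α) (hmd α) i hz
  rw [hsum, taylorTerm]
  by_cases hi : i.1 ∈ KJ A J
  · have h0 : ∀ α : MultiIndex n, partialD i (bdryValue A σ (iterPartialD (listOf α) g) J) z = 0 :=
      fun α => by
        rw [(differentiableAt_bdryValue hs hσ hV hε (hg.iterPartialD hs hV _) J hz).2 i, if_pos hi]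
    simp only [h0, zero_mul, add_zero]
    rw [sum_partialD_divMono (fun α => bdryValue A σ (iterPartialD (listOf α) g) J z)
      (t := below n hA σ J fun j => N j - natWeight A σ j i.1) i]
    · refine Finset.sum_congr rfl fun β _ => ?_
      congr 1
      refine bdryValue_congr hs hσ hV hε ?_ J hz
      rw [← iterPartialD_singleton, ← iterPartialD_append]
      refine iterPartialD_eq_of_idxOf_eq hU hg.1 ?_
      rw [idxOf_append, idxOf_listOf, idxOf_listOf, idxOf_cons, idxOf_nil, zero_add]
    · intro β
      rw [mem_below hσ hA, mem_below hσ hA]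
      refine and_congr ⟨fun h b hb => ?_, fun h b hb => ?_⟩ (forall₂_congr fun j _ => ?_)
      · have hbi : b ≠ i.1 := fun e => hb (e ▸ hi)
        rw [Pi.add_apply, h b hb, zero_add]
        funext k
        rw [unitIdx_apply i ⟨b, k⟩, if_neg fun e => hbi (congrArg Sigma.fst e)]
        rfl
      · exact (add_eq_zero.1 (h b hb)).1
      · rw [deg_add, deg_unitIdx]
        omega
  · have h0 : ∀ α ∈ below n hA σ J N, partialD i (divMono α) z = 0 := by
      intro α hα
      have := congrFun (((mem_below hσ hA).1 hα).1 i.1 hi) i.2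
      rw [partialD_divMono, if_pos (by exact this)]
    have hset : below n hA σ J (fun j => N j - natWeight A σ j i.1) = below n hA σ J N := by
      ext α
      rw [mem_below hσ hA, mem_below hσ hA]
      refine and_congr Iff.rfl (forall₂_congr fun j hj => ?_)
      rw [natWeight_eq_zero_of_notMem hσ hA hi hj, Nat.sub_zero]
    rw [hset]
    refine Finset.sum_congr rfl fun α hα => ?_
    rw [h0 α hα, mul_zero, zero_add,
      (differentiableAt_bdryValue hs hσ hV hε (hg.iterPartialD hs hV _) J hz).2 i, if_neg hi]
    congr 1
    refine bdryValue_congr hs hσ hV hε ?_ J hz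
    rw [← iterPartialD_singleton, ← iterPartialD_singleton, ← iterPartialD_append,
      ← iterPartialD_append]
    refine iterPartialD_eq_of_idxOf_eq hU hg.1 ?_
    rw [idxOf_append, idxOf_append, add_comm]

lemma differentiableOn_taylorRemainder (hs : Admissible A ζ H) (hσ : IsScale A σ)
    (hV : IsConeAt ζ V) (hε : ε.Pos H) (hg : HasSmoothExtensions ζ H V ε g)
    (N : Fin L ⊕ Fin p → ℕ) :
    DifferentiableOn ℂ (taylorRemainder hs.nonneg σ N g) (multicone H V ε) :=
  DifferentiableOn.fun_sum fun J _ =>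
    (differentiableOn_taylorTerm hs hσ hV hε hg N J).const_mul _

lemma iterPartialD_taylorRemainder (hs : Admissible A ζ H) (hσ : IsScale A σ) (hV : IsConeAt ζ V)
    (hε : ε.Pos H) (hg : HasSmoothExtensions ζ H V ε g) (N : Fin L ⊕ Fin p → ℕ)
    (l : List (Coord n)) :
    EqOn (iterPartialD l (taylorRemainder hs.nonneg σ N g))
      (taylorRemainder hs.nonneg σ (fun j => N j - deg A σ j (idxOf l)) (iterPartialD l g))
      (multicone H V ε) := by
  have hU : IsOpen (multicone (n := n) H V ε) := isOpen_multicone hs hV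
  induction l with
  | nil =>
    intro z _
    simp only [idxOf_nil, deg, wdeg_zero, Nat.sub_zero]
    rfl
  | cons i l ih =>
    intro z hz
    have hgl := hg.iterPartialD hs hV l
    set M : Fin L ⊕ Fin p → ℕ := fun j => N j - deg A σ j (idxOf l)
    have h1 := partialD_sum (s := Finset.univ) (f := fun (J : Finset (Fin L ⊕ Fin p)) z =>
      (-1) ^ J.card * taylorTerm hs.nonneg σ M J (iterPartialD l g) z) hU
      (fun J _ => (differentiableOn_taylorTerm hs hσ hV hε hgl M J).const_mul _) i hz
    refine (partialD_congr hU ih i hz).trans (h1.trans (Finset.sum_congr rfl fun J _ => ?_))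
    have h2 := partialD_const_mul hU (differentiableOn_taylorTerm hs hσ hV hε hgl M J)
      ((-1) ^ J.card) i hz
    refine h2.trans ?_
    beta_reduce
    rw [partialD_taylorTerm hs hσ hV hε hgl M J i hz]
    have h3 : (fun j => M j - natWeight A σ j i.1)
        = fun j => N j - deg A σ j (idxOf (i :: l)) := by
      funext j
      rw [deg_idxOf_cons, Nat.sub_add_eq]
    rw [h3]
    rfl

lemma divMono_scaleSet_zero_eq_zero
    {j : Fin L ⊕ Fin p} {α : MultiIndex n} (h : deg A σ j α ≠ 0) (z : Space n) :
    divMono α (scaleSet A σ {j} 0 z) = 0 := by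
  rw [deg, wdeg, Ne, Finset.sum_eq_zero_iff] at h
  push Not at h
  obtain ⟨i, -, hi⟩ := h
  rw [smul_eq_mul, mul_ne_zero_iff] at hi
  rw [divMono]
  refine Finset.prod_eq_zero (Finset.mem_univ i) ?_
  have h0 : scaleSet A σ {j} 0 z i.1 = 0 := by
    rw [scaleSet, Finset.sum_singleton, zero_pow hi.2, zero_smul]
  rw [h0]
  simp [hi.1]

/-- In the limit along the action `μ_j` the terms for `J` and `J ∪ {j}` agree. -/
lemma exists_tendsto_taylorTerm [DecidableEq (Fin L ⊕ Fin p)] (hs : Admissible A ζ H)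
    (hσ : IsScale A σ) (hV : IsConeAt ζ V) (hε : ε.Pos H) (hg : HasSmoothExtensions ζ H V ε g)
    {N : Fin L ⊕ Fin p → ℕ} {J : Finset (Fin L ⊕ Fin p)} {j : Fin L ⊕ Fin p} (hj : j ∉ J)
    (hN : 0 < N j) {z : Space n} (hz : z ∈ multicone H V ε) : ∃ v,
      Tendsto (fun s => taylorTerm hs.nonneg σ N J g (scaleSet A σ {j} s z)) (𝓝[>] 0) (𝓝 v) ∧
      Tendsto (fun s => taylorTerm hs.nonneg σ N (insert j J) g (scaleSet A σ {j} s z)) (𝓝[>] 0)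
        (𝓝 v) := by
  have hA := hs.nonneg
  set c : MultiIndex n → ℂ := fun α => bdryValue A σ (iterPartialD (listOf α) g) (insert j J) z *
    divMono α (scaleSet A σ {j} 0 z) with hc
  have hmono : ∀ α : MultiIndex n, Tendsto (fun s => divMono α (scaleSet A σ {j} s z)) (𝓝[>] 0)
      (𝓝 (divMono α (scaleSet A σ {j} 0 z))) := fun α =>
    ((differentiable_divMono α).continuous.tendsto _).comp (tendsto_scaleSet {j} z)
  have h1 : Tendsto (fun s => taylorTerm hA σ N J g (scaleSet A σ {j} s z)) (𝓝[>] 0)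
      (𝓝 (∑ α ∈ below n hA σ J N, c α)) :=
    tendsto_finsetSum _ fun α _ => (tendsto_bdryValue_scaleSet hs hσ hV hε
      (hg.iterPartialD hs hV _) hj hz).mul (hmono α)
  have h2 : Tendsto (fun s => taylorTerm hA σ N (insert j J) g (scaleSet A σ {j} s z)) (𝓝[>] 0)
      (𝓝 (∑ α ∈ below n hA σ (insert j J) N, c α)) := by
    refine tendsto_finsetSum _ fun α _ => Tendsto.mul ?_ (hmono α)
    refine tendsto_const_nhds.congr' ?_
    filter_upwards [Ioo_mem_nhdsGT (zero_lt_one' ℝ)] with s hs'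
    refine bdryValue_eq_of_projJ_eq hs hσ hV hε (hg.iterPartialD hs hV _) hz
      (scaleSet_mem hs hσ hV hε {j} hs'.1 hs'.2.le hz) ?_
    funext b
    refine (scaleSet_zero_apply_of_notMem hσ hA (fun hb => b.2 ?_) s z).symm
    obtain ⟨k, hk, i, hi, hik⟩ := hb
    exact ⟨k, hk, i, Finset.mem_insert.2 (Or.inl (Finset.mem_singleton.1 hi)), hik⟩
  refine ⟨_, h1, ?_⟩
  have h3 : ∑ α ∈ below n hA σ (insert j J) N, c α = ∑ α ∈ below n hA σ J N, c α := by
    have hc0 : ∀ α : MultiIndex n, c α ≠ 0 → deg A σ j α = 0 := fun α h => by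
      by_contra hd
      exact h (by rw [hc]; simp only; rw [divMono_scaleSet_zero_eq_zero hd, mul_zero])
    rw [← Finset.sum_filter_of_ne (p := fun α => deg A σ j α = 0) fun α _ => hc0 α,
      ← Finset.sum_filter_of_ne (p := fun α => deg A σ j α = 0) (s := below n hA σ J N)
        fun α _ => hc0 α]
    refine Finset.sum_congr ?_ fun _ _ => rfl
    ext α
    rw [Finset.mem_filter, Finset.mem_filter, mem_below hσ hA, mem_below hσ hA]
    constructor
    · rintro ⟨⟨hα, hd⟩, h0⟩
      refine ⟨⟨fun b hb => ?_, fun i hi => hd i (Finset.mem_insert_of_mem hi)⟩, h0⟩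
      by_cases hb' : b ∈ KJ A (insert j J)
      · obtain ⟨k, rfl, i, hi, hik⟩ := hb'
        rcases Finset.mem_insert.1 hi with rfl | hi
        · funext q
          rw [deg, wdeg, Finset.sum_eq_zero_iff] at h0
          have h4 := h0 ⟨some k, q⟩ (Finset.mem_univ _)
          rw [smul_eq_mul, mul_eq_zero, natWeight_eq_zero_iff hσ hA] at h4
          exact h4.resolve_right hik
        · exact absurd ⟨k, rfl, i, hi, hik⟩ hb
      · exact hα b hb'
    · rintro ⟨⟨hα, hd⟩, h0⟩
      refine ⟨⟨fun b hb => hα b fun ⟨k, hk, i, hi, hik⟩ =>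
        hb ⟨k, hk, i, Finset.mem_insert_of_mem hi, hik⟩, fun i hi => ?_⟩, h0⟩
      rcases Finset.mem_insert.1 hi with rfl | hi
      · rw [h0]; exact hN
      · exact hd i hi
  rwa [h3] at h2

/-- The terms for `J` and for `J ∪ {j}` cancel each other in the limit along the action `μ_j`. -/
lemma tendsto_taylorRemainder (hs : Admissible A ζ H) (hσ : IsScale A σ) (hV : IsConeAt ζ V)
    (hε : ε.Pos H) (hg : HasSmoothExtensions ζ H V ε g) {N : Fin L ⊕ Fin p → ℕ}
    {j : Fin L ⊕ Fin p} (hN : 0 < N j) {z : Space n} (hz : z ∈ multicone H V ε) :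
    Tendsto (fun s => taylorRemainder hs.nonneg σ N g (scaleSet A σ {j} s z)) (𝓝[>] 0) (𝓝 0) := by
  classical
  have h1 : ∀ w, taylorRemainder hs.nonneg σ N g w = ∑ J ∈ (Finset.univ.erase j).powerset,
      (-1) ^ J.card * (taylorTerm hs.nonneg σ N J g w
        - taylorTerm hs.nonneg σ N (insert j J) g w) := by
    intro w
    rw [taylorRemainder, ← Finset.powerset_univ, ← Finset.insert_erase (Finset.mem_univ j),
      Finset.sum_powerset_insert (Finset.notMem_erase _ _), ← Finset.sum_add_distrib]
    refine Finset.sum_congr (by rw [Finset.erase_insert (Finset.notMem_erase _ _)]) fun J hJ => ?_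
    have hjJ : j ∉ J := fun h => Finset.notMem_erase j _ (Finset.mem_powerset.1 hJ h)
    rw [Finset.card_insert_of_notMem hjJ, pow_succ]
    ring
  simp only [h1]
  rw [← Finset.sum_const_zero (M := ℂ) (s := (Finset.univ.erase j).powerset)]
  refine tendsto_finsetSum _ fun J hJ => ?_
  have hjJ : j ∉ J := fun h => Finset.notMem_erase j _ (Finset.mem_powerset.1 hJ h)
  obtain ⟨v, hv1, hv2⟩ := exists_tendsto_taylorTerm hs hσ hV hε hg hjJ hN hz
  have := (hv1.sub hv2).const_mul ((-1 : ℂ) ^ J.card)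
  rwa [sub_self, mul_zero] at this

end Expansion

section Expansion

variable {L p r : ℕ} {n : Option (Fin L ⊕ Fin r) → ℕ}
  {A : Matrix (Fin L ⊕ Fin p) (Fin L ⊕ Fin r) ℚ} {ζ : (k : Fin L ⊕ Fin r) → Fin (n (some k)) → ℂ}
  {H : Finset (PairT L r)} {V V' : (k : Fin L ⊕ Fin r) → Set (Fin (n (some k)) → ℂ)}
  {ε ε' : Radii L r} {σ : ℚ} {f g : Space n → ℂ}

lemma HasSmoothExtensions.bdryValue (hs : Admissible A ζ H) (hσ : IsScale A σ) (hV : IsConeAt ζ V)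
    (hε : ε.Pos H) (hg : HasSmoothExtensions ζ H V ε g) (J : Finset (Fin L ⊕ Fin p)) :
    HasSmoothExtensions ζ H V ε (bdryValue A σ g J) := by
  refine ⟨hg.differentiableOn_bdryValue hs hσ hV hε J, fun V' ε' hpc => ?_⟩
  obtain ⟨G, hG, hGg⟩ := hg.2 V' ε' hpc
  refine ⟨fun z => G (scaleSetL A σ J 0 z),
    hG.comp ((scaleSetL A σ J 0).contDiff.restrict_scalars ℝ), fun z hz => ?_⟩
  beta_reduce
  rw [bdryValue_eq hs hσ hpc hG.continuous hGg J hz, scaleSetL_apply]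

lemma exists_bound_taylorRemainder (hs : Admissible A ζ H) (hσ : IsScale A σ) (hV : IsConeAt ζ V)
    (hε : ε.Pos H) (hg : HasSmoothExtensions ζ H V ε g) (N : Fin L ⊕ Fin p → ℕ)
    (hpc : ProperlyContained H ζ V' ε' V ε) :
    ∃ C, ∀ z ∈ multicone H V' ε', ‖taylorRemainder hs.nonneg σ N g z‖ ≤ C := by
  choose B hB using fun (J : Finset (Fin L ⊕ Fin p)) (α : MultiIndex n) =>
    ((hg.iterPartialD hs hV (listOf α)).bdryValue hs hσ hV hε J).exists_bound hs hpc
  choose D hD using fun α : MultiIndex n =>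
    (hasBoundedDerivs_divMono (V := V) (ε := ε) hs α).2 [] V' ε' hpc
  refine ⟨∑ J : Finset (Fin L ⊕ Fin p), ∑ α ∈ below n hs.nonneg σ J N, B J α * D α,
    fun z hz => ?_⟩
  refine (norm_sum_le _ _).trans (Finset.sum_le_sum fun J _ => ?_)
  rw [norm_mul, norm_pow, norm_neg, norm_one, one_pow, one_mul]
  refine (norm_sum_le _ _).trans (Finset.sum_le_sum fun α _ => ?_)
  rw [norm_mul]
  exact mul_le_mul (hB J α z hz) (hD α z hz) (norm_nonneg _) ((norm_nonneg _).trans (hB J α z hz))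

/-- The coefficients `f_{J,α}`: the boundary values of `∂^α f`, at any point of the multicone over
the given point of `Z_J`. -/
def taylorCoeffs (A : Matrix (Fin L ⊕ Fin p) (Fin L ⊕ Fin r) ℚ) (σ : ℚ) (S : Set (Space n))
    (f : Space n → ℂ) : Coeffs n A :=
  fun J α w => bdryValue A σ (iterPartialD (listOf α) f) J (Function.invFunOn (projJ A J) S w)

lemma taylorCoeffs_projJ (hs : Admissible A ζ H) (hσ : IsScale A σ) (hV : IsConeAt ζ V)
    (hε : ε.Pos H) (hf : HasSmoothExtensions ζ H V ε f) (J : Finset (Fin L ⊕ Fin p))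
    (α : MultiIndex n) {z : Space n} (hz : z ∈ multicone H V ε) :
    taylorCoeffs A σ (multicone H V ε) f J α (projJ A J z)
      = bdryValue A σ (iterPartialD (listOf α) f) J z := by
  have h : ∃ w ∈ multicone H V ε, projJ A J w = projJ A J z := ⟨z, hz, rfl⟩
  exact bdryValue_eq_of_projJ_eq hs hσ hV hε (hf.iterPartialD hs hV _)
    (Function.invFunOn_mem h) hz (Function.invFunOn_eq h)

lemma isTotalFamily_taylorCoeffs (hs : Admissible A ζ H) (hσ : IsScale A σ) (hV : IsConeAt ζ V)
    (hε : ε.Pos H) (hf : HasSmoothExtensions ζ H V ε f) :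
    IsTotalFamily A (multicone H V ε) (taylorCoeffs A σ (multicone H V ε) f) := by
  classical
  rintro J - α - _ ⟨z, hz, rfl⟩
  have hU : IsOpen (multicone (n := n) H V ε) := isOpen_multicone hs hV
  -- the space `ZJ n A J` carries a norm only after the choice of this instance
  let _ : Fintype {b : Option (Fin L ⊕ Fin r) // b ∉ KJ A J} := Fintype.ofFinite _
  -- the points near `z` with the same coordinates as `z` in the blocks of `K_J`
  let ι : ZJ n A J →L[ℂ] Space n := ContinuousLinearMap.pi fun b =>
    if hb : b ∉ KJ A J then ContinuousLinearMap.proj (⟨b, hb⟩ : {b // b ∉ KJ A J}) else 0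
  let e : ZJ n A J → Space n := fun w => z + ι (w - projJ A J z)
  have hez : e (projJ A J z) = z := by simp [e]
  have hproj : ∀ w, projJ A J (e w) = w := by
    intro w
    funext b
    have hb := b.2
    simp [e, ι, projJ, hb]
  have hed : Differentiable ℂ e := fun w =>
    ((ι.differentiable.comp (differentiable_id.sub_const _)).const_add z) w
  have hmem : ∀ᶠ w in 𝓝 (projJ A J z), e w ∈ multicone H V ε :=
    hed.continuous.continuousAt.preimage_mem_nhds (by rw [hez]; exact hU.mem_nhds hz)
  have hd : DifferentiableAt ℂ (bdryValue A σ (iterPartialD (listOf α) f) J) (e (projJ A J z)) := by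
    rw [hez]
    exact (differentiableAt_bdryValue hs hσ hV hε (hf.iterPartialD hs hV _) J hz).1
  have hcomp := hd.comp (projJ A J z) (hed (projJ A J z))
  refine (hcomp.congr_of_eventuallyEq ?_).differentiableWithinAt
  filter_upwards [hmem] with w hw
  have := taylorCoeffs_projJ hs hσ hV hε hf J α hw
  rw [hproj] at this
  exact this

/-- For the coefficients given by the boundary values, the remainder of the expansion is
`taylorRemainder`. -/
lemma sub_app_taylorCoeffs (hs : Admissible A ζ H) (hσ : IsScale A σ) (hV : IsConeAt ζ V)
    (hε : ε.Pos H) (hf : HasSmoothExtensions ζ H V ε f) (N : Fin L ⊕ Fin p → ℕ) {z : Space n}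
    (hz : z ∈ multicone H V ε) :
    f z - app A σ (taylorCoeffs A σ (multicone H V ε) f) N z
      = taylorRemainder hs.nonneg σ N f z := by
  rw [sub_app_eq hσ hs.nonneg, taylorRemainder]
  refine Finset.sum_congr rfl fun J _ => ?_
  congr 1
  refine Finset.sum_congr rfl fun α hα => ?_
  congr 1
  rw [liftCoeff]
  split_ifs with hJ
  · exact taylorCoeffs_projJ hs hσ hV hε hf J α hz
  · rw [Finset.not_nonempty_iff_eq_empty] at hJ
    subst hJ
    have h0 : α = 0 := indicesJ_empty.1 ((mem_below hσ hs.nonneg).1 hα).1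
    rw [bdryValue_empty, h0, iterPartialD_eq_of_idxOf_eq (l' := []) (isOpen_multicone hs hV) hf.1
      (by rw [idxOf_listOf, idxOf_nil]) hz]
    rfl

/-- A function with smooth extensions has an asymptotic expansion: its coefficients are the boundary
values of the derivatives, and the remainders are flat. -/
theorem HasSmoothExtensions.developable (hs : Admissible A ζ H) (hσ : IsScale A σ)
    (hV : IsConeAt ζ V) (hε : ε.Pos H) (hf : HasSmoothExtensions ζ H V ε f) :
    Developable A σ ζ H V ε f := by
  refine ⟨_, isTotalFamily_taylorCoeffs hs hσ hV hε hf, fun V' ε' hpc N => ?_⟩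
  have hU : IsOpen (multicone (n := n) H V' ε') := isOpen_multicone hs hpc.1
  have hsub := hpc.subset (n := n) hV
  have hst : ∀ j, ∀ s : ℝ, 0 < s → s ≤ 1 → ∀ z ∈ multicone (n := n) H V' ε',
      scaleSet A σ {j} s z ∈ multicone H V' ε' :=
    fun j s h0 h1 z hz => scaleSet_mem hs hσ hpc.1 hpc.2.1 {j} h0 h1 hz
  have hderiv := fun l => iterPartialD_taylorRemainder hs hσ hV hε hf N l
  obtain ⟨C₀, hC₀, hsize⟩ := exists_norm_le_blockSize (A := A) hs hpc.1 ε'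
  obtain ⟨C₁, hC₁, hroot⟩ := exists_root_le hs hσ hpc.1 ε'
  obtain ⟨C, -, hC⟩ := exists_bound_of_flat hU hst hC₀.le hC₁ N
    (Ψ := taylorRemainder hs.nonneg σ N f)
    ((differentiableOn_taylorRemainder hs hσ hV hε hf N).mono hsub)
    (fun l => by
      obtain ⟨B, hB⟩ := exists_bound_taylorRemainder hs hσ hV hε (hf.iterPartialD hs hV l)
        (fun j => N j - deg A σ j (idxOf l)) hpc
      exact ⟨B, fun z hz => by rw [hderiv l (hsub hz)]; exact hB z hz⟩)
    (fun l j hj z hz => by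
      refine (tendsto_taylorRemainder hs hσ hV hε (hf.iterPartialD hs hV l)
        (N := fun j => N j - deg A σ j (idxOf l)) (Nat.sub_pos_of_lt hj) (hsub hz)).congr' ?_
      filter_upwards [Ioo_mem_nhdsGT (zero_lt_one' ℝ)] with s hs'
      exact (hderiv l (hsub (hst j s hs'.1 hs'.2.le z hz))).symm)
  refine ⟨C, fun z hz => ?_⟩
  rw [sub_app_taylorCoeffs hs hσ hV hε hf N (hsub hz)]
  refine (hC (root A ζ σ z) (fun j => (root_pos hs hpc.1 hz j).le) (hroot z hz) z hz fun b => ?_).trans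
    (le_of_eq ?_)
  · rw [← blockSize_eq_prod_root hs hσ hpc.1 hz]
    exact hsize z hz b
  · congr 1
    exact Finset.prod_congr rfl fun j _ => root_pow hs hpc.1 hz j _

end Expansion

end MultiAsymptotics

end

theorem theorem3p37 {L p r : ℕ} (n : Option (Fin L ⊕ Fin r) → ℕ)
    (A : Matrix (Fin L ⊕ Fin p) (Fin L ⊕ Fin r) ℚ) (hA : ∀ j k, 0 ≤ A j k)
    (hrank : A.rank = L) (hdet : A.toBlocks₁₁.det ≠ 0)
    (σ : ℚ) (hσ : MultiAsymptotics.IsScale A σ)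
    (ζ : (k : Fin L ⊕ Fin r) → Fin (n (some k)) → ℂ)
    (hζ₀ : ∀ k, (∀ j, A j k = 0) → ζ k = 0)
    (hζ : ∀ k : Fin L, ζ (Sum.inl k) ≠ 0)
    (H : Finset (MultiAsymptotics.PairT L r))
    (hH : MultiAsymptotics.Equivalent
      (Submonoid.closure (H : Set (MultiAsymptotics.PairT L r)) : Set (MultiAsymptotics.PairT L r))
      (MultiAsymptotics.semigroupG A ζ))
    (V : (k : Fin L ⊕ Fin r) → Set (Fin (n (some k)) → ℂ))
    (hV : MultiAsymptotics.IsConeAt ζ V)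
    (ε : MultiAsymptotics.Radii L r) (hε : ε.Pos H)
    (f : MultiAsymptotics.Space n → ℂ)
    (hf : DifferentiableOn ℂ f (MultiAsymptotics.multicone H V ε)) :
    List.TFAE
      [MultiAsymptotics.Developable A σ ζ H V ε f,
       ∀ V' ε', MultiAsymptotics.ProperlyContained H ζ V' ε' V ε →
         ∀ α : List ((b : Option (Fin L ⊕ Fin r)) × Fin (n b)), ∃ C : ℝ,
           ∀ z ∈ MultiAsymptotics.multicone H V' ε',
             ‖MultiAsymptotics.iterPartialD α f z‖ ≤ C,
       ∀ V' ε', MultiAsymptotics.ProperlyContained H ζ V' ε' V ε →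
         ∃ g : MultiAsymptotics.Space n → ℂ, ContDiff ℝ ∞ g ∧
           Set.EqOn g f (MultiAsymptotics.multicone H V' ε')] := by
  open MultiAsymptotics in
  have hs : Admissible A ζ H := ⟨hA, hrank, hdet, hζ, hH⟩
  open MultiAsymptotics in
  tfae_have 1 → 2 := by
    rintro ⟨F, hF, hD⟩ V' ε' hpc l
    exact (hD.hasBoundedDerivs hs hσ hV hf hF).2 l V' ε' hpc
  open MultiAsymptotics in
  tfae_have 2 → 3 := by
    intro h V' ε' hpc
    obtain ⟨C, hC⟩ := exists_ctrl_multicone (n := n) hs hV hpc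
    exact exists_contDiff_extension (isOpen_multicone hs hpc.1) (isBounded_multicone hs hpc.1) hC
      (hf.mono (hpc.subset hV)) (h V' ε' hpc)
  open MultiAsymptotics in
  tfae_have 3 → 1 := fun h => HasSmoothExtensions.developable hs hσ hV hε ⟨hf, h⟩
  tfae_finish
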